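/- **Conventions.** Let $k$ be an algebraically closed field. Algebras are finite-dimensional $k$-algebras, modules are finitely generated left modules, and $\mathrm{D^b}(A)$ is the bounded derived category of finitely generated left $A$-modules. An algebra $A$ is *symmetric* if $A\cong \mathrm{Hom}_k(A,k)$ as $A$-$A$-bimodules. For an algebra $E$ and $\sigma\in\mathrm{Aut}_k(E)$ let $E_\sigma$ be the bimodule $E$ with action $a\cdot x\cdot b=a\,x\,\sigma(b)$. For $n\ge 1$, a *truncated resolution of $E$ of period $n$ with automorphism $\sigma$* is a complex $Y\colon P_{n-1}\to\cdots\to P_0$ of finitely generated projective $E$-$E$-bimodules, with $P_i$ in cohomological degree $-i$, together with a map $f\colon P_0\to E$, which is part of an exact sequence of bimodules $0\to E_\sigma\to P_{n-1}\to\cdots\to P_0\xrightarrow{f}E\to0$. The algebra $E$ is *twisted-periodic of period $n$* if such a $Y$ exists for some $\sigma$, and *twisted-periodic* if this holds for some $n\geq 1$. Let $A$ be a symmetric algebra, $P$ a projective $A$-module, $E=\mathrm{End}_A(P)^{\mathrm{op}}$, $P^\vee=\mathrm{Hom}_A(P,A)$, and let $Y$ be a truncated resolution of $E$. Let $X$ be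 the cone of the map of complexes of $A$-$A$-bimodules $P\otimes_EY\otimes_EP^\vee\to A$ given in degree $0$ by $p\otimes y\otimes\varphi\mapsto\varphi(p\,f(y))$. The *periodic twist* is $\Psi_{P,Y}=X\otimes_A-\colon \mathrm{D^b}(A)\to\mathrm{D^b}(A)$. **(A) Multiplicities.** Let $A$ be a symmetric algebra, let $P=\bigoplus_{j\in J}P_j$ be a finite direct sum of pairwise non-isomorphic indecomposable projective $A$-modules, and let $P'=\bigoplus_{j\in J}P_j^{m_j}$ with $m_j\ge1$ for all $j\in J$. Put $E=\mathrm{End}_A(P)^{\mathrm{op}}$ and $E'=\mathrm{End}_A(P')^{\mathrm{op}}$. 1. $E$ is twisted-periodic if and only if $E'$ is twisted-periodic. 2. For every $n$ and every truncated resolution $Y'$ of $E'$ of period $n$ there is a truncated resolution $Y$ of $E$ of period $n$ such that $\Psi_{P,Y}\cong\Psi_{P',Y'}$ (natural isomorphism of functors). 3. For every $n$ and every truncated resolution $Y$ of $E$ of period $n$ whose automorphism $\sigma$ satisfies the condition below there is a truncated resolution $Y'$ of $E'$ of period $n$ such that $\Psi_{P,Y}\cong\Psi_{P',Y'}$. Condition: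 if $e_i\in E$ is the projection of $P$ onto $P_i$, then $m_i=m_j$ whenever the image of the endomorphism $\sigma(e_i)$ of $P$ is isomorphic to $P_j$. **(B) Blocks.** Let $A=A_1\times\cdots\times A_c$ be a symmetric algebra, where each $A_i$ is nonzero and indecomposable as an algebra, and let $P=P_{(1)}\oplus\cdots\oplus P_{(c)}$ with $P_{(i)}$ a projective $A_i$-module. Put $E=\mathrm{End}_A(P)^{\mathrm{op}}$ and $E_i=\mathrm{End}_{A_i}(P_{(i)})^{\mathrm{op}}$, and let $e_i\in E$ be the projection of $P$ onto $P_{(i)}$. Identify $\mathrm{D^b}(A)$ with $\prod_i\mathrm{D^b}(A_i)$ through the functors $A_i\otimes_A-$. Let $n\ge1$. 1. $E$ is twisted-periodic of period $n$ if and only if every $E_i$ is twisted-periodic of period $n$. 2. For every family of truncated resolutions $Y_i$ of $E_i$ of period $n$ there is a truncated resolution $Y$ of $E$ of period $n$ such that $\Psi_{P,Y}\cong\Psi_{P_{(1)},Y_1}\times\cdots\times\Psi_{P_{(c)},Y_c}$. 3. For every truncated resolution $Y$ of $E$ of period $n$ whose automorphism $\sigma$ satisfies $\sigma(e_i)=e_i$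 for each $i$ such that $A_i$ is a simple algebra, there are truncated resolutions $Y_i$ of $E_i$ of period $n$ such that $\Psi_{P,Y}\cong\Psi_{P_{(1)},Y_1}\times\cdots\times\Psi_{P_{(c)},Y_c}$. -/

import Mathlib

open CategoryTheory TensorProduct MulOpposite
open scoped ModuleCat

universe u

namespace PeriodicTwist

noncomputable section

/-! ### Tensor products over a noncommutative algebra -/

section Balanced

variable (k R : Type u) [Field k] [Ring R]
variable (M N : Type u) [AddCommGroup M] [Module k M] [Module Rᵐᵒᵖ M]
  [AddCommGroup N] [Module k N] [Module R N]

/-- The relations `m r ⊗ n = m ⊗ r n` imposed on `M ⊗[k] N`, for a right `R`-module `M` and a left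
`R`-module `N`. -/
def balancedRel : Submodule k (M ⊗[k] N) :=
  Submodule.span k {z | ∃ (m : M) (r : R) (n : N), z = (op r • m) ⊗ₜ[k] n - m ⊗ₜ[k] (r • n)}

/-- The tensor product `M ⊗_R N` of a right `R`-module `M` and a left `R`-module `N`. -/
def BalancedTensor : Type u := (M ⊗[k] N) ⧸ balancedRel k R M N

instance : AddCommGroup (BalancedTensor k R M N) :=
  inferInstanceAs (AddCommGroup ((M ⊗[k] N) ⧸ balancedRel k R M N))

instance : Module k (BalancedTensor k R M N) :=
  inferInstanceAs (Module k ((M ⊗[k] N) ⧸ balancedRel k R M N))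

namespace BalancedTensor

variable {M N}

/-- The class of `m ⊗ n`. -/
def tmul (m : M) (n : N) : BalancedTensor k R M N :=
  (balancedRel k R M N).mkQ (m ⊗ₜ[k] n)

lemma tmul_add (m : M) (n n' : N) : tmul k R m (n + n') = tmul k R m n + tmul k R m n' := by
  simp only [tmul, TensorProduct.tmul_add]; exact map_add (balancedRel k R M N).mkQ _ _

lemma add_tmul (m m' : M) (n : N) : tmul k R (m + m') n = tmul k R m n + tmul k R m' n := by
  simp only [tmul, TensorProduct.add_tmul]; exact map_add (balancedRel k R M N).mkQ _ _

lemma smul_tmul' (c : k) (m : M) (n : N) : tmul k R (c • m) n = c • tmul k R m n := by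
  simp only [tmul, ← TensorProduct.smul_tmul']; exact map_smul (balancedRel k R M N).mkQ _ _

lemma tmul_smul (c : k) (m : M) (n : N) : tmul k R m (c • n) = c • tmul k R m n := by
  simp only [tmul, TensorProduct.tmul_smul]; exact map_smul (balancedRel k R M N).mkQ _ _

lemma smul_tmul (m : M) (r : R) (n : N) : tmul k R (op r • m) n = tmul k R m (r • n) := by
  rw [← sub_eq_zero]
  change (balancedRel k R M N).mkQ _ - (balancedRel k R M N).mkQ _ = 0
  rw [← map_sub, Submodule.mkQ_apply, Submodule.Quotient.mk_eq_zero]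
  exact Submodule.subset_span ⟨m, r, n, rfl⟩

variable {k R}

/-- The linear map on `M ⊗_R N` defined by an `R`-balanced bilinear map. -/
def lift {Q : Type*} [AddCommGroup Q] [Module k Q] (f : M →ₗ[k] N →ₗ[k] Q)
    (hf : ∀ (m : M) (r : R) (n : N), f (op r • m) n = f m (r • n)) :
    BalancedTensor k R M N →ₗ[k] Q :=
  (balancedRel k R M N).liftQ (TensorProduct.lift f) (by
    rw [balancedRel, Submodule.span_le]
    rintro _ ⟨m, r, n, rfl⟩
    simp [hf])

@[simp]
lemma lift_tmul {Q : Type*} [AddCommGroup Q] [Module k Q] (f : M →ₗ[k] N →ₗ[k] Q)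
    (hf : ∀ (m : M) (r : R) (n : N), f (op r • m) n = f m (r • n)) (m : M) (n : N) :
    lift f hf (tmul k R m n) = f m n := by
  simp only [lift, tmul, Submodule.mkQ_apply]
  erw [Submodule.liftQ_apply]

@[elab_as_elim]
lemma induction_on {p : BalancedTensor k R M N → Prop} (z : BalancedTensor k R M N)
    (h0 : p 0) (ht : ∀ m n, p (tmul k R m n)) (ha : ∀ x y, p x → p y → p (x + y)) : p z := by
  obtain ⟨z, rfl⟩ := (balancedRel k R M N).mkQ_surjective z
  induction z using TensorProduct.induction_on with
  | zero => rw [map_zero]; exact h0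
  | tmul m n => exact ht m n
  | add x y hx hy => rw [map_add]; exact ha _ _ hx hy

lemma ext {Q : Type*} [AddCommGroup Q] {F : Type*} [FunLike F (BalancedTensor k R M N) Q]
    [AddMonoidHomClass F (BalancedTensor k R M N) Q] {f g : F}
    (h : ∀ m n, f (tmul k R m n) = g (tmul k R m n)) : f = g := by
  refine DFunLike.ext _ _ fun z => ?_
  induction z using induction_on with
  | h0 => rw [map_zero, map_zero]
  | ht m n => exact h m n
  | ha x y hx hy => rw [map_add, map_add, hx, hy]

variable {M' N' : Type u} [AddCommGroup M'] [Module k M'] [Module Rᵐᵒᵖ M']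
  [AddCommGroup N'] [Module k N'] [Module R N']

/-- The map `f ⊗ g` on tensor products over `R`. -/
def map (f : M →ₗ[k] M') (hf : ∀ (r : R) (m : M), f (op r • m) = op r • f m)
    (g : N →ₗ[k] N') (hg : ∀ (r : R) (n : N), g (r • n) = r • g n) :
    BalancedTensor k R M N →ₗ[k] BalancedTensor k R M' N' :=
  lift (LinearMap.mk₂ k (fun m n => tmul k R (f m) (g n))
    (fun m m' n => by rw [map_add, add_tmul]) (fun c m n => by rw [map_smul, smul_tmul'])
    (fun m n n' => by rw [map_add, tmul_add]) (fun c m n => by rw [map_smul, tmul_smul]))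
    (fun m r n => by simp only [LinearMap.mk₂_apply]; rw [hf, hg, smul_tmul])

@[simp]
lemma map_tmul (f : M →ₗ[k] M') (hf : ∀ (r : R) (m : M), f (op r • m) = op r • f m)
    (g : N →ₗ[k] N') (hg : ∀ (r : R) (n : N), g (r • n) = r • g n) (m : M) (n : N) :
    map f hf g hg (tmul k R m n) = tmul k R (f m) (g n) := by
  simp [map]

variable (k R M N)

section left

variable (B : Type u) [Ring B] [Algebra k B] [Module B M] [IsScalarTower k B M]
  [SMulCommClass B Rᵐᵒᵖ M]

/-- The action of `b : B` on `M ⊗_R N` when `M` is a `B`-`R`-bimodule: `b (m ⊗ n) = bm ⊗ n`. -/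
def leftSMul (b : B) : Module.End k (BalancedTensor k R M N) :=
  map (Algebra.lsmul k k M b : M →ₗ[k] M) (fun r m => smul_comm b (op r) m)
    LinearMap.id (fun _ _ => rfl)

@[simp]
lemma leftSMul_tmul (b : B) (m : M) (n : N) :
    leftSMul k R M N B b (tmul k R m n) = tmul k R (b • m) n :=
  map_tmul _ _ _ _ m n

/-- The left action of `B` on `M ⊗_R N` when `M` is a `B`-`R`-bimodule. -/
def leftAction : B →ₐ[k] Module.End k (BalancedTensor k R M N) :=
  AlgHom.ofLinearMap
    { toFun := leftSMul k R M N B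
      map_add' := fun b b' => ext fun m n => by simp [add_smul, add_tmul]
      map_smul' := fun c b => ext fun m n => by simp [smul_tmul'] }
    (ext fun m n => by simp)
    (fun b b' => ext fun m n => by simp [mul_smul])

@[simp]
lemma leftAction_tmul (b : B) (m : M) (n : N) :
    leftAction k R M N B b (tmul k R m n) = tmul k R (b • m) n :=
  leftSMul_tmul k R M N B b m n

end left

section right

variable (C : Type u) [Ring C] [Algebra k C] [Module Cᵐᵒᵖ N] [IsScalarTower k Cᵐᵒᵖ N]
  [SMulCommClass R Cᵐᵒᵖ N]

/-- The action of `c : C` on `M ⊗_R N` when `N` is an `R`-`C`-bimodule: `(m ⊗ n) c = m ⊗ nc`. -/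
def rightSMul (c : Cᵐᵒᵖ) : Module.End k (BalancedTensor k R M N) :=
  map LinearMap.id (fun _ _ => rfl)
    (Algebra.lsmul k k N c : N →ₗ[k] N) (fun r n => (smul_comm r c n).symm)

@[simp]
lemma rightSMul_tmul (c : Cᵐᵒᵖ) (m : M) (n : N) :
    rightSMul k R M N C c (tmul k R m n) = tmul k R m (c • n) :=
  map_tmul _ _ _ _ m n

/-- The right action of `C` on `M ⊗_R N` when `N` is an `R`-`C`-bimodule. -/
def rightAction : Cᵐᵒᵖ →ₐ[k] Module.End k (BalancedTensor k R M N) :=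
  AlgHom.ofLinearMap
    { toFun := rightSMul k R M N C
      map_add' := fun b b' => ext fun m n => by simp [add_smul, tmul_add]
      map_smul' := fun c b => ext fun m n => by simp [tmul_smul] }
    (ext fun m n => by simp)
    (fun b b' => ext fun m n => by simp [mul_smul])

@[simp]
lemma rightAction_tmul (c : Cᵐᵒᵖ) (m : M) (n : N) :
    rightAction k R M N C c (tmul k R m n) = tmul k R m (c • n) :=
  rightSMul_tmul k R M N C c m n

end right

end BalancedTensor

end Balanced

/-! ### Bimodules -/

section Bimodules

variable (k : Type u) [Field k]

/-- The category of `B`-`C`-bimodules with central action of `k`, that is, of left modules over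
`B ⊗[k] Cᵒᵖ`. -/
abbrev BimodCat (B C : Type u) [Ring B] [Algebra k B] [Ring C] [Algebra k C] :=
  ModuleCat.{u} (B ⊗[k] Cᵐᵒᵖ)

variable {k} {B C D R : Type u} [Ring B] [Algebra k B] [Ring C] [Algebra k C]
  [Ring D] [Algebra k D] [Ring R] [Algebra k R]

namespace BimodCat

/-- The left action `b m = (b ⊗ 1) m` on a bimodule. -/
instance leftModule (L : BimodCat k B C) : Module B L :=
  Module.compHom L (Algebra.TensorProduct.includeLeft : B →ₐ[k] B ⊗[k] Cᵐᵒᵖ).toRingHom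

/-- The right action `m c = (1 ⊗ c) m` on a bimodule. -/
instance rightModule (L : BimodCat k B C) : Module Cᵐᵒᵖ L :=
  Module.compHom L (Algebra.TensorProduct.includeRight : Cᵐᵒᵖ →ₐ[k] B ⊗[k] Cᵐᵒᵖ).toRingHom

lemma left_smul_def (L : BimodCat k B C) (b : B) (m : L) :
    b • m = (b ⊗ₜ[k] (1 : Cᵐᵒᵖ)) • m := rfl

lemma right_smul_def (L : BimodCat k B C) (c : Cᵐᵒᵖ) (m : L) :
    c • m = ((1 : B) ⊗ₜ[k] c) • m := rfl

lemma k_smul_def (L : BimodCat k B C) (c : k) (m : L) :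
    c • m = (algebraMap k (B ⊗[k] Cᵐᵒᵖ) c) • m := rfl

instance (L : BimodCat k B C) : SMulCommClass B Cᵐᵒᵖ L where
  smul_comm b c m := by
    simp only [left_smul_def, right_smul_def, ← mul_smul, Algebra.TensorProduct.tmul_mul_tmul,
      mul_one, one_mul]

instance (L : BimodCat k B C) : IsScalarTower k B L where
  smul_assoc c b m := by
    simp only [left_smul_def, ← TensorProduct.smul_tmul']
    exact smul_assoc c (b ⊗ₜ[k] (1 : Cᵐᵒᵖ)) m

instance (L : BimodCat k B C) : IsScalarTower k Cᵐᵒᵖ L where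
  smul_assoc c b m := by
    simp only [right_smul_def, TensorProduct.tmul_smul]
    exact smul_assoc c ((1 : B) ⊗ₜ[k] b) m

/-- The bimodule with given commuting left and right actions. -/
def ofActions (M : Type u) [AddCommGroup M] [Module k M] (l : B →ₐ[k] Module.End k M)
    (r : Cᵐᵒᵖ →ₐ[k] Module.End k M) (h : ∀ b c, Commute (l b) (r c)) : BimodCat k B C :=
  letI : Module (B ⊗[k] Cᵐᵒᵖ) M :=
    Module.compHom M (Algebra.TensorProduct.lift l r h).toRingHom
  ModuleCat.of (B ⊗[k] Cᵐᵒᵖ) M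

section ofActions

variable (M : Type u) [AddCommGroup M] [Module k M] (l : B →ₐ[k] Module.End k M)
    (r : Cᵐᵒᵖ →ₐ[k] Module.End k M) (h : ∀ b c, Commute (l b) (r c))

/-- The identification of the underlying additive group of `ofActions M l r h` with `M`. -/
def ofActionsEquiv : ofActions M l r h ≃+ M := AddEquiv.refl M

lemma ofActionsEquiv_smul (s : B ⊗[k] Cᵐᵒᵖ) (m : ofActions M l r h) :
    ofActionsEquiv M l r h (s • m) =
      Algebra.TensorProduct.lift l r h s (ofActionsEquiv M l r h m) := rfl

@[simp]
lemma ofActionsEquiv_left (b : B) (m : ofActions M l r h) :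
    ofActionsEquiv M l r h (b • m) = l b (ofActionsEquiv M l r h m) := by
  rw [left_smul_def, ofActionsEquiv_smul]; simp

@[simp]
lemma ofActionsEquiv_right (c : Cᵐᵒᵖ) (m : ofActions M l r h) :
    ofActionsEquiv M l r h (c • m) = r c (ofActionsEquiv M l r h m) := by
  rw [right_smul_def, ofActionsEquiv_smul]; simp

@[simp]
lemma ofActionsEquiv_k (c : k) (m : ofActions M l r h) :
    ofActionsEquiv M l r h (c • m) = c • (ofActionsEquiv M l r h m) := by
  rw [k_smul_def, ofActionsEquiv_smul]; simp

end ofActions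

/-- A `k`-linear map commuting with the left and with the right actions is a morphism of
bimodules. -/
def homMk {L L' : BimodCat k B C} (f : L →+ L') (hl : ∀ (b : B) (m : L), f (b • m) = b • f m)
    (hr : ∀ (c : Cᵐᵒᵖ) (m : L), f (c • m) = c • f m) : L ⟶ L' :=
  ModuleCat.ofHom
    { toFun := f
      map_add' := map_add f
      map_smul' := fun s m => by
        induction s using TensorProduct.induction_on with
        | zero =>
          exact (congrArg f (zero_smul (B ⊗[k] Cᵐᵒᵖ) m)).trans
            ((map_zero f).trans (zero_smul (B ⊗[k] Cᵐᵒᵖ) (f m)).symm)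
        | tmul b c =>
          have e : (b ⊗ₜ[k] c) = (b ⊗ₜ[k] (1 : Cᵐᵒᵖ)) * ((1 : B) ⊗ₜ[k] c) := by simp
          rw [RingHom.id_apply, e, mul_smul, mul_smul, ← right_smul_def, ← left_smul_def, hl, hr]
          rfl
        | add x y hx hy => simp only [RingHom.id_apply] at *; rw [add_smul, add_smul, map_add, hx, hy] }

@[simp]
lemma homMk_apply {L L' : BimodCat k B C} (f : L →+ L')
    (hl : ∀ (b : B) (m : L), f (b • m) = b • f m)
    (hr : ∀ (c : Cᵐᵒᵖ) (m : L), f (c • m) = c • f m) (m : L) : (homMk f hl hr).hom m = f m := rfl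

lemma hom_left {L L' : BimodCat k B C} (f : L ⟶ L') (b : B) (m : L) :
    f.hom (b • m) = b • f.hom m := map_smul f.hom _ _

lemma hom_right {L L' : BimodCat k B C} (f : L ⟶ L') (c : Cᵐᵒᵖ) (m : L) :
    f.hom (c • m) = c • f.hom m := map_smul f.hom _ _

end BimodCat

/-! ### Tensor products of bimodules with modules and with bimodules -/

/-- The left `B`-module `L ⊗_R V`, for a `B`-`R`-bimodule `L` and a left `R`-module `V`. -/
def tensorObj (L : BimodCat k B R) (V : ModuleCat.{u} R) : ModuleCat.{u} B :=
  letI : Module B (BalancedTensor k R L V) :=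
    Module.compHom (BalancedTensor k R L V) (BalancedTensor.leftAction k R L V B).toRingHom
  ModuleCat.of B (BalancedTensor k R L V)

/-- The element `l ⊗ v` of `L ⊗_R V`. -/
def tmul (L : BimodCat k B R) (V : ModuleCat.{u} R) (l : L) (v : V) : tensorObj L V :=
  BalancedTensor.tmul k R l v

/-- The underlying additive group of `L ⊗_R V`. -/
def tensorObjEquiv (L : BimodCat k B R) (V : ModuleCat.{u} R) :
    tensorObj L V ≃+ BalancedTensor k R L V := AddEquiv.refl _

lemma tensorObj_smul_def (L : BimodCat k B R) (V : ModuleCat.{u} R) (b : B) (z : tensorObj L V) :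
    tensorObjEquiv L V (b • z) =
      BalancedTensor.leftAction k R L V B b (tensorObjEquiv L V z) := rfl

lemma smul_tmul (L : BimodCat k B R) (V : ModuleCat.{u} R) (b : B) (l : L) (v : V) :
    b • tmul L V l v = tmul L V (b • l) v :=
  BalancedTensor.leftAction_tmul k R L V B b l v

lemma tmul_balanced (L : BimodCat k B R) (V : ModuleCat.{u} R) (l : L) (r : R) (v : V) :
    tmul L V (op r • l) v = tmul L V l (r • v) :=
  BalancedTensor.smul_tmul k R l r v

@[elab_as_elim]
lemma tensorObj_induction {L : BimodCat k B R} {V : ModuleCat.{u} R} {p : tensorObj L V → Prop}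
    (z : tensorObj L V) (h0 : p 0) (ht : ∀ l v, p (tmul L V l v))
    (ha : ∀ x y, p x → p y → p (x + y)) : p z :=
  BalancedTensor.induction_on (p := p) z h0 ht ha

lemma tmul_add (L : BimodCat k B R) (V : ModuleCat.{u} R) (l : L) (v v' : V) :
    tmul L V l (v + v') = tmul L V l v + tmul L V l v' := BalancedTensor.tmul_add k R l v v'

lemma add_tmul (L : BimodCat k B R) (V : ModuleCat.{u} R) (l l' : L) (v : V) :
    tmul L V (l + l') v = tmul L V l v + tmul L V l' v := BalancedTensor.add_tmul k R l l' v

/-- The map `f ⊗ g : L ⊗_R V → L' ⊗_R V'`, as an additive map. -/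
def tensorMapAux {L L' : BimodCat k B R} (f : L ⟶ L') {V V' : ModuleCat.{u} R} (g : V ⟶ V') :
    tensorObj L V →+ tensorObj L' V' :=
  (BalancedTensor.map (R := R) (f.hom.restrictScalars k)
        (fun r m => BimodCat.hom_right f (op r) m) (g.hom.restrictScalars k)
        (fun r n => map_smul g.hom r n)).toAddMonoidHom

lemma tensorMapAux_tmul {L L' : BimodCat k B R} (f : L ⟶ L') {V V' : ModuleCat.{u} R}
    (g : V ⟶ V') (l : L) (v : V) :
    tensorMapAux f g (tmul L V l v) = tmul L' V' (f.hom l) (g.hom v) :=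
  BalancedTensor.map_tmul (R := R) (f.hom.restrictScalars k)
        (fun r m => BimodCat.hom_right f (op r) m) (g.hom.restrictScalars k)
        (fun r n => map_smul g.hom r n) l v

/-- An additive map commuting with scalars is a morphism in `ModuleCat`. -/
def moduleHomMk {V W : ModuleCat.{u} B} (f : V →+ W) (h : ∀ (b : B) (v : V), f (b • v) = b • f v) :
    V ⟶ W :=
  ModuleCat.ofHom { toFun := f, map_add' := map_add f, map_smul' := h }

/-- The map `f ⊗ g : L ⊗_R V → L' ⊗_R V'`. -/
def tensorMap {L L' : BimodCat k B R} (f : L ⟶ L') {V V' : ModuleCat.{u} R} (g : V ⟶ V') :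
    tensorObj L V ⟶ tensorObj L' V' :=
  moduleHomMk (tensorMapAux f g) fun b z => by
    induction z using tensorObj_induction with
    | h0 => rw [smul_zero, map_zero, smul_zero]
    | ht l v => rw [smul_tmul, tensorMapAux_tmul, tensorMapAux_tmul, smul_tmul, BimodCat.hom_left]
    | ha x y hx hy => rw [smul_add, map_add, map_add, smul_add, hx, hy]

@[simp]
lemma tensorMap_tmul {L L' : BimodCat k B R} (f : L ⟶ L') {V V' : ModuleCat.{u} R} (g : V ⟶ V')
    (l : L) (v : V) :
    (tensorMap f g).hom (tmul L V l v) = tmul L' V' (f.hom l) (g.hom v) :=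
  tensorMapAux_tmul f g l v

lemma tensorObj_hom_ext {L : BimodCat k B R} {V : ModuleCat.{u} R} {W : ModuleCat.{u} B}
    {f g : tensorObj L V ⟶ W} (h : ∀ l v, f.hom (tmul L V l v) = g.hom (tmul L V l v)) : f = g := by
  ext z
  induction z using tensorObj_induction with
  | h0 => rw [map_zero, map_zero]
  | ht l v => exact h l v
  | ha x y hx hy => rw [map_add, map_add, hx, hy]

/-- The bifunctor `(L, V) ↦ L ⊗_R V` from `B`-`R`-bimodules and left `R`-modules to left
`B`-modules. -/
def tensorFunctor (k B R : Type u) [Field k] [Ring B] [Algebra k B] [Ring R] [Algebra k R] :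
    BimodCat k B R ⥤ ModuleCat.{u} R ⥤ ModuleCat.{u} B where
  obj L :=
    { obj := fun V => tensorObj L V
      map := fun g => tensorMap (𝟙 L) g
      map_id := fun V => tensorObj_hom_ext fun l v => by rw [tensorMap_tmul]; rfl
      map_comp := fun f g => tensorObj_hom_ext fun l v => by
        simp only [ModuleCat.hom_comp, LinearMap.comp_apply, tensorMap_tmul, ModuleCat.hom_id,
          LinearMap.id_coe, id_eq] }
  map f :=
    { app := fun V => tensorMap f (𝟙 V)
      naturality := fun V W g => tensorObj_hom_ext fun l v => by
        simp only [ModuleCat.hom_comp, LinearMap.comp_apply, tensorMap_tmul, ModuleCat.hom_id,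
          LinearMap.id_coe, id_eq] }
  map_id L := by
    ext V : 2
    exact tensorObj_hom_ext fun l v => by rw [tensorMap_tmul]; rfl
  map_comp f g := by
    ext V : 2
    refine tensorObj_hom_ext fun l v => ?_
    simp only [NatTrans.comp_app, ModuleCat.hom_comp, LinearMap.comp_apply, tensorMap_tmul,
      ModuleCat.hom_id, LinearMap.id_coe, id_eq]

lemma tensorMap_add_left {L L' : BimodCat k B R} (f g : L ⟶ L') (V : ModuleCat.{u} R) :
    tensorMap (f + g) (𝟙 V) = tensorMap f (𝟙 V) + tensorMap g (𝟙 V) :=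
  tensorObj_hom_ext fun l v => by
    rw [ModuleCat.hom_add, LinearMap.add_apply, tensorMap_tmul, tensorMap_tmul, tensorMap_tmul,
      ModuleCat.hom_add, LinearMap.add_apply, add_tmul]

lemma tensorMap_add_right (L : BimodCat k B R) {V V' : ModuleCat.{u} R} (f g : V ⟶ V') :
    tensorMap (𝟙 L) (f + g) = tensorMap (𝟙 L) f + tensorMap (𝟙 L) g :=
  tensorObj_hom_ext fun l v => by
    rw [ModuleCat.hom_add, LinearMap.add_apply, tensorMap_tmul, tensorMap_tmul, tensorMap_tmul,
      ModuleCat.hom_add, LinearMap.add_apply, tmul_add]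

instance : (tensorFunctor k B R).Additive where
  map_add {_ _ f g} := by
    ext V : 2
    exact tensorMap_add_left f g V

instance (L : BimodCat k B R) : ((tensorFunctor k B R).obj L).Additive where
  map_add {_ _ f g} := tensorMap_add_right L f g

namespace BimodCat

lemma tensor_commute (L : BimodCat k B R) (N : BimodCat k R C) (b : B) (c : Cᵐᵒᵖ) :
    Commute (BalancedTensor.leftAction k R L N B b) (BalancedTensor.rightAction k R L N C c) :=
  BalancedTensor.ext fun m n => by simp

/-- The `B`-`C`-bimodule `L ⊗_R N`, for a `B`-`R`-bimodule `L` and an `R`-`C`-bimodule `N`. -/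
def tensor (L : BimodCat k B R) (N : BimodCat k R C) : BimodCat k B C :=
  ofActions (BalancedTensor k R L N) (BalancedTensor.leftAction k R L N B)
    (BalancedTensor.rightAction k R L N C) (tensor_commute L N)

/-- The element `l ⊗ n` of the bimodule `L ⊗_R N`. -/
def tmul (L : BimodCat k B R) (N : BimodCat k R C) (l : L) (n : N) : tensor L N :=
  BalancedTensor.tmul k R l n

lemma left_smul_tmul (L : BimodCat k B R) (N : BimodCat k R C) (b : B) (l : L) (n : N) :
    b • tmul L N l n = tmul L N (b • l) n := by
  refine (ofActionsEquiv_left _ _ _ (tensor_commute L N) b (tmul L N l n)).trans ?_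
  exact BalancedTensor.leftAction_tmul k R L N B b l n

lemma right_smul_tmul (L : BimodCat k B R) (N : BimodCat k R C) (c : Cᵐᵒᵖ) (l : L) (n : N) :
    c • tmul L N l n = tmul L N l (c • n) := by
  refine (ofActionsEquiv_right _ _ _ (tensor_commute L N) c (tmul L N l n)).trans ?_
  exact BalancedTensor.rightAction_tmul k R L N C c l n

lemma tmul_balanced (L : BimodCat k B R) (N : BimodCat k R C) (l : L) (r : R) (n : N) :
    tmul L N (op r • l) n = tmul L N l (r • n) :=
  BalancedTensor.smul_tmul k R l r n

lemma tmul_add (L : BimodCat k B R) (N : BimodCat k R C) (l : L) (v v' : N) :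
    tmul L N l (v + v') = tmul L N l v + tmul L N l v' := BalancedTensor.tmul_add k R l v v'

lemma add_tmul (L : BimodCat k B R) (N : BimodCat k R C) (l l' : L) (v : N) :
    tmul L N (l + l') v = tmul L N l v + tmul L N l' v := BalancedTensor.add_tmul k R l l' v

@[elab_as_elim]
lemma tensor_induction {L : BimodCat k B R} {N : BimodCat k R C} {p : tensor L N → Prop}
    (z : tensor L N) (h0 : p 0) (ht : ∀ l v, p (tmul L N l v))
    (ha : ∀ x y, p x → p y → p (x + y)) : p z :=
  BalancedTensor.induction_on (p := p) z h0 ht ha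

/-- A morphism of bimodules `L ⊗_R N ⟶ W` from a balanced bilinear map compatible with the
actions. -/
def tensorDesc {L : BimodCat k B R} {N : BimodCat k R C} {W : BimodCat k B C}
    (f : L →ₗ[k] N →ₗ[k] W) (hf : ∀ (l : L) (r : R) (n : N), f (op r • l) n = f l (r • n))
    (hl : ∀ (b : B) (l : L) (n : N), f (b • l) n = b • f l n)
    (hr : ∀ (c : Cᵐᵒᵖ) (l : L) (n : N), f l (c • n) = c • f l n) : tensor L N ⟶ W :=
  homMk (L := tensor L N)
    { toFun := fun z => BalancedTensor.lift f hf z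
      map_zero' := map_zero (BalancedTensor.lift f hf)
      map_add' := fun x y => map_add (BalancedTensor.lift f hf) x y }
    (fun b z => by
      induction z using tensor_induction with
      | h0 => rw [smul_zero, map_zero, smul_zero]
      | ht l n =>
        rw [left_smul_tmul]
        exact (BalancedTensor.lift_tmul f hf _ _).trans ((hl b l n).trans
          (congrArg (fun t => b • t) (BalancedTensor.lift_tmul f hf l n).symm))
      | ha x y hx hy => rw [smul_add, map_add, map_add, smul_add, hx, hy])
    (fun c z => by
      induction z using tensor_induction with
      | h0 => rw [smul_zero, map_zero, smul_zero]
      | ht l n =>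
        rw [right_smul_tmul]
        exact (BalancedTensor.lift_tmul f hf _ _).trans ((hr c l n).trans
          (congrArg (fun t => c • t) (BalancedTensor.lift_tmul f hf l n).symm))
      | ha x y hx hy => rw [smul_add, map_add, map_add, smul_add, hx, hy])

lemma tensorDesc_tmul {L : BimodCat k B R} {N : BimodCat k R C} {W : BimodCat k B C}
    (f : L →ₗ[k] N →ₗ[k] W) (hf : ∀ (l : L) (r : R) (n : N), f (op r • l) n = f l (r • n))
    (hl : ∀ (b : B) (l : L) (n : N), f (b • l) n = b • f l n)
    (hr : ∀ (c : Cᵐᵒᵖ) (l : L) (n : N), f l (c • n) = c • f l n) (l : L) (n : N) :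
    (tensorDesc f hf hl hr).hom (tmul L N l n) = f l n :=
  BalancedTensor.lift_tmul f hf l n

lemma tensor_hom_ext {L : BimodCat k B R} {N : BimodCat k R C} {W : BimodCat k B C}
    {f g : tensor L N ⟶ W} (h : ∀ l v, f.hom (tmul L N l v) = g.hom (tmul L N l v)) : f = g := by
  ext z
  induction z using tensor_induction with
  | h0 => rw [map_zero, map_zero]
  | ht l v => exact h l v
  | ha x y hx hy => rw [map_add, map_add, hx, hy]

/-- The map `f ⊗ g : L ⊗_R N → L' ⊗_R N'`, as an additive map. -/
def tensorMapAux {L L' : BimodCat k B R} (f : L ⟶ L') {N N' : BimodCat k R C} (g : N ⟶ N') :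
    tensor L N →+ tensor L' N' :=
  (BalancedTensor.map (R := R) (f.hom.restrictScalars k)
        (fun r m => hom_right f (op r) m) (g.hom.restrictScalars k)
        (fun r n => hom_left g r n)).toAddMonoidHom

lemma tensorMapAux_tmul {L L' : BimodCat k B R} (f : L ⟶ L') {N N' : BimodCat k R C}
    (g : N ⟶ N') (l : L) (n : N) :
    tensorMapAux f g (tmul L N l n) = tmul L' N' (f.hom l) (g.hom n) :=
  BalancedTensor.map_tmul (R := R) (f.hom.restrictScalars k)
        (fun r m => hom_right f (op r) m) (g.hom.restrictScalars k)
        (fun r n => hom_left g r n) l n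

/-- The map of bimodules `f ⊗ g : L ⊗_R N → L' ⊗_R N'`. -/
def tensorMap {L L' : BimodCat k B R} (f : L ⟶ L') {N N' : BimodCat k R C} (g : N ⟶ N') :
    tensor L N ⟶ tensor L' N' :=
  homMk (tensorMapAux f g)
    (fun b z => by
      induction z using tensor_induction with
      | h0 => rw [smul_zero, map_zero, smul_zero]
      | ht l n =>
        rw [left_smul_tmul, tensorMapAux_tmul, tensorMapAux_tmul, left_smul_tmul, hom_left]
      | ha x y hx hy => rw [smul_add, map_add, map_add, smul_add, hx, hy])
    (fun c z => by
      induction z using tensor_induction with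
      | h0 => rw [smul_zero, map_zero, smul_zero]
      | ht l n =>
        rw [right_smul_tmul, tensorMapAux_tmul, tensorMapAux_tmul, right_smul_tmul, hom_right]
      | ha x y hx hy => rw [smul_add, map_add, map_add, smul_add, hx, hy])

@[simp]
lemma tensorMap_tmul {L L' : BimodCat k B R} (f : L ⟶ L') {N N' : BimodCat k R C} (g : N ⟶ N')
    (l : L) (n : N) :
    (tensorMap f g).hom (tmul L N l n) = tmul L' N' (f.hom l) (g.hom n) :=
  tensorMapAux_tmul f g l n

/-- The functor `Q ↦ (L ⊗_R Q) ⊗_R N` from `R`-`R`-bimodules to `B`-`C`-bimodules. -/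
def sandwich (L : BimodCat k B R) (N : BimodCat k R C) : BimodCat k R R ⥤ BimodCat k B C where
  obj Q := tensor (tensor L Q) N
  map f := tensorMap (tensorMap (𝟙 L) f) (𝟙 N)
  map_id Q := by
    have h : tensorMap (𝟙 L) (𝟙 Q) = 𝟙 _ :=
      tensor_hom_ext fun l q => by rw [tensorMap_tmul]; rfl
    rw [h]
    exact tensor_hom_ext fun l q => by rw [tensorMap_tmul]; rfl
  map_comp {Q Q' Q''} f g := by
    have h : tensorMap (𝟙 L) (f ≫ g) = tensorMap (𝟙 L) f ≫ tensorMap (𝟙 L) g :=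
      tensor_hom_ext fun l q => by
        simp only [ModuleCat.hom_comp, LinearMap.comp_apply, tensorMap_tmul, ModuleCat.hom_id,
          LinearMap.id_coe, id_eq]
    rw [h]
    exact tensor_hom_ext fun l q => by
        simp only [ModuleCat.hom_comp, LinearMap.comp_apply, tensorMap_tmul, ModuleCat.hom_id,
          LinearMap.id_coe, id_eq]

lemma tensorMap_add_right (L : BimodCat k B R) {N N' : BimodCat k R C} (f g : N ⟶ N') :
    tensorMap (𝟙 L) (f + g) = tensorMap (𝟙 L) f + tensorMap (𝟙 L) g :=
  tensor_hom_ext fun l v => by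
    rw [ModuleCat.hom_add, LinearMap.add_apply, tensorMap_tmul, tensorMap_tmul, tensorMap_tmul,
      ModuleCat.hom_add, LinearMap.add_apply, tmul_add]

lemma tensorMap_add_left {L L' : BimodCat k B R} (f g : L ⟶ L') (N : BimodCat k R C) :
    tensorMap (f + g) (𝟙 N) = tensorMap f (𝟙 N) + tensorMap g (𝟙 N) :=
  tensor_hom_ext fun l v => by
    rw [ModuleCat.hom_add, LinearMap.add_apply, tensorMap_tmul, tensorMap_tmul, tensorMap_tmul,
      ModuleCat.hom_add, LinearMap.add_apply, add_tmul]

instance (L : BimodCat k B R) (N : BimodCat k R C) : (sandwich L N).Additive where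
  map_add {_ _ f g} :=
    (congrArg (fun t => tensorMap t (𝟙 N)) (tensorMap_add_right L f g)).trans
      (tensorMap_add_left _ _ N)

end BimodCat

/-! ### Quasi-isomorphisms in terms of elements -/

section Elements

/-- The elementwise form of the acyclicity of the mapping cone of `φ`. -/
def ConeExact {S : Type u} [Ring S] {V W : CochainComplex (ModuleCat.{u} S) ℤ} (φ : V ⟶ W) : Prop :=
  ∀ (g h i j : ℤ), g + 1 = h → h + 1 = i → i + 1 = j → ∀ (z : V.X i) (w : W.X h),
    (V.d i j).hom z = 0 → (φ.f i).hom z = (W.d h i).hom w →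
    ∃ (z' : V.X h) (w' : W.X g), (V.d h i).hom z' = z ∧
      (φ.f h).hom z' + (W.d g h).hom w' = w

variable {S : Type u} [Ring S]

lemma comp_d_apply (V : CochainComplex (ModuleCat.{u} S) ℤ) (h i j : ℤ) (z : V.X h) :
    (V.d i j).hom ((V.d h i).hom z) = 0 := by
  rw [← LinearMap.comp_apply, ← ModuleCat.hom_comp, V.d_comp_d]; rfl

lemma hom_d_apply {V W : CochainComplex (ModuleCat.{u} S) ℤ} (φ : V ⟶ W) (i j : ℤ) (z : V.X i) :
    (φ.f j).hom ((V.d i j).hom z) = (W.d i j).hom ((φ.f i).hom z) := by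
  rw [← LinearMap.comp_apply, ← ModuleCat.hom_comp, ← φ.comm]; rfl

lemma exists_cycle (V : CochainComplex (ModuleCat.{u} S) ℤ) (i j : ℤ) (hij : i + 1 = j) (z : V.X i)
    (hz : (V.d i j).hom z = 0) : ∃ c : V.cycles i, (V.iCycles i).hom c = z := by
  have h : Function.Exact (V.iCycles i).hom (V.d i j).hom := by
    have e : (ShortComplex.mk (V.iCycles i) (V.d i j) (V.iCycles_d i j)).Exact :=
      ShortComplex.exact_of_f_is_kernel _ (V.cyclesIsKernel i j (by simpa using hij))
    exact (ShortComplex.ShortExact.moduleCat_exact_iff_function_exact _).1 e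
  exact (h z).1 hz

lemma iCycles_injective (V : CochainComplex (ModuleCat.{u} S) ℤ) (i : ℤ) :
    Function.Injective (V.iCycles i).hom := (ModuleCat.mono_iff_injective _).1 inferInstance

lemma homologyπ_surjective (V : CochainComplex (ModuleCat.{u} S) ℤ) (i : ℤ) :
    Function.Surjective (V.homologyπ i).hom := (ModuleCat.epi_iff_surjective _).1 inferInstance

lemma homologyπ_eq_zero_iff (V : CochainComplex (ModuleCat.{u} S) ℤ) (h i : ℤ) (hh : h + 1 = i)
    (c : V.cycles i) :
    (V.homologyπ i).hom c = 0 ↔ ∃ y : V.X h, (V.d h i).hom y = (V.iCycles i).hom c := by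
  have e : (ShortComplex.mk (V.toCycles h i) (V.homologyπ i) (V.toCycles_comp_homologyπ h i)).Exact :=
    ShortComplex.exact_of_g_is_cokernel _ (V.homologyIsCokernel h i (by simp [← hh]))
  have e' := (ShortComplex.ShortExact.moduleCat_exact_iff_function_exact _).1 e
  have ht : ∀ y : V.X h, (V.iCycles i).hom ((V.toCycles h i).hom y) = (V.d h i).hom y := by
    intro y; rw [← V.toCycles_i]; rfl
  constructor
  · intro hc
    obtain ⟨y, rfl⟩ := (e' c).1 hc
    exact ⟨y, (ht y).symm⟩
  · rintro ⟨y, hy⟩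
    refine (e' c).2 ⟨y, iCycles_injective V i ?_⟩
    exact (ht y).trans hy

lemma quasiIso_iff_coneExact {V W : CochainComplex (ModuleCat.{u} S) ℤ} (φ : V ⟶ W) :
    QuasiIso φ ↔ ConeExact φ := by
  have hcyc : ∀ i (c : V.cycles i), (W.iCycles i).hom ((HomologicalComplex.cyclesMap φ i).hom c) =
      (φ.f i).hom ((V.iCycles i).hom c) := by
    intro i c
    have := congrArg (fun f => f.hom c) (HomologicalComplex.cyclesMap_i φ i)
    exact this
  have hhom : ∀ i (c : V.cycles i), (HomologicalComplex.homologyMap φ i).hom ((V.homologyπ i).hom c) =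
      (W.homologyπ i).hom ((HomologicalComplex.cyclesMap φ i).hom c) := by
    intro i c
    exact congrArg (fun f => f.hom c) (HomologicalComplex.homologyπ_naturality φ i)
  constructor
  · intro hφ g h i j hg hh hi z w hz hzw
    have bij : ∀ i, Function.Bijective (HomologicalComplex.homologyMap φ i).hom := fun i =>
      (ConcreteCategory.isIso_iff_bijective (HomologicalComplex.homologyMap φ i)).1 inferInstance
    obtain ⟨c, rfl⟩ := exists_cycle V i j hi z hz
    have h0 : (V.homologyπ i).hom c = 0 := by
      apply (bij i).1
      rw [hhom, map_zero, homologyπ_eq_zero_iff W h i hh]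
      exact ⟨w, by rw [hcyc, hzw]⟩
    obtain ⟨y, hy⟩ := (homologyπ_eq_zero_iff V h i hh c).1 h0
    have hw : (W.d h i).hom (w - (φ.f h).hom y) = 0 := by
      rw [map_sub, ← hom_d_apply, hy, hzw, sub_self]
    obtain ⟨d, hd⟩ := exists_cycle W h i hh _ hw
    obtain ⟨x, hx⟩ := (bij h).2 ((W.homologyπ h).hom d)
    obtain ⟨c', rfl⟩ := homologyπ_surjective V h x
    have h1 : (W.homologyπ h).hom (d - (HomologicalComplex.cyclesMap φ h).hom c') = 0 := by
      rw [map_sub, ← hhom, hx, sub_self]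
    obtain ⟨w', hw'⟩ := (homologyπ_eq_zero_iff W g h hg _).1 h1
    refine ⟨y + (V.iCycles h).hom c', w', ?_, ?_⟩
    · rw [map_add, hy]
      have : (V.d h i).hom ((V.iCycles h).hom c') = 0 := by
        rw [← LinearMap.comp_apply, ← ModuleCat.hom_comp, V.iCycles_d]; rfl
      rw [this, add_zero]
    · rw [hw', map_sub, hd, hcyc, map_add]; abel
  · intro H
    rw [quasiIso_iff]
    intro i
    rw [quasiIsoAt_iff_isIso_homologyMap]
    apply (ConcreteCategory.isIso_iff_bijective (HomologicalComplex.homologyMap φ i)).2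
    constructor
    · change Function.Injective (HomologicalComplex.homologyMap φ i).hom
      rw [injective_iff_map_eq_zero]
      intro x hx
      obtain ⟨c, rfl⟩ := homologyπ_surjective V i x
      rw [hhom, homologyπ_eq_zero_iff W (i - 1) i (by ring)] at hx
      obtain ⟨w, hw⟩ := hx
      rw [hcyc] at hw
      obtain ⟨z', -, hz', -⟩ := H (i - 1 - 1) (i - 1) i (i + 1) (by ring) (by ring) rfl
        ((V.iCycles i).hom c) w
        (by rw [← LinearMap.comp_apply, ← ModuleCat.hom_comp, V.iCycles_d]; rfl) hw.symm
      exact (homologyπ_eq_zero_iff V (i - 1) i (by ring) c).2 ⟨z', hz'⟩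
    · intro x
      obtain ⟨d, rfl⟩ := homologyπ_surjective W i x
      obtain ⟨z', w', hz', hw'⟩ := H (i - 1) i (i + 1) (i + 1 + 1) (by ring) rfl rfl 0
        ((W.iCycles i).hom d) (map_zero _)
        (by rw [map_zero, ← LinearMap.comp_apply, ← ModuleCat.hom_comp, W.iCycles_d]; rfl)
      obtain ⟨c, rfl⟩ := exists_cycle V i (i + 1) rfl z' hz'
      refine ⟨(V.homologyπ i).hom c, ?_⟩
      refine (hhom i c).trans ?_
      rw [← sub_eq_zero, ← map_sub, homologyπ_eq_zero_iff W (i - 1) i (by ring)]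
      refine ⟨- w', ?_⟩
      rw [map_neg, map_sub, hcyc, ← hw']; abel

end Elements

/-! ### Exactness of `L ⊗_R -` when `L` is projective as a right module -/

section Projective

variable (L : BimodCat k B R)

/-- The bilinear map underlying `toFinsupp`. -/
def toFinsuppBilin (s : L →ₗ[Rᵐᵒᵖ] L →₀ Rᵐᵒᵖ) (V : Type u) [AddCommGroup V] [Module k V]
    [Module R V] [IsScalarTower k R V] : L →ₗ[k] V →ₗ[k] (L →₀ V) :=
  LinearMap.mk₂ k
    (fun (l : L) (v : V) => (s l).mapRange (fun r => unop r • v) (by simp))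
    (fun l l' v => by ext x; simp [add_smul])
    (fun c l v => by
      ext x
      have : s (c • l) = c • s l := map_smul (s.restrictScalars k) c l
      simp [this, smul_assoc])
    (fun l v v' => by ext x; simp)
    (fun c l v => by ext x; simp [smul_comm c])

lemma toFinsuppBilin_balanced (s : L →ₗ[Rᵐᵒᵖ] L →₀ Rᵐᵒᵖ) (V : Type u) [AddCommGroup V]
    [Module k V] [Module R V] [IsScalarTower k R V] (l : L) (r : R) (v : V) : toFinsuppBilin L s V (op r • l) v = toFinsuppBilin L s V l (r • v) := by
  ext x; simp [toFinsuppBilin, mul_smul]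

/-- The map `L ⊗_R V → V^(L)` given by a map `s` from the right module `L` to a free module. -/
def toFinsupp (s : L →ₗ[Rᵐᵒᵖ] L →₀ Rᵐᵒᵖ) (V : ModuleCat.{u} R) : tensorObj L V →+ (L →₀ V) :=
  (BalancedTensor.lift (toFinsuppBilin L s V) (toFinsuppBilin_balanced L s V)).toAddMonoidHom

lemma toFinsupp_tmul (s : L →ₗ[Rᵐᵒᵖ] L →₀ Rᵐᵒᵖ) (V : ModuleCat.{u} R) (l : L) (v : V) (x : L) :
    toFinsupp L s V (tmul L V l v) x = unop (s l x) • v := by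
  refine (DFunLike.congr_fun (BalancedTensor.lift_tmul (toFinsuppBilin L s V)
    (toFinsuppBilin_balanced L s V) l v) x).trans ?_
  simp [toFinsuppBilin]

lemma toFinsupp_map (s : L →ₗ[Rᵐᵒᵖ] L →₀ Rᵐᵒᵖ) {V W : ModuleCat.{u} R} (f : V ⟶ W)
    (z : tensorObj L V) (x : L) :
    toFinsupp L s W ((tensorMap (𝟙 L) f).hom z) x = f.hom (toFinsupp L s V z x) := by
  induction z using tensorObj_induction with
  | h0 => simp
  | ht l v => rw [tensorMap_tmul, toFinsupp_tmul, toFinsupp_tmul, map_smul]; rfl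
  | ha x y hx hy => simp only [map_add, Finsupp.add_apply, hx, hy]

/-- The map `V^(L) → L ⊗_R V` sending `v` in position `l` to `l ⊗ v`. -/
def ofFinsupp (V : ModuleCat.{u} R) : (L →₀ V) →+ tensorObj L V :=
  Finsupp.liftAddHom fun l => AddMonoidHom.mk' (fun v => tmul L V l v) (tmul_add L V l)

lemma ofFinsupp_single (V : ModuleCat.{u} R) (l : L) (v : V) :
    ofFinsupp L V (Finsupp.single l v) = tmul L V l v := by
  exact Finsupp.liftAddHom_apply_single _ _ _

lemma ofFinsupp_map {V W : ModuleCat.{u} R} (f : V ⟶ W) (z : L →₀ V) :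
    ofFinsupp L W (z.mapRange f.hom (map_zero _)) = (tensorMap (𝟙 L) f).hom (ofFinsupp L V z) := by
  induction z using Finsupp.induction_linear with
  | zero => simp
  | add x y hx hy => rw [map_add, map_add, ← hx, ← hy, ← map_add, Finsupp.mapRange_add (by simp)]
  | single l v =>
    rw [Finsupp.mapRange_single, ofFinsupp_single, ofFinsupp_single, tensorMap_tmul]; rfl

lemma ofFinsupp_toFinsupp (s : L →ₗ[Rᵐᵒᵖ] L →₀ Rᵐᵒᵖ)
    (hs : Function.LeftInverse (Finsupp.linearCombination Rᵐᵒᵖ id) s) (V : ModuleCat.{u} R)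
    (z : tensorObj L V) : ofFinsupp L V (toFinsupp L s V z) = z := by
  induction z using tensorObj_induction with
  | h0 => simp
  | ht l v =>
    have h1 : toFinsupp L s V (tmul L V l v) =
        (s l).mapRange (fun r => unop r • v) (by simp) := by
      ext x; rw [toFinsupp_tmul]; simp
    have h2 : ∀ t : L →₀ Rᵐᵒᵖ, ofFinsupp L V (t.mapRange (fun r => unop r • v) (by simp)) =
        tmul L V (Finsupp.linearCombination Rᵐᵒᵖ id t) v := by
      intro t
      induction t using Finsupp.induction_linear with
      | zero =>
        simp only [Finsupp.mapRange_zero, map_zero]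
        have := add_tmul L V 0 0 v
        rw [add_zero] at this
        exact (left_eq_add.1 this).symm
      | add x y hx hy =>
        rw [Finsupp.mapRange_add (by simp [add_smul]), map_add, map_add, add_tmul, hx, hy]
      | single x r =>
        rw [Finsupp.mapRange_single, ofFinsupp_single, Finsupp.linearCombination_single,
          ← tmul_balanced]
        rfl
    rw [h1, h2, hs]
  | ha x y hx hy => rw [map_add, map_add, hx, hy]

variable {L}

/-- For a right projective `L`, the functor `L ⊗_R -` preserves the exactness of cones. -/
lemma ConeExact.tensor [Module.Projective Rᵐᵒᵖ L] {V W : CochainComplex (ModuleCat.{u} R) ℤ}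
    {φ : V ⟶ W} (H : ConeExact φ) (g h i j : ℤ) (hg : g + 1 = h) (hh : h + 1 = i) (hi : i + 1 = j)
    (z : tensorObj L (V.X i)) (w : tensorObj L (W.X h))
    (hz : (tensorMap (𝟙 L) (V.d i j)).hom z = 0)
    (hzw : (tensorMap (𝟙 L) (φ.f i)).hom z = (tensorMap (𝟙 L) (W.d h i)).hom w) :
    ∃ (z' : tensorObj L (V.X h)) (w' : tensorObj L (W.X g)),
      (tensorMap (𝟙 L) (V.d h i)).hom z' = z ∧
      (tensorMap (𝟙 L) (φ.f h)).hom z' + (tensorMap (𝟙 L) (W.d g h)).hom w' = w := by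
  classical
  obtain ⟨s, hs⟩ := Module.projective_def.1 (inferInstance : Module.Projective Rᵐᵒᵖ L)
  have key : ∀ x : L, ∃ (z' : V.X h) (w' : W.X g),
      (V.d h i).hom z' = toFinsupp L s _ z x ∧
      (φ.f h).hom z' + (W.d g h).hom w' = toFinsupp L s _ w x := fun x =>
    H g h i j hg hh hi _ _ (by rw [← toFinsupp_map, hz]; simp)
      (by rw [← toFinsupp_map, hzw, toFinsupp_map])
  choose a b hab hab' using key
  let S : Finset L := (toFinsupp L s _ z).support ∪ (toFinsupp L s _ w).support
  let a' : L →₀ V.X h := Finsupp.onFinset S (fun x => if x ∈ S then a x else 0)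
    (fun x hx => by by_contra hxS; simp [hxS] at hx)
  let b' : L →₀ W.X g := Finsupp.onFinset S (fun x => if x ∈ S then b x else 0)
    (fun x hx => by by_contra hxS; simp [hxS] at hx)
  have hS : ∀ x, x ∉ S → toFinsupp L s _ z x = 0 ∧ toFinsupp L s _ w x = 0 := by
    intro x hx
    simpa [S] using hx
  refine ⟨ofFinsupp L _ a', ofFinsupp L _ b', ?_, ?_⟩
  · rw [← ofFinsupp_map]
    refine Eq.trans (congrArg _ ?_) (ofFinsupp_toFinsupp L s hs _ z)
    ext x
    by_cases hx : x ∈ S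
    · simp [a', hx, hab]
    · simp [a', hx, (hS x hx).1]
  · rw [← ofFinsupp_map, ← ofFinsupp_map, ← map_add]
    refine Eq.trans (congrArg _ ?_) (ofFinsupp_toFinsupp L s hs _ w)
    ext x
    by_cases hx : x ∈ S
    · simp [a', b', hx, hab']
    · simp [a', b', hx, (hS x hx).2]

end Projective

/-! ### Tensoring complexes -/

section Total

/-- The functor `X ⊗_R -` from complexes of `R`-modules to complexes of `B`-modules, for a complex
`X` of `B`-`R`-bimodules (the total complex, with the usual signs). -/
def tensorComplex (X : CochainComplex (BimodCat k B R) ℤ) :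
    CochainComplex (ModuleCat.{u} R) ℤ ⥤ CochainComplex (ModuleCat.{u} B) ℤ :=
  ((tensorFunctor k B R).map₂CochainComplex).obj X

variable (X : CochainComplex (BimodCat k B R) ℤ) (V W : CochainComplex (ModuleCat.{u} R) ℤ)

/-- The inclusion of `X^p ⊗ V^q` in `(X ⊗ V)^n`, for `p + q = n`. -/
def ιT (p q n : ℤ) (h : p + q = n) :
    tensorObj (X.X p) (V.X q) ⟶ ((tensorComplex X).obj V).X n :=
  HomologicalComplex.ιMapBifunctor X V (tensorFunctor k B R) (ComplexShape.up ℤ) p q n h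

/-- The projection of `(X ⊗ V)^n` on `X^p ⊗ V^q`, for `p + q = n`. -/
def πT (p q n : ℤ) (h : p + q = n) :
    ((tensorComplex X).obj V).X n ⟶ tensorObj (X.X p) (V.X q) :=
  HomologicalComplex.mapBifunctorDesc (K₁ := X) (K₂ := V) (F := tensorFunctor k B R)
    (c := ComplexShape.up ℤ) (j := n)
    (fun p' q' (h' : p' + q' = n) => if hp : p' = p then
      (eqToHom (by subst hp; obtain rfl : q' = q := by omega
                   rfl) : tensorObj (X.X p') (V.X q') ⟶ tensorObj (X.X p) (V.X q)) else 0)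

lemma total_hom_ext {n : ℤ} {Z : ModuleCat.{u} B} {f g : ((tensorComplex X).obj V).X n ⟶ Z}
    (h : ∀ p q (hpq : p + q = n), ιT X V p q n hpq ≫ f = ιT X V p q n hpq ≫ g) : f = g :=
  HomologicalComplex.mapBifunctor.hom_ext (fun p q hpq => h p q hpq)

lemma ι_π_self (p q n : ℤ) (h : p + q = n) : ιT X V p q n h ≫ πT X V p q n h = 𝟙 _ := by
  refine (HomologicalComplex.ι_mapBifunctorDesc _ p q h).trans ?_
  simp
  rfl

lemma ι_π_of_ne (p q p' q' n : ℤ) (h : p + q = n) (h' : p' + q' = n) (hp : p ≠ p') :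
    ιT X V p q n h ≫ πT X V p' q' n h' = 0 := by
  refine (HomologicalComplex.ι_mapBifunctorDesc _ p q h).trans ?_
  simp [hp]
  rfl

lemma ι_d (p p' q q' n n' : ℤ) (h : p + q = n) (hp : p + 1 = p') (hq : q + 1 = q')
    (hn : n + 1 = n') :
    ιT X V p q n h ≫ ((tensorComplex X).obj V).d n n' =
      tensorMap (X.d p p') (𝟙 _) ≫ ιT X V p' q n' (by omega) +
      p.negOnePow • (tensorMap (𝟙 _) (V.d q q') ≫ ιT X V p q' n' (by omega)) := by
  subst hp hq hn
  have h1 := (HomologicalComplex.mapBifunctor.ι_D₁ X V (tensorFunctor k B R) (.up ℤ)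
    n (n + 1) p q h).trans (HomologicalComplex.mapBifunctor.d₁_eq X V (tensorFunctor k B R) (.up ℤ)
      (i₁ := p) (i₁' := p + 1) rfl q (n + 1) (by change p + 1 + q = n + 1; omega))
  have h2 := (HomologicalComplex.mapBifunctor.ι_D₂ X V (tensorFunctor k B R) (.up ℤ)
    n (n + 1) p q h).trans (HomologicalComplex.mapBifunctor.d₂_eq X V (tensorFunctor k B R) (.up ℤ)
      p (i₂ := q) (i₂' := q + 1) rfl (n + 1) (by change p + (q + 1) = n + 1; omega))
  refine (Preadditive.comp_add _ _ _ (HomologicalComplex.ιMapBifunctor X V (tensorFunctor k B R)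
    (.up ℤ) p q n h) _ _).trans ((congrArg₂ (· + ·) h1 h2).trans ?_)
  exact congrArg₂ (· + ·) (one_smul _ _) rfl

lemma ι_map {V W : CochainComplex (ModuleCat.{u} R) ℤ} (φ : V ⟶ W) (p q n : ℤ) (h : p + q = n) :
    ιT X V p q n h ≫ ((tensorComplex X).map φ).f n =
      tensorMap (𝟙 _) (φ.f q) ≫ ιT X W p q n h := by
  refine (HomologicalComplex.ι_mapBifunctorMap (𝟙 X) φ (tensorFunctor k B R) (.up ℤ) p q n h).trans ?_
  rw [HomologicalComplex.id_f, CategoryTheory.Functor.map_id, NatTrans.id_app]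
  exact Category.id_comp _

/-- A complex is bounded if its terms vanish outside a finite range of degrees. -/
def IsBounded {S : Type u} [Ring S] (K : CochainComplex (ModuleCat.{u} S) ℤ) : Prop :=
  ∃ a b : ℤ, ∀ i, (i < a ∨ b < i) → Subsingleton (K.X i)

lemma ιT_apply_eq_zero (p q n : ℤ) (h : p + q = n) [Subsingleton (X.X p)]
    (z : tensorObj (X.X p) (V.X q)) : (ιT X V p q n h).hom z = 0 := by
  have : z = 0 := by
    induction z using tensorObj_induction with
    | h0 => rfl
    | ht l v =>
      rw [Subsingleton.elim l 0]
      have := add_tmul (X.X p) (V.X q) 0 0 v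
      rw [add_zero] at this
      exact left_eq_add.1 this
    | ha x y hx hy => rw [hx, hy, add_zero]
  rw [this, map_zero]

lemma sum_ι_π {a b : ℤ} (hX : ∀ i, (i < a ∨ b < i) → Subsingleton (X.X i)) (n : ℤ)
    (z : ((tensorComplex X).obj V).X n) :
    ∑ p ∈ Finset.Icc a b, (ιT X V p (n - p) n (by omega)).hom
      ((πT X V p (n - p) n (by omega)).hom z) = z := by
  have : ∑ p ∈ Finset.Icc a b, πT X V p (n - p) n (by omega) ≫ ιT X V p (n - p) n (by omega)
      = 𝟙 _ := by
    refine total_hom_ext X V fun p q hpq => ?_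
    obtain rfl : q = n - p := by omega
    rw [Category.comp_id, Preadditive.comp_sum]
    by_cases hp : p ∈ Finset.Icc a b
    · rw [Finset.sum_eq_single p]
      · rw [← Category.assoc, ι_π_self, Category.id_comp]
      · intro p' _ hne
        rw [← Category.assoc, ι_π_of_ne X V _ _ _ _ _ _ _ (Ne.symm hne), Limits.zero_comp]
      · exact fun h => (h hp).elim
    · have : Subsingleton (X.X p) := hX p (by
        rw [Finset.mem_Icc] at hp
        omega)
      have h0 : ιT X V p (n - p) n hpq = 0 := by
        ext z
        exact ιT_apply_eq_zero X V p (n - p) n hpq z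
      rw [h0]
      simp
  have h := congrArg (fun f => f.hom z) this
  simp only [ModuleCat.hom_sum, LinearMap.sum_apply, ModuleCat.hom_comp, LinearMap.comp_apply,
    ModuleCat.hom_id, LinearMap.id_apply] at h
  exact h

lemma π_ι_apply_self (p q n : ℤ) (h : p + q = n) (z : tensorObj (X.X p) (V.X q)) :
    (πT X V p q n h).hom ((ιT X V p q n h).hom z) = z :=
  congrArg (fun f => f.hom z) (ι_π_self X V p q n h)

lemma π_ι_apply_of_ne (p q p' q' n : ℤ) (h : p + q = n) (h' : p' + q' = n) (hp : p ≠ p')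
    (z : tensorObj (X.X p) (V.X q)) :
    (πT X V p' q' n h').hom ((ιT X V p q n h).hom z) = 0 :=
  congrArg (fun f => f.hom z) (ι_π_of_ne X V p q p' q' n h h' hp)

lemma d_ι_apply (p p' q q' n n' : ℤ) (h : p + q = n) (hp : p + 1 = p') (hq : q + 1 = q')
    (hn : n + 1 = n') (z : tensorObj (X.X p) (V.X q)) :
    (((tensorComplex X).obj V).d n n').hom ((ιT X V p q n h).hom z) =
      (ιT X V p' q n' (by omega)).hom ((tensorMap (X.d p p') (𝟙 _)).hom z) +
      p.negOnePow • (ιT X V p q' n' (by omega)).hom ((tensorMap (𝟙 _) (V.d q q')).hom z) :=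
  congrArg (fun f => f.hom z) (ι_d X V p p' q q' n n' h hp hq hn)

lemma map_ι_apply {V W : CochainComplex (ModuleCat.{u} R) ℤ} (φ : V ⟶ W) (p q n : ℤ)
    (h : p + q = n) (z : tensorObj (X.X p) (V.X q)) :
    (((tensorComplex X).map φ).f n).hom ((ιT X V p q n h).hom z) =
      (ιT X W p q n h).hom ((tensorMap (𝟙 _) (φ.f q)).hom z) :=
  congrArg (fun f => f.hom z) (ι_map X φ p q n h)

lemma π_map_apply {V W : CochainComplex (ModuleCat.{u} R) ℤ} (φ : V ⟶ W) (p q n : ℤ)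
    (h : p + q = n) (z : ((tensorComplex X).obj V).X n) :
    (πT X W p q n h).hom ((((tensorComplex X).map φ).f n).hom z) =
      (tensorMap (𝟙 _) (φ.f q)).hom ((πT X V p q n h).hom z) := by
  have : ((tensorComplex X).map φ).f n ≫ πT X W p q n h =
      πT X V p q n h ≫ tensorMap (𝟙 _) (φ.f q) := by
    refine total_hom_ext X V fun p' q' h' => ?_
    rw [← Category.assoc, ι_map, Category.assoc, ← Category.assoc (ιT X V p' q' n h')]
    by_cases hp : p' = p
    · subst hp
      obtain rfl : q' = q := by omega
      rw [ι_π_self, ι_π_self, Category.comp_id, Category.id_comp]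
    · rw [ι_π_of_ne X W _ _ _ _ _ _ _ hp, ι_π_of_ne X V _ _ _ _ _ _ _ hp]
      simp
  exact congrArg (fun f => f.hom z) this

/-- If all components of `z` of index less than `p` vanish, then the component of `dz` of index `p`
is, up to sign, the differential of the component of `z` of index `p`. -/
lemma π_d_apply (p q q' n n' : ℤ) (h : p + q = n) (hq : q + 1 = q') (hn : n + 1 = n')
    (z : ((tensorComplex X).obj V).X n)
    (hz : ∀ p' q' (h' : p' + q' = n), p' < p → (πT X V p' q' n h').hom z = 0) :
    (πT X V p q' n' (by omega)).hom ((((tensorComplex X).obj V).d n n').hom z) =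
      p.negOnePow • (tensorMap (𝟙 _) (V.d q q')).hom ((πT X V p q n h).hom z) := by
  obtain ⟨p₀, hp₀⟩ : ∃ p₀, p₀ + 1 = p := ⟨p - 1, by omega⟩
  have : ((tensorComplex X).obj V).d n n' ≫ πT X V p q' n' (by omega) =
      πT X V p₀ q' n (by omega) ≫ tensorMap (X.d p₀ p) (𝟙 _) +
      p.negOnePow • (πT X V p q n h ≫ tensorMap (𝟙 _) (V.d q q')) := by
    refine total_hom_ext X V fun p₁ q₁ h₁ => ?_
    rw [← Category.assoc, ι_d X V p₁ (p₁ + 1) q₁ (q₁ + 1) n n' h₁ rfl rfl hn, Preadditive.comp_add,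
      Preadditive.add_comp, ← Category.assoc (ιT X V p₁ q₁ n h₁), Linear.units_smul_comp,
      Linear.comp_units_smul, Category.assoc, Category.assoc, ← Category.assoc (ιT X V p₁ q₁ n h₁)]
    by_cases hp : p₁ = p
    · subst hp
      obtain rfl : q₁ = q := by omega
      subst hq
      rw [ι_π_of_ne X V (p₁ + 1) q₁ p₁ (q₁ + 1) n' _ _ (by omega), ι_π_self, ι_π_self,
        ι_π_of_ne X V p₁ q₁ p₀ (q₁ + 1) n _ _ (by omega)]
      simp
    · by_cases hp' : p₁ = p₀
      · subst hp' hp₀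
        obtain rfl : q' = q₁ := by omega
        rw [ι_π_self X V (p₁ + 1), ι_π_of_ne X V p₁ (q' + 1) (p₁ + 1) q' n' _ _ (by omega),
          ι_π_of_ne X V p₁ q' (p₁ + 1) q n _ _ (by omega), ι_π_self X V p₁]
        simp
      · rw [ι_π_of_ne X V (p₁ + 1) q₁ p q' n' _ _ (by omega),
          ι_π_of_ne X V p₁ (q₁ + 1) p q' n' _ _ (by omega),
          ι_π_of_ne X V p₁ q₁ p₀ q' n _ _ (by omega),
          ι_π_of_ne X V p₁ q₁ p q n _ _ (by omega)]
        simp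
  have h2 := congrArg (fun f => f.hom z) this
  refine h2.trans ?_
  have h3 := hz p₀ q' (by omega) (by omega)
  change (tensorMap (X.d p₀ p) (𝟙 _)).hom ((πT X V p₀ q' n _).hom z) + _ = _
  rw [h3, map_zero, zero_add]
  rfl

lemma map_units_smul' {S : Type u} [Ring S] {V W : ModuleCat.{u} S} (f : V →ₗ[S] W) (c : ℤˣ)
    (x : V) : f (c • x) = c • f x := by
  rw [Units.smul_def, Units.smul_def, map_zsmul]

/-- Tensoring with a bounded complex of right projective bimodules preserves exactness of cones. -/
lemma ConeExact.tensorComplex {X : CochainComplex (BimodCat k B R) ℤ} (hX : IsBounded X)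
    [∀ i, Module.Projective Rᵐᵒᵖ (X.X i)] {V W : CochainComplex (ModuleCat.{u} R) ℤ} {φ : V ⟶ W}
    (H : ConeExact φ) : ConeExact ((tensorComplex X).map φ) := by
  obtain ⟨a, b, hab⟩ := hX
  intro g h i j hg hh hi
  have main : ∀ (N : ℕ) (z : ((PeriodicTwist.tensorComplex X).obj V).X i)
      (w : ((PeriodicTwist.tensorComplex X).obj W).X h),
      (((PeriodicTwist.tensorComplex X).obj V).d i j).hom z = 0 →
      (((PeriodicTwist.tensorComplex X).map φ).f i).hom z =
        (((PeriodicTwist.tensorComplex X).obj W).d h i).hom w →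
      (∀ p q (hpq : p + q = i), p < b + 1 - N → (πT X V p q i hpq).hom z = 0) →
      (∀ p q (hpq : p + q = h), p < b + 1 - N → (πT X W p q h hpq).hom w = 0) →
      ∃ (z' : ((PeriodicTwist.tensorComplex X).obj V).X h)
        (w' : ((PeriodicTwist.tensorComplex X).obj W).X g),
        (((PeriodicTwist.tensorComplex X).obj V).d h i).hom z' = z ∧
        (((PeriodicTwist.tensorComplex X).map φ).f h).hom z' +
          (((PeriodicTwist.tensorComplex X).obj W).d g h).hom w' = w := by
    intro N
    induction N with
    | zero =>
      intro z w _ _ hz hw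
      refine ⟨0, 0, ?_, ?_⟩
      · rw [map_zero, ← sum_ι_π X V hab i z]
        symm
        refine Finset.sum_eq_zero fun p hp => ?_
        rw [hz p _ _ (by rw [Finset.mem_Icc] at hp; push_cast; omega), map_zero]
      · rw [map_zero, map_zero, zero_add, ← sum_ι_π X W hab h w]
        symm
        refine Finset.sum_eq_zero fun p hp => ?_
        rw [hw p _ _ (by rw [Finset.mem_Icc] at hp; push_cast; omega), map_zero]
    | succ N ih =>
      intro z w hdz hzw hz hw
      obtain ⟨p, hp⟩ : ∃ p : ℤ, p = b + 1 - (N + 1 : ℕ) := ⟨_, rfl⟩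
      rw [← hp] at hz hw
      obtain ⟨qj, hqj⟩ : ∃ q, p + q = j := ⟨j - p, by omega⟩
      obtain ⟨qi, hqi⟩ : ∃ q, p + q = i := ⟨i - p, by omega⟩
      obtain ⟨qh, hqh⟩ : ∃ q, p + q = h := ⟨h - p, by omega⟩
      obtain ⟨qg, hqg⟩ : ∃ q, p + q = g := ⟨g - p, by omega⟩
      have hsq : p.negOnePow * p.negOnePow = 1 := Int.units_mul_self _
      have e1 := π_d_apply X V p qi qj i j hqi (by omega) hi z hz
      rw [hdz, map_zero] at e1
      have e1' : (tensorMap (𝟙 (X.X p)) (V.d qi qj)).hom ((πT X V p qi i hqi).hom z) = 0 := by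
        have := congrArg (fun t => p.negOnePow • t) e1
        simp only [smul_smul, hsq, one_smul, smul_zero] at this
        exact this.symm
      have e2 := π_d_apply X W p qh qi h i hqh (by omega) hh w hw
      rw [← hzw, π_map_apply] at e2
      obtain ⟨z₁, w₁, hz₁, hw₁⟩ := ConeExact.tensor (L := X.X p) H qg qh qi qj (by omega) (by omega)
        (by omega) ((πT X V p qi i hqi).hom z) (p.negOnePow • (πT X W p qh h hqh).hom w) e1'
        (e2.trans (map_units_smul' _ _ _).symm)
      have hz' : ∀ p' q' (h' : p' + q' = i), p' < p + 1 →
          (πT X V p' q' i h').hom ((((PeriodicTwist.tensorComplex X).obj V).d h i).hom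
            (p.negOnePow • (ιT X V p qh h hqh).hom z₁)) = (πT X V p' q' i h').hom z := by
        intro p' q' h' hp'
        rw [map_units_smul', map_units_smul', d_ι_apply X V p (p + 1) qh qi h i hqh rfl (by omega) hh,
          map_add, π_ι_apply_of_ne X V (p + 1) qh p' q' i _ _ (by omega), zero_add]
        by_cases hpp : p' = p
        · subst hpp
          obtain rfl : q' = qi := by omega
          rw [map_units_smul', π_ι_apply_self, smul_smul, hsq, one_smul, hz₁]
        · rw [map_units_smul', π_ι_apply_of_ne X V p qi p' q' i _ _ (Ne.symm hpp), smul_zero,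
            smul_zero, hz p' q' h' (by omega)]
      have hw' : ∀ p' q' (h' : p' + q' = h), p' < p + 1 →
          (πT X W p' q' h h').hom ((((PeriodicTwist.tensorComplex X).map φ).f h).hom
            (p.negOnePow • (ιT X V p qh h hqh).hom z₁) +
            (((PeriodicTwist.tensorComplex X).obj W).d g h).hom ((ιT X W p qg g hqg).hom w₁)) =
          (πT X W p' q' h h').hom w := by
        intro p' q' h' hp'
        rw [map_units_smul', map_ι_apply, d_ι_apply X W p (p + 1) qg qh g h hqg rfl (by omega) hg,
          map_add, map_add, π_ι_apply_of_ne X W (p + 1) qg p' q' h _ _ (by omega), zero_add,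
          map_units_smul', map_units_smul']
        by_cases hpp : p' = p
        · subst hpp
          obtain rfl : q' = qh := by omega
          rw [π_ι_apply_self, π_ι_apply_self, ← smul_add, hw₁, smul_smul, hsq, one_smul]
        · rw [π_ι_apply_of_ne X W p qh p' q' h _ _ (Ne.symm hpp),
            π_ι_apply_of_ne X W p qh p' q' h _ _ (Ne.symm hpp), smul_zero, add_zero,
            hw p' q' h' (by omega)]
      obtain ⟨z₂, w₂, hz₂, hw₂⟩ := ih
        (z - (((PeriodicTwist.tensorComplex X).obj V).d h i).hom
            (p.negOnePow • (ιT X V p qh h hqh).hom z₁))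
        (w - ((((PeriodicTwist.tensorComplex X).map φ).f h).hom
            (p.negOnePow • (ιT X V p qh h hqh).hom z₁) +
            (((PeriodicTwist.tensorComplex X).obj W).d g h).hom ((ιT X W p qg g hqg).hom w₁)))
        (by rw [map_sub, hdz, comp_d_apply, sub_zero])
        (by rw [map_sub, map_sub, map_add, hom_d_apply, comp_d_apply, add_zero, hzw])
        (fun p' q' h' hp' => by rw [map_sub, hz' p' q' h' (by omega), sub_self])
        (fun p' q' h' hp' => by rw [map_sub, hw' p' q' h' (by omega), sub_self])
      refine ⟨z₂ + p.negOnePow • (ιT X V p qh h hqh).hom z₁,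
        w₂ + (ιT X W p qg g hqg).hom w₁, ?_, ?_⟩
      · rw [map_add, hz₂, sub_add_cancel]
      · rw [map_add, map_add, add_add_add_comm, hw₂, sub_add_cancel]
  have hzero : ∀ (U : CochainComplex (ModuleCat.{u} R) ℤ) (n : ℤ)
      (x : ((PeriodicTwist.tensorComplex X).obj U).X n) (p q : ℤ) (hpq : p + q = n), p < a →
      (πT X U p q n hpq).hom x = 0 := by
    intro U n x p q hpq hp
    rw [← sum_ι_π X U hab n x, map_sum]
    refine Finset.sum_eq_zero fun p' hp' => ?_
    rw [Finset.mem_Icc] at hp'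
    exact π_ι_apply_of_ne X U p' _ p q n _ _ (by omega) _
  intro z w hz hzw
  exact main (b + 1 - a).toNat z w hz hzw
    (fun p q hpq hp => hzero V i z p q hpq (by omega))
    (fun p q hpq hp => hzero W h w p q hpq (by omega))

/-- The tensor product of bounded complexes is bounded. -/
lemma IsBounded.tensorComplex {X : CochainComplex (BimodCat k B R) ℤ} (hX : IsBounded X)
    {V : CochainComplex (ModuleCat.{u} R) ℤ} (hV : IsBounded V) :
    IsBounded ((tensorComplex X).obj V) := by
  obtain ⟨a, b, hab⟩ := hX
  obtain ⟨c, d, hcd⟩ := hV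
  refine ⟨a + c, b + d, fun i hi => ⟨fun x y => ?_⟩⟩
  have key : ∀ x : ((PeriodicTwist.tensorComplex X).obj V).X i, x = 0 := by
    intro x
    rw [← sum_ι_π X V hab i x]
    refine Finset.sum_eq_zero fun p hp => ?_
    rw [Finset.mem_Icc] at hp
    have : Subsingleton (V.X (i - p)) := hcd _ (by omega)
    have h0 : ∀ t : tensorObj (X.X p) (V.X (i - p)), t = 0 := by
      intro t
      induction t using tensorObj_induction with
      | h0 => rfl
      | ht l v =>
        rw [Subsingleton.elim v 0]
        have := tmul_add (X.X p) (V.X (i - p)) l 0 0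
        rw [add_zero] at this
        exact left_eq_add.1 this
      | ha x y hx hy => rw [hx, hy, add_zero]
    rw [h0 ((πT X V p (i - p) i _).hom x), map_zero]
  rw [key x, key y]

instance finite_tensorObj [Module.Finite k B] [Module.Finite k R] (L : BimodCat k B R)
    (V : ModuleCat.{u} R) [Module.Finite (B ⊗[k] Rᵐᵒᵖ) L] [Module.Finite R V] :
    Module.Finite B (tensorObj L V) := by
  have : Module.Finite k Rᵐᵒᵖ := Module.Finite.equiv (MulOpposite.opLinearEquiv k : R ≃ₗ[k] Rᵐᵒᵖ)
  have hL : Module.Finite k L := Module.Finite.trans (B ⊗[k] Rᵐᵒᵖ) L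
  have hV : Module.Finite k V := Module.Finite.trans R V
  have hT : Module.Finite k (BalancedTensor k R L V) :=
    inferInstanceAs (Module.Finite k ((L ⊗[k] V) ⧸ balancedRel k R L V))
  have hk : ∀ (c : k) (z : BalancedTensor k R L V), (tensorObjEquiv L V).symm (c • z) =
      algebraMap k B c • (tensorObjEquiv L V).symm z := by
    intro c z
    induction z using BalancedTensor.induction_on with
    | h0 => rw [smul_zero, map_zero, smul_zero]
    | ht l v =>
      refine Eq.trans ?_ (smul_tmul L V (algebraMap k B c) l v).symm
      rw [← BalancedTensor.smul_tmul', algebraMap_smul]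
      rfl
    | ha x y hx hy => rw [smul_add, map_add, map_add, smul_add, hx, hy]
  have hT' : Module.Finite k (tensorObj L V) := by
    let f : BalancedTensor k R L V →ₗ[k] tensorObj L V :=
      { toFun := (tensorObjEquiv L V).symm
        map_add' := map_add _
        map_smul' := hk }
    exact Module.Finite.of_surjective f (tensorObjEquiv L V).symm.surjective
  exact Module.Finite.of_restrictScalars_finite k B _

/-- The tensor product of a bounded complex of finitely generated bimodules with a complex of
finitely generated modules is a complex of finitely generated modules. -/
lemma finite_tensorComplex [Module.Finite k B] [Module.Finite k R]
    {X : CochainComplex (BimodCat k B R) ℤ} (hX : IsBounded X)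
    [∀ i, Module.Finite (B ⊗[k] Rᵐᵒᵖ) (X.X i)]
    (V : CochainComplex (ModuleCat.{u} R) ℤ) [∀ i, Module.Finite R (V.X i)] (n : ℤ) :
    Module.Finite B (((tensorComplex X).obj V).X n) := by
  obtain ⟨a, b, hab⟩ := hX
  let f : (∀ p : Finset.Icc a b, tensorObj (X.X p) (V.X (n - p))) →ₗ[B]
      ((tensorComplex X).obj V).X n :=
    ∑ p : Finset.Icc a b, (ιT X V p (n - p) n (by omega)).hom ∘ₗ LinearMap.proj p
  refine Module.Finite.of_surjective f fun x => ?_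
  refine ⟨fun p => (πT X V p (n - p) n (by omega)).hom x, ?_⟩
  refine Eq.trans ?_ (sum_ι_π X V hab n x)
  rw [← Finset.sum_coe_sort]
  simp [f]

end Total

/-! ### Finiteness and one-sided projectivity of bimodules -/

namespace BimodCat

/-- The right `C`-linear map underlying a morphism of bimodules. -/
def rightLinear {L L' : BimodCat k B C} (f : L ⟶ L') : L →ₗ[Cᵐᵒᵖ] L' where
  toFun := f.hom
  map_add' := map_add f.hom
  map_smul' := fun c m => hom_right f c m

lemma rightProjective_of_split {L L' : BimodCat k B C} [Module.Projective Cᵐᵒᵖ L'] (i : L ⟶ L')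
    (p : L' ⟶ L) (h : i ≫ p = 𝟙 L) : Module.Projective Cᵐᵒᵖ L :=
  Module.Projective.of_split (rightLinear i) (rightLinear p)
    (LinearMap.ext fun m => congrArg (fun f => f.hom m) h)

lemma rightProjective_of_sum {L L₁ L₂ : BimodCat k B C} [Module.Projective Cᵐᵒᵖ L₁]
    [Module.Projective Cᵐᵒᵖ L₂] (i₁ : L₁ ⟶ L) (p₁ : L ⟶ L₁) (i₂ : L₂ ⟶ L) (p₂ : L ⟶ L₂)
    (h : p₁ ≫ i₁ + p₂ ≫ i₂ = 𝟙 L) : Module.Projective Cᵐᵒᵖ L :=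
  Module.Projective.of_split (M := L₁ × L₂) ((rightLinear p₁).prod (rightLinear p₂))
    ((rightLinear i₁).coprod (rightLinear i₂))
    (LinearMap.ext fun m => congrArg (fun f => f.hom m) h)

lemma finite_of_sum {L L₁ L₂ : BimodCat k B C} [Module.Finite (B ⊗[k] Cᵐᵒᵖ) L₁]
    [Module.Finite (B ⊗[k] Cᵐᵒᵖ) L₂] (i₁ : L₁ ⟶ L) (p₁ : L ⟶ L₁) (i₂ : L₂ ⟶ L) (p₂ : L ⟶ L₂)
    (h : p₁ ≫ i₁ + p₂ ≫ i₂ = 𝟙 L) : Module.Finite (B ⊗[k] Cᵐᵒᵖ) L :=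
  Module.Finite.of_surjective (i₁.hom.coprod i₂.hom) fun m =>
    ⟨(p₁.hom m, p₂.hom m), congrArg (fun f => f.hom m) h⟩

lemma finite_of_finite_field (L : BimodCat k B C) [Module.Finite k L] :
    Module.Finite (B ⊗[k] Cᵐᵒᵖ) L :=
  Module.Finite.of_restrictScalars_finite k (B ⊗[k] Cᵐᵒᵖ) L

lemma finite_field_of_finite [Module.Finite k B] [Module.Finite k C] (L : BimodCat k B C)
    [Module.Finite (B ⊗[k] Cᵐᵒᵖ) L] : Module.Finite k L :=
  have : Module.Finite k Cᵐᵒᵖ := Module.Finite.equiv (MulOpposite.opLinearEquiv k : C ≃ₗ[k] Cᵐᵒᵖ)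
  Module.Finite.trans (B ⊗[k] Cᵐᵒᵖ) L

lemma finite_field_ofActions (M : Type u) [AddCommGroup M] [Module k M] [Module.Finite k M]
    (l : B →ₐ[k] Module.End k M) (r : Cᵐᵒᵖ →ₐ[k] Module.End k M) (h : ∀ b c, Commute (l b) (r c)) :
    Module.Finite k (ofActions M l r h) := by
  let f : ofActions M l r h →ₗ[k] M :=
    { toFun := ofActionsEquiv M l r h
      map_add' := map_add _
      map_smul' := ofActionsEquiv_k M l r h }
  exact Module.Finite.of_injective f (ofActionsEquiv M l r h).injective

lemma finite_field_tensor (L : BimodCat k B R) (N : BimodCat k R C) [Module.Finite k L]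
    [Module.Finite k N] : Module.Finite k (tensor L N) := by
  have : Module.Finite k (BalancedTensor k R L N) :=
    inferInstanceAs (Module.Finite k ((L ⊗[k] N) ⧸ balancedRel k R L N))
  exact finite_field_ofActions _ _ _ (tensor_commute L N)

lemma tmul_zero (L : BimodCat k B R) (N : BimodCat k R C) (l : L) : tmul L N l 0 = 0 := by
  have := tmul_add L N l 0 0
  rw [add_zero] at this
  exact left_eq_add.1 this

/-- If `L` is projective over `R` and `N` over `C`, as right modules, then so is `L ⊗_R N`. -/
lemma rightProjective_tensor (L : BimodCat k B R) (N : BimodCat k R C) [Module.Projective Rᵐᵒᵖ L]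
    [hN : Module.Projective Cᵐᵒᵖ N] : Module.Projective Cᵐᵒᵖ (tensor L N) := by
  classical
  obtain ⟨s, hs⟩ := Module.projective_def.1 (inferInstance : Module.Projective Rᵐᵒᵖ L)
  let S₀ := BalancedTensor.lift (toFinsuppBilin L s N) (toFinsuppBilin_balanced L s N)
  have hS₀ : ∀ l n x, S₀ (BalancedTensor.tmul k R l n) x = unop (s l x) • n := fun l n x => by
    simp [S₀, toFinsuppBilin]
  let S : tensor L N →ₗ[Cᵐᵒᵖ] (L →₀ N) :=
    { toFun := fun z => S₀ z
      map_add' := fun x y => map_add S₀ x y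
      map_smul' := fun c z => by
        induction z using tensor_induction with
        | h0 => rw [smul_zero]; exact (map_zero S₀).trans ((congrArg _ (map_zero S₀)).trans (smul_zero _)).symm
        | ht l n =>
          rw [right_smul_tmul]
          ext x
          refine (hS₀ _ _ _).trans ?_
          refine Eq.trans ?_ (congrArg (fun t => c • t) (hS₀ l n x).symm)
          exact smul_comm _ _ _
        | ha x y hx hy =>
          rw [smul_add]
          refine (map_add S₀ _ _).trans ((congrArg₂ (· + ·) hx hy).trans ?_)
          exact (smul_add _ _ _).symm.trans (congrArg _ (map_add S₀ x y).symm) }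
  let t : L → N →ₗ[Cᵐᵒᵖ] tensor L N := fun l =>
    { toFun := fun n => tmul L N l n
      map_add' := tmul_add L N l
      map_smul' := fun c n => (right_smul_tmul L N c l n).symm }
  let T : (L →₀ N) →ₗ[Cᵐᵒᵖ] tensor L N := Finsupp.lsum ℕ t
  have : Module.Projective Cᵐᵒᵖ (L →₀ N) :=
    Module.Projective.of_equiv' (finsuppLequivDFinsupp Cᵐᵒᵖ).symm
  refine Module.Projective.of_split S T (LinearMap.ext fun z => ?_)
  induction z using tensor_induction with
  | h0 => rw [map_zero, map_zero]
  | ht l n =>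
    have h1 : S (tmul L N l n) = (s l).mapRange (fun r => unop r • n) (by simp) := by
      ext x; exact (hS₀ l n x).trans (by simp)
    have h2 : ∀ y : L →₀ Rᵐᵒᵖ, T (y.mapRange (fun r => unop r • n) (by simp)) =
        tmul L N (Finsupp.linearCombination Rᵐᵒᵖ id y) n := by
      intro y
      induction y using Finsupp.induction_linear with
      | zero =>
        simp only [Finsupp.mapRange_zero, map_zero]
        have := add_tmul L N 0 0 n
        rw [add_zero] at this
        exact (left_eq_add.1 this).symm
      | add x y hx hy =>
        rw [Finsupp.mapRange_add (by simp [add_smul]), map_add, map_add, add_tmul, hx, hy]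
      | single x r =>
        rw [Finsupp.mapRange_single, Finsupp.linearCombination_single]
        simp only [T, Finsupp.lsum_single, t, LinearMap.coe_mk, AddHom.coe_mk]
        rw [← tmul_balanced]
        rfl
    rw [LinearMap.comp_apply, h1, h2, hs]; rfl
  | ha x y hx hy => rw [map_add, hx, hy, map_add]

/-- If `Q` is a projective bimodule then `L ⊗_R Q` is projective as a right module. -/
lemma rightProjective_tensor_of_projective (L : BimodCat k B R) (Q : BimodCat k R C)
    [hQ : Module.Projective (R ⊗[k] Cᵐᵒᵖ) Q] : Module.Projective Cᵐᵒᵖ (tensor L Q) := by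
  classical
  obtain ⟨s, hs⟩ := Module.projective_def.1 hQ
  let ψ : L → R ⊗[k] Cᵐᵒᵖ →ₗ[k] Cᵐᵒᵖ ⊗[k] L := fun l => TensorProduct.lift
    (LinearMap.mk₂ k (fun (r : R) (c : Cᵐᵒᵖ) => c ⊗ₜ[k] (op r • l))
      (fun r r' c => by rw [MulOpposite.op_add, add_smul, TensorProduct.tmul_add])
      (fun a r c => by rw [MulOpposite.op_smul, smul_assoc, TensorProduct.tmul_smul])
      (fun r c c' => by rw [TensorProduct.add_tmul])
      (fun a r c => by rw [TensorProduct.smul_tmul']))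
  have hψ : ∀ l r c, ψ l (r ⊗ₜ[k] c) = c ⊗ₜ[k] (op r • l) := fun l r c => rfl
  have ψ_add : ∀ l l' x, ψ (l + l') x = ψ l x + ψ l' x := by
    intro l l' x
    induction x using TensorProduct.induction_on with
    | zero => simp
    | tmul r c => rw [hψ, hψ, hψ, smul_add, TensorProduct.tmul_add]
    | add x y hx hy => rw [map_add, map_add, map_add, hx, hy]; abel
  have ψ_smul : ∀ (a : k) l x, ψ (a • l) x = a • ψ l x := by
    intro a l x
    induction x using TensorProduct.induction_on with
    | zero => simp
    | tmul r c => rw [hψ, hψ, smul_comm, TensorProduct.tmul_smul]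
    | add x y hx hy => rw [map_add, map_add, hx, hy, smul_add]
  have ψ_bal : ∀ (r : R) l x, ψ (op r • l) x = ψ l ((r ⊗ₜ[k] (1 : Cᵐᵒᵖ)) * x) := by
    intro r l x
    induction x using TensorProduct.induction_on with
    | zero => simp
    | tmul r' c =>
      rw [hψ, Algebra.TensorProduct.tmul_mul_tmul, hψ, one_mul, MulOpposite.op_mul, mul_smul]
    | add x y hx hy => rw [mul_add, map_add, map_add, hx, hy]
  have ψ_right : ∀ (c : Cᵐᵒᵖ) l x, ψ l (((1 : R) ⊗ₜ[k] c) * x) = c • ψ l x := by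
    intro c l x
    induction x using TensorProduct.induction_on with
    | zero => simp
    | tmul r' c' =>
      rw [Algebra.TensorProduct.tmul_mul_tmul, hψ, hψ, one_mul, TensorProduct.smul_tmul',
        smul_eq_mul]
    | add x y hx hy => rw [mul_add, map_add, map_add, hx, hy, smul_add]
  let S₁ : L →ₗ[k] Q →ₗ[k] (Q →₀ Cᵐᵒᵖ ⊗[k] L) := LinearMap.mk₂ k
    (fun l q => (s q).mapRange (ψ l) (map_zero _))
    (fun l l' q => by ext x; simp [ψ_add])
    (fun a l q => by ext x; simp [ψ_smul])
    (fun l q q' => by ext x; simp)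
    (fun a l q => by
      ext x
      have : s (a • q) = a • s q := map_smul (s.restrictScalars k) a q
      simp [this])
  have hS₁ : ∀ (l : L) (r : R) (q : Q), S₁ (op r • l) q = S₁ l (r • q) := fun l r q => by
    ext x
    have : s (r • q) = (r ⊗ₜ[k] (1 : Cᵐᵒᵖ)) • s q := map_smul s _ q
    simp [S₁, this, ψ_bal]
  let S₀ : BalancedTensor k R L Q →ₗ[k] (Q →₀ Cᵐᵒᵖ ⊗[k] L) :=
    BalancedTensor.lift (Q := Q →₀ Cᵐᵒᵖ ⊗[k] L) S₁ hS₁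
  have hS₀ : ∀ l q, S₀ (BalancedTensor.tmul k R l q) = (s q).mapRange (ψ l) (map_zero _) :=
    fun l q => by simp [S₀, S₁]
  let S : tensor L Q →ₗ[Cᵐᵒᵖ] (Q →₀ Cᵐᵒᵖ ⊗[k] L) :=
    { toFun := fun z => S₀ z
      map_add' := fun x y => map_add S₀ x y
      map_smul' := fun c z => by
        induction z using tensor_induction with
        | h0 => rw [smul_zero]; exact (map_zero S₀).trans ((congrArg _ (map_zero S₀)).trans (smul_zero _)).symm
        | ht l q =>
          rw [right_smul_tmul]
          refine (hS₀ _ _).trans ?_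
          refine Eq.trans ?_ (congrArg (fun t => c • t) (hS₀ l q).symm)
          have : s (c • q) = ((1 : R) ⊗ₜ[k] c) • s q := map_smul s _ q
          ext x
          rw [this]
          simp [ψ_right]
        | ha x y hx hy =>
          rw [smul_add]
          refine (map_add S₀ _ _).trans ((congrArg₂ (· + ·) hx hy).trans ?_)
          exact (smul_add _ _ _).symm.trans (congrArg _ (map_add S₀ x y).symm) }
  let t : Q → (Cᵐᵒᵖ ⊗[k] L) →ₗ[Cᵐᵒᵖ] tensor L Q := fun q => 
    TensorProduct.AlgebraTensorModule.lift
      { toFun := fun c =>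
          { toFun := fun l => tmul L Q l (c • q)
            map_add' := fun l l' => add_tmul L Q l l' _
            map_smul' := fun a l =>
              (ofActionsEquiv _ _ _ (tensor_commute L Q)).injective
                ((BalancedTensor.smul_tmul' k R a l (c • q)).trans
                  (ofActionsEquiv_k _ _ _ (tensor_commute L Q) a (tmul L Q l (c • q))).symm) }
        map_add' := fun c c' => LinearMap.ext fun l => by
          simp only [LinearMap.coe_mk, AddHom.coe_mk, LinearMap.add_apply, add_smul, tmul_add]
          rfl
        map_smul' := fun c c' => LinearMap.ext fun l => by
          simp only [LinearMap.coe_mk, AddHom.coe_mk, LinearMap.smul_apply, smul_eq_mul, mul_smul,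
            RingHom.id_apply]
          exact (right_smul_tmul L Q c l (c' • q)).symm }
  have ht : ∀ q c l, t q (c ⊗ₜ[k] l) = tmul L Q l (c • q) := fun q c l => rfl
  let T : (Q →₀ Cᵐᵒᵖ ⊗[k] L) →ₗ[Cᵐᵒᵖ] tensor L Q := Finsupp.lsum ℕ t
  have : Module.Projective Cᵐᵒᵖ (Q →₀ Cᵐᵒᵖ ⊗[k] L) :=
    Module.Projective.of_equiv' (finsuppLequivDFinsupp Cᵐᵒᵖ).symm
  refine Module.Projective.of_split S T (LinearMap.ext fun z => ?_)
  induction z using tensor_induction with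
  | h0 => rw [map_zero, map_zero]
  | ht l q =>
    have h1 : S (tmul L Q l q) = (s q).mapRange (ψ l) (map_zero _) := hS₀ l q
    have h3 : ∀ q x, t q (ψ l x) = tmul L Q l (x • q) := by
      intro q x
      induction x using TensorProduct.induction_on with
      | zero => rw [map_zero, map_zero, ← tmul_zero L Q l]; congr 1; exact (zero_smul (R ⊗[k] Cᵐᵒᵖ) q).symm
      | tmul r c =>
        rw [hψ, ht, tmul_balanced, left_smul_def, right_smul_def, ← mul_smul,
          Algebra.TensorProduct.tmul_mul_tmul, mul_one, one_mul]
      | add x y hx hy => rw [map_add, map_add, hx, hy, add_smul, tmul_add]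
    have h2 : ∀ y : Q →₀ R ⊗[k] Cᵐᵒᵖ, T (y.mapRange (ψ l) (map_zero _)) =
        tmul L Q l (Finsupp.linearCombination (R ⊗[k] Cᵐᵒᵖ) id y) := by
      intro y
      induction y using Finsupp.induction_linear with
      | zero =>
        simp only [Finsupp.mapRange_zero, map_zero]
        exact (tmul_zero L Q l).symm
      | add x y hx hy =>
        rw [Finsupp.mapRange_add (by simp), map_add, map_add, tmul_add, hx, hy]
      | single x r =>
        rw [Finsupp.mapRange_single, Finsupp.linearCombination_single]
        simp only [T, Finsupp.lsum_single]
        exact h3 _ _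
    rw [LinearMap.comp_apply, h1, h2, hs]; rfl
  | ha x y hx hy => rw [map_add, hx, hy, map_add]

end BimodCat

/-! ### Bounded derived categories and derived tensor products -/

section Derived

/-- The bounded complexes of finitely generated modules. -/
def boundedFinite (A : Type u) [Ring A] : ObjectProperty (CochainComplex (ModuleCat.{u} A) ℤ) :=
  fun V => IsBounded V ∧ ∀ i, Module.Finite A (V.X i)

/-- The class of quasi-isomorphisms between bounded complexes of finitely generated modules. -/
def quasiIsos (A : Type u) [Ring A] : MorphismProperty (boundedFinite A).FullSubcategory :=
  (HomologicalComplex.quasiIso (ModuleCat.{u} A) (ComplexShape.up ℤ)).inverseImage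
    (boundedFinite A).ι

/-- The bounded derived category of finitely generated left `A`-modules: the localization of the
category of bounded complexes of such modules at the quasi-isomorphisms. -/
abbrev Db (A : Type u) [Ring A] := (quasiIsos A).Localization

/-- Bounded complexes of finitely generated bimodules whose terms are projective as right modules.
For such a complex `X`, the functor `X ⊗ -` induces a functor on bounded derived categories. -/
structure IsTensorable (X : CochainComplex (BimodCat k B R) ℤ) : Prop where
  bounded : IsBounded X
  finite : ∀ i, Module.Finite (B ⊗[k] Rᵐᵒᵖ) (X.X i)
  projective : ∀ i, Module.Projective Rᵐᵒᵖ (X.X i)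

variable [Module.Finite k B] [Module.Finite k R]

/-- The functor `X ⊗_R -` on bounded complexes of finitely generated modules. -/
def boundedTensor (X : CochainComplex (BimodCat k B R) ℤ) (hX : IsTensorable X) :
    (boundedFinite R).FullSubcategory ⥤ (boundedFinite B).FullSubcategory :=
  (boundedFinite B).lift ((boundedFinite R).ι ⋙ tensorComplex X) fun V =>
    ⟨hX.bounded.tensorComplex V.property.1, fun n =>
      have := hX.finite
      have := V.property.2
      finite_tensorComplex hX.bounded V.obj n⟩

lemma boundedTensor_map_quasiIsos (X : CochainComplex (BimodCat k B R) ℤ) (hX : IsTensorable X)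
    {V W : (boundedFinite R).FullSubcategory} (f : V ⟶ W) (hf : quasiIsos R f) :
    quasiIsos B ((boundedTensor X hX).map f) := by
  have := hX.projective
  have h1 : ConeExact ((boundedFinite R).ι.map f) := (quasiIso_iff_coneExact _).1 hf
  exact (quasiIso_iff_coneExact _).2 (h1.tensorComplex hX.bounded)

/-- The functor `X ⊗_R - : D^b(R) ⥤ D^b(B)`. -/
def derivedTensor (X : CochainComplex (BimodCat k B R) ℤ) (hX : IsTensorable X) : Db R ⥤ Db B :=
  Localization.Construction.lift (boundedTensor X hX ⋙ (quasiIsos B).Q) fun _ _ f hf =>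
    (quasiIsos B).Q_inverts _ (boundedTensor_map_quasiIsos X hX f hf)

end Derived

section Constructions

lemma isTensorable_single (M : BimodCat k B R) [Module.Finite (B ⊗[k] Rᵐᵒᵖ) M]
    [Module.Projective Rᵐᵒᵖ M] :
    IsTensorable ((HomologicalComplex.single (BimodCat k B R) (ComplexShape.up ℤ) 0).obj M) where
  bounded := ⟨0, 0, fun i hi => ModuleCat.subsingleton_of_isZero
    (HomologicalComplex.isZero_single_obj_X _ _ _ _ (by omega))⟩
  finite i := by
    by_cases hi : i = 0
    · subst hi
      exact Module.Finite.equiv (HomologicalComplex.singleObjXSelf (ComplexShape.up ℤ) 0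
        M).toLinearEquiv.symm
    · have := ModuleCat.subsingleton_of_isZero
        (HomologicalComplex.isZero_single_obj_X (ComplexShape.up ℤ) 0 M i hi)
      infer_instance
  projective i := by
    by_cases hi : i = 0
    · subst hi
      exact BimodCat.rightProjective_of_split
        (HomologicalComplex.singleObjXSelf (ComplexShape.up ℤ) 0 M).hom _ (Iso.hom_inv_id _)
    · have := ModuleCat.subsingleton_of_isZero
        (HomologicalComplex.isZero_single_obj_X (ComplexShape.up ℤ) 0 M i hi)
      infer_instance

lemma mappingCone_decomp {K L : CochainComplex (BimodCat k B R) ℤ} (g : K ⟶ L) (i : ℤ) :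
    HomologicalComplex.homotopyCofiber.fstX g i (i + 1) rfl ≫
      HomologicalComplex.homotopyCofiber.inlX g (i + 1) i rfl +
    HomologicalComplex.homotopyCofiber.sndX g i ≫ HomologicalComplex.homotopyCofiber.inrX g i =
      𝟙 (HomologicalComplex.homotopyCofiber.X g i) := by
  have hr : (ComplexShape.up ℤ).Rel i (i + 1) := rfl
  have h1 := HomologicalComplex.homotopyCofiber.inlX_fstX g (i + 1) i hr
  have h2 := HomologicalComplex.homotopyCofiber.inlX_sndX g (i + 1) i hr
  have h3 := HomologicalComplex.homotopyCofiber.inrX_fstX g i (i + 1) hr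
  have h4 := HomologicalComplex.homotopyCofiber.inrX_sndX g i
  apply HomologicalComplex.homotopyCofiber.ext_from_X g (i + 1) i hr
  · rw [Preadditive.comp_add, ← Category.assoc, ← Category.assoc, h1, h2, Category.id_comp,
      Limits.zero_comp, add_zero, Category.comp_id]
  · rw [Preadditive.comp_add, ← Category.assoc, ← Category.assoc, h3, h4, Category.id_comp,
      Limits.zero_comp, zero_add, Category.comp_id]

lemma IsTensorable.mappingCone {K L : CochainComplex (BimodCat k B R) ℤ} (hK : IsTensorable K)
    (hL : IsTensorable L) (g : K ⟶ L) : IsTensorable (CochainComplex.mappingCone g) where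
  bounded := by
    obtain ⟨a, b, h⟩ := hK.bounded
    obtain ⟨c, d, h'⟩ := hL.bounded
    refine ⟨min (a - 1) c, max b d, fun i hi => ⟨fun x y => ?_⟩⟩
    have h1 : Subsingleton (K.X (i + 1)) := h _ (by omega)
    have h2 : Subsingleton (L.X i) := h' _ (by omega)
    have key := fun z : (CochainComplex.mappingCone g).X i =>
      congrArg (fun f => f.hom z) (mappingCone_decomp g i)
    refine (key x).symm.trans (Eq.trans ?_ (key y))
    exact congrArg₂ (· + ·)
      (congrArg (HomologicalComplex.homotopyCofiber.inlX g (i + 1) i rfl).hom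
        (Subsingleton.elim (α := K.X (i + 1)) _ _))
      (congrArg (HomologicalComplex.homotopyCofiber.inrX g i).hom
        (Subsingleton.elim (α := L.X i) _ _))
  finite i :=
    have := hK.finite (i + 1)
    have := hL.finite i
    BimodCat.finite_of_sum _ _ _ _ (mappingCone_decomp g i)
  projective i :=
    have := hK.projective (i + 1)
    have := hL.projective i
    BimodCat.rightProjective_of_sum _ _ _ _ (mappingCone_decomp g i)

end Constructions

/-- The `k`-linear identification of `ofActions M l r h` with `M`. -/
def BimodCat.ofActionsLinearEquiv (M : Type u) [AddCommGroup M] [Module k M]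
    (l : B →ₐ[k] Module.End k M) (r : Cᵐᵒᵖ →ₐ[k] Module.End k M) (h : ∀ b c, Commute (l b) (r c)) :
    BimodCat.ofActions M l r h ≃ₗ[k] M :=
  { BimodCat.ofActionsEquiv M l r h with
    map_smul' := BimodCat.ofActionsEquiv_k M l r h }

/-- A morphism out of a tensor product of bimodules given by actions, from a bilinear map
compatible with the actions. -/
def BimodCat.tensorDescOfActions {M N W : Type u} [AddCommGroup M] [Module k M] [AddCommGroup N]
    [Module k N] [AddCommGroup W] [Module k W]
    {lM : B →ₐ[k] Module.End k M} {rM : Rᵐᵒᵖ →ₐ[k] Module.End k M} {hM : ∀ b c, Commute (lM b) (rM c)}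
    {lN : R →ₐ[k] Module.End k N} {rN : Cᵐᵒᵖ →ₐ[k] Module.End k N} {hN : ∀ b c, Commute (lN b) (rN c)}
    {lW : B →ₐ[k] Module.End k W} {rW : Cᵐᵒᵖ →ₐ[k] Module.End k W} {hW : ∀ b c, Commute (lW b) (rW c)}
    (g : M →ₗ[k] N →ₗ[k] W) (hg : ∀ m r n, g (rM (op r) m) n = g m (lN r n))
    (hl : ∀ b m n, g (lM b m) n = lW b (g m n)) (hr : ∀ c m n, g m (rN c n) = rW c (g m n)) :
    BimodCat.tensor (BimodCat.ofActions M lM rM hM) (BimodCat.ofActions N lN rN hN) ⟶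
      BimodCat.ofActions W lW rW hW :=
  let eM := BimodCat.ofActionsLinearEquiv M lM rM hM
  let eN := BimodCat.ofActionsLinearEquiv N lN rN hN
  let eW := BimodCat.ofActionsLinearEquiv W lW rW hW
  BimodCat.tensorDesc (L := BimodCat.ofActions M lM rM hM) (N := BimodCat.ofActions N lN rN hN)
    (W := BimodCat.ofActions W lW rW hW)
    ((g.compl₁₂ eM.toLinearMap eN.toLinearMap).compr₂ eW.symm.toLinearMap)
    (fun m r n => congrArg eW.symm (by
      refine Eq.trans ?_ ((hg (eM m) r (eN n)).trans ?_)
      · exact congrArg (fun t => g t (eN n)) (BimodCat.ofActionsEquiv_right M lM rM hM (op r) m)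
      · exact congrArg (g (eM m)) (BimodCat.ofActionsEquiv_left N lN rN hN r n).symm))
    (fun b m n => eW.injective (by
      refine Eq.trans ?_ (BimodCat.ofActionsEquiv_left W lW rW hW b _).symm
      refine Eq.trans ?_ (hl b (eM m) (eN n))
      exact congrArg (fun t => g t (eN n)) (BimodCat.ofActionsEquiv_left M lM rM hM b m)))
    (fun c m n => eW.injective (by
      refine Eq.trans ?_ (BimodCat.ofActionsEquiv_right W lW rW hW c _).symm
      refine Eq.trans ?_ (hr c (eM m) (eN n))
      exact congrArg (g (eM m)) (BimodCat.ofActionsEquiv_right N lN rN hN c n)))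

/-! ### Truncated periodic resolutions -/

section Resolutions

/-- The algebra `S` viewed as a `B`-`C`-bimodule through algebra maps `f : B → S` and
`g : C → S`: `b x c = f(b) x g(c)`. -/
def viaAlgHoms {S : Type u} [Ring S] [Algebra k S] (f : B →ₐ[k] S) (g : C →ₐ[k] S) :
    BimodCat k B C :=
  BimodCat.ofActions S ((Algebra.lsmul k k S : S →ₐ[k] Module.End k S).comp f)
    ((Algebra.lsmul k k S : Sᵐᵒᵖ →ₐ[k] Module.End k S).comp (AlgHom.op g))
    fun b c => LinearMap.ext fun x => (mul_assoc (f b) x (g (unop c))).symm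

lemma finite_viaAlgHoms {S : Type u} [Ring S] [Algebra k S] [Module.Finite k S] (f : B →ₐ[k] S)
    (g : C →ₐ[k] S) : Module.Finite (B ⊗[k] Cᵐᵒᵖ) (viaAlgHoms f g) :=
  have : Module.Finite k (viaAlgHoms f g) := BimodCat.finite_field_ofActions S _ _ _
  BimodCat.finite_of_finite_field _

lemma rightProjective_viaAlgHoms {S : Type u} [Ring S] [Algebra k S] (f : B →ₐ[k] S)
    (g : C →ₐ[k] S) (h : S →ₗ[k] C) (hgh : ∀ x, g (h x) = x) (hr : ∀ x c, h (x * g c) = h x * c) :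
    Module.Projective Cᵐᵒᵖ (viaAlgHoms f g) := by
  let e : viaAlgHoms f g ≃+ S := BimodCat.ofActionsEquiv _ _ _ _
  have he : ∀ (c : Cᵐᵒᵖ) x, e (c • x) = e x * g (unop c) := fun c x =>
    BimodCat.ofActionsEquiv_right _ _ _ _ c x
  let i : viaAlgHoms f g →ₗ[Cᵐᵒᵖ] Cᵐᵒᵖ :=
    { toFun := fun x => op (h (e x))
      map_add' := fun x y => by rw [map_add, map_add, MulOpposite.op_add]
      map_smul' := fun c x => by rw [he, hr, MulOpposite.op_mul]; rfl }
  let p : Cᵐᵒᵖ →ₗ[Cᵐᵒᵖ] viaAlgHoms f g :=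
    { toFun := fun c => e.symm (g (unop c))
      map_add' := fun x y => by rw [MulOpposite.unop_add, map_add, map_add]
      map_smul' := fun c x => e.injective (by
        rw [RingHom.id_apply, he, e.apply_symm_apply, e.apply_symm_apply, smul_eq_mul,
          MulOpposite.unop_mul, map_mul]) }
  exact Module.Projective.of_split i p (LinearMap.ext fun x => e.injective (by
    simp only [LinearMap.comp_apply, p, i, LinearMap.coe_mk, AddHom.coe_mk, e.apply_symm_apply,
      unop_op, hgh, LinearMap.id_apply]))

/-- The bimodule `E_σ`: the algebra `E` with its usual left action and with right action twisted by
the automorphism `σ`, that is, `a x b = a x σ(b)`. -/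
def twistedBimod {E : Type u} [Ring E] [Algebra k E] (σ : E ≃ₐ[k] E) : BimodCat k E E :=
  viaAlgHoms (AlgHom.id k E) σ.toAlgHom

/-- The regular bimodule. -/
def regularBimod (k E : Type u) [Field k] [Ring E] [Algebra k E] : BimodCat k E E :=
  viaAlgHoms (AlgHom.id k E) (AlgHom.id k E)

/-- A truncated periodic resolution of `E` of period `n ≥ 1`, with automorphism `σ`: a complex
`P_{n-1} → ⋯ → P_1 → P_0` of finitely generated projective `E`-`E`-bimodules (with `P_i` in
cohomological degree `-i`) which is part of an exact sequence of bimodules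
`0 → E_σ → P_{n-1} → ⋯ → P_1 → P_0 → E → 0`. -/
structure TruncatedResolution (k E : Type u) [Field k] [Ring E] [Algebra k E] (n : ℕ) where
  /-- The twisting automorphism. -/
  σ : E ≃ₐ[k] E
  /-- The complex of projective bimodules. -/
  Y : CochainComplex (BimodCat k E E) ℤ
  one_le : 1 ≤ n
  finite : ∀ i, Module.Finite (E ⊗[k] Eᵐᵒᵖ) (Y.X i)
  projective : ∀ i, Module.Projective (E ⊗[k] Eᵐᵒᵖ) (Y.X i)
  subsingleton : ∀ i : ℤ, (i ≤ -n ∨ 0 < i) → Subsingleton (Y.X i)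
  /-- The augmentation `P_0 → E`. -/
  aug : Y.X 0 ⟶ regularBimod k E
  aug_surjective : Function.Surjective aug.hom
  d_aug : Y.d (-1) 0 ≫ aug = 0
  exact_aug : 2 ≤ n → Function.Exact (Y.d (-1) 0).hom aug.hom
  exact : ∀ i : ℤ, 1 - n < i → i < 0 → Function.Exact (Y.d (i - 1) i).hom (Y.d i (i + 1)).hom
  ker_of_eq_one : n = 1 →
    Nonempty (LinearMap.ker aug.hom ≃ₗ[E ⊗[k] Eᵐᵒᵖ] twistedBimod σ)
  ker_of_two_le : 2 ≤ n →
    Nonempty (LinearMap.ker (Y.d (1 - n) (2 - n)).hom ≃ₗ[E ⊗[k] Eᵐᵒᵖ] twistedBimod σ)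

/-- The algebra `E` is twisted-periodic of period `n`. -/
def IsTwistedPeriodicOfPeriod (k E : Type u) [Field k] [Ring E] [Algebra k E] (n : ℕ) : Prop :=
  Nonempty (TruncatedResolution k E n)

/-- The algebra `E` is twisted-periodic (of some period `n ≥ 1`). -/
def IsTwistedPeriodic (k E : Type u) [Field k] [Ring E] [Algebra k E] : Prop :=
  ∃ n, IsTwistedPeriodicOfPeriod k E n

end Resolutions

/-! ### Periodic twists -/

section Twist

/-- The opposite of the endomorphism algebra of the left `A`-module `P`, acting on `P` from the
right. -/
abbrev EndOp (A P : Type u) [Ring A] [AddCommGroup P] [Module A P] := (Module.End A P)ᵐᵒᵖ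

variable (k) (A : Type u) [Ring A] [Algebra k A] (P : Type u) [AddCommGroup P] [Module k P]
  [Module A P] [IsScalarTower k A P]

/-- The right action of `EndOp A P` on `P`, `p e = e(p)`. -/
def endAction : (EndOp A P)ᵐᵒᵖ →ₐ[k] Module.End k P :=
  AlgHom.ofLinearMap
    { toFun := fun e => (unop (unop e)).restrictScalars k
      map_add' := fun _ _ => rfl
      map_smul' := fun _ _ => rfl } rfl (fun _ _ => rfl)

/-- The `A`-module `P` as an `A`-`EndOp A P`-bimodule. -/
def moduleBimod : BimodCat k A (EndOp A P) :=
  BimodCat.ofActions P (Algebra.lsmul k k P) (endAction k A P) fun a e =>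
    LinearMap.ext fun p => (map_smul (unop (unop e)) a p).symm

/-- The left action of `EndOp A P` on `P^∨ = Hom_A(P, A)`, `e φ = φ ∘ e`. -/
def dualEndAction : EndOp A P →ₐ[k] Module.End k (P →ₗ[A] A) :=
  AlgHom.ofLinearMap
    { toFun := fun e =>
        { toFun := fun φ => φ ∘ₗ unop e
          map_add' := fun _ _ => rfl
          map_smul' := fun _ _ => rfl }
      map_add' := fun e e' => by ext φ p; simp
      map_smul' := fun c e => by
        ext φ p
        exact map_smul (φ.restrictScalars k) c _ } rfl (fun _ _ => rfl)

/-- The right action of `A` on `P^∨ = Hom_A(P, A)`, `(φ a)(p) = φ(p) a`. -/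
def dualRightAction : Aᵐᵒᵖ →ₐ[k] Module.End k (P →ₗ[A] A) :=
  AlgHom.ofLinearMap
    { toFun := fun a =>
        { toFun := fun φ =>
            { toFun := fun p => φ p * unop a
              map_add' := fun p q => by simp [add_mul]
              map_smul' := fun b p => by simp [mul_assoc] }
          map_add' := fun φ ψ => by ext p; simp [add_mul]
          map_smul' := fun c φ => by ext p; simp }
      map_add' := fun a b => by ext φ p; simp [mul_add]
      map_smul' := fun c a => by ext φ p; simp }
    (by ext φ p; simp) (fun a b => by ext φ p; simp [mul_assoc])

/-- The bimodule `P^∨ = Hom_A(P, A)`. -/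
def dualBimod : BimodCat k (EndOp A P) A :=
  BimodCat.ofActions (P →ₗ[A] A) (dualEndAction k A P) (dualRightAction k A P) fun _ _ => rfl

/-- The map `P ⊗_E E → P`, `p ⊗ e ↦ p e`. -/
def actionMap : BimodCat.tensor (moduleBimod k A P) (regularBimod k (EndOp A P)) ⟶
    moduleBimod k A P :=
  BimodCat.tensorDescOfActions
    (LinearMap.mk₂ k (fun (p : P) (e : EndOp A P) => unop e p)
      (fun p q _ => map_add _ p q) (fun c p e => map_smul ((unop e).restrictScalars k) c p)
      (fun _ _ _ => rfl) (fun _ _ _ => rfl))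
    (fun _ _ _ => rfl) (fun b p e => map_smul (unop e) b p) (fun _ _ _ => rfl)

/-- The evaluation `P ⊗_E P^∨ → A`, `p ⊗ φ ↦ φ(p)`. -/
def evaluationMap : BimodCat.tensor (moduleBimod k A P) (dualBimod k A P) ⟶ regularBimod k A :=
  BimodCat.tensorDescOfActions
    (LinearMap.mk₂ k (fun (p : P) (φ : P →ₗ[A] A) => φ p)
      (fun p q _ => map_add _ p q) (fun c p φ => map_smul (φ.restrictScalars k) c p)
      (fun _ _ _ => rfl) (fun _ _ _ => rfl))
    (fun _ _ _ => rfl) (fun b p φ => map_smul φ b p) (fun _ _ _ => rfl)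

variable {k P} {n : ℕ} (Y : TruncatedResolution k (EndOp A P) n)

/-- The complex of `A`-`A`-bimodules `P ⊗_E Y ⊗_E P^∨`. -/
def sandwichComplex : CochainComplex (BimodCat k A A) ℤ :=
  ((BimodCat.sandwich (moduleBimod k A P) (dualBimod k A P)).mapHomologicalComplex
    (ComplexShape.up ℤ)).obj Y.Y

/-- The map of complexes of bimodules `g : P ⊗_E Y ⊗_E P^∨ → A` given in degree `0` by
`p ⊗ y ⊗ φ ↦ φ(p f(y))`, where `f` is the augmentation of `Y`. -/
def twistMap : sandwichComplex A Y ⟶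
    (HomologicalComplex.single (BimodCat k A A) (ComplexShape.up ℤ) 0).obj (regularBimod k A) :=
  HomologicalComplex.mkHomToSingle
    ((BimodCat.sandwich (moduleBimod k A P) (dualBimod k A P)).map Y.aug ≫
      BimodCat.tensorMap (actionMap k A P) (𝟙 _) ≫ evaluationMap k A P) (by
    intro i hi
    obtain rfl : i = -1 := by
      have : i + 1 = 0 := hi
      omega
    have h : (BimodCat.sandwich (moduleBimod k A P) (dualBimod k A P)).map (Y.Y.d (-1) 0) ≫
        (BimodCat.sandwich (moduleBimod k A P) (dualBimod k A P)).map Y.aug = 0 := by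
      rw [← Functor.map_comp, Y.d_aug, Functor.map_zero]
    exact (Category.assoc _ _ _).symm.trans ((congrArg (fun t => t ≫ _) h).trans
      Limits.zero_comp))

/-- The complex of `A`-`A`-bimodules `X = cone(g : P ⊗_E Y ⊗_E P^∨ → A)`. -/
def twistComplex : CochainComplex (BimodCat k A A) ℤ :=
  CochainComplex.mappingCone (twistMap A Y)

variable [Module.Finite A P] [Module.Projective A P]

variable (k P) in
lemma dualBimod_projective : Module.Projective Aᵐᵒᵖ (dualBimod k A P) := by
  obtain ⟨m, π, hπ⟩ := Module.Finite.exists_fin' A P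
  obtain ⟨s, hs⟩ := Module.projective_lifting_property π LinearMap.id hπ
  let e : dualBimod k A P ≃+ (P →ₗ[A] A) := BimodCat.ofActionsEquiv _ _ _ _
  have he : ∀ (a : Aᵐᵒᵖ) φ p, e (a • φ) p = e φ p * unop a := fun a φ p =>
    LinearMap.congr_fun (BimodCat.ofActionsEquiv_right _ _ _ _ a φ) p
  let i : dualBimod k A P →ₗ[Aᵐᵒᵖ] (Fin m → Aᵐᵒᵖ) :=
    { toFun := fun φ j => op (e φ (π (Pi.single j 1)))
      map_add' := fun φ ψ => rfl
      map_smul' := fun a φ => by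
        ext j
        simp [he] }
  let p₀ : (Fin m → Aᵐᵒᵖ) → (P →ₗ[A] A) := fun y =>
    { toFun := fun x => ∑ j, s x j * unop (y j)
      map_add' := fun x x' => by simp [add_mul, Finset.sum_add_distrib]
      map_smul' := fun b x => by simp [Finset.mul_sum, mul_assoc] }
  let p : (Fin m → Aᵐᵒᵖ) →ₗ[Aᵐᵒᵖ] dualBimod k A P :=
    { toFun := fun y => e.symm (p₀ y)
      map_add' := fun y y' => by
        rw [← map_add]
        congr 1
        ext x
        simp [p₀, mul_add, Finset.sum_add_distrib]
      map_smul' := fun a y => e.injective (by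
        ext x
        rw [RingHom.id_apply, he, e.apply_symm_apply, e.apply_symm_apply]
        simp [p₀, Finset.sum_mul, mul_assoc]) }
  refine Module.Projective.of_split i p (LinearMap.ext fun φ => e.injective ?_)
  ext x
  change e (e.symm (p₀ (i φ))) x = e φ x
  rw [e.apply_symm_apply]
  have hx : π (s x) = x := LinearMap.congr_fun hs x
  have h1 : s x = ∑ j, s x j • (Pi.single j 1 : Fin m → A) := by
    refine (Finset.univ_sum_single (s x)).symm.trans (Finset.sum_congr rfl fun j _ => ?_)
    rw [← Pi.single_smul, smul_eq_mul, mul_one]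
  conv_rhs => rw [← hx, h1, map_sum, map_sum]
  simp only [map_smul, smul_eq_mul]
  rfl

variable [Module.Finite k A]

lemma isTensorable_sandwichComplex : IsTensorable (sandwichComplex A Y) := by
  have : Module.Finite k P := Module.Finite.trans A P
  have : Module.Finite k (Module.End A P) := Module.Finite.of_injective
    (LinearMap.restrictScalarsₗ k A P P k) (LinearMap.restrictScalars_injective k)
  have : Module.Finite k (EndOp A P) := Module.Finite.equiv (MulOpposite.opLinearEquiv k)
  have : Module.Finite k (P →ₗ[A] A) := Module.Finite.of_injective
    (LinearMap.restrictScalarsₗ k A P A k) (LinearMap.restrictScalars_injective k)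
  have hP : Module.Finite k (moduleBimod k A P) := BimodCat.finite_field_ofActions _ _ _ _
  have hP' : Module.Finite k (dualBimod k A P) := BimodCat.finite_field_ofActions _ _ _ _
  have := dualBimod_projective (k := k) A P
  refine ⟨?_, fun i => ?_, fun i => ?_⟩
  · refine ⟨-n, 0, fun i hi => ModuleCat.subsingleton_of_isZero ?_⟩
    have : Subsingleton (Y.Y.X i) := Y.subsingleton i (by omega)
    exact Functor.map_isZero (BimodCat.sandwich (moduleBimod k A P) (dualBimod k A P))
      (ModuleCat.isZero_of_subsingleton (Y.Y.X i))
  · have := Y.finite i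
    have := BimodCat.finite_field_of_finite (Y.Y.X i)
    have := BimodCat.finite_field_tensor (moduleBimod k A P) (Y.Y.X i)
    have := BimodCat.finite_field_tensor (BimodCat.tensor (moduleBimod k A P) (Y.Y.X i))
      (dualBimod k A P)
    exact BimodCat.finite_of_finite_field
      (BimodCat.tensor (BimodCat.tensor (moduleBimod k A P) (Y.Y.X i)) (dualBimod k A P))
  · have := Y.projective i
    have := BimodCat.rightProjective_tensor_of_projective (moduleBimod k A P) (Y.Y.X i)
    exact BimodCat.rightProjective_tensor (BimodCat.tensor (moduleBimod k A P) (Y.Y.X i))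
      (dualBimod k A P)

lemma isTensorable_twistComplex : IsTensorable (twistComplex A Y) :=
  have : Module.Finite (A ⊗[k] Aᵐᵒᵖ) (regularBimod k A) := finite_viaAlgHoms _ _
  have : Module.Projective Aᵐᵒᵖ (regularBimod k A) :=
    rightProjective_viaAlgHoms _ _ (AlgHom.id k A).toLinearMap (fun _ => rfl) (fun _ _ => rfl)
  (isTensorable_sandwichComplex A Y).mappingCone (isTensorable_single _) (twistMap A Y)

/-- The periodic twist `Ψ_{P,Y} = X ⊗_A - : D^b(A) ⥤ D^b(A)`. -/
def periodicTwist : Db A ⥤ Db A :=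
  derivedTensor (twistComplex A Y) (isTensorable_twistComplex A Y)

end Twist

/-! ### Symmetric algebras, indecomposable modules and blocks -/

section Blocks

/-- The `k`-algebra `A` is symmetric: `A` and its dual `Hom_k(A, k)`, with the actions
`(a f b)(c) = f(b c a)`, are isomorphic as `A`-`A`-bimodules. -/
def IsSymmetricAlgebra (k A : Type u) [Field k] [Ring A] [Algebra k A] : Prop :=
  ∃ φ : A ≃ₗ[k] Module.Dual k A, ∀ a x b c : A, φ (a * x * b) c = φ x (b * c * a)

/-- A module is indecomposable if it is nonzero and is not the direct sum of two nonzero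
submodules. -/
def IsIndecomposableModule (A M : Type u) [Ring A] [AddCommGroup M] [Module A M] : Prop :=
  Nontrivial M ∧ ∀ N₁ N₂ : Submodule A M, IsCompl N₁ N₂ → N₁ = ⊥ ∨ N₂ = ⊥

/-- A ring is indecomposable (as a ring) if it is nonzero and its only central idempotents are `0`
and `1`. -/
def IsIndecomposableRing (A : Type u) [Ring A] : Prop :=
  Nontrivial A ∧ ∀ e : A, IsIdempotentElem e → (∀ x, e * x = x * e) → e = 0 ∨ e = 1

/-- The idempotent of `EndOp A (⨁ Q_j)` given by the projection onto the summand `Q_j`. -/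
def summandIdempotent {A : Type u} [Ring A] {J : Type} [DecidableEq J] (Q : J → Type u)
    [∀ j, AddCommGroup (Q j)] [∀ j, Module A (Q j)] (j : J) : EndOp A (∀ j, Q j) :=
  op (LinearMap.single A Q j ∘ₗ LinearMap.proj j)

/-- An automorphism `σ` of `E = EndOp A (⨁ Q_j)`, for pairwise non-isomorphic indecomposable
modules `Q_j`, permutes the isomorphism classes of the `Q_j`: the image of the idempotent
`σ(e_i)` is isomorphic to some `Q_j`. The automorphism preserves the multiplicities `m` if
`m i = m j` whenever this is the case. -/
def PreservesMultiplicities {k A : Type u} [Field k] [Ring A] [Algebra k A] {J : Type}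
    [DecidableEq J] (Q : J → Type u) [∀ j, AddCommGroup (Q j)] [∀ j, Module k (Q j)]
    [∀ j, Module A (Q j)] [∀ j, IsScalarTower k A (Q j)] (m : J → ℕ)
    (σ : EndOp A (∀ j, Q j) ≃ₐ[k] EndOp A (∀ j, Q j)) : Prop :=
  ∀ i j : J, Nonempty (LinearMap.range (unop (σ (summandIdempotent Q i))) ≃ₗ[A] Q j) → m i = m j

instance projective_pi_const {A : Type u} [Ring A] {J : Type} [Finite J] (Q : J → Type u)
    [∀ j, AddCommGroup (Q j)] [∀ j, Module A (Q j)] [∀ j, Module.Projective A (Q j)] :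
    Module.Projective A (∀ j, Q j) := by
  classical
  have := Fintype.ofFinite J
  exact Module.Projective.of_equiv' (DFinsupp.linearEquivFunOnFintype (R := A) (M := Q))

variable {c : ℕ} (A : Fin c → Type u) [∀ i, Ring (A i)]
  (P : Fin c → Type u) [∀ i, AddCommGroup (P i)] [∀ i, Module (A i) (P i)]

/-- The idempotent `e_i` of `EndOp (∏ A_i) (⨁ P_i)`, the endomorphism `p ↦ a_i p` where `a_i` is the
central idempotent of `∏ A_i` that corresponds to the factor `A_i`. -/
def blockIdempotent (i : Fin c) : EndOp (∀ i, A i) (∀ i, P i) :=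
  op
    { toFun := fun p => Pi.single i (1 : A i) • p
      map_add' := fun p q => smul_add _ p q
      map_smul' := fun a p => by
        ext j
        by_cases h : j = i
        · subst h; simp
        · simp [h] }

instance projective_pi [∀ i, Module.Finite (A i) (P i)] [∀ i, Module.Projective (A i) (P i)] :
    Module.Projective (∀ i, A i) (∀ i, P i) := by
  have h : ∀ i, ∃ (m : ℕ) (π : (Fin m → A i) →ₗ[A i] P i) (s : P i →ₗ[A i] (Fin m → A i)),
      π ∘ₗ s = LinearMap.id := fun i => by
    obtain ⟨m, π, hπ⟩ := Module.Finite.exists_fin' (A i) (P i)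
    obtain ⟨s, hs⟩ := Module.projective_lifting_property π LinearMap.id hπ
    exact ⟨m, π, s, hs⟩
  choose m π s hs using h
  let S : (∀ i, P i) →ₗ[∀ i, A i] ((Σ i, Fin (m i)) → ∀ i, A i) :=
    { toFun := fun p x => Pi.single x.1 (s x.1 (p x.1) x.2)
      map_add' := fun p q => by
        ext x : 1
        simp [Pi.single_add]
      map_smul' := fun a p => by
        ext x j
        by_cases h : j = x.1
        · subst h; simp
        · simp [h] }
  let T : ((Σ i, Fin (m i)) → ∀ i, A i) →ₗ[∀ i, A i] (∀ i, P i) :=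
    { toFun := fun y i => π i fun j => y ⟨i, j⟩ i
      map_add' := fun y z => by
        ext i
        exact map_add (π i) (fun j => y ⟨i, j⟩ i) (fun j => z ⟨i, j⟩ i)
      map_smul' := fun a y => by
        ext i
        exact map_smul (π i) (a i) (fun j => y ⟨i, j⟩ i) }
  refine Module.Projective.of_split S T (LinearMap.ext fun p => funext fun i => ?_)
  have : (fun j => (S p) ⟨i, j⟩ i) = s i (p i) := by
    ext j
    simp [S]
  change π i (fun j => (S p) ⟨i, j⟩ i) = p i
  rw [this]
  exact LinearMap.congr_fun (hs i) (p i)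

instance finite_pi [∀ i, Module.Finite (A i) (P i)] : Module.Finite (∀ i, A i) (∀ i, P i) := by
  have h : ∀ i, ∃ (m : ℕ) (π : (Fin m → A i) →ₗ[A i] P i), Function.Surjective π := fun i =>
    Module.Finite.exists_fin' (A i) (P i)
  choose m π hπ using h
  let T : ((Σ i, Fin (m i)) → ∀ i, A i) →ₗ[∀ i, A i] (∀ i, P i) :=
    { toFun := fun y i => π i fun j => y ⟨i, j⟩ i
      map_add' := fun y z => by
        ext i
        exact map_add (π i) (fun j => y ⟨i, j⟩ i) (fun j => z ⟨i, j⟩ i)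
      map_smul' := fun a y => by
        ext i
        exact map_smul (π i) (a i) (fun j => y ⟨i, j⟩ i) }
  refine Module.Finite.of_surjective T fun p => ?_
  choose y hy using fun i => hπ i (p i)
  exact ⟨fun x => Pi.single x.1 (y x.1 x.2), funext fun i => by simp [T, hy]⟩

variable (k) [∀ i, Algebra k (A i)] [∀ i, Module.Finite k (A i)]

/-- The functor `D^b(∏ A_i) ⥤ D^b(A_i)`, `V ↦ A_i ⊗ V = a_i V`. -/
def blockProjection (i : Fin c) : Db (∀ i, A i) ⥤ Db (A i) :=
  derivedTensor
    ((HomologicalComplex.single (BimodCat k (A i) (∀ i, A i)) (ComplexShape.up ℤ) 0).obj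
      (viaAlgHoms (AlgHom.id k (A i)) (Pi.evalAlgHom k A i)))
    (have : Module.Finite (A i ⊗[k] (∀ i, A i)ᵐᵒᵖ)
        (viaAlgHoms (AlgHom.id k (A i)) (Pi.evalAlgHom k A i)) := finite_viaAlgHoms _ _
      have : Module.Projective (∀ i, A i)ᵐᵒᵖ
          (viaAlgHoms (AlgHom.id k (A i)) (Pi.evalAlgHom k A i)) :=
        rightProjective_viaAlgHoms _ _ (LinearMap.single k A i) (fun x => by simp) (fun x a => by
          ext j
          by_cases h : j = i
          · subst h; simp
          · simp [h])
      isTensorable_single _)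

/-- The functor `D^b(∏ A_i) ⥤ ∏ D^b(A_i)` with components `V ↦ a_i V`. It is the standard
identification of the derived category of a product of algebras with the product of the derived
categories. -/
def blockDecomposition : Db (∀ i, A i) ⥤ (∀ i, Db (A i)) :=
  Functor.pi' (blockProjection k A)

end Blocks

end Bimodules

end

end PeriodicTwist

/-!
The endomorphism algebra `E` of `P = ⨁ P_j` is the corner `e E' e` of the endomorphism algebra `E'`
of `P' = ⨁ P_j ^ m_j`, for the projection `e` of `P'` onto the first copy of every `P_j`, and this
corner is full. So `M ↦ e M e` is an exact functor of bimodules that preserves finitely generated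
projectives and sends `E'` to `E`. As `e` is full, `P ⊗_E e Y' e ⊗_E P^∨ ≅ P' ⊗_E' Y' ⊗_E' P'^∨`
for every complex `Y'`, compatibly with the maps to `A`, so that the periodic twists agree
(`periodicTwist_iso_of_cornerMap`). It remains to recognize the last term of the sequence: the
bimodule `e E'_σ e = e E' σ(e)` is a twisted regular bimodule as soon as `e` and `σ(e)` are
equivalent idempotents (`CornerHom.exists_truncatedResolution`). By the Krull–Schmidt theorem
(`IsLocalIdempotent.exists_idemEquiv`), `σ` permutes the equivalence classes of local idempotents;
since `e` is a sum of one idempotent from each class, `e` and `σ(e)` are indeed equivalent.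

In the other direction, `E'` is the corner `F Mat(E) F` of a matrix algebra over `E`, and the same
argument applies to the matrices over `Y` cut by `F`, provided that `F` and `σ(F)` are equivalent
(`MatrixPresentation.exists_truncatedResolution`). The multiplicities of the classes in `F` are the
`m_j`, so this is the condition that the permutation of the classes preserves the `m_j`. For
twisted-periodicity itself the condition can be enforced: splicing the twists `Y`, `Y_σ`, …,
`Y_{σ^(r-1)}` gives a truncated resolution with automorphism `σ^r`
(`TruncatedResolution.exactRes_pow`), and for a suitable `r` the permutation becomes trivial.

For `A = ∏ A_i`, the algebra `E` is the product of the `E_i`. Truncated resolutions of the `E_i` of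
the same period add up to one of `E` (`IsProduct.resolution`), and its twist is the product of
their twists (`periodicTwist_blockDecomposition_iso`). Conversely, suppose that `σ` fixes the
central idempotents `e_i`. Then the `e_i Y e_i` are truncated resolutions of the `E_i`, and the
off-diagonal part of `Y` is an acyclic bounded complex of projectives, hence contractible, so that
`Y` may be replaced by its diagonal part (`IsProduct.exists_periodicTwist_iso`).

The idempotents of the blocks that are not simple are always fixed. If `j ≠ i`, the complex
`e_i Y e_j` is a resolution of `e_i E e_j = 0`, so its last syzygy `e_i E_σ e_j` is projective;
if it is not zero, this means that the factor of `E` with unit `z = e_i σ(e_j)` is separable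
(`TruncatedResolution.hasCasimir`). By Maschke's argument the summand `P z` of `P` is then a
semisimple projective module over `A_i` (`IsSymmetrizing.isSemisimpleModule_range`). The trace ideal
of such a module over a symmetric algebra is a direct factor, so the indecomposable algebra `A_i`
is simple (`IsSymmetrizing.isSimpleRing`). Over a simple block nothing can be said about `σ`, but
there `E_i` is separable, so projective as a bimodule over itself, and therefore periodic of every
period (`hasCasimir_endOp`, `HasCasimir.isTwistedPeriodicOfPeriod`).
-/

namespace PeriodicTwist

noncomputable section

/-! ### Finitely generated projective modules and exact functors preserving them -/

section ExactFunctors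

/-- A module is finitely generated and projective. -/
def FGProj (S M : Type u) [Ring S] [AddCommGroup M] [Module S M] : Prop :=
  Module.Finite S M ∧ Module.Projective S M

lemma fgProj_iff_dualBasis {S M : Type u} [Ring S] [AddCommGroup M] [Module S M] :
    FGProj S M ↔ ∃ (ι : Type) (_ : Fintype ι) (x : ι → M) (f : ι → M →ₗ[S] S),
      ∀ m, ∑ i, f i m • x i = m := by
  constructor
  · rintro ⟨_, _⟩
    obtain ⟨n, π, hπ⟩ := Module.Finite.exists_fin' S M
    obtain ⟨s, hs⟩ := Module.projective_lifting_property π LinearMap.id hπ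
    refine ⟨Fin n, inferInstance, fun i => π (Pi.single i 1), fun i => LinearMap.proj i ∘ₗ s,
      fun m => ?_⟩
    conv_rhs => rw [← LinearMap.id_apply (R := S) m, ← hs, LinearMap.comp_apply,
      ← Finset.univ_sum_single (s m), map_sum]
    refine Finset.sum_congr rfl fun i _ => ?_
    rw [← map_smul, ← Pi.single_smul, smul_eq_mul, mul_one]
    rfl
  · rintro ⟨ι, _, x, f, h⟩
    have hs : Fintype.linearCombination S x ∘ₗ LinearMap.pi f = LinearMap.id :=
      LinearMap.ext fun m => by simpa [Fintype.linearCombination_apply] using h m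
    exact ⟨Module.Finite.of_surjective (Fintype.linearCombination S x)
      fun m => ⟨LinearMap.pi f m, LinearMap.congr_fun hs m⟩, Module.Projective.of_split _ _ hs⟩

lemma FGProj.of_subsingleton {S M : Type u} [Ring S] [AddCommGroup M] [Module S M]
    [Subsingleton M] : FGProj S M := ⟨inferInstance, inferInstance⟩

lemma FGProj.pi {S : Type u} [Ring S] {J : Type} [Finite J] {M : J → Type u}
    [∀ j, AddCommGroup (M j)] [∀ j, Module S (M j)] (h : ∀ j, FGProj S (M j)) :
    FGProj S (∀ j, M j) :=
  have := fun j => (h j).1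
  have := fun j => (h j).2
  ⟨inferInstance, inferInstance⟩

/-- A functor between module categories which is exact (expressed through elements) and preserves
finitely generated projective modules. -/
structure PreservesResolutions {S S' : Type u} [Ring S] [Ring S']
    (G : ModuleCat.{u} S ⥤ ModuleCat.{u} S') : Prop where
  exact : ∀ {X Y Z : ModuleCat.{u} S} (f : X ⟶ Y) (g : Y ⟶ Z),
    Function.Exact f.hom g.hom → Function.Exact (G.map f).hom (G.map g).hom
  injective : ∀ {X Y : ModuleCat.{u} S} (f : X ⟶ Y), Function.Injective f.hom →
    Function.Injective (G.map f).hom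
  surjective : ∀ {X Y : ModuleCat.{u} S} (f : X ⟶ Y), Function.Surjective f.hom →
    Function.Surjective (G.map f).hom
  fgProj : ∀ M : ModuleCat.{u} S, FGProj S M → FGProj S' (G.obj M)

lemma PreservesResolutions.comp {S S' S'' : Type u} [Ring S] [Ring S'] [Ring S'']
    {G : ModuleCat.{u} S ⥤ ModuleCat.{u} S'} {H : ModuleCat.{u} S' ⥤ ModuleCat.{u} S''}
    (hG : PreservesResolutions G) (hH : PreservesResolutions H) :
    PreservesResolutions (G ⋙ H) where
  exact f g h := hH.exact _ _ (hG.exact f g h)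
  injective f h := hH.injective _ (hG.injective f h)
  surjective f h := hH.surjective _ (hG.surjective f h)
  fgProj M h := hH.fgProj _ (hG.fgProj M h)

end ExactFunctors

/-! ### Corners -/

section Corners

/-- An identification of the `k`-algebra `S` with the corner `e S' e` of the `k`-algebra `S'`, for
the idempotent `e = toFun 1`: a multiplicative linear map `toFun : S → S'` with a linear retraction
`retr` such that `toFun (retr x) = e x e`. -/
structure CornerHom (k S S' : Type u) [Field k] [Ring S] [Algebra k S] [Ring S']
    [Algebra k S'] where
  /-- The multiplicative map `S → S'`. -/
  toFun : S →ₗ[k] S'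
  /-- The retraction `S' → S`. -/
  retr : S' →ₗ[k] S
  map_mul : ∀ x y, toFun (x * y) = toFun x * toFun y
  retr_toFun : ∀ x, retr (toFun x) = x
  toFun_retr : ∀ x, toFun (retr x) = toFun 1 * x * toFun 1

variable {k S S' : Type u} [Field k] [Ring S] [Algebra k S] [Ring S'] [Algebra k S']

namespace CornerHom

variable (c : CornerHom k S S')

/-- The idempotent `e` with `S ≅ e S' e`. -/
def e : S' := c.toFun 1

lemma injective : Function.Injective c.toFun := fun x y h => by
  rw [← c.retr_toFun x, h, c.retr_toFun]

lemma e_mul_e : c.e * c.e = c.e := by rw [e, ← c.map_mul, mul_one]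

lemma e_mul (x : S) : c.e * c.toFun x = c.toFun x := by rw [e, ← c.map_mul, one_mul]

lemma mul_e (x : S) : c.toFun x * c.e = c.toFun x := by rw [e, ← c.map_mul, mul_one]

lemma toFun_retr' (x : S') : c.toFun (c.retr x) = c.e * x * c.e := c.toFun_retr x

lemma retr_mul (a : S) (x : S') : c.retr (c.toFun a * x) = a * c.retr x :=
  c.injective (by
    rw [c.toFun_retr', c.map_mul, c.toFun_retr', ← mul_assoc, ← mul_assoc, ← mul_assoc, c.e_mul,
      c.mul_e])

lemma retr_mul_right (a : S) (x : S') : c.retr (x * c.toFun a) = c.retr x * a :=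
  c.injective (by
    rw [c.toFun_retr', c.map_mul, c.toFun_retr', mul_assoc, mul_assoc, c.mul_e, mul_assoc (_ * _),
      c.e_mul, mul_assoc])

/-- The module `e M`, as an additive subgroup of `M`. -/
def cornerSubgroup (M : Type u) [AddCommGroup M] [Module S' M] : AddSubgroup M where
  carrier := {m | c.e • m = m}
  zero_mem' := smul_zero _
  add_mem' := fun {a b} ha hb => by
    change c.e • (a + b) = a + b
    rw [smul_add]; exact congrArg₂ _ ha hb
  neg_mem' := fun {a} ha => by
    change c.e • (-a) = -a
    rw [smul_neg]; exact congrArg _ ha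

lemma mem_corner {M : Type u} [AddCommGroup M] [Module S' M] {m : M} :
    m ∈ c.cornerSubgroup M ↔ c.e • m = m := Iff.rfl

lemma e_smul_mem {M : Type u} [AddCommGroup M] [Module S' M] (m : M) :
    c.e • m ∈ c.cornerSubgroup M := by rw [mem_corner, ← mul_smul, e_mul_e]

/-- The action of `S ≅ e S' e` on `e M`. -/
instance cornerModule (M : Type u) [AddCommGroup M] [Module S' M] :
    Module S (c.cornerSubgroup M) where
  smul x m := ⟨c.toFun x • m.1, by rw [mem_corner, ← mul_smul, c.e_mul]⟩
  one_smul m := Subtype.ext m.2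
  mul_smul x y m := Subtype.ext (by
    change c.toFun (x * y) • m.1 = c.toFun x • c.toFun y • m.1
    rw [c.map_mul, mul_smul])
  smul_zero x := Subtype.ext (smul_zero _)
  smul_add x m n := Subtype.ext (smul_add _ _ _)
  add_smul x y m := Subtype.ext (by
    change c.toFun (x + y) • m.1 = c.toFun x • m.1 + c.toFun y • m.1
    rw [map_add, add_smul])
  zero_smul m := Subtype.ext (by
    change c.toFun 0 • m.1 = 0
    rw [map_zero, zero_smul])

/-- The exact functor `M ↦ e M` from `S'`-modules to `S`-modules. -/
def functor : ModuleCat.{u} S' ⥤ ModuleCat.{u} S where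
  obj M := ModuleCat.of S (c.cornerSubgroup M)
  map f := ModuleCat.ofHom
    { toFun := fun m => ⟨f.hom m.1, by rw [mem_corner, ← map_smul, m.2]⟩
      map_add' := fun m n => Subtype.ext (map_add f.hom _ _)
      map_smul' := fun x m => Subtype.ext (map_smul f.hom _ _) }

instance : c.functor.Additive where

/-- The condition that `e S'` is a finitely generated projective `S`-module, in the form of a dual
basis: elements `w_s` and `r_s` such that `∑ w_s e r_s` acts as the identity on `e S'`. -/
def HasLeftBasis : Prop := ∃ (ι : Type) (_ : Fintype ι) (w r : ι → S'),
  ∀ x, c.e * x * ∑ i, w i * c.e * r i = c.e * x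

/-- If `f_q` and `x_q` form a dual basis of `M` over `S'`, then the maps `m ↦ e f_q(m) w_s e` and the
elements `e r_s x_q` form a dual basis of `e M` over `S`. -/
lemma fgProj_corner (h : c.HasLeftBasis) (M : Type u) [AddCommGroup M] [Module S' M]
    (hM : FGProj S' M) : FGProj S (c.cornerSubgroup M) := by
  obtain ⟨ι, _, w, r, hwr⟩ := h
  obtain ⟨κ, _, x, f, hf⟩ := fgProj_iff_dualBasis.1 hM
  refine fgProj_iff_dualBasis.2 ⟨κ × ι, inferInstance,
    fun p => ⟨c.e • r p.2 • x p.1, c.e_smul_mem _⟩,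
    fun p => { toFun := fun m => c.retr (f p.1 m.1 * w p.2)
               map_add' := fun m n => by
                change c.retr (f p.1 (m.1 + n.1) * w p.2) = _
                rw [map_add, add_mul, map_add]
               map_smul' := fun a m => by
                change c.retr (f p.1 (c.toFun a • m.1) * w p.2) = a * _
                rw [map_smul, smul_eq_mul, mul_assoc, c.retr_mul] }, fun m => ?_⟩
  apply Subtype.ext
  change (c.cornerSubgroup M).subtype _ = m.1
  rw [map_sum, Fintype.sum_prod_type]
  refine Eq.trans (Finset.sum_congr rfl fun q _ => ?_) (hf m.1)
  have hm : f q m.1 = c.e * f q m.1 := by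
    conv_lhs => rw [← c.mem_corner.1 m.2, map_smul, smul_eq_mul]
  conv_rhs => rw [hm, ← hwr, Finset.mul_sum, Finset.sum_smul]
  refine Finset.sum_congr rfl fun s _ => ?_
  change c.toFun (c.retr (f q m.1 * w s)) • c.e • r s • x q = _
  rw [c.toFun_retr', smul_smul, smul_smul]
  congr 1
  simp only [mul_assoc]
  rw [← mul_assoc c.e c.e, e_mul_e]

lemma preservesResolutions (h : c.HasLeftBasis) : PreservesResolutions c.functor where
  exact {X Y Z} f g hfg := by
    intro y
    constructor
    · intro hy
      obtain ⟨x, hx⟩ := (hfg y.1).1 (congrArg Subtype.val hy)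
      have key : f.hom (c.e • x) = y.1 := by rw [map_smul, hx]; exact y.2
      exact ⟨⟨c.e • x, c.e_smul_mem x⟩, Subtype.ext key⟩
    · rintro ⟨x, rfl⟩
      exact Subtype.ext ((hfg _).2 ⟨x.1, rfl⟩)
  injective f hf x y hxy := Subtype.ext (hf (congrArg Subtype.val hxy))
  surjective f hf y := by
    obtain ⟨x, hx⟩ := hf y.1
    have key : f.hom (c.e • x) = y.1 := by rw [map_smul, hx]; exact y.2
    exact ⟨⟨c.e • x, c.e_smul_mem x⟩, Subtype.ext key⟩
  fgProj M hM := c.fgProj_corner h M hM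

/-- The condition that `e S'` and `S' e` are finitely generated projective over `S`. -/
def HasBasis : Prop := ∃ (ι : Type) (_ : Fintype ι) (w r : ι → S'),
  (∀ x, c.e * x * ∑ i, w i * c.e * r i = c.e * x) ∧
    ∀ x, (∑ i, w i * c.e * r i) * x * c.e = x * c.e

/-- The corner of `S' ⊗ S'ᵒᵖ` defined by a corner of `S'`. -/
def enveloping : CornerHom k (S ⊗[k] Sᵐᵒᵖ) (S' ⊗[k] S'ᵐᵒᵖ) where
  toFun := TensorProduct.map c.toFun
    ((opLinearEquiv k).toLinearMap ∘ₗ c.toFun ∘ₗ (opLinearEquiv k).symm.toLinearMap)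
  retr := TensorProduct.map c.retr
    ((opLinearEquiv k).toLinearMap ∘ₗ c.retr ∘ₗ (opLinearEquiv k).symm.toLinearMap)
  map_mul x y := by
    induction x using TensorProduct.induction_on with
    | zero => simp
    | add x x' hx hx' => rw [add_mul, map_add, map_add, add_mul, hx, hx']
    | tmul x x' =>
      induction y using TensorProduct.induction_on with
      | zero => simp
      | add y y' hy hy' => rw [mul_add, map_add, map_add, mul_add, hy, hy']
      | tmul y y' => simp [c.map_mul]
  retr_toFun x := by
    induction x using TensorProduct.induction_on with
    | zero => simp
    | add x x' hx hx' => rw [map_add, map_add, hx, hx']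
    | tmul x x' => simp [c.retr_toFun]
  toFun_retr x := by
    induction x using TensorProduct.induction_on with
    | zero => simp
    | add x x' hx hx' => rw [map_add, map_add, hx, hx', mul_add, add_mul]
    | tmul x x' => simp [c.toFun_retr, Algebra.TensorProduct.one_def, mul_assoc]

lemma enveloping_e : c.enveloping.e = c.e ⊗ₜ op c.e := rfl

lemma HasBasis.enveloping {c : CornerHom k S S'} (h : c.HasBasis) :
    c.enveloping.HasLeftBasis := by
  obtain ⟨ι, _, w, r, h1, h2⟩ := h
  refine ⟨ι × ι, inferInstance, fun p => w p.1 ⊗ₜ op (r p.2), fun p => r p.1 ⊗ₜ op (w p.2),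
    fun x => ?_⟩
  have h3 : ∑ p : ι × ι, w p.1 ⊗ₜ[k] op (r p.2) * c.enveloping.e * r p.1 ⊗ₜ[k] op (w p.2) =
      (∑ i, w i * c.e * r i) ⊗ₜ[k] op (∑ i, w i * c.e * r i) := by
    rw [Fintype.sum_prod_type, TensorProduct.sum_tmul, Finset.op_sum]
    refine Finset.sum_congr rfl fun i _ => ?_
    rw [TensorProduct.tmul_sum]
    refine Finset.sum_congr rfl fun j _ => ?_
    simp [enveloping_e, mul_assoc]
  rw [h3]
  induction x using TensorProduct.induction_on with
  | zero => simp
  | add x x' hx hx' => rw [mul_add, add_mul, hx, hx']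
  | tmul x x' =>
    rw [enveloping_e, Algebra.TensorProduct.tmul_mul_tmul, Algebra.TensorProduct.tmul_mul_tmul, h1]
    congr 1
    apply unop_injective
    rw [unop_mul, unop_mul, unop_op, unop_op, ← mul_assoc, h2]

end CornerHom

end Corners

/-! ### Modules over matrix algebras -/

section Matrices

open Matrix.Module

variable {S : Type u} [Ring S] (U : Type) [Fintype U] [DecidableEq U]

/-- The functor `M ↦ M^U` from modules over `S` to modules over matrices with entries in `S`. -/
def columnFunctor : ModuleCat.{u} S ⥤ ModuleCat.{u} (Matrix U U S) where
  obj M := ModuleCat.of (Matrix U U S) (U → M)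
  map f := ModuleCat.ofHom
    { toFun := fun m a => f.hom (m a)
      map_add' := fun m n => funext fun a => map_add f.hom _ _
      map_smul' := fun x m => funext fun a => by
        change f.hom (∑ b, x a b • m b) = ∑ b, x a b • f.hom (m b)
        rw [map_sum]
        simp only [map_smul] }

instance : (columnFunctor (S := S) U).Additive where

lemma fgProj_column (M : Type u) [AddCommGroup M] [Module S M] (hM : FGProj S M) :
    FGProj (Matrix U U S) (U → M) := by
  rcases isEmpty_or_nonempty U with hU | ⟨⟨u₀⟩⟩
  · have : Subsingleton (U → M) := ⟨fun x y => funext fun a => hU.elim a⟩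
    exact FGProj.of_subsingleton
  -- a dual basis of `M`, placed in the coordinate `u₀`, is one of the module of columns
  · obtain ⟨κ, _, x, f, hf⟩ := fgProj_iff_dualBasis.1 hM
    refine fgProj_iff_dualBasis.2 ⟨κ, inferInstance,
      fun q => (Pi.single u₀ (x q) : U → M),
      fun q => { toFun := fun m => Matrix.of fun a b => if b = u₀ then f q (m a) else 0
                 map_add' := fun m n => by
                  ext a b
                  by_cases hb : b = u₀
                  · simp only [hb, Matrix.of_apply, if_true, Matrix.add_apply]
                    exact map_add (f q) _ _
                  · simp [hb]
                 map_smul' := fun t m => by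
                  ext a b
                  by_cases hb : b = u₀
                  · simp only [hb, Matrix.of_apply, if_true, RingHom.id_apply, smul_eq_mul,
                      Matrix.mul_apply]
                    change f q (∑ b, t a b • m b) = _
                    rw [map_sum]
                    simp only [map_smul, smul_eq_mul]
                  · simp [hb, Matrix.mul_apply] }, fun m => ?_⟩
    refine funext fun a => ?_
    refine (map_sum (Pi.evalAddMonoidHom (fun _ : U => M) a) _ _).trans ?_
    refine Eq.trans (Finset.sum_congr rfl fun q _ => ?_) (hf (m a))
    change ∑ b, (if b = u₀ then f q (m a) else 0) • (Pi.single u₀ (x q) : U → M) b = _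
    rw [Finset.sum_eq_single u₀]
    · simp
    · intro b _ hb; simp [hb]
    · intro h; exact absurd (Finset.mem_univ _) h

lemma columnFunctor_preservesResolutions : PreservesResolutions (columnFunctor (S := S) U) where
  exact {X Y Z} f g hfg := by
    intro y
    constructor
    · intro hy
      choose x hx using fun a => (hfg (y a)).1 (congrFun hy a)
      exact ⟨x, funext hx⟩
    · rintro ⟨x, rfl⟩
      exact funext fun a => (hfg _).2 ⟨x a, rfl⟩
  injective f hf x y hxy := funext fun a => hf (congrFun hxy a)
  surjective f hf y := by
    choose x hx using fun a => hf (y a)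
    exact ⟨x, funext hx⟩
  fgProj M hM := fgProj_column U M hM

end Matrices

/-! ### Transport of truncated resolutions along exact functors -/

section Transport

/-- The isomorphism given by a bijective morphism of modules. -/
def isoOfBijective {S : Type u} [Ring S] {M N : ModuleCat.{u} S} (f : M ⟶ N)
    (h : Function.Bijective f.hom) : M ≅ N :=
  (LinearEquiv.ofBijective f.hom h).toModuleIso

lemma PreservesResolutions.ker_equiv {S S' : Type u} [Ring S] [Ring S']
    {G : ModuleCat.{u} S ⥤ ModuleCat.{u} S'} (hG : PreservesResolutions G)
    {X Z N : ModuleCat.{u} S} (f : X ⟶ Z) (h : Nonempty (LinearMap.ker f.hom ≃ₗ[S] N)) :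
    Nonempty (LinearMap.ker (G.map f).hom ≃ₗ[S'] G.obj N) := by
  obtain ⟨e⟩ := h
  let i : N ⟶ X := ModuleCat.ofHom ((LinearMap.ker f.hom).subtype ∘ₗ e.symm.toLinearMap)
  have hi : Function.Injective i.hom :=
    (Submodule.injective_subtype _).comp e.symm.injective
  have hif : Function.Exact i.hom f.hom := fun x =>
    ⟨fun hx => ⟨e ⟨x, hx⟩, by simp [i]⟩, by rintro ⟨y, rfl⟩; exact (e.symm y).2⟩
  have h1 := hG.injective i hi
  have h2 := hG.exact i f hif
  have h3 : LinearMap.ker (G.map f).hom = LinearMap.range (G.map i).hom :=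
    LinearMap.exact_iff.1 h2
  exact ⟨(LinearEquiv.ofEq _ _ h3).trans (LinearEquiv.ofInjective _ h1).symm⟩

variable {k E E' : Type u} [Field k] [Ring E] [Algebra k E] [Ring E'] [Algebra k E']

/-- The image of a truncated resolution under an exact functor that preserves finitely generated
projective bimodules, the regular bimodule and the twisted regular bimodule. -/
def TruncatedResolution.map {n : ℕ} (Y : TruncatedResolution k E n)
    (G : BimodCat k E E ⥤ BimodCat k E' E') [G.Additive] (hG : PreservesResolutions G)
    (ρ : G.obj (regularBimod k E) ≅ regularBimod k E') (σ' : E' ≃ₐ[k] E')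
    (τ : G.obj (twistedBimod Y.σ) ≅ twistedBimod σ') : TruncatedResolution k E' n where
  σ := σ'
  Y := (G.mapHomologicalComplex (ComplexShape.up ℤ)).obj Y.Y
  one_le := Y.one_le
  finite i := (hG.fgProj _ ⟨Y.finite i, Y.projective i⟩).1
  projective i := (hG.fgProj _ ⟨Y.finite i, Y.projective i⟩).2
  subsingleton i hi := by
    have := Y.subsingleton i hi
    exact ModuleCat.subsingleton_of_isZero
      (Functor.map_isZero G (ModuleCat.isZero_of_subsingleton (Y.Y.X i)))
  aug := G.map Y.aug ≫ ρ.hom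
  aug_surjective := by
    have h : Function.Surjective ρ.hom.hom := (ModuleCat.epi_iff_surjective _).1 inferInstance
    exact h.comp (hG.surjective _ Y.aug_surjective)
  d_aug := by
    have h : G.map (Y.Y.d (-1) 0) ≫ G.map Y.aug = 0 := by
      rw [← Functor.map_comp, Y.d_aug, Functor.map_zero]
    exact (Category.assoc _ _ _).symm.trans ((congrArg (fun t => t ≫ _) h).trans
      Limits.zero_comp)
  exact_aug hn := by
    have h : Function.Injective ρ.hom.hom := (ModuleCat.mono_iff_injective _).1 inferInstance
    intro x
    refine Iff.trans ?_ (hG.exact _ _ (Y.exact_aug hn) x)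
    exact (map_eq_zero_iff ρ.hom.hom h)
  exact i h1 h2 := hG.exact _ _ (Y.exact i h1 h2)
  ker_of_eq_one hn := by
    have h : Function.Injective ρ.hom.hom := (ModuleCat.mono_iff_injective _).1 inferInstance
    obtain ⟨e⟩ := hG.ker_equiv _ (Y.ker_of_eq_one hn)
    have h' : LinearMap.ker (G.map Y.aug ≫ ρ.hom).hom = LinearMap.ker (G.map Y.aug).hom :=
      LinearMap.ker_comp_of_ker_eq_bot _ (LinearMap.ker_eq_bot.2 h)
    exact ⟨(LinearEquiv.ofEq _ _ h').trans (e.trans τ.toLinearEquiv)⟩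
  ker_of_two_le hn := by
    obtain ⟨e⟩ := hG.ker_equiv _ (Y.ker_of_two_le hn)
    exact ⟨e.trans τ.toLinearEquiv⟩

end Transport

/-! ### Recognition of twisted regular bimodules -/

section TwistedRegular

variable {k E : Type u} [Field k] [Ring E] [Algebra k E]

/-- The identification of the twisted bimodule with the algebra. -/
def twistedEquiv (σ : E ≃ₐ[k] E) : twistedBimod σ ≃+ E := BimodCat.ofActionsEquiv _ _ _ _

lemma twistedEquiv_left (σ : E ≃ₐ[k] E) (a : E) (x : twistedBimod σ) :
    twistedEquiv σ (a • x) = a * twistedEquiv σ x :=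
  BimodCat.ofActionsEquiv_left _ _ _ _ a x

lemma twistedEquiv_right (σ : E ≃ₐ[k] E) (a : E) (x : twistedBimod σ) :
    twistedEquiv σ (op a • x) = twistedEquiv σ x * σ a :=
  BimodCat.ofActionsEquiv_right _ _ _ _ (op a) x

variable (k E) in
/-- The identification of the regular bimodule with the algebra. -/
def regularEquiv : regularBimod k E ≃+ E := BimodCat.ofActionsEquiv _ _ _ _

lemma regularEquiv_left (a : E) (x : regularBimod k E) :
    regularEquiv k E (a • x) = a * regularEquiv k E x :=
  BimodCat.ofActionsEquiv_left _ _ _ _ a x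

lemma regularEquiv_right (a : E) (x : regularBimod k E) :
    regularEquiv k E (op a • x) = regularEquiv k E x * a :=
  BimodCat.ofActionsEquiv_right _ _ _ _ (op a) x

/-- A bimodule which is freely generated by an element `g` as a left module, and such that no
nonzero element of `E` kills `g` on the right, is a twisted regular bimodule: the automorphism `σ`
is defined by `g y = σ(y) g`. -/
lemma exists_iso_twistedBimod [Module.Finite k E] (M : BimodCat k E E) (g : M)
    (hl : Function.Bijective fun x : E => x • g) (hr : ∀ y : E, op y • g = 0 → y = 0) :
    ∃ σ : E ≃ₐ[k] E, Nonempty (M ≅ twistedBimod σ) := by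
  choose s hs using fun y : E => hl.2 (op y • g)
  have hs' : ∀ y, s y • g = op y • g := hs
  have key : ∀ x y, x • g = op y • g → s y = x := fun x y h => hl.1 ((hs' y).trans h.symm)
  let S : E →ₐ[k] E := AlgHom.ofLinearMap
    { toFun := s
      map_add' := fun y y' => key _ _ (by
        rw [add_smul, hs', hs', MulOpposite.op_add, add_smul])
      map_smul' := fun c y => key _ _ (by
        rw [RingHom.id_apply, MulOpposite.op_smul, smul_assoc, smul_assoc, hs']) }
    (key _ _ (by rw [one_smul, MulOpposite.op_one, one_smul]))
    (fun y y' => key _ _ (by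
      change (s y * s y') • g = _
      rw [mul_smul, hs', smul_comm, hs', MulOpposite.op_mul, mul_smul]))
  have hS : ∀ y, S y • g = op y • g := hs'
  have hinj : Function.Injective S := by
    rw [injective_iff_map_eq_zero]
    exact fun y hy => hr y (by rw [← hS, hy, zero_smul])
  let σ : E ≃ₐ[k] E := AlgEquiv.ofBijective S
    ⟨hinj, (LinearMap.injective_iff_surjective (f := S.toLinearMap)).1 hinj⟩
  have hσ : ∀ y, σ y • g = op y • g := hS
  let φ : twistedBimod σ ⟶ M := BimodCat.homMk
    { toFun := fun x => twistedEquiv σ x • g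
      map_zero' := by rw [map_zero, zero_smul]
      map_add' := fun x y => by rw [map_add, add_smul] }
    (fun b m => by
      change twistedEquiv σ (b • m) • g = b • twistedEquiv σ m • g
      rw [twistedEquiv_left, mul_smul])
    (fun c m => by
      change twistedEquiv σ (c • m) • g = c • twistedEquiv σ m • g
      rw [← op_unop c, twistedEquiv_right, mul_smul, hσ, smul_comm])
  have hφ : Function.Bijective φ.hom := hl.comp (twistedEquiv σ).bijective
  exact ⟨σ, ⟨(isoOfBijective φ hφ).symm⟩⟩

end TwistedRegular

/-! ### Corners of matrix algebras -/

section MatrixCorners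

variable {k : Type u} [Field k]

/-- A linear map, viewed as a map between opposite algebras. -/
def opMap {V W : Type u} [AddCommGroup V] [Module k V] [AddCommGroup W] [Module k W]
    (f : V →ₗ[k] W) : Vᵐᵒᵖ →ₗ[k] Wᵐᵒᵖ :=
  (opLinearEquiv k).toLinearMap ∘ₗ f ∘ₗ (opLinearEquiv k).symm.toLinearMap

@[simp]
lemma opMap_apply {V W : Type u} [AddCommGroup V] [Module k V] [AddCommGroup W] [Module k W]
    (f : V →ₗ[k] W) (x : Vᵐᵒᵖ) : opMap f x = op (f (unop x)) := rfl

lemma sum_tmul_op_sum {T : Type} [Fintype T] {V W : Type u} [AddCommGroup V] [Module k V]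
    [AddCommGroup W] [Module k W] (f : T → T → V) (g : T → T → W) :
    (∑ a, ∑ c, f a c) ⊗ₜ[k] op (∑ b, ∑ d, g b d) =
      ∑ u : T × T, ∑ v : T × T, f u.1 v.1 ⊗ₜ[k] op (g v.2 u.2) := by
  simp only [Fintype.sum_prod_type]
  rw [TensorProduct.sum_tmul]
  refine Finset.sum_congr rfl fun a _ => ?_
  rw [TensorProduct.sum_tmul]
  refine Eq.trans (Finset.sum_congr rfl fun c _ => ?_) Finset.sum_comm
  rw [Finset.sum_comm, Finset.op_sum, TensorProduct.tmul_sum]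
  refine Finset.sum_congr rfl fun b _ => ?_
  rw [Finset.op_sum, TensorProduct.tmul_sum]

/-- A presentation of the algebra `E'` as a corner of the algebra of matrices over `E` with rows and
columns indexed by `T`: the element `x` of `E'` corresponds to the matrix with entries
`entry a c x`, and `∑ ofEntry a c (z a c)` is the element of `E'` that corresponds to the
projection of the matrix `z` to the corner. -/
structure MatrixPresentation (k : Type u) [Field k] (T : Type) [Fintype T] (E E' : Type u) [Ring E]
    [Algebra k E] [Ring E'] [Algebra k E'] where
  /-- The entries of the matrix of an element. -/
  entry : T → T → E' →ₗ[k] E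
  /-- The projection to `E'` of the matrix with a single nonzero entry. -/
  ofEntry : T → T → E →ₗ[k] E'
  entry_mul : ∀ a c x y, entry a c (x * y) = ∑ d, entry a d x * entry d c y
  entry_ofEntry : ∀ a c p r z, entry a c (ofEntry p r z) = entry a p 1 * z * entry r c 1
  sum_ofEntry : ∀ x, ∑ a, ∑ c, ofEntry a c (entry a c x) = x

namespace MatrixPresentation

variable {T : Type} [Fintype T] {E E' : Type u} [Ring E] [Algebra k E] [Ring E'] [Algebra k E']
  (c : MatrixPresentation k T E E')

/-- The matrix, indexed by pairs, of an element of the enveloping algebra of `E'`. -/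
def envelopingMatrix : E' ⊗[k] E'ᵐᵒᵖ →ₗ[k] Matrix (T × T) (T × T) (E ⊗[k] Eᵐᵒᵖ) where
  toFun x := Matrix.of fun u v =>
    TensorProduct.map (c.entry u.1 v.1) (opMap (c.entry v.2 u.2)) x
  map_add' x y := by ext u v; simp
  map_smul' x y := by ext u v; simp

lemma envelopingMatrix_apply (x : E' ⊗[k] E'ᵐᵒᵖ) (u v : T × T) : c.envelopingMatrix x u v =
    TensorProduct.map (c.entry u.1 v.1) (opMap (c.entry v.2 u.2)) x := rfl

lemma envelopingMatrix_tmul (x : E') (y : E'ᵐᵒᵖ) (u v : T × T) :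
    c.envelopingMatrix (x ⊗ₜ y) u v = c.entry u.1 v.1 x ⊗ₜ op (c.entry v.2 u.2 (unop y)) := rfl

lemma envelopingMatrix_one (u v : T × T) :
    c.envelopingMatrix 1 u v = c.entry u.1 v.1 1 ⊗ₜ op (c.entry v.2 u.2 1) := rfl

lemma envelopingMatrix_mul (x y : E' ⊗[k] E'ᵐᵒᵖ) :
    c.envelopingMatrix (x * y) = c.envelopingMatrix x * c.envelopingMatrix y := by
  induction x using TensorProduct.induction_on with
  | zero => rw [zero_mul, map_zero, zero_mul]
  | add x x' hx hx' => rw [add_mul, map_add, map_add, add_mul, hx, hx']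
  | tmul x x' =>
    induction y using TensorProduct.induction_on with
    | zero => rw [mul_zero, map_zero, mul_zero]
    | add y y' hy hy' => rw [mul_add, map_add, map_add, mul_add, hy, hy']
    | tmul y y' =>
      ext u v
      rw [Algebra.TensorProduct.tmul_mul_tmul, Matrix.mul_apply, envelopingMatrix_tmul, unop_mul,
        entry_mul, entry_mul, Fintype.sum_prod_type, TensorProduct.sum_tmul]
      refine Finset.sum_congr rfl fun c _ => ?_
      rw [Finset.op_sum, TensorProduct.tmul_sum]
      refine Finset.sum_congr rfl fun d _ => ?_
      rw [envelopingMatrix_tmul, envelopingMatrix_tmul, Algebra.TensorProduct.tmul_mul_tmul, op_mul]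

/-- The element of the enveloping algebra of `E'` defined by a matrix. -/
def envelopingRetr : Matrix (T × T) (T × T) (E ⊗[k] Eᵐᵒᵖ) →ₗ[k] E' ⊗[k] E'ᵐᵒᵖ :=
  ∑ u : T × T, ∑ v : T × T,
    TensorProduct.map (c.ofEntry u.1 v.1) (opMap (c.ofEntry v.2 u.2)) ∘ₗ
      Matrix.entryLinearMap k _ u v

lemma envelopingRetr_apply (x : Matrix (T × T) (T × T) (E ⊗[k] Eᵐᵒᵖ)) :
    c.envelopingRetr x = ∑ u : T × T, ∑ v : T × T,
      TensorProduct.map (c.ofEntry u.1 v.1) (opMap (c.ofEntry v.2 u.2)) (x u v) := by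
  simp [envelopingRetr]

lemma envelopingRetr_envelopingMatrix (x : E' ⊗[k] E'ᵐᵒᵖ) :
    c.envelopingRetr (c.envelopingMatrix x) = x := by
  induction x using TensorProduct.induction_on with
  | zero => rw [map_zero, map_zero]
  | add x y hx hy => rw [map_add, map_add, hx, hy]
  | tmul x x' =>
    conv_rhs => rw [← c.sum_ofEntry x, ← op_unop x', ← c.sum_ofEntry (unop x')]
    rw [sum_tmul_op_sum, envelopingRetr_apply]
    rfl

lemma map_entry_map_ofEntry (u v p r : T × T) (z : E ⊗[k] Eᵐᵒᵖ) :
    TensorProduct.map (c.entry u.1 v.1) (opMap (c.entry v.2 u.2))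
      (TensorProduct.map (c.ofEntry p.1 r.1) (opMap (c.ofEntry r.2 p.2)) z) =
      c.envelopingMatrix 1 u p * z * c.envelopingMatrix 1 r v := by
  induction z using TensorProduct.induction_on with
  | zero => simp only [map_zero, mul_zero, zero_mul]
  | add z z' hz hz' => rw [map_add, map_add, mul_add, add_mul, hz, hz']
  | tmul z z' =>
    rw [TensorProduct.map_tmul, TensorProduct.map_tmul, envelopingMatrix_one, envelopingMatrix_one,
      Algebra.TensorProduct.tmul_mul_tmul, Algebra.TensorProduct.tmul_mul_tmul, entry_ofEntry]
    simp only [opMap_apply, unop_op, entry_ofEntry, op_mul, op_unop, mul_assoc]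

variable [DecidableEq T]

/-- The enveloping algebra of `E'` is a corner of a matrix algebra over the enveloping algebra
of `E`. -/
def corner : CornerHom k (E' ⊗[k] E'ᵐᵒᵖ) (Matrix (T × T) (T × T) (E ⊗[k] Eᵐᵒᵖ)) where
  toFun := c.envelopingMatrix
  retr := c.envelopingRetr
  map_mul := c.envelopingMatrix_mul
  retr_toFun := c.envelopingRetr_envelopingMatrix
  toFun_retr x := by
    ext u v
    rw [envelopingMatrix_apply, envelopingRetr_apply, map_sum]
    simp only [Matrix.mul_apply, map_sum, map_entry_map_ofEntry, Finset.sum_mul]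
    rw [Finset.sum_comm]

lemma corner_e : c.corner.e = c.envelopingMatrix 1 := rfl

/-- The corner `E'` of the matrix algebra over `E` is full if there are a row `t` and a column `s`
with `t e s = 1`. -/
lemma hasLeftBasis (t s : T → E)
    (hst : ∑ a, ∑ b, t a * c.entry a b 1 * s b = 1) : c.corner.HasLeftBasis := by
  let row : T × T → E ⊗[k] Eᵐᵒᵖ := fun v => t v.1 ⊗ₜ op (s v.2)
  let col : T × T → E ⊗[k] Eᵐᵒᵖ := fun v => s v.1 ⊗ₜ op (t v.2)
  have h1 : ∑ u, ∑ v, row u * c.envelopingMatrix 1 u v * col v = 1 := by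
    have h3 : (1 : E ⊗[k] Eᵐᵒᵖ) = (∑ a, ∑ b, t a * c.entry a b 1 * s b) ⊗ₜ
        op (∑ a, ∑ b, t a * c.entry a b 1 * s b) := by
      rw [hst, Algebra.TensorProduct.one_def, op_one]
    rw [h3]
    rw [sum_tmul_op_sum]
    simp only [row, col, envelopingMatrix_one, Algebra.TensorProduct.tmul_mul_tmul, op_mul,
      mul_assoc]
  have h : ∑ u : T × T, (Matrix.of fun u' v => if u' = u then row v else 0) * c.corner.e *
      (Matrix.of fun v u' => if u' = u then col v else 0) = 1 := by
    ext u₁ u₂ : 2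
    rw [Matrix.sum_apply, Finset.sum_eq_single u₁]
    · rw [Matrix.one_apply, corner_e]
      simp only [Matrix.mul_apply, Matrix.of_apply, if_true]
      by_cases h12 : u₁ = u₂
      · subst h12
        simp only [if_true, ← h1, Finset.sum_mul]
        rw [Finset.sum_comm]
      · simp [h12, Ne.symm h12]
    · intro u _ hu
      simp [Matrix.mul_apply, Ne.symm hu]
    · exact fun h => absurd (Finset.mem_univ _) h
  exact ⟨T × T, inferInstance, _, _, fun x => by rw [h, mul_one]⟩

end MatrixPresentation

end MatrixCorners

/-! ### Corners of endomorphism algebras -/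

section EndCorners

variable {k A P P' : Type u} [Field k] [Ring A] [Algebra k A]
  [AddCommGroup P] [Module k P] [Module A P] [IsScalarTower k A P]
  [AddCommGroup P'] [Module k P'] [Module A P'] [IsScalarTower k A P']

/-- The map `x ↦ g ∘ x ∘ f` between opposite endomorphism algebras. -/
def endConj (k : Type u) [Field k] [Algebra k A] [Module k P] [IsScalarTower k A P]
    [Module k P'] [IsScalarTower k A P'] (f : P' →ₗ[A] P) (g : P →ₗ[A] P') :
    EndOp A P →ₗ[k] EndOp A P' where
  toFun x := op (g ∘ₗ unop x ∘ₗ f)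
  map_add' x y := congrArg op (LinearMap.ext fun p => by simp)
  map_smul' c x := congrArg op (LinearMap.ext fun p => by
    exact map_smul (g.restrictScalars k) c _)

@[simp]
lemma unop_endConj_apply (f : P' →ₗ[A] P) (g : P →ₗ[A] P') (x : EndOp A P) (p : P') :
    unop (endConj k f g x) p = g (unop x (f p)) := rfl

lemma endOp_ext {A P : Type u} [Ring A] [AddCommGroup P] [Module A P] {x y : EndOp A P} (h : ∀ p, unop x p = unop y p) : x = y :=
  unop_injective (LinearMap.ext h)

/-- If `P` is a direct summand of `P'` then `EndOp A P` is a corner of `EndOp A P'`. -/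
def summandCorner (k : Type u) [Field k] [Algebra k A] [Module k P] [IsScalarTower k A P]
    [Module k P'] [IsScalarTower k A P'] (j : P →ₗ[A] P') (q : P' →ₗ[A] P)
    (hqj : ∀ p, q (j p) = p) : CornerHom k (EndOp A P) (EndOp A P') where
  toFun := endConj k q j
  retr := endConj k j q
  map_mul x y := endOp_ext fun p => by simp [hqj]
  retr_toFun x := endOp_ext fun p => by simp [hqj]
  toFun_retr x := endOp_ext fun p => by simp

lemma summandCorner_hasBasis {j : P →ₗ[A] P'} {q : P' →ₗ[A] P} (hqj : ∀ p, q (j p) = p)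
    {T : Type} [Fintype T] (α : T → P' →ₗ[A] P) (β : T → P →ₗ[A] P')
    (hαβ : ∀ p, ∑ a, β a (α a p) = p) : (summandCorner k j q hqj).HasBasis := by
  have h : ∑ a, op (j ∘ₗ α a) * (summandCorner k j q hqj).e * op (β a ∘ₗ q) = 1 := by
    apply unop_injective
    rw [Finset.unop_sum]
    refine LinearMap.ext fun p => ?_
    rw [LinearMap.sum_apply]
    refine Eq.trans (Finset.sum_congr rfl fun a _ => ?_) (hαβ p)
    simp [summandCorner, CornerHom.e, hqj]
  exact ⟨T, inferInstance, fun a => op (j ∘ₗ α a), fun a => op (β a ∘ₗ q),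
    fun x => by rw [h, mul_one], fun x => by rw [h, one_mul]⟩

/-- The entries of the matrix over `EndOp A P` of an endomorphism of `P'`, where `P'` is presented
as a direct summand of a finite direct sum of copies of `P`. -/
abbrev entry {T : Type} (k : Type u) [Field k] [Algebra k A] [Module k P] [IsScalarTower k A P]
    [Module k P'] [IsScalarTower k A P'] (α : T → P' →ₗ[A] P) (β : T → P →ₗ[A] P') (a c : T) :
    EndOp A P' →ₗ[k] EndOp A P :=
  endConj k (β a) (α c)

variable {T : Type} [Fintype T]

lemma entry_mul {α : T → P' →ₗ[A] P} {β : T → P →ₗ[A] P'}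
    (hαβ : ∀ p, ∑ a, β a (α a p) = p) (a c : T) (x y : EndOp A P') :
    entry k α β a c (x * y) = ∑ d, entry k α β a d x * entry k α β d c y := by
  apply unop_injective
  rw [Finset.unop_sum]
  refine LinearMap.ext fun p => ?_
  rw [LinearMap.sum_apply]
  change α c (unop y (unop x (β a p))) = _
  conv_lhs => rw [← hαβ (unop x (β a p)), map_sum, map_sum]
  rfl

/-- If `P'` is a direct summand of a finite direct sum of copies of `P`, then `EndOp A P'` is a
corner of a matrix algebra over `EndOp A P`. -/
def matrixPresentation (k : Type u) [Field k] [Algebra k A] [Module k P] [IsScalarTower k A P]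
    [Module k P'] [IsScalarTower k A P'] (α : T → P' →ₗ[A] P) (β : T → P →ₗ[A] P')
    (hαβ : ∀ p, ∑ a, β a (α a p) = p) : MatrixPresentation k T (EndOp A P) (EndOp A P') where
  entry := entry k α β
  ofEntry a c := endConj k (α a) (β c)
  entry_mul := entry_mul hαβ
  entry_ofEntry a c p r z := endOp_ext fun _ => rfl
  sum_ofEntry x := by
    apply unop_injective
    simp only [Finset.unop_sum]
    refine LinearMap.ext fun p => ?_
    simp only [LinearMap.sum_apply, unop_endConj_apply]
    rw [Finset.sum_comm]
    simp only [← map_sum, hαβ]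

lemma matrixPresentation_hasLeftBasis [DecidableEq T] {α : T → P' →ₗ[A] P} {β : T → P →ₗ[A] P'}
    (hαβ : ∀ p, ∑ a, β a (α a p) = p) {j : P →ₗ[A] P'} {q : P' →ₗ[A] P} (hqj : ∀ p, q (j p) = p) :
    (matrixPresentation k α β hαβ).corner.HasLeftBasis := by
  refine (matrixPresentation k α β hαβ).hasLeftBasis (fun a => op (α a ∘ₗ j))
    (fun a => op (q ∘ₗ β a)) ?_
  apply unop_injective
  simp only [Finset.unop_sum]
  refine LinearMap.ext fun p => ?_
  simp only [LinearMap.sum_apply, unop_mul]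
  change ∑ a, ∑ c, q (β c (α c (β a (α a (j p))))) = p
  simp only [← map_sum, hαβ, hqj]

end EndCorners

/-! ### Isomorphisms between derived tensor functors -/

section DerivedIso

variable {k B R : Type u} [Field k] [Ring B] [Algebra k B] [Ring R] [Algebra k R]

/-- The natural transformation `X ⊗ - ⟶ X' ⊗ -` defined by a map of complexes `X ⟶ X'`. -/
def tensorComplexMap {X X' : CochainComplex (BimodCat k B R) ℤ} (f : X ⟶ X') :
    tensorComplex X ⟶ tensorComplex X' :=
  ((tensorFunctor k B R).map₂CochainComplex).map f

lemma tensorComplexMap_quasiIso {X X' : CochainComplex (BimodCat k B R) ℤ} (f : X ⟶ X')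
    (hf : HomologicalComplex.homotopyEquivalences _ _ f) (V : CochainComplex (ModuleCat.{u} R) ℤ) :
    QuasiIso ((tensorComplexMap f).app V) := by
  obtain ⟨e, rfl⟩ := hf
  let F : ∀ {X X' : CochainComplex (BimodCat k B R) ℤ}, (X ⟶ X') →
    ((tensorComplex X).obj V ⟶ (tensorComplex X').obj V) := fun f => (tensorComplexMap f).app V
  have hF : ∀ {X X' : CochainComplex (BimodCat k B R) ℤ} {f g : X ⟶ X'}, Homotopy f g →
      Homotopy (F f) (F g) := fun h =>
    HomologicalComplex.mapBifunctorMapHomotopy₁ h (𝟙 V) (tensorFunctor k B R) (ComplexShape.up ℤ)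
  have hF1 : ∀ X : CochainComplex (BimodCat k B R) ℤ, F (𝟙 X) = 𝟙 _ := fun X =>
    congrArg (fun t => NatTrans.app t V)
      (((tensorFunctor k B R).map₂CochainComplex).map_id X)
  have hF2 : ∀ {X X' X'' : CochainComplex (BimodCat k B R) ℤ} (f : X ⟶ X') (g : X' ⟶ X''),
      F (f ≫ g) = F f ≫ F g := fun f g =>
    congrArg (fun t => NatTrans.app t V)
      (((tensorFunctor k B R).map₂CochainComplex).map_comp f g)
  let e' : HomotopyEquiv ((tensorComplex X).obj V) ((tensorComplex X').obj V) :=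
    { hom := F e.hom
      inv := F e.inv
      homotopyHomInvId := by
        have := hF e.homotopyHomInvId
        rwa [hF1, hF2] at this
      homotopyInvHomId := by
        have := hF e.homotopyInvHomId
        rwa [hF1, hF2] at this }
  exact homotopyEquivalences_le_quasiIso _ _ _ ⟨e', rfl⟩

variable [Module.Finite k B] [Module.Finite k R]

lemma derivedTensor_iso_of_quasiIso {X X' : CochainComplex (BimodCat k B R) ℤ}
    (hX : IsTensorable X) (hX' : IsTensorable X') (τ : tensorComplex X ⟶ tensorComplex X')
    (hτ : ∀ V, boundedFinite R V → QuasiIso (τ.app V)) :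
    Nonempty (derivedTensor X hX ≅ derivedTensor X' hX') := by
  let t : boundedTensor X hX ⟶ boundedTensor X' hX' :=
    { app := fun V => ObjectProperty.homMk (τ.app V.obj)
      naturality := fun V W f => by
        ext1
        exact τ.naturality f.hom }
  have ht : ∀ V, IsIso ((Functor.whiskerRight t (quasiIsos B).Q).app V) := fun V =>
    (quasiIsos B).Q_inverts _ (hτ V.obj V.property)
  have : IsIso (Functor.whiskerRight t (quasiIsos B).Q) := NatIso.isIso_of_isIso_app _
  have h1 : Localization.Lifting (quasiIsos R).Q (quasiIsos R)
      (boundedTensor X hX ⋙ (quasiIsos B).Q) (derivedTensor X hX) :=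
    Localization.liftingConstructionLift _ _
  have h2 : Localization.Lifting (quasiIsos R).Q (quasiIsos R)
      (boundedTensor X' hX' ⋙ (quasiIsos B).Q) (derivedTensor X' hX') :=
    Localization.liftingConstructionLift _ _
  exact ⟨Localization.liftNatIso (quasiIsos R).Q (quasiIsos R)
    (boundedTensor X hX ⋙ (quasiIsos B).Q) (boundedTensor X' hX' ⋙ (quasiIsos B).Q) _ _
    (asIso (Functor.whiskerRight t (quasiIsos B).Q))⟩

lemma derivedTensor_iso_of_homotopyEquivalence {X X' : CochainComplex (BimodCat k B R) ℤ}
    (hX : IsTensorable X) (hX' : IsTensorable X') (f : X ⟶ X')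
    (hf : HomologicalComplex.homotopyEquivalences _ _ f) :
    Nonempty (derivedTensor X hX ≅ derivedTensor X' hX') :=
  derivedTensor_iso_of_quasiIso hX hX' (tensorComplexMap f) fun V _ =>
    tensorComplexMap_quasiIso f hf V

end DerivedIso

/-! ### Comparison of periodic twists -/

section CompareTwists

/-- A map of complexes that commutes with maps to a third complex and is an isomorphism in the
homotopy category induces a homotopy equivalence between the mapping cones. -/
lemma mappingCone_homotopyEquivalence {C : Type*} [Category* C] [Preadditive C]
    [Limits.HasZeroObject C] [Limits.HasBinaryBiproducts C]
    {K K' L : CochainComplex C ℤ} (g : K ⟶ L) (g' : K' ⟶ L) (f : K ⟶ K') (hf : f ≫ g' = g)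
    (h : IsIso ((HomotopyCategory.quotient C (ComplexShape.up ℤ)).map f)) :
    HomologicalComplex.homotopyEquivalences _ _
      (CochainComplex.mappingCone.map g g' f (𝟙 L) (by rw [Category.comp_id, hf])) := by
  rw [← HomotopyCategory.inverseImage_quotient_isomorphisms]
  rw [CochainComplex.mappingCone.map_eq_mapOfHomotopy]
  exact Pretriangulated.isIso₃_of_isIso₁₂
    (CochainComplex.mappingCone.trianglehMapOfHomotopy (Homotopy.ofEq (by rw [Category.comp_id, hf])))
    (HomotopyCategory.mappingCone_triangleh_distinguished g)
    (HomotopyCategory.mappingCone_triangleh_distinguished g') h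
    (by
      change IsIso ((HomotopyCategory.quotient C (ComplexShape.up ℤ)).map (𝟙 L))
      infer_instance)

variable {k : Type u} [Field k] {A : Type u} [Ring A] [Algebra k A] [Module.Finite k A]
  {P P' : Type u} [AddCommGroup P] [Module k P] [Module A P] [IsScalarTower k A P]
  [AddCommGroup P'] [Module k P'] [Module A P'] [IsScalarTower k A P']
  [Module.Finite A P] [Module.Projective A P] [Module.Finite A P'] [Module.Projective A P']

/-- Two periodic twists are isomorphic if the complexes `P ⊗ Y ⊗ P^∨` that define them are homotopy
equivalent over `A`. -/
lemma periodicTwist_iso_of_isIso {n n' : ℕ} (Y : TruncatedResolution k (EndOp A P) n)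
    (Y' : TruncatedResolution k (EndOp A P') n') (f : sandwichComplex A Y ⟶ sandwichComplex A Y')
    (hf : f ≫ twistMap A Y' = twistMap A Y)
    (h : IsIso ((HomotopyCategory.quotient _ (ComplexShape.up ℤ)).map f)) :
    Nonempty (periodicTwist A Y ≅ periodicTwist A Y') :=
  derivedTensor_iso_of_homotopyEquivalence _ _ _
    (mappingCone_homotopyEquivalence (twistMap A Y) (twistMap A Y') f hf h)

end CompareTwists

/-! ### Maps out of `L ⊗ Q ⊗ N` -/

namespace BimodCat

variable {k B C R R' : Type u} [Field k] [Ring B] [Algebra k B] [Ring C] [Algebra k C]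
  [Ring R] [Algebra k R] [Ring R'] [Algebra k R']

section Sandwich

variable (L : BimodCat k B R) (N : BimodCat k R C)

/-- The element `l ⊗ x ⊗ n` of `L ⊗ Q ⊗ N`. -/
def stmul (Q : BimodCat k R R) (l : L) (x : Q) (n : N) : (sandwich L N).obj Q :=
  tmul (tensor L Q) N (tmul L Q l x) n

lemma sandwich_map_stmul {Q Q' : BimodCat k R R} (f : Q ⟶ Q') (l : L) (x : Q) (n : N) :
    ((sandwich L N).map f).hom (stmul L N Q l x n) = stmul L N Q' l (f.hom x) n := by
  refine (tensorMap_tmul _ _ _ _).trans ?_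
  rw [tensorMap_tmul]
  rfl

variable {L N}

lemma sandwich_hom_ext {Q : BimodCat k R R} {W : BimodCat k B C}
    {f g : (sandwich L N).obj Q ⟶ W}
    (h : ∀ l x n, f.hom (stmul L N Q l x n) = g.hom (stmul L N Q l x n)) : f = g := by
  refine tensor_hom_ext (L := tensor L Q) fun z n => ?_
  induction z using tensor_induction with
  | h0 =>
    have h0 : tmul (tensor L Q) N 0 n = 0 := by
      have := add_tmul (tensor L Q) N 0 0 n
      rw [add_zero] at this
      exact left_eq_add.1 this
    rw [h0, map_zero, map_zero]
  | ht l x => exact h l x n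
  | ha x y hx hy => rw [add_tmul, map_add, map_add, hx, hy]

/-- The trilinear maps that define morphisms of bimodules `L ⊗ Q ⊗ N ⟶ W`. -/
structure IsTrilinear {Q : BimodCat k R R} {W : BimodCat k B C} (T : L → Q → N → W) : Prop where
  add_left : ∀ l l' x n, T (l + l') x n = T l x n + T l' x n
  add_mid : ∀ l x x' n, T l (x + x') n = T l x n + T l x' n
  add_right : ∀ l x n n', T l x (n + n') = T l x n + T l x n'
  balanced_left : ∀ l (r : R) x n, T (op r • l) x n = T l (r • x) n
  balanced_right : ∀ l x (r : R) n, T l (op r • x) n = T l x (r • n)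
  left_smul : ∀ (b : B) l x n, T (b • l) x n = b • T l x n
  right_smul : ∀ (c : Cᵐᵒᵖ) l x n, T l x (c • n) = c • T l x n

namespace IsTrilinear

variable {Q : BimodCat k R R} {W : BimodCat k B C} {T : L → Q → N → W}

lemma smul_left (hT : IsTrilinear T) (a : k) (l x n) : T (a • l) x n = a • T l x n := by
  rw [← algebraMap_smul B a l, hT.left_smul, algebraMap_smul]

lemma smul_mid (hT : IsTrilinear T) (a : k) (l x n) : T l (a • x) n = a • T l x n := by
  rw [← algebraMap_smul R a x, ← hT.balanced_left, ← hT.smul_left,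
    ← algebraMap_smul Rᵐᵒᵖ a l]
  rfl

lemma smul_right (hT : IsTrilinear T) (a : k) (l x n) : T l x (a • n) = a • T l x n := by
  rw [← algebraMap_smul Cᵐᵒᵖ a n, hT.right_smul, algebraMap_smul]

end IsTrilinear

/-- The map `L ⊗ Q → Hom(N, W)` defined by a trilinear map. -/
def trilinearAux {Q : BimodCat k R R} {W : BimodCat k B C} (T : L → Q → N → W)
    (hT : IsTrilinear T) : tensor L Q →ₗ[k] N →ₗ[k] W :=
  let f : L →ₗ[k] Q →ₗ[k] N →ₗ[k] W := LinearMap.mk₂ k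
    (fun l x => { toFun := T l x, map_add' := hT.add_right l x,
                  map_smul' := fun a n => hT.smul_right a l x n })
    (fun l l' x => LinearMap.ext fun n => hT.add_left l l' x n)
    (fun a l x => LinearMap.ext fun n => hT.smul_left a l x n)
    (fun l x x' => LinearMap.ext fun n => hT.add_mid l x x' n)
    (fun a l x => LinearMap.ext fun n => hT.smul_mid a l x n)
  BalancedTensor.lift (R := R) f (fun l r x => LinearMap.ext fun n => hT.balanced_left l r x n) ∘ₗ
      (ofActionsLinearEquiv _ _ _ (tensor_commute L Q)).toLinearMap

lemma trilinearAux_tmul {Q : BimodCat k R R} {W : BimodCat k B C} (T : L → Q → N → W)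
    (hT : IsTrilinear T) (l : L) (x : Q) (n : N) : trilinearAux T hT (tmul L Q l x) n = T l x n :=
  LinearMap.congr_fun (BalancedTensor.lift_tmul (R := R) _
      (fun l r x => LinearMap.ext fun n => hT.balanced_left l r x n) l x) n

lemma trilinearAux_zero {Q : BimodCat k R R} {W : BimodCat k B C} (T : L → Q → N → W)
    (hT : IsTrilinear T) (n : N) : trilinearAux T hT 0 n = 0 := by rw [map_zero]; rfl

lemma trilinearAux_add {Q : BimodCat k R R} {W : BimodCat k B C} (T : L → Q → N → W)
    (hT : IsTrilinear T) (z z' : tensor L Q) (n : N) :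
    trilinearAux T hT (z + z') n = trilinearAux T hT z n + trilinearAux T hT z' n := by
  rw [map_add]; rfl

lemma trilinearAux_balanced {Q : BimodCat k R R} {W : BimodCat k B C} (T : L → Q → N → W)
    (hT : IsTrilinear T) (z : tensor L Q) (r : R) (n : N) :
    trilinearAux T hT (op r • z) n = trilinearAux T hT z (r • n) := by
  induction z using tensor_induction with
  | h0 => rw [smul_zero, trilinearAux_zero, trilinearAux_zero]
  | ht l x => rw [right_smul_tmul, trilinearAux_tmul, trilinearAux_tmul, hT.balanced_right]
  | ha z z' h h' => rw [smul_add, trilinearAux_add, trilinearAux_add, h, h']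

lemma trilinearAux_left {Q : BimodCat k R R} {W : BimodCat k B C} (T : L → Q → N → W)
    (hT : IsTrilinear T) (b : B) (z : tensor L Q) (n : N) :
    trilinearAux T hT (b • z) n = b • trilinearAux T hT z n := by
  induction z using tensor_induction with
  | h0 => rw [smul_zero, trilinearAux_zero, smul_zero]
  | ht l x => rw [left_smul_tmul, trilinearAux_tmul, trilinearAux_tmul, hT.left_smul]
  | ha z z' h h' => rw [smul_add, trilinearAux_add, trilinearAux_add, h, h', smul_add]

lemma trilinearAux_right {Q : BimodCat k R R} {W : BimodCat k B C} (T : L → Q → N → W)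
    (hT : IsTrilinear T) (c : Cᵐᵒᵖ) (z : tensor L Q) (n : N) :
    trilinearAux T hT z (c • n) = c • trilinearAux T hT z n := by
  induction z using tensor_induction with
  | h0 => rw [trilinearAux_zero, trilinearAux_zero, smul_zero]
  | ht l x => rw [trilinearAux_tmul, trilinearAux_tmul, hT.right_smul]
  | ha z z' h h' => rw [trilinearAux_add, trilinearAux_add, h, h', smul_add]

/-- The morphism of bimodules `L ⊗ Q ⊗ N ⟶ W` defined by a trilinear map. -/
def sandwichDesc {Q : BimodCat k R R} {W : BimodCat k B C} (T : L → Q → N → W)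
    (hT : IsTrilinear T) : (sandwich L N).obj Q ⟶ W :=
  tensorDesc (L := tensor L Q) (trilinearAux T hT) (trilinearAux_balanced T hT)
    (trilinearAux_left T hT) (trilinearAux_right T hT)

lemma sandwichDesc_stmul {Q : BimodCat k R R} {W : BimodCat k B C} (T : L → Q → N → W)
    (hT : IsTrilinear T) (l : L) (x : Q) (n : N) :
    (sandwichDesc T hT).hom (stmul L N Q l x n) = T l x n :=
  (tensorDesc_tmul (L := tensor L Q) (trilinearAux T hT) (trilinearAux_balanced T hT)
    (trilinearAux_left T hT) (trilinearAux_right T hT) _ _).trans (trilinearAux_tmul T hT l x n)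

lemma isTrilinear_stmul (Q : BimodCat k R R) : IsTrilinear (stmul L N Q) where
  add_left l l' x n := by rw [stmul, add_tmul, add_tmul]; rfl
  add_mid l x x' n := by rw [stmul, tmul_add, add_tmul]; rfl
  add_right l x n n' := tmul_add _ _ _ _ _
  balanced_left l r x n := by rw [stmul, tmul_balanced]; rfl
  balanced_right l x r n := by rw [stmul, ← right_smul_tmul, tmul_balanced]; rfl
  left_smul b l x n := by rw [stmul, ← left_smul_tmul]; exact (left_smul_tmul _ _ _ _ _).symm
  right_smul c l x n := (right_smul_tmul _ _ _ _ _).symm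

end Sandwich

end BimodCat

/-! ### The bimodules `P ⊗ Q ⊗ P^∨` -/

section ModuleSandwich

variable (k A P : Type u) [Field k] [Ring A] [Algebra k A] [AddCommGroup P] [Module k P]
  [Module A P] [IsScalarTower k A P]

/-- The identification of the bimodule `P` with the module `P`. -/
def moduleEquiv : moduleBimod k A P ≃+ P := BimodCat.ofActionsEquiv _ _ _ _

/-- The identification of the bimodule `P^∨` with `Hom_A(P, A)`. -/
def dualEquiv : dualBimod k A P ≃+ (P →ₗ[A] A) := BimodCat.ofActionsEquiv _ _ _ _

lemma moduleEquiv_left (a : A) (p : moduleBimod k A P) :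
    moduleEquiv k A P (a • p) = a • moduleEquiv k A P p :=
  BimodCat.ofActionsEquiv_left _ _ _ _ a p

lemma moduleEquiv_right (x : EndOp A P) (p : moduleBimod k A P) :
    moduleEquiv k A P (op x • p) = unop x (moduleEquiv k A P p) :=
  BimodCat.ofActionsEquiv_right _ _ _ _ (op x) p

lemma dualEquiv_left (x : EndOp A P) (f : dualBimod k A P) :
    dualEquiv k A P (x • f) = dualEquiv k A P f ∘ₗ unop x :=
  BimodCat.ofActionsEquiv_left _ _ _ _ x f

lemma dualEquiv_right (a : Aᵐᵒᵖ) (f : dualBimod k A P) :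
    dualEquiv k A P (a • f) = dualRightAction k A P a (dualEquiv k A P f) :=
  BimodCat.ofActionsEquiv_right _ _ _ _ a f

variable {k A P}

/-- The functor `Q ↦ P ⊗ Q ⊗ P^∨`. -/
abbrev moduleSandwich (k A P : Type u) [Field k] [Ring A] [Algebra k A] [AddCommGroup P]
    [Module k P] [Module A P] [IsScalarTower k A P] :
    BimodCat k (EndOp A P) (EndOp A P) ⥤ BimodCat k A A :=
  BimodCat.sandwich (moduleBimod k A P) (dualBimod k A P)

/-- The element `p ⊗ x ⊗ f` of `P ⊗ Q ⊗ P^∨`. -/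
def ptmul (Q : BimodCat k (EndOp A P) (EndOp A P)) (p : P) (x : Q) (f : P →ₗ[A] A) :
    (moduleSandwich k A P).obj Q :=
  BimodCat.stmul _ _ Q ((moduleEquiv k A P).symm p) x ((dualEquiv k A P).symm f)

/-- The trilinear maps that define morphisms of bimodules `P ⊗ Q ⊗ P^∨ ⟶ W`. -/
structure IsEndTrilinear {Q : BimodCat k (EndOp A P) (EndOp A P)} {W : BimodCat k A A}
    (T : P → Q → (P →ₗ[A] A) → W) : Prop where
  add_left : ∀ l l' x n, T (l + l') x n = T l x n + T l' x n
  add_mid : ∀ l x x' n, T l (x + x') n = T l x n + T l x' n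
  add_right : ∀ l x n n', T l x (n + n') = T l x n + T l x n'
  balanced_left : ∀ l (r : EndOp A P) x n, T (unop r l) x n = T l (r • x) n
  balanced_right : ∀ l x (r : EndOp A P) n, T l (op r • x) n = T l x (n ∘ₗ unop r)
  left_smul : ∀ (b : A) l x n, T (b • l) x n = b • T l x n
  right_smul : ∀ (c : Aᵐᵒᵖ) l x n, T l x (dualRightAction k A P c n) = c • T l x n

lemma IsEndTrilinear.isTrilinear {Q : BimodCat k (EndOp A P) (EndOp A P)} {W : BimodCat k A A}
    {T : P → Q → (P →ₗ[A] A) → W} (hT : IsEndTrilinear T) :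
    BimodCat.IsTrilinear (L := moduleBimod k A P) (N := dualBimod k A P)
      (fun p x f => T (moduleEquiv k A P p) x (dualEquiv k A P f)) where
  add_left l l' x n := by rw [map_add, hT.add_left]
  add_mid l x x' n := hT.add_mid _ _ _ _
  add_right l x n n' := by rw [map_add, hT.add_right]
  balanced_left l r x n := by rw [moduleEquiv_right, hT.balanced_left]
  balanced_right l x r n := by rw [dualEquiv_left, hT.balanced_right]
  left_smul b l x n := by rw [moduleEquiv_left, hT.left_smul]
  right_smul c l x n := by rw [dualEquiv_right, hT.right_smul]

lemma isEndTrilinear_ptmul (Q : BimodCat k (EndOp A P) (EndOp A P)) :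
    IsEndTrilinear (ptmul (k := k) (A := A) (P := P) Q) := by
  have h := BimodCat.isTrilinear_stmul (L := moduleBimod k A P) (N := dualBimod k A P) Q
  refine ⟨fun l l' x n => ?_, fun l x x' n => h.add_mid _ _ _ _, fun l x n n' => ?_,
    fun l r x n => ?_, fun l x r n => ?_, fun b l x n => ?_, fun c l x n => ?_⟩
  · rw [ptmul, map_add, h.add_left]; rfl
  · rw [ptmul, map_add, h.add_right]; rfl
  · rw [ptmul, ptmul, ← h.balanced_left]
    refine congrArg (fun t => BimodCat.stmul _ _ Q t x _) ?_
    apply (moduleEquiv k A P).injective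
    rw [moduleEquiv_right, AddEquiv.apply_symm_apply, AddEquiv.apply_symm_apply]
  · rw [ptmul, ptmul, h.balanced_right]
    refine congrArg (fun t => BimodCat.stmul _ _ Q _ x t) ?_
    apply (dualEquiv k A P).injective
    rw [dualEquiv_left, AddEquiv.apply_symm_apply, AddEquiv.apply_symm_apply]
  · rw [ptmul, ptmul, ← h.left_smul]
    refine congrArg (fun t => BimodCat.stmul _ _ Q t x _) ?_
    apply (moduleEquiv k A P).injective
    rw [moduleEquiv_left, AddEquiv.apply_symm_apply, AddEquiv.apply_symm_apply]
  · rw [ptmul, ptmul, ← h.right_smul]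
    refine congrArg (fun t => BimodCat.stmul _ _ Q _ x t) ?_
    apply (dualEquiv k A P).injective
    rw [dualEquiv_right, AddEquiv.apply_symm_apply, AddEquiv.apply_symm_apply]

/-- The morphism of bimodules `P ⊗ Q ⊗ P^∨ ⟶ W` defined by a trilinear map. -/
def moduleSandwichDesc {Q : BimodCat k (EndOp A P) (EndOp A P)} {W : BimodCat k A A}
    (T : P → Q → (P →ₗ[A] A) → W) (hT : IsEndTrilinear T) : (moduleSandwich k A P).obj Q ⟶ W :=
  BimodCat.sandwichDesc _ hT.isTrilinear

lemma moduleSandwichDesc_ptmul {Q : BimodCat k (EndOp A P) (EndOp A P)} {W : BimodCat k A A}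
    (T : P → Q → (P →ₗ[A] A) → W) (hT : IsEndTrilinear T) (p : P) (x : Q) (f : P →ₗ[A] A) :
    (moduleSandwichDesc T hT).hom (ptmul Q p x f) = T p x f := by
  refine (BimodCat.sandwichDesc_stmul _ hT.isTrilinear _ _ _).trans ?_
  rw [AddEquiv.apply_symm_apply, AddEquiv.apply_symm_apply]

lemma moduleSandwich_hom_ext {Q : BimodCat k (EndOp A P) (EndOp A P)} {W : BimodCat k A A}
    {f g : (moduleSandwich k A P).obj Q ⟶ W}
    (h : ∀ p x φ, f.hom (ptmul Q p x φ) = g.hom (ptmul Q p x φ)) : f = g :=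
  BimodCat.sandwich_hom_ext fun l x n => by
    have := h (moduleEquiv k A P l) x (dualEquiv k A P n)
    rw [ptmul, AddEquiv.symm_apply_apply, AddEquiv.symm_apply_apply] at this
    exact this

lemma moduleSandwich_map_ptmul {Q Q' : BimodCat k (EndOp A P) (EndOp A P)} (f : Q ⟶ Q') (p : P)
    (x : Q) (φ : P →ₗ[A] A) :
    ((moduleSandwich k A P).map f).hom (ptmul Q p x φ) = ptmul Q' p (f.hom x) φ :=
  BimodCat.sandwich_map_stmul _ _ f _ _ _

lemma ptmul_sum_left {ι : Type*} (s : Finset ι) (Q : BimodCat k (EndOp A P) (EndOp A P))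
    (p : ι → P) (x : Q) (f : P →ₗ[A] A) :
    ptmul Q (∑ i ∈ s, p i) x f = ∑ i ∈ s, ptmul Q (p i) x f :=
  map_sum (AddMonoidHom.mk' (fun p => ptmul Q p x f)
    fun p p' => (isEndTrilinear_ptmul Q).add_left p p' x f) _ _

lemma ptmul_sum_mid {ι : Type*} (s : Finset ι) (Q : BimodCat k (EndOp A P) (EndOp A P))
    (p : P) (x : ι → Q) (f : P →ₗ[A] A) :
    ptmul Q p (∑ i ∈ s, x i) f = ∑ i ∈ s, ptmul Q p (x i) f :=
  map_sum (AddMonoidHom.mk' (fun x => ptmul Q p x f)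
    fun x x' => (isEndTrilinear_ptmul Q).add_mid p x x' f) _ _

lemma ptmul_sum_right {ι : Type*} (s : Finset ι) (Q : BimodCat k (EndOp A P) (EndOp A P))
    (p : P) (x : Q) (f : ι → P →ₗ[A] A) :
    ptmul Q p x (∑ i ∈ s, f i) = ∑ i ∈ s, ptmul Q p x (f i) :=
  map_sum (AddMonoidHom.mk' (fun f => ptmul Q p x f)
    fun f f' => (isEndTrilinear_ptmul Q).add_right p x f f') _ _

lemma actionMap_tmul (p : moduleBimod k A P) (x : regularBimod k (EndOp A P)) :
    (actionMap k A P).hom (BimodCat.tmul _ _ p x) = (moduleEquiv k A P).symm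
      (unop (regularEquiv k (EndOp A P) x) (moduleEquiv k A P p)) := by
  rfl

lemma evaluationMap_tmul (p : moduleBimod k A P) (f : dualBimod k A P) :
    regularEquiv k A ((evaluationMap k A P).hom (BimodCat.tmul _ _ p f)) =
      dualEquiv k A P f (moduleEquiv k A P p) := by
  rfl

/-- The map `P ⊗ Q ⊗ P^∨ ⟶ A`, `p ⊗ x ⊗ φ ↦ φ (p (aug x))`, defined by a map `aug : Q ⟶ E`. -/
def sandwichAug {Q : BimodCat k (EndOp A P) (EndOp A P)}
    (aug : Q ⟶ regularBimod k (EndOp A P)) : (moduleSandwich k A P).obj Q ⟶ regularBimod k A :=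
  (moduleSandwich k A P).map aug ≫
      BimodCat.tensorMap (actionMap k A P) (𝟙 _) ≫ evaluationMap k A P

lemma sandwichAug_ptmul {Q : BimodCat k (EndOp A P) (EndOp A P)}
    (aug : Q ⟶ regularBimod k (EndOp A P)) (p : P) (x : Q) (φ : P →ₗ[A] A) :
    regularEquiv k A ((sandwichAug aug).hom (ptmul Q p x φ)) =
      φ (unop (regularEquiv k (EndOp A P) (aug.hom x)) p) := by
  have h1 : (BimodCat.tensorMap (actionMap k A P) (𝟙 _)).hom (((moduleSandwich k A P).map aug).hom
      (ptmul Q p x φ)) = BimodCat.tmul (moduleBimod k A P) (dualBimod k A P)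
        ((moduleEquiv k A P).symm (unop (regularEquiv k (EndOp A P) (aug.hom x)) p))
        ((dualEquiv k A P).symm φ) := by
    rw [moduleSandwich_map_ptmul]
    refine (BimodCat.tensorMap_tmul _ _ _ _).trans ?_
    rw [actionMap_tmul, AddEquiv.apply_symm_apply]
    rfl
  refine (congrArg (fun t => regularEquiv k A ((evaluationMap k A P).hom t)) h1).trans ?_
  rw [evaluationMap_tmul, AddEquiv.apply_symm_apply, AddEquiv.apply_symm_apply]

end ModuleSandwich

/-! ### Periodic twists and corners -/

section CornerTwist

variable {k : Type u} [Field k]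

/-- An identification of the bimodule `Q` over `E` with `e Q' e`, where `Q'` is a bimodule over `E'`
and `E` is identified with `e E' e`. -/
structure CornerMap {E E' : Type u} [Ring E] [Algebra k E] [Ring E'] [Algebra k E']
    (c : CornerHom k E E') (Q : BimodCat k E E) (Q' : BimodCat k E' E') where
  /-- The additive map `Q → Q'`. -/
  toFun : Q →+ Q'
  left : ∀ (x : E) m, toFun (x • m) = c.toFun x • toFun m
  right : ∀ (x : E) m, toFun (op x • m) = op (c.toFun x) • toFun m
  injective : Function.Injective toFun
  surjective : ∀ m : Q', ∃ m₀, toFun m₀ = c.e • op c.e • m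

namespace CornerMap

variable {E E' : Type u} [Ring E] [Algebra k E] [Ring E'] [Algebra k E']
    {c : CornerHom k E E'} {Q : BimodCat k E E} {Q' : BimodCat k E' E'} (φ : CornerMap c Q Q')

lemma e_smul (m : Q) : c.e • φ.toFun m = φ.toFun m := by
  rw [CornerHom.e, ← φ.left, one_smul]

lemma op_e_smul (m : Q) : op c.e • φ.toFun m = φ.toFun m := by
  rw [CornerHom.e, ← φ.right, MulOpposite.op_one, one_smul]

/-- The projection `Q' → e Q' e ≅ Q`. -/
def retr : Q' →+ Q :=
  AddMonoidHom.mk' (fun m => (φ.surjective m).choose) fun m m' => φ.injective (by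
    rw [map_add, (φ.surjective m).choose_spec, (φ.surjective m').choose_spec,
      (φ.surjective (m + m')).choose_spec, smul_add, smul_add])

lemma toFun_retr (m : Q') : φ.toFun (φ.retr m) = c.e • op c.e • m := (φ.surjective m).choose_spec

lemma retr_toFun (m : Q) : φ.retr (φ.toFun m) = m :=
  φ.injective (by rw [toFun_retr, op_e_smul, e_smul])

lemma retr_left (x : E) (m : Q') : φ.retr (c.toFun x • m) = x • φ.retr m :=
  φ.injective (by
    rw [φ.left, toFun_retr, toFun_retr, ← smul_comm (c.toFun x) (op c.e), smul_smul, smul_smul,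
      c.e_mul, c.mul_e])

lemma retr_right (x : E) (m : Q') : φ.retr (op (c.toFun x) • m) = op x • φ.retr m :=
  φ.injective (by
    rw [φ.right, toFun_retr, toFun_retr, ← smul_comm c.e (op (c.toFun x)), smul_smul (op _) (op _),
      smul_smul (op _) (op _), ← op_mul, ← op_mul, c.e_mul, c.mul_e])

end CornerMap

variable {A P P' : Type u} [Ring A] [Algebra k A]
  [AddCommGroup P] [Module k P] [Module A P] [IsScalarTower k A P]
  [AddCommGroup P'] [Module k P'] [Module A P'] [IsScalarTower k A P']
  {T : Type} [Fintype T] {j : P →ₗ[A] P'} {q : P' →ₗ[A] P} {hqj : ∀ p, q (j p) = p}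
  {Q : BimodCat k (EndOp A P) (EndOp A P)} {Q' : BimodCat k (EndOp A P') (EndOp A P')}

lemma isEndTrilinear_toCorner (φ : CornerMap (summandCorner k j q hqj) Q Q') :
    IsEndTrilinear (fun p m f => ptmul Q' (j p) (φ.toFun m) (f ∘ₗ q)) := by
    have h := isEndTrilinear_ptmul Q'
    refine ⟨fun l l' x n => ?_, fun l x x' n => ?_, fun l x n n' => ?_,
      fun l r x n => ?_, fun l x r n => ?_, fun b l x n => ?_, fun c l x n => ?_⟩
    · rw [map_add, h.add_left]
    · rw [map_add, h.add_mid]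
    · rw [LinearMap.add_comp, h.add_right]
    · rw [φ.left, ← h.balanced_left]
      congr 1
      exact congrArg (fun t => j (unop r t)) (hqj l).symm
    · rw [φ.right, h.balanced_right]
      congr 1
      exact LinearMap.ext fun p => congrArg n (hqj (unop r (q p)))
    · rw [map_smul, h.left_smul]
    · rw [← h.right_smul]; rfl

/-- The map `P ⊗ Q ⊗ P^∨ → P' ⊗ Q' ⊗ P'^∨`, `p ⊗ m ⊗ f ↦ j(p) ⊗ m ⊗ f ∘ q`. -/
def sandwichToCorner (φ : CornerMap (summandCorner k j q hqj) Q Q') :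
    (moduleSandwich k A P).obj Q ⟶ (moduleSandwich k A P').obj Q' :=
  moduleSandwichDesc _ (isEndTrilinear_toCorner φ)

lemma sandwichToCorner_ptmul (φ : CornerMap (summandCorner k j q hqj) Q Q') (p : P) (m : Q)
    (f : P →ₗ[A] A) :
    (sandwichToCorner φ).hom (ptmul Q p m f) = ptmul Q' (j p) (φ.toFun m) (f ∘ₗ q) :=
  moduleSandwichDesc_ptmul _ (isEndTrilinear_toCorner φ) p m f

lemma isEndTrilinear_ofCorner (φ : CornerMap (summandCorner k j q hqj) Q Q')
    (α : T → P' →ₗ[A] P) (β : T → P →ₗ[A] P') (hαβ : ∀ p, ∑ a, β a (α a p) = p) :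
    IsEndTrilinear (fun p m f => ∑ s, ∑ t, ptmul Q (α s p) (φ.retr
      ((op (β s ∘ₗ q) : EndOp A P') • op (op (j ∘ₗ α t) : EndOp A P') • m)) (f ∘ₗ β t)) := by
    have h := isEndTrilinear_ptmul Q
    refine ⟨fun l l' x n => ?_, fun l x x' n => ?_, fun l x n n' => ?_,
      fun l r x n => ?_, fun l x r n => ?_, fun b l x n => ?_, fun c l x n => ?_⟩
    · simp only [map_add, h.add_left, Finset.sum_add_distrib]
    · simp only [smul_add, map_add, h.add_mid, Finset.sum_add_distrib]
    · simp only [LinearMap.add_comp, h.add_right, Finset.sum_add_distrib]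
    · have key : ∀ s, (op (β s ∘ₗ q) : EndOp A P') * r = ∑ v,
          (summandCorner k j q hqj).toFun (op (α v ∘ₗ unop r ∘ₗ β s)) * op (β v ∘ₗ q) := by
        intro s
        apply unop_injective
        rw [Finset.unop_sum]
        refine LinearMap.ext fun p => ?_
        rw [LinearMap.sum_apply]
        refine (hαβ (unop r (β s (q p)))).symm.trans (Finset.sum_congr rfl fun v _ => ?_)
        exact congrArg (β v) (hqj _).symm
      have key2 : ∀ s t, φ.retr ((op (β s ∘ₗ q) : EndOp A P') • op (op (j ∘ₗ α t) : EndOp A P') •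
          r • x) = ∑ v, (op (α v ∘ₗ unop r ∘ₗ β s) : EndOp A P) •
            φ.retr ((op (β v ∘ₗ q) : EndOp A P') • op (op (j ∘ₗ α t) : EndOp A P') • x) := by
        intro s t
        rw [← smul_comm r, smul_smul, key, Finset.sum_smul, map_sum]
        refine Finset.sum_congr rfl fun v _ => ?_
        rw [mul_smul, φ.retr_left]
      simp only [key2, ptmul_sum_mid, ← h.balanced_left]
      rw [Finset.sum_comm (γ := T)]
      conv_rhs => rw [Finset.sum_comm]
      refine Finset.sum_congr rfl fun t _ => ?_
      rw [Finset.sum_comm]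
      refine Finset.sum_congr rfl fun v _ => ?_
      rw [← ptmul_sum_left]
      congr 1
      change _ = ∑ s, α v (unop r (β s (α s l)))
      rw [← map_sum, ← map_sum, hαβ]
    · have key : ∀ t, r * (op (j ∘ₗ α t) : EndOp A P') = ∑ v,
          op (j ∘ₗ α v) * (summandCorner k j q hqj).toFun (op (α t ∘ₗ unop r ∘ₗ β v)) := by
        intro t
        apply unop_injective
        rw [Finset.unop_sum]
        refine LinearMap.ext fun p => ?_
        rw [LinearMap.sum_apply]
        change j (α t (unop r p)) = ∑ v, j (α t (unop r (β v (q (j (α v p))))))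
        simp only [hqj, ← map_sum, hαβ]
      have key2 : ∀ s t, φ.retr ((op (β s ∘ₗ q) : EndOp A P') • op (op (j ∘ₗ α t) : EndOp A P') •
          op r • x) = ∑ v, op (op (α t ∘ₗ unop r ∘ₗ β v) : EndOp A P) •
            φ.retr ((op (β s ∘ₗ q) : EndOp A P') • op (op (j ∘ₗ α v) : EndOp A P') • x) := by
        intro s t
        rw [smul_smul (op _), ← op_mul, key, Finset.op_sum, Finset.sum_smul, Finset.smul_sum,
          map_sum]
        refine Finset.sum_congr rfl fun v _ => ?_
        rw [op_mul, mul_smul, smul_comm, φ.retr_right]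
      simp only [key2, ptmul_sum_mid, h.balanced_right]
      refine Finset.sum_congr rfl fun s _ => ?_
      rw [Finset.sum_comm]
      refine Finset.sum_congr rfl fun v _ => ?_
      rw [← ptmul_sum_right]
      congr 1
      refine LinearMap.ext fun p => ?_
      rw [LinearMap.sum_apply]
      change ∑ t, n (β t (α t (unop r (β v p)))) = n (unop r (β v p))
      rw [← map_sum, hαβ]
    · simp only [map_smul, h.left_smul, Finset.smul_sum]
    · simp only [Finset.smul_sum, ← h.right_smul]; rfl

/-- The map `P' ⊗ Q' ⊗ P'^∨ → P ⊗ Q ⊗ P^∨` inverse to `sandwichToCorner`. It is obtained by writing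
`p' = ∑ β_s(α_s(p'))` and `f' = ∑ f' ∘ β_t ∘ α_t`. -/
def sandwichOfCorner (φ : CornerMap (summandCorner k j q hqj) Q Q') (α : T → P' →ₗ[A] P)
    (β : T → P →ₗ[A] P') (hαβ : ∀ p, ∑ a, β a (α a p) = p) :
    (moduleSandwich k A P').obj Q' ⟶ (moduleSandwich k A P).obj Q :=
  moduleSandwichDesc _ (isEndTrilinear_ofCorner φ α β hαβ)

lemma sandwichOfCorner_ptmul (φ : CornerMap (summandCorner k j q hqj) Q Q') (α : T → P' →ₗ[A] P)
    (β : T → P →ₗ[A] P') (hαβ : ∀ p, ∑ a, β a (α a p) = p) (p : P') (m : Q') (f : P' →ₗ[A] A) :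
    (sandwichOfCorner φ α β hαβ).hom (ptmul Q' p m f) = ∑ s, ∑ t, ptmul Q (α s p) (φ.retr
      ((op (β s ∘ₗ q) : EndOp A P') • op (op (j ∘ₗ α t) : EndOp A P') • m)) (f ∘ₗ β t) :=
  moduleSandwichDesc_ptmul _ (isEndTrilinear_ofCorner φ α β hαβ) p m f

/-- If the summand `P` of `P'` generates `P'`, and `Q` is identified with `e Q' e`, then
`P ⊗ Q ⊗ P^∨ ≅ P' ⊗ Q' ⊗ P'^∨`. -/
def sandwichCornerIso (φ : CornerMap (summandCorner k j q hqj) Q Q') (α : T → P' →ₗ[A] P)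
    (β : T → P →ₗ[A] P') (hαβ : ∀ p, ∑ a, β a (α a p) = p) :
    (moduleSandwich k A P).obj Q ≅ (moduleSandwich k A P').obj Q' where
  hom := sandwichToCorner φ
  inv := sandwichOfCorner φ α β hαβ
  hom_inv_id := moduleSandwich_hom_ext fun p m f => by
    have h := isEndTrilinear_ptmul Q
    refine (congrArg (sandwichOfCorner φ α β hαβ).hom
      (sandwichToCorner_ptmul φ p m f)).trans ?_
    rw [sandwichOfCorner_ptmul]
    have key : ∀ s t, φ.retr ((op (β s ∘ₗ q) : EndOp A P') • op (op (j ∘ₗ α t) : EndOp A P') •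
        φ.toFun m) = (op (q ∘ₗ β s) : EndOp A P) • op (op (α t ∘ₗ j) : EndOp A P) • m := by
      intro s t
      have h1 : (op (β s ∘ₗ q) : EndOp A P') * (summandCorner k j q hqj).e =
          (summandCorner k j q hqj).toFun (op (q ∘ₗ β s)) := endOp_ext fun _ => rfl
      have h2 : (summandCorner k j q hqj).e * (op (j ∘ₗ α t) : EndOp A P') =
          (summandCorner k j q hqj).toFun (op (α t ∘ₗ j)) := endOp_ext fun _ => rfl
      rw [← φ.e_smul, ← smul_comm (_ : EndOp A P') (op _), smul_smul, h1, φ.retr_left, ← φ.op_e_smul, smul_smul,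
        ← op_mul, h2, φ.retr_right, φ.retr_toFun]
    simp only [key, ← h.balanced_left, h.balanced_right]
    rw [Finset.sum_congr rfl fun s _ => (ptmul_sum_right _ Q _ m _).symm, ← ptmul_sum_left]
    change _ = ptmul Q p m f
    congr 1
    · change ∑ s, q (β s (α s (j p))) = p
      rw [← map_sum, hαβ, hqj]
    · refine LinearMap.ext fun p => ?_
      rw [LinearMap.sum_apply]
      change ∑ t, f (q (β t (α t (j p)))) = f p
      rw [← map_sum, ← map_sum, hαβ, hqj]
  inv_hom_id := moduleSandwich_hom_ext fun p m f => by
    have h := isEndTrilinear_ptmul Q'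
    refine (congrArg (sandwichToCorner φ).hom
      (sandwichOfCorner_ptmul φ α β hαβ p m f)).trans ?_
    rw [map_sum]
    simp only [map_sum]
    have key : ∀ s t, (sandwichToCorner φ).hom (ptmul Q (α s p)
        (φ.retr ((op (β s ∘ₗ q) : EndOp A P') • op (op (j ∘ₗ α t) : EndOp A P') • m))
          (f ∘ₗ β t)) = ptmul Q' (β s (α s p)) m (f ∘ₗ β t ∘ₗ α t) := by
      intro s t
      rw [sandwichToCorner_ptmul]
      have h1 : (summandCorner k j q hqj).e * (op (β s ∘ₗ q) : EndOp A P') = op (β s ∘ₗ q) :=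
        endOp_ext fun p => congrArg (β s) (hqj (q p))
      have h2 : (op (j ∘ₗ α t) : EndOp A P') * (summandCorner k j q hqj).e = op (j ∘ₗ α t) :=
        endOp_ext fun p => congrArg j (hqj _)
      rw [φ.toFun_retr, ← smul_comm (op (β s ∘ₗ q) : EndOp A P') (op (summandCorner k j q hqj).e),
        smul_smul _ (op (β s ∘ₗ q) : EndOp A P'), h1, smul_smul (op _) (op _), ← op_mul, h2, ← h.balanced_left, h.balanced_right]
      congr 1
      · exact congrArg (β s) (hqj _)
      · exact LinearMap.ext fun p => congrArg (fun t' => f (β t t')) (hqj _)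
    simp only [key]
    rw [Finset.sum_congr rfl fun s _ => (ptmul_sum_right _ Q' _ m _).symm, ← ptmul_sum_left, hαβ]
    change _ = ptmul Q' p m f
    congr 1
    refine LinearMap.ext fun p => ?_
    rw [LinearMap.sum_apply]
    change ∑ t, f (β t (α t p)) = f p
    rw [← map_sum, hαβ]

variable [Module.Finite k A] [Module.Finite A P] [Module.Projective A P] [Module.Finite A P']
  [Module.Projective A P']

/-- If `P` is a direct summand of `P'` which generates `P'`, then truncated resolutions `Y` of
`EndOp A P = e (EndOp A P') e` and `Y'` of `EndOp A P'` such that `Y = e Y' e` define isomorphic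
periodic twists. -/
lemma periodicTwist_iso_of_cornerMap {n : ℕ} (Y : TruncatedResolution k (EndOp A P) n)
    (Y' : TruncatedResolution k (EndOp A P') n)
    (φ : ∀ i, CornerMap (summandCorner k j q hqj) (Y.Y.X i) (Y'.Y.X i))
    (hd : ∀ i i' x, (φ i').toFun ((Y.Y.d i i').hom x) = (Y'.Y.d i i').hom ((φ i).toFun x))
    (haug : ∀ x, regularEquiv k _ (Y'.aug.hom ((φ 0).toFun x)) =
      (summandCorner k j q hqj).toFun (regularEquiv k _ (Y.aug.hom x)))
    (α : T → P' →ₗ[A] P) (β : T → P →ₗ[A] P') (hαβ : ∀ p, ∑ a, β a (α a p) = p) :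
    Nonempty (periodicTwist A Y ≅ periodicTwist A Y') := by
  let f : sandwichComplex A Y ≅ sandwichComplex A Y' :=
    HomologicalComplex.Hom.isoOfComponents (fun i => sandwichCornerIso (φ i) α β hαβ)
      fun i i' _ => moduleSandwich_hom_ext fun p m g => by
        refine (congrArg ((moduleSandwich k A P').map (Y'.Y.d i i')).hom
          (sandwichToCorner_ptmul (φ i) p m g)).trans ?_
        refine (moduleSandwich_map_ptmul _ _ _ _).trans ?_
        rw [← hd]
        refine (sandwichToCorner_ptmul (φ i') _ _ _).symm.trans ?_
        exact congrArg (sandwichToCorner (φ i')).hom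
          (moduleSandwich_map_ptmul (Y.Y.d i i') p m g).symm
  refine periodicTwist_iso_of_isIso Y Y' f.hom ?_ inferInstance
  apply HomologicalComplex.to_single_hom_ext
  have h1 : (sandwichCornerIso (φ 0) α β hαβ).hom ≫ sandwichAug Y'.aug = sandwichAug Y.aug := by
    refine moduleSandwich_hom_ext fun p m g => (regularEquiv k A).injective ?_
    refine (congrArg (fun t => regularEquiv k A ((sandwichAug Y'.aug).hom t))
      (sandwichToCorner_ptmul (φ 0) p m g)).trans ?_
    rw [sandwichAug_ptmul, sandwichAug_ptmul, haug]
    change g (q (j (unop (regularEquiv k _ (Y.aug.hom m)) (q (j p))))) = _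
    rw [hqj, hqj]
  rw [HomologicalComplex.comp_f, twistMap, twistMap, HomologicalComplex.mkHomToSingle_f,
    HomologicalComplex.mkHomToSingle_f]
  exact (Category.assoc _ _ _).symm.trans (congrArg (fun t => t ≫ _) h1)

end CornerTwist

/-! ### Equivalence of idempotents -/

section Idempotents

/-- The idempotents `e` and `f` of a ring `R` are equivalent if there are `x ∈ e R f` and
`y ∈ f R e` with `x y = e` and `y x = f`. -/
def IdemEquiv {R : Type*} [Ring R] (e f : R) : Prop :=
  ∃ x y, e * x = x ∧ x * f = x ∧ f * y = y ∧ y * e = y ∧ x * y = e ∧ y * x = f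

variable {R S : Type*} [Ring R] [Ring S]

lemma IdemEquiv.refl {e : R} (he : e * e = e) : IdemEquiv e e := ⟨e, e, he, he, he, he, he, he⟩

lemma IdemEquiv.symm {e f : R} (h : IdemEquiv e f) : IdemEquiv f e := by
  obtain ⟨x, y, h1, h2, h3, h4, h5, h6⟩ := h
  exact ⟨y, x, h3, h4, h1, h2, h6, h5⟩

lemma IdemEquiv.trans {e f g : R} (h : IdemEquiv e f) (h' : IdemEquiv f g) : IdemEquiv e g := by
  obtain ⟨x, y, h1, h2, h3, h4, h5, h6⟩ := h
  obtain ⟨x', y', h1', h2', h3', h4', h5', h6'⟩ := h'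
  refine ⟨x * x', y' * y, ?_, ?_, ?_, ?_, ?_, ?_⟩
  · rw [← mul_assoc, h1]
  · rw [mul_assoc, h2']
  · rw [← mul_assoc, h3']
  · rw [mul_assoc, h4]
  · rw [mul_assoc, ← mul_assoc x', h5', h3, h5]
  · rw [mul_assoc, ← mul_assoc y, h6, h1', h6']

lemma IdemEquiv.map {F : Type*} [FunLike F R S] [NonUnitalRingHomClass F R S] (σ : F) {e f : R}
    (h : IdemEquiv e f) : IdemEquiv (σ e) (σ f) := by
  obtain ⟨x, y, h1, h2, h3, h4, h5, h6⟩ := h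
  refine ⟨σ x, σ y, ?_, ?_, ?_, ?_, ?_, ?_⟩ <;> rw [← map_mul] <;> congr 1

lemma IdemEquiv.sum {ι : Type*} [Fintype ι] {e f : ι → R} (h : ∀ i, IdemEquiv (e i) (f i))
    (he : ∀ i j, i ≠ j → e i * e j = 0) (hf : ∀ i j, i ≠ j → f i * f j = 0) :
    IdemEquiv (∑ i, e i) (∑ i, f i) := by
  choose x y h1 h2 h3 h4 h5 h6 using h
  have key : ∀ a b : ι → R, (∀ i j, i ≠ j → a i * b j = 0) →
      (∑ i, a i) * ∑ i, b i = ∑ i, a i * b i := by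
    intro a b hab
    rw [Finset.sum_mul_sum]
    refine Finset.sum_congr rfl fun i _ => Finset.sum_eq_single i (fun j _ hj => hab i j hj.symm) ?_
    exact fun h => absurd (Finset.mem_univ _) h
  refine ⟨∑ i, x i, ∑ i, y i, ?_, ?_, ?_, ?_, ?_, ?_⟩
  · rw [key _ _ fun i j hij => by rw [← h1 j, ← mul_assoc, he i j hij, zero_mul]]
    simp only [h1]
  · rw [key _ _ fun i j hij => by rw [← h2 i, mul_assoc, hf i j hij, mul_zero]]
    simp only [h2]
  · rw [key _ _ fun i j hij => by rw [← h3 j, ← mul_assoc, hf i j hij, zero_mul]]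
    simp only [h3]
  · rw [key _ _ fun i j hij => by rw [← h4 i, mul_assoc, he i j hij, mul_zero]]
    simp only [h4]
  · rw [key _ _ fun i j hij => by
      rw [← h2 i, ← h3 j, mul_assoc, ← mul_assoc (f i), hf i j hij, zero_mul, mul_zero]]
    simp only [h5]
  · rw [key _ _ fun i j hij => by
      rw [← h4 i, ← h1 j, mul_assoc, ← mul_assoc (e i), he i j hij, zero_mul, mul_zero]]
    simp only [h6]

/-- An idempotent `f ≠ 0` is local if for each `x ∈ f R f`, one of `x` and `f - x` has a right
inverse in `f R f`. -/
structure IsLocalIdempotent (f : R) : Prop where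
  ne_zero : f ≠ 0
  idem : f * f = f
  isLocal : ∀ x, f * x = x → x * f = x → (∃ y, x * y = f) ∨ ∃ y, (f - x) * y = f

lemma IsLocalIdempotent.map {f : R} (h : IsLocalIdempotent f) (σ : R ≃+* S) :
    IsLocalIdempotent (σ f) where
  ne_zero := by simpa using h.ne_zero
  idem := by rw [← map_mul, h.idem]
  isLocal x hx hx' := by
    obtain ⟨x, rfl⟩ := σ.surjective x
    rw [← map_mul] at hx hx'
    rcases h.isLocal x (σ.injective hx) (σ.injective hx') with ⟨y, hy⟩ | ⟨y, hy⟩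
    · exact Or.inl ⟨σ y, by rw [← map_mul, hy]⟩
    · exact Or.inr ⟨σ y, by rw [← map_sub, ← map_mul, hy]⟩

lemma IsLocalIdempotent.eq_zero_or_eq {f t : R} (h : IsLocalIdempotent f) (ht : t * t = t)
    (h1 : f * t = t) (h2 : t * f = t) : t = 0 ∨ t = f := by
  rcases h.isLocal t h1 h2 with ⟨y, hy⟩ | ⟨y, hy⟩
  · right
    rw [← h2, ← hy, ← mul_assoc, ht]
  · left
    rw [← h2, ← hy, ← mul_assoc, mul_sub, h2, ht, sub_self, zero_mul]

/-- A form of the Krull–Schmidt theorem: a local idempotent is equivalent to one of the summands of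
any decomposition of `1` into local idempotents. -/
lemma IsLocalIdempotent.exists_idemEquiv {ι : Type*} [Fintype ι] {f : R}
    (hf : IsLocalIdempotent f) {ε : ι → R} (hε : ∀ i, IsLocalIdempotent (ε i))
    (hsum : ∑ i, ε i = 1) : ∃ i, IdemEquiv f (ε i) := by
  classical
  -- As `f = ∑ f ε i f` and `f` is local, one of the summands is right invertible in the corner of `f`.
  have key : ∀ s : Finset ι, ∀ w, (∑ i ∈ s, f * ε i * f) * w = f → ∃ i y, f * ε i * f * y = f := by
    intro s
    induction s using Finset.induction_on with
    | empty =>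
      intro w hw
      rw [Finset.sum_empty, zero_mul] at hw
      exact absurd hw.symm hf.ne_zero
    | insert i s hi ih =>
      intro w hw
      rw [Finset.sum_insert hi, add_mul] at hw
      rcases hf.isLocal (f * ε i * f * w * f) (by simp only [← mul_assoc, hf.idem])
        (by rw [mul_assoc, hf.idem]) with ⟨y, hy⟩ | ⟨y, hy⟩
      · exact ⟨i, w * f * y, by simpa only [← mul_assoc] using hy⟩
      · refine ih (w * f * y) (Eq.trans ?_ hy)
        rw [← mul_assoc, ← mul_assoc]
        congr 1
        rw [eq_sub_iff_add_eq, ← add_mul, add_comm, hw, hf.idem]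
  obtain ⟨i, y, hy⟩ := key Finset.univ f (by
    rw [← Finset.sum_mul, ← Finset.mul_sum, hsum, mul_one, hf.idem, hf.idem])
  have hXY : f * ε i * (ε i * f * y * f) = f := by
    rw [← mul_assoc, ← mul_assoc, ← mul_assoc, mul_assoc f, (hε i).idem, hy, hf.idem]
  have hX : f * (f * ε i) = f * ε i := by rw [← mul_assoc, hf.idem]
  -- The idempotent `t` of the corner of the local idempotent `ε i` is equivalent to `f ≠ 0`.
  have ht := (hε i).eq_zero_or_eq (t := ε i * f * y * f * (f * ε i))
    (by
      rw [mul_assoc, ← mul_assoc (f * ε i), hXY, hX])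
    (by simp only [← mul_assoc, (hε i).idem]) (by rw [mul_assoc, mul_assoc f, (hε i).idem])
  refine ⟨i, f * ε i, ε i * f * y * f, hX, by rw [mul_assoc, (hε i).idem],
    by simp only [← mul_assoc, (hε i).idem], by rw [mul_assoc, hf.idem], hXY, ?_⟩
  refine ht.resolve_left fun h0 => hf.ne_zero ?_
  rw [← hf.idem, ← hXY]
  rw [mul_assoc, ← mul_assoc (ε i * f * y * f), h0, zero_mul, mul_zero]

end Idempotents

section LocalEnd

variable {A M P : Type*} [Ring A] [AddCommGroup M] [Module A M] [AddCommGroup P] [Module A P]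

/-- Fitting's lemma. -/
lemma IsIndecomposableModule.isUnit_or_isNilpotent {M : Type u} {A : Type u} [Ring A]
    [AddCommGroup M] [Module A M] [IsNoetherian A M] [IsArtinian A M]
    (h : IsIndecomposableModule A M) (u : Module.End A M) : IsUnit u ∨ IsNilpotent u := by
  obtain ⟨n, hn⟩ := (LinearMap.eventually_isCompl_ker_pow_range_pow u).exists_forall_of_atTop
  have h1 := hn (n + 1) (Nat.le_succ n)
  rcases h.2 _ _ h1 with h2 | h2
  · left
    have h3 : Function.Injective (u ^ (n + 1)) := LinearMap.ker_eq_bot.1 h2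
    have h4 : Function.Injective u := by
      rw [pow_succ] at h3
      exact Function.Injective.of_comp (f := (u ^ n : Module.End A M)) h3
    exact (Module.End.isUnit_iff u).2 (IsArtinian.bijective_of_injective_endomorphism u h4)
  · right
    exact ⟨n + 1, LinearMap.range_eq_bot.1 h2⟩

/-- The projection of a module to an indecomposable direct summand of finite length is a local
idempotent of the endomorphism ring. -/
lemma IsIndecomposableModule.isLocalIdempotent {A M P : Type u} [Ring A] [AddCommGroup M]
    [Module A M] [AddCommGroup P] [Module A P] [IsNoetherian A M] [IsArtinian A M]
    (h : IsIndecomposableModule A M) (i : M →ₗ[A] P) (p : P →ₗ[A] M) (hpi : ∀ m, p (i m) = m) :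
    IsLocalIdempotent (op (i ∘ₗ p) : EndOp A P) where
  ne_zero := by
    intro h0
    obtain ⟨m, hm⟩ := @exists_ne M h.1 0
    apply hm
    have := congrArg (fun t : EndOp A P => p (unop t (i m))) h0
    simpa [hpi] using this
  idem := endOp_ext fun m => congrArg i (hpi _)
  isLocal := by
    have key : ∀ x : EndOp A P, (op (i ∘ₗ p) : EndOp A P) * x = x →
        x * (op (i ∘ₗ p) : EndOp A P) = x → IsUnit (p ∘ₗ unop x ∘ₗ i : Module.End A M) →
        ∃ y, x * y = (op (i ∘ₗ p) : EndOp A P) := by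
      intro x h1 h2 hu
      obtain ⟨v, hv⟩ := hu
      refine ⟨op (i ∘ₗ (↑v⁻¹ : Module.End A M) ∘ₗ p), endOp_ext fun m => ?_⟩
      have e1 : ∀ m, unop x (i (p m)) = unop x m := fun m =>
        congrArg (fun t : EndOp A P => unop t m) h1
      have e3 : ∀ m, (↑v⁻¹ : Module.End A M) (p (unop x (i m))) = m := fun m => by
        have := v.inv_mul
        rw [hv] at this
        exact LinearMap.congr_fun this m
      change i ((↑v⁻¹ : Module.End A M) (p (unop x m))) = i (p m)
      rw [← e1, e3]
    intro x h1 h2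
    rcases h.isUnit_or_isNilpotent (p ∘ₗ unop x ∘ₗ i) with hu | hu
    · exact Or.inl (key x h1 h2 hu)
    · right
      have hi : (op (i ∘ₗ p) : EndOp A P) * op (i ∘ₗ p) = op (i ∘ₗ p) :=
        endOp_ext fun m => congrArg i (hpi _)
      refine key _ (by rw [mul_sub, hi, h1]) (by rw [sub_mul, hi, h2]) ?_
      have : (p ∘ₗ unop ((op (i ∘ₗ p) : EndOp A P) - x) ∘ₗ i : Module.End A M) =
          1 - p ∘ₗ unop x ∘ₗ i := by
        refine LinearMap.ext fun m => ?_
        change p (i (p (i m)) - unop x (i m)) = m - p (unop x (i m))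
        rw [map_sub, hpi, hpi]
      rw [this]
      exact hu.isUnit_one_sub

/-- Equivalent idempotents of an endomorphism ring are projections to isomorphic summands. -/
lemma nonempty_linearEquiv_of_idemEquiv {A M N P : Type u} [Ring A] [AddCommGroup M]
    [Module A M] [AddCommGroup N] [Module A N] [AddCommGroup P] [Module A P]
    (i : M →ₗ[A] P) (p : P →ₗ[A] M) (hpi : ∀ m, p (i m) = m)
    (i' : N →ₗ[A] P) (p' : P →ₗ[A] N) (hpi' : ∀ m, p' (i' m) = m)
    (h : IdemEquiv (op (i ∘ₗ p) : EndOp A P) (op (i' ∘ₗ p'))) : Nonempty (M ≃ₗ[A] N) := by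
  obtain ⟨x, y, h1, h2, h3, h4, h5, h6⟩ := h
  have e5 : ∀ m, unop y (unop x m) = i (p m) := fun m =>
    congrArg (fun t : EndOp A P => unop t m) h5
  have e6 : ∀ m, unop x (unop y m) = i' (p' m) := fun m =>
    congrArg (fun t : EndOp A P => unop t m) h6
  have e2 : ∀ m, i' (p' (unop x m)) = unop x m := fun m =>
    congrArg (fun t : EndOp A P => unop t m) h2
  have e4 : ∀ m, i (p (unop y m)) = unop y m := fun m =>
    congrArg (fun t : EndOp A P => unop t m) h4
  exact ⟨LinearEquiv.ofLinearMap (p' ∘ₗ unop x ∘ₗ i) (p ∘ₗ unop y ∘ₗ i')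
    (LinearMap.ext fun m => by
      change p' (unop x (i (p (unop y (i' m))))) = m
      rw [e4, e6, hpi', hpi'])
    (LinearMap.ext fun m => by
      change p (unop y (i' (p' (unop x (i m))))) = m
      rw [e2, e5, hpi, hpi])⟩

end LocalEnd

/-! ### Corners of truncated resolutions -/

section CornerResolution

variable {k E E' : Type u} [Field k] [Ring E] [Algebra k E] [Ring E'] [Algebra k E']
  (c : CornerHom k E E')

namespace CornerHom

/-- The inclusion of `e M e` in the bimodule `M`. -/
def val (M : BimodCat k E' E') : c.enveloping.functor.obj M →+ M :=
  (c.enveloping.cornerSubgroup M).subtype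

lemma val_injective (M : BimodCat k E' E') : Function.Injective (c.val M) :=
  Subtype.val_injective

lemma enveloping_e_smul (M : BimodCat k E' E') (m : M) :
    c.enveloping.e • m = c.e • op c.e • m := by
  rw [BimodCat.left_smul_def, BimodCat.right_smul_def, smul_smul, enveloping_e]
  simp

lemma exists_val (M : BimodCat k E' E') (m : M) : ∃ m₀, c.val M m₀ = c.e • op c.e • m :=
  ⟨⟨c.enveloping.e • m, c.enveloping.e_smul_mem m⟩, c.enveloping_e_smul M m⟩

lemma e_smul_val (M : BimodCat k E' E') (m : c.enveloping.functor.obj M) :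
    c.e • op c.e • c.val M m = c.val M m :=
  (c.enveloping_e_smul M _).symm.trans (c.enveloping.mem_corner.1 m.2)

lemma e_smul_val' (M : BimodCat k E' E') (m : c.enveloping.functor.obj M) :
    c.e • c.val M m = c.val M m := by
  rw [← e_smul_val, smul_smul, c.e_mul_e]

lemma op_e_smul_val (M : BimodCat k E' E') (m : c.enveloping.functor.obj M) :
    op c.e • c.val M m = c.val M m := by
  rw [← e_smul_val, ← smul_comm c.e (op c.e), smul_smul (op _) (op _), ← op_mul, c.e_mul_e]

lemma val_left (M : BimodCat k E' E') (x : E) (m : c.enveloping.functor.obj M) :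
    c.val M (x • m) = c.toFun x • c.val M m := by
  conv_rhs => rw [← c.op_e_smul_val]
  rw [BimodCat.left_smul_def, BimodCat.left_smul_def, BimodCat.right_smul_def, smul_smul,
    Algebra.TensorProduct.tmul_mul_tmul, mul_one, one_mul]
  rfl

lemma val_right (M : BimodCat k E' E') (x : E) (m : c.enveloping.functor.obj M) :
    c.val M (op x • m) = op (c.toFun x) • c.val M m := by
  conv_rhs => rw [← c.e_smul_val']
  rw [BimodCat.right_smul_def, BimodCat.left_smul_def, BimodCat.right_smul_def, smul_smul,
    Algebra.TensorProduct.tmul_mul_tmul, mul_one, one_mul]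
  rfl

/-- The bimodule `M` over `E'` has the corner `e M e`. -/
def cornerMap (M : BimodCat k E' E') : CornerMap c (c.enveloping.functor.obj M) M where
  toFun := c.val M
  left := c.val_left M
  right := c.val_right M
  injective := c.val_injective M
  surjective := c.exists_val M

/-- The isomorphism `e E' e ≅ E`. -/
def regularIso : c.enveloping.functor.obj (regularBimod k E') ≅ regularBimod k E :=
  isoOfBijective (BimodCat.homMk
    { toFun := fun m => (regularEquiv k E).symm (c.retr (regularEquiv k E' (c.val _ m)))
      map_zero' := by simp only [map_zero]
      map_add' := fun m m' => by simp only [map_add] }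
    (fun b m => (regularEquiv k E).injective (by
      change regularEquiv k E ((regularEquiv k E).symm (c.retr (regularEquiv k E' (c.val _ _)))) =
        regularEquiv k E (b • (regularEquiv k E).symm (c.retr (regularEquiv k E' (c.val _ m))))
      rw [AddEquiv.apply_symm_apply, regularEquiv_left, AddEquiv.apply_symm_apply, val_left,
        regularEquiv_left, retr_mul]))
    (fun b m => (regularEquiv k E).injective (by
      change regularEquiv k E ((regularEquiv k E).symm (c.retr (regularEquiv k E' (c.val _ _)))) =
        regularEquiv k E (b • (regularEquiv k E).symm (c.retr (regularEquiv k E' (c.val _ m))))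
      rw [← op_unop b, AddEquiv.apply_symm_apply, regularEquiv_right, AddEquiv.apply_symm_apply,
        val_right, regularEquiv_right, retr_mul_right]))) <| by
  have h : ∀ m, c.toFun (c.retr (regularEquiv k E' (c.val _ m))) = regularEquiv k E' (c.val _ m) := by
    intro m
    conv_rhs => rw [← c.e_smul_val, regularEquiv_left, regularEquiv_right, ← mul_assoc]
    exact c.toFun_retr _
  constructor
  · intro m m' hm
    have h1 : c.retr (regularEquiv k E' (c.val _ m)) = c.retr (regularEquiv k E' (c.val _ m')) :=
      (regularEquiv k E).symm.injective hm
    exact c.val_injective _ ((regularEquiv k E').injective (by rw [← h, h1, h]))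
  · intro x
    obtain ⟨m, hm⟩ := c.exists_val (regularBimod k E')
      ((regularEquiv k E').symm (c.toFun (regularEquiv k E x)))
    refine ⟨m, (regularEquiv k E).injective ?_⟩
    change regularEquiv k E ((regularEquiv k E).symm (c.retr (regularEquiv k E' (c.val _ m)))) = _
    rw [AddEquiv.apply_symm_apply, hm, regularEquiv_left, regularEquiv_right,
      AddEquiv.apply_symm_apply, c.mul_e, c.e_mul, c.retr_toFun]

lemma toFun_regularIso (m : c.enveloping.functor.obj (regularBimod k E')) :
    c.toFun (regularEquiv k E (c.regularIso.hom.hom m)) = regularEquiv k E' (c.val _ m) := by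
  change c.toFun (regularEquiv k E ((regularEquiv k E).symm
    (c.retr (regularEquiv k E' (c.val _ m))))) = _
  rw [AddEquiv.apply_symm_apply]
  conv_rhs => rw [← c.e_smul_val, regularEquiv_left, regularEquiv_right, ← mul_assoc]
  exact c.toFun_retr _

/-- If `e` and `σ(e)` are equivalent then the corner `e E'_σ e = e E' σ(e)` is a twisted regular
bimodule, since it is generated by an invertible element of `e E' σ(e)`. -/
lemma exists_corner_twistedBimod [Module.Finite k E] (σ : E' ≃ₐ[k] E')
    (h : IdemEquiv c.e (σ c.e)) :
    ∃ σ' : E ≃ₐ[k] E, Nonempty (c.enveloping.functor.obj (twistedBimod σ) ≅ twistedBimod σ') := by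
  obtain ⟨x, y, h1, h2, h3, h4, h5, h6⟩ := h
  obtain ⟨g, hg⟩ := c.exists_val (twistedBimod σ) ((twistedEquiv σ).symm x)
  have hg' : twistedEquiv σ (c.val _ g) = x := by
    rw [hg, twistedEquiv_left, twistedEquiv_right, AddEquiv.apply_symm_apply, h2, h1]
  refine exists_iso_twistedBimod _ g ⟨fun a b hab => ?_, fun m => ?_⟩ fun z hz => ?_
  · have : twistedEquiv σ (c.val _ (a • g)) = twistedEquiv σ (c.val _ (b • g)) :=
      congrArg (fun t => twistedEquiv σ (c.val _ t)) hab
    rw [val_left, val_left, twistedEquiv_left, twistedEquiv_left, hg'] at this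
    have := congrArg (fun t => t * y) this
    simp only [mul_assoc, h5, c.mul_e] at this
    exact c.injective this
  · refine ⟨c.retr (twistedEquiv σ (c.val _ m) * y), c.val_injective _ ((twistedEquiv σ).injective ?_)⟩
    rw [val_left, twistedEquiv_left, hg', c.toFun_retr']
    have hm : twistedEquiv σ (c.val _ m) = c.e * (twistedEquiv σ (c.val _ m) * σ c.e) := by
      conv_lhs => rw [← c.e_smul_val, twistedEquiv_left, twistedEquiv_right]
    rw [mul_assoc, h1, mul_assoc, mul_assoc, h6, ← hm]
  · have : twistedEquiv σ (c.val _ (op z • g)) = 0 := by rw [hz, map_zero, map_zero]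
    rw [val_right, twistedEquiv_right, hg'] at this
    have := congrArg (fun t => y * t) this
    simp only [← mul_assoc, h6, mul_zero] at this
    rw [← _root_.map_mul σ, c.e_mul] at this
    apply c.injective
    rw [map_zero]
    exact (map_eq_zero_iff σ σ.injective).1 this

/-- A truncated resolution of `E'` restricts to a truncated resolution of the corner `E = e E' e`,
if `e` generates `E'` and is equivalent to `σ(e)`. -/
lemma exists_truncatedResolution [Module.Finite k E] (hc : c.HasBasis) {n : ℕ}
    (Y' : TruncatedResolution k E' n) (h : IdemEquiv c.e (Y'.σ c.e)) :
    ∃ (Y : TruncatedResolution k E n) (φ : ∀ i, CornerMap c (Y.Y.X i) (Y'.Y.X i)),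
      (∀ i i' x, (φ i').toFun ((Y.Y.d i i').hom x) = (Y'.Y.d i i').hom ((φ i).toFun x)) ∧
      ∀ x, regularEquiv k _ (Y'.aug.hom ((φ 0).toFun x)) =
        c.toFun (regularEquiv k _ (Y.aug.hom x)) := by
  obtain ⟨σ', ⟨τ⟩⟩ := c.exists_corner_twistedBimod Y'.σ h
  refine ⟨Y'.map c.enveloping.functor (c.enveloping.preservesResolutions hc.enveloping) c.regularIso
    σ' τ, fun i => c.cornerMap (Y'.Y.X i), fun i i' x => rfl, fun x => ?_⟩
  exact (c.toFun_regularIso ((c.enveloping.functor.map Y'.aug).hom x)).symm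

end CornerHom

end CornerResolution

/-! ### Truncated resolutions and matrix algebras -/

section MatrixResolution

variable {k E E' : Type u} [Field k] [Ring E] [Algebra k E] [Ring E'] [Algebra k E']
  {T : Type} [Fintype T] [DecidableEq T] (c : MatrixPresentation k T E E')

namespace MatrixPresentation

/-- The functor from bimodules over `E` to bimodules over the corner `E'` of the algebra of matrices
over `E`. It sends `M` to the corner of the bimodule of matrices with entries in `M`. -/
def functor : BimodCat k E E ⥤ BimodCat k E' E' := columnFunctor (T × T) ⋙ c.corner.functor

instance : c.functor.Additive := inferInstanceAs (columnFunctor (T × T) ⋙ c.corner.functor).Additive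

/-- The entries of an element of `c.functor.obj M`. -/
def val (M : BimodCat k E E) (a b : T) : c.functor.obj M →+ M :=
  (Pi.evalAddMonoidHom (fun _ : T × T => (M : Type u)) (a, b)).comp
    (c.corner.cornerSubgroup ((columnFunctor (T × T)).obj M)).subtype

lemma val_ext {M : BimodCat k E E} {m m' : c.functor.obj M}
    (h : ∀ a b, c.val M a b m = c.val M a b m') : m = m' :=
  Subtype.ext (funext fun u => h u.1 u.2)

lemma val_tmul (M : BimodCat k E E) (a b : T) (x y : E') (m : c.functor.obj M) :
    c.val M a b ((x ⊗ₜ[k] op y) • m) =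
      ∑ u, ∑ v, c.entry a u x • op (c.entry v b y) • c.val M u v m := by
  have h : c.val M a b ((x ⊗ₜ[k] op y) • m) =
      ∑ w : T × T, (c.entry a w.1 x ⊗ₜ[k] op (c.entry w.2 b y)) • c.val M w.1 w.2 m := rfl
  rw [h, Fintype.sum_prod_type]
  refine Finset.sum_congr rfl fun u _ => Finset.sum_congr rfl fun v _ => ?_
  rw [BimodCat.left_smul_def, BimodCat.right_smul_def, smul_smul]
  simp

lemma sum_one (M : BimodCat k E E) (a b : T) (m : c.functor.obj M) :
    ∑ u, ∑ v, c.entry a u 1 • op (c.entry v b 1) • c.val M u v m = c.val M a b m := by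
  have := c.val_tmul M a b 1 1 m
  rw [← this]
  congr 1
  exact one_smul _ _

lemma sum_right_one (M : BimodCat k E E) (a b : T) (m : c.functor.obj M) :
    ∑ v, op (c.entry v b 1) • c.val M a v m = c.val M a b m := by
  rw [← c.sum_one M a b]
  have h : ∀ v, op (c.entry v b 1) • c.val M a v m = ∑ u, ∑ w,
      c.entry a u 1 • op (c.entry w v 1 * c.entry v b 1) • c.val M u w m := by
    intro v
    rw [← c.sum_one M a v m, Finset.smul_sum]
    refine Finset.sum_congr rfl fun u _ => ?_
    rw [Finset.smul_sum]
    refine Finset.sum_congr rfl fun w _ => ?_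
    rw [← smul_comm (c.entry a u 1) (op (c.entry v b 1)), op_mul, mul_smul]
  simp only [h]
  rw [Finset.sum_comm]
  refine Finset.sum_congr rfl fun u _ => ?_
  rw [Finset.sum_comm]
  refine Finset.sum_congr rfl fun w _ => ?_
  rw [← Finset.smul_sum, ← Finset.sum_smul, ← Finset.op_sum, ← c.entry_mul, one_mul]

lemma sum_left_one (M : BimodCat k E E) (a b : T) (m : c.functor.obj M) :
    ∑ u, c.entry a u 1 • c.val M u b m = c.val M a b m := by
  rw [← c.sum_one M a b]
  refine Finset.sum_congr rfl fun u _ => ?_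
  rw [← Finset.smul_sum, sum_right_one]

lemma val_left (M : BimodCat k E E) (a b : T) (x : E') (m : c.functor.obj M) :
    c.val M a b (x • m) = ∑ u, c.entry a u x • c.val M u b m := by
  rw [BimodCat.left_smul_def]
  refine (c.val_tmul M a b x 1 m).trans (Finset.sum_congr rfl fun u _ => ?_)
  rw [← Finset.smul_sum, sum_right_one]

lemma val_right (M : BimodCat k E E) (a b : T) (x : E') (m : c.functor.obj M) :
    c.val M a b (op x • m) = ∑ v, op (c.entry v b x) • c.val M a v m := by
  rw [BimodCat.right_smul_def]
  refine (c.val_tmul M a b 1 x m).trans ?_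
  rw [Finset.sum_comm]
  refine Finset.sum_congr rfl fun v _ => ?_
  simp only [smul_comm (_ : E) (op (c.entry v b x))]
  rw [← Finset.smul_sum, sum_left_one]

lemma exists_val (M : BimodCat k E E) (m : T → T → M) : ∃ m₀ : c.functor.obj M, ∀ a b,
    c.val M a b m₀ = ∑ u, ∑ v, c.entry a u 1 • op (c.entry v b 1) • m u v := by
  let m' : (columnFunctor (T × T)).obj M := fun w : T × T => m w.1 w.2
  refine ⟨⟨c.corner.e • m', c.corner.e_smul_mem m'⟩, fun a b => ?_⟩
  have h : c.val M a b ⟨c.corner.e • m', c.corner.e_smul_mem m'⟩ =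
      ∑ w : T × T, (c.entry a w.1 1 ⊗ₜ[k] op (c.entry w.2 b 1)) • m w.1 w.2 := rfl
  rw [h, Fintype.sum_prod_type]
  refine Finset.sum_congr rfl fun u _ => Finset.sum_congr rfl fun v _ => ?_
  rw [BimodCat.left_smul_def, BimodCat.right_smul_def, smul_smul]
  simp

/-- The element of `E'` with the given matrix, for an element of the corner of the regular
bimodule. -/
def ofRegular (m : c.functor.obj (regularBimod k E)) : E' :=
  ∑ a, ∑ b, c.ofEntry a b (regularEquiv k E (c.val _ a b m))

lemma entry_ofRegular (m : c.functor.obj (regularBimod k E)) (a b : T) :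
    c.entry a b (c.ofRegular m) = regularEquiv k E (c.val _ a b m) := by
  rw [ofRegular, ← c.sum_one _ a b]
  simp only [map_sum, c.entry_ofEntry, regularEquiv_left, regularEquiv_right, mul_assoc]

lemma eq_of_entry {x y : E'} (h : ∀ a b, c.entry a b x = c.entry a b y) : x = y := by
  rw [← c.sum_ofEntry x, ← c.sum_ofEntry y]
  simp only [h]

/-- The functor preserves the regular bimodule. -/
def regularIso : c.functor.obj (regularBimod k E) ≅ regularBimod k E' :=
  isoOfBijective (BimodCat.homMk
    { toFun := fun m => (regularEquiv k E').symm (c.ofRegular m)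
      map_zero' := by simp only [ofRegular, map_zero, Finset.sum_const_zero]
      map_add' := fun m m' => by simp only [ofRegular, map_add, Finset.sum_add_distrib] }
    (fun x m => (regularEquiv k E').injective (by
      change regularEquiv k E' ((regularEquiv k E').symm (c.ofRegular _)) =
        regularEquiv k E' (x • (regularEquiv k E').symm (c.ofRegular m))
      rw [AddEquiv.apply_symm_apply, regularEquiv_left, AddEquiv.apply_symm_apply]
      refine c.eq_of_entry fun a b => ?_
      rw [entry_ofRegular, c.entry_mul, val_left, map_sum]
      simp only [regularEquiv_left, entry_ofRegular]))
    (fun x m => (regularEquiv k E').injective (by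
      change regularEquiv k E' ((regularEquiv k E').symm (c.ofRegular _)) =
        regularEquiv k E' (x • (regularEquiv k E').symm (c.ofRegular m))
      rw [← op_unop x, AddEquiv.apply_symm_apply, regularEquiv_right, AddEquiv.apply_symm_apply]
      refine c.eq_of_entry fun a b => ?_
      rw [entry_ofRegular, c.entry_mul, val_right, map_sum]
      simp only [regularEquiv_right, entry_ofRegular]))) <| by
  constructor
  · intro m m' hm
    have h1 : c.ofRegular m = c.ofRegular m' := (regularEquiv k E').symm.injective hm
    refine c.val_ext fun a b => (regularEquiv k E).injective ?_
    rw [← entry_ofRegular, h1, entry_ofRegular]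
  · intro x
    obtain ⟨m, hm⟩ := c.exists_val (regularBimod k E)
      fun a b => (regularEquiv k E).symm (c.entry a b (regularEquiv k E' x))
    refine ⟨m, (regularEquiv k E').injective ?_⟩
    change regularEquiv k E' ((regularEquiv k E').symm (c.ofRegular m)) = _
    rw [AddEquiv.apply_symm_apply]
    refine c.eq_of_entry fun a b => ?_
    rw [entry_ofRegular, hm]
    simp only [map_sum, regularEquiv_left, regularEquiv_right, AddEquiv.apply_symm_apply]
    conv_rhs => rw [← one_mul (regularEquiv k E' x), c.entry_mul]
    refine Finset.sum_congr rfl fun u _ => ?_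
    rw [← Finset.mul_sum, ← c.entry_mul, mul_one]

lemma regularIso_apply (m : c.functor.obj (regularBimod k E)) :
    regularEquiv k E' (c.regularIso.hom.hom m) = c.ofRegular m :=
  (regularEquiv k E').apply_symm_apply _

/-- The idempotent matrix `F` with `E' = F Mat(E) F`. -/
def idem : Matrix T T E := Matrix.of fun a b => c.entry a b 1

/-- The matrix of an element of `E'`. -/
def toMatrix (x : E') : Matrix T T E := Matrix.of fun a b => c.entry a b x

lemma toMatrix_injective : Function.Injective c.toMatrix := fun _ _ h =>
  c.eq_of_entry fun a b => congrFun (congrFun h a) b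

lemma toMatrix_mul (x y : E') : c.toMatrix (x * y) = c.toMatrix x * c.toMatrix y := by
  ext a b
  rw [Matrix.mul_apply]
  exact c.entry_mul a b x y

lemma idem_mul (x : E') : c.idem * c.toMatrix x = c.toMatrix x := by
  conv_rhs => rw [← one_mul x, toMatrix_mul]
  rfl

lemma mul_idem (x : E') : c.toMatrix x * c.idem = c.toMatrix x := by
  conv_rhs => rw [← mul_one x, toMatrix_mul]
  rfl

lemma exists_toMatrix (z : Matrix T T E) (h1 : c.idem * z = z) (h2 : z * c.idem = z) :
    ∃ x, c.toMatrix x = z := by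
  refine ⟨∑ a, ∑ b, c.ofEntry a b (z a b), ?_⟩
  conv_rhs => rw [← h2, ← h1]
  ext a b
  simp only [toMatrix, Matrix.of_apply, map_sum, c.entry_ofEntry, Matrix.mul_apply, idem,
    Finset.sum_mul]
  rw [Finset.sum_comm]

/-- The matrix of an element of `c.functor.obj (twistedBimod σ)`. -/
def twistedMatrix (σ : E ≃ₐ[k] E) (m : c.functor.obj (twistedBimod σ)) : Matrix T T E :=
  Matrix.of fun a b => twistedEquiv σ (c.val _ a b m)

lemma twistedMatrix_left (σ : E ≃ₐ[k] E) (x : E') (m : c.functor.obj (twistedBimod σ)) :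
    c.twistedMatrix σ (x • m) = c.toMatrix x * c.twistedMatrix σ m := by
  ext a b
  simp only [twistedMatrix, Matrix.of_apply, val_left, map_sum, twistedEquiv_left,
    Matrix.mul_apply, toMatrix]

lemma twistedMatrix_right (σ : E ≃ₐ[k] E) (x : E') (m : c.functor.obj (twistedBimod σ)) :
    c.twistedMatrix σ (op x • m) = c.twistedMatrix σ m * (c.toMatrix x).map σ := by
  ext a b
  simp only [twistedMatrix, Matrix.of_apply, val_right, map_sum, twistedEquiv_right,
    Matrix.mul_apply, toMatrix, Matrix.map_apply]

lemma twistedMatrix_injective (σ : E ≃ₐ[k] E) : Function.Injective (c.twistedMatrix σ) :=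
  fun _ _ h => c.val_ext fun a b => (twistedEquiv σ).injective (congrFun (congrFun h a) b)

lemma twistedMatrix_zero (σ : E ≃ₐ[k] E) : c.twistedMatrix σ 0 = 0 := by
  ext a b
  simp [twistedMatrix]

lemma exists_twistedMatrix (σ : E ≃ₐ[k] E) (z : Matrix T T E) (h1 : c.idem * z = z)
    (h2 : z * c.idem.map σ = z) : ∃ m, c.twistedMatrix σ m = z := by
  obtain ⟨m, hm⟩ := c.exists_val (twistedBimod σ) fun a b => (twistedEquiv σ).symm (z a b)
  refine ⟨m, ?_⟩
  conv_rhs => rw [← h1, ← h2]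
  ext a b
  simp only [twistedMatrix, Matrix.of_apply, hm, map_sum, twistedEquiv_right, twistedEquiv_left,
    AddEquiv.apply_symm_apply, Matrix.mul_apply, idem, Matrix.map_apply, Finset.mul_sum]

/-- If the idempotent matrices `F` and `σ(F)` are equivalent, then the functor sends `E_σ` to a
twisted regular bimodule. -/
lemma exists_functor_twistedBimod [Module.Finite k E'] (σ : E ≃ₐ[k] E)
    (h : IdemEquiv c.idem (c.idem.map σ)) :
    ∃ σ' : E' ≃ₐ[k] E', Nonempty (c.functor.obj (twistedBimod σ) ≅ twistedBimod σ') := by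
  obtain ⟨x, y, h1, h2, h3, h4, h5, h6⟩ := h
  obtain ⟨g, hg⟩ := c.exists_twistedMatrix σ x h1 h2
  have hmap : ∀ z w : Matrix T T E, (z * w).map σ = z.map σ * w.map σ := fun z w =>
    Matrix.map_mul
  refine exists_iso_twistedBimod _ g ⟨fun a b hab => ?_, fun m => ?_⟩ fun z hz => ?_
  · have := congrArg (fun t => c.twistedMatrix σ t * y) hab
    simp only [twistedMatrix_left, hg, mul_assoc, h5, c.mul_idem] at this
    exact c.toMatrix_injective this
  · have hm : c.idem * c.twistedMatrix σ m = c.twistedMatrix σ m := by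
      have := c.twistedMatrix_left σ 1 m
      rw [one_smul] at this
      exact this.symm
    have hm' : c.twistedMatrix σ m * c.idem.map σ = c.twistedMatrix σ m := by
      have := c.twistedMatrix_right σ 1 m
      rw [MulOpposite.op_one, one_smul] at this
      exact this.symm
    obtain ⟨x', hx'⟩ := c.exists_toMatrix (c.twistedMatrix σ m * y) (by rw [← mul_assoc, hm])
      (by rw [mul_assoc, h4])
    refine ⟨x', c.twistedMatrix_injective σ ?_⟩
    change c.twistedMatrix σ (x' • g) = _
    rw [twistedMatrix_left, hx', hg, mul_assoc, h6, hm']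
  · have := congrArg (fun t => y * c.twistedMatrix σ t) hz
    simp only [twistedMatrix_right, hg, twistedMatrix_zero, mul_zero] at this
    rw [← mul_assoc, h6, ← hmap, c.idem_mul] at this
    refine c.eq_of_entry fun a b => σ.injective ?_
    rw [map_zero, map_zero]
    exact congrFun (congrFun this a) b

lemma exists_cornerMap {ι : CornerHom k E E'} {s t : T → E}
    (hst : ∀ a b x, c.entry a b (ι.toFun x) = s a * x * t b) (hts : ∑ a, t a * s a = 1)
    (M : BimodCat k E E) (m : M) :
    ∃ m₀ : c.functor.obj M, ∀ a b, c.val M a b m₀ = s a • op (t b) • m := by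
  have hs : ∀ a, ∑ u, c.entry a u 1 * s u = s a := fun a => by
    have h1 : ∀ b, ∑ u, c.entry a u 1 * s u * t b = s a * t b := fun b => by
      have := c.entry_mul a b 1 (ι.toFun 1)
      simp only [one_mul, hst, mul_one] at this
      rw [this]
      simp only [mul_assoc]
    have h2 : ∑ b, (∑ u, c.entry a u 1 * s u) * t b * s b = ∑ b, s a * t b * s b :=
      Finset.sum_congr rfl fun b _ => by rw [Finset.sum_mul, h1]
    simpa only [mul_assoc, ← Finset.mul_sum, hts, mul_one] using h2
  have ht : ∀ b, ∑ v, t v * c.entry v b 1 = t b := fun b => by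
    have h1 : ∀ a, ∑ v, s a * t v * c.entry v b 1 = s a * t b := fun a => by
      have := c.entry_mul a b (ι.toFun 1) 1
      simp only [mul_one, hst] at this
      rw [this]
    have h2 : ∑ a, t a * (s a * ∑ v, t v * c.entry v b 1) = ∑ a, t a * (s a * t b) :=
      Finset.sum_congr rfl fun a _ => by rw [← h1, Finset.mul_sum]; simp only [mul_assoc]
    simpa only [← mul_assoc, ← Finset.sum_mul, hts, one_mul] using h2
  obtain ⟨m₀, hm₀⟩ := c.exists_val M fun a b => s a • op (t b) • m
  refine ⟨m₀, fun a b => ?_⟩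
  rw [hm₀]
  have : ∀ u v, c.entry a u 1 • op (c.entry v b 1) • s u • op (t v) • m =
      (c.entry a u 1 * s u) • op (t v * c.entry v b 1) • m := fun u v => by
    rw [← smul_comm (s u) (op (c.entry v b 1)), smul_smul, smul_smul (op _), op_mul]
  simp only [this]
  rw [← hs a, ← ht b, Finset.sum_smul, Finset.op_sum]
  simp only [Finset.sum_smul, Finset.smul_sum]

/-- If `E` is identified with a full corner of `E'`, in a way compatible with the presentation of
`E'` as a corner of a matrix algebra over `E`, then a bimodule `M` over `E` is the corner of the
bimodule over `E'` obtained from `M`. -/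
def cornerMap {ι : CornerHom k E E'} {s t : T → E}
    (hst : ∀ a b x, c.entry a b (ι.toFun x) = s a * x * t b) (hts : ∑ a, t a * s a = 1)
    (M : BimodCat k E E) : CornerMap ι M (c.functor.obj M) :=
  have hex := c.exists_cornerMap hst hts M
  { toFun := AddMonoidHom.mk' (fun m => (hex m).choose) fun m m' => c.val_ext fun a b => by
      rw [map_add, (hex (m + m')).choose_spec, (hex m).choose_spec, (hex m').choose_spec, smul_add,
        smul_add]
    left := fun x m => c.val_ext fun a b => by
      change c.val M a b (hex (x • m)).choose = c.val M a b (ι.toFun x • (hex m).choose)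
      rw [(hex (x • m)).choose_spec, val_left]
      simp only [(hex m).choose_spec, hst, smul_smul, mul_assoc, ← Finset.sum_smul,
        ← Finset.mul_sum, hts, mul_one]
      rw [mul_smul, smul_comm x]
    right := fun x m => c.val_ext fun a b => by
      change c.val M a b (hex (op x • m)).choose = c.val M a b (op (ι.toFun x) • (hex m).choose)
      rw [(hex (op x • m)).choose_spec, val_right]
      have : ∀ v, op (c.entry v b (ι.toFun x)) • c.val M a v (hex m).choose =
          s a • op (t v * s v * (x * t b)) • m := fun v => by
        rw [(hex m).choose_spec, hst, ← smul_comm (s a), smul_smul (op _), ← op_mul]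
        simp only [mul_assoc]
      simp only [this]
      rw [← Finset.smul_sum, ← Finset.sum_smul, ← Finset.op_sum, ← Finset.sum_mul, hts, one_mul,
        smul_smul (op _), op_mul]
    injective := fun m m' h => by
      have h1 : ∀ a b, s a • op (t b) • m = s a • op (t b) • m' := fun a b => by
        rw [← (hex m).choose_spec, ← (hex m').choose_spec]
        exact congrArg (c.val M a b) h
      have h2 : ∀ m : M, ∑ a, ∑ b, t a • op (s b) • s a • op (t b) • m = m := fun m => by
        have : ∀ a b, t a • op (s b) • s a • op (t b) • m = (t a * s a) • op (t b * s b) • m :=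
          fun a b => by rw [← smul_comm (s a) (op (s b)), smul_smul, smul_smul (op _), op_mul]
        simp only [this]
        simp only [← Finset.smul_sum, ← Finset.sum_smul, ← Finset.op_sum, hts, MulOpposite.op_one,
          one_smul]
      rw [← h2 m, ← h2 m']
      simp only [h1]
    surjective := fun m => by
      refine ⟨∑ a, ∑ b, t a • op (s b) • c.val M a b m, c.val_ext fun a b => ?_⟩
      refine ((hex _).choose_spec a b).trans ?_
      rw [CornerHom.e, val_left]
      simp only [val_right, hst, mul_one, Finset.smul_sum]
      refine Finset.sum_congr rfl fun u _ => Finset.sum_congr rfl fun v _ => ?_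
      rw [← smul_comm (t u) (op (t b)), smul_smul, smul_smul (op _), op_mul] }

lemma cornerMap_val {ι : CornerHom k E E'} {s t : T → E}
    (hst : ∀ a b x, c.entry a b (ι.toFun x) = s a * x * t b) (hts : ∑ a, t a * s a = 1)
    (M : BimodCat k E E) (m : M) (a b : T) :
    c.val M a b ((c.cornerMap hst hts M).toFun m) = s a • op (t b) • m :=
  (c.exists_cornerMap hst hts M m).choose_spec a b

/-- A truncated resolution of `E` induces a truncated resolution of `E'`, if the idempotent
matrices `F` and `σ(F)` are equivalent, where `E' = F Mat(E) F`. -/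
lemma exists_truncatedResolution [Module.Finite k E'] (hc : c.corner.HasLeftBasis) {n : ℕ}
    (Y : TruncatedResolution k E n) (h : IdemEquiv c.idem (c.idem.map Y.σ))
    {ι : CornerHom k E E'} {s t : T → E}
    (hst : ∀ a b x, c.entry a b (ι.toFun x) = s a * x * t b) (hts : ∑ a, t a * s a = 1) :
    ∃ (Y' : TruncatedResolution k E' n) (φ : ∀ i, CornerMap ι (Y.Y.X i) (Y'.Y.X i)),
      (∀ i i' x, (φ i').toFun ((Y.Y.d i i').hom x) = (Y'.Y.d i i').hom ((φ i).toFun x)) ∧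
      ∀ x, regularEquiv k _ (Y'.aug.hom ((φ 0).toFun x)) =
        ι.toFun (regularEquiv k _ (Y.aug.hom x)) := by
  obtain ⟨σ', ⟨τ⟩⟩ := c.exists_functor_twistedBimod Y.σ h
  refine ⟨Y.map c.functor ((columnFunctor_preservesResolutions _).comp
      (c.corner.preservesResolutions hc)) c.regularIso σ' τ,
    fun i => c.cornerMap hst hts (Y.Y.X i), fun i i' x => c.val_ext fun a b => ?_, fun x => ?_⟩
  · refine (c.cornerMap_val hst hts _ _ a b).trans ?_
    refine Eq.trans ?_ (congrArg (Y.Y.d i i').hom (c.cornerMap_val hst hts _ x a b)).symm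
    rw [BimodCat.hom_left, BimodCat.hom_right]
  · refine (c.regularIso_apply ((c.functor.map Y.aug).hom _)).trans ?_
    refine c.eq_of_entry fun a b => ?_
    refine (c.entry_ofRegular _ a b).trans ?_
    have h1 : c.val _ a b ((c.functor.map Y.aug).hom ((c.cornerMap hst hts (Y.Y.X 0)).toFun x)) =
        s a • op (t b) • Y.aug.hom x := by
      refine (congrArg Y.aug.hom (c.cornerMap_val hst hts _ x a b)).trans ?_
      rw [BimodCat.hom_left, BimodCat.hom_right]
    refine (congrArg (regularEquiv k E) h1).trans ?_
    rw [regularEquiv_left, regularEquiv_right, hst, mul_assoc]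

end MatrixPresentation

end MatrixResolution

/-! ### Changing the multiplicities of the summands -/

section Multiplicities

/-- An automorphism permutes the equivalence classes of local idempotents. -/
lemma exists_perm_idemEquiv {R J : Type*} [Ring R] [Finite J] {ε : J → R}
    (hε : ∀ j, IsLocalIdempotent (ε j))
    (hex : ∀ f, IsLocalIdempotent f → ∃ j, IdemEquiv f (ε j))
    (hinj : ∀ i j, IdemEquiv (ε i) (ε j) → i = j) (σ : R ≃+* R) :
    ∃ π : Equiv.Perm J, ∀ j, IdemEquiv (σ (ε j)) (ε (π j)) := by
  choose π hπ using fun j => hex _ ((hε j).map σ)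
  have h : Function.Injective π := fun i j hij => by
    have h1 : IdemEquiv (σ (ε i)) (σ (ε j)) := (hπ i).trans (hij ▸ (hπ j).symm)
    have h2 := h1.map σ.symm
    rw [σ.symm_apply_apply, σ.symm_apply_apply] at h2
    exact hinj i j h2
  exact ⟨Equiv.ofBijective π (Finite.injective_iff_bijective.1 h), hπ⟩

lemma IdemEquiv.matrix_single {R T : Type*} [Ring R] [Fintype T] [DecidableEq T] {e f : R}
    (h : IdemEquiv e f) (a b : T) : IdemEquiv (Matrix.single a a e) (Matrix.single b b f) := by
  obtain ⟨x, y, h1, h2, h3, h4, h5, h6⟩ := h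
  exact ⟨Matrix.single a b x, Matrix.single b a y, by simp [h1], by simp [h2], by simp [h3],
    by simp [h4], by simp [h5], by simp [h6]⟩

lemma finite_endOp (k A P : Type u) [Field k] [Ring A] [Algebra k A] [Module.Finite k A]
    [AddCommGroup P] [Module k P] [Module A P] [IsScalarTower k A P] [Module.Finite A P] :
    Module.Finite k (EndOp A P) := by
  have : Module.Finite k P := Module.Finite.trans A P
  have : Module.Finite k (Module.End A P) := Module.Finite.of_injective
    (LinearMap.restrictScalarsₗ k A P P k) (LinearMap.restrictScalars_injective k)
  exact Module.Finite.equiv (MulOpposite.opLinearEquiv k)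

variable {A J : Type*} [Ring A] [Fintype J] [DecidableEq J] (Q : J → Type*)
  [∀ j, AddCommGroup (Q j)] [∀ j, Module A (Q j)] (m : J → ℕ)

/-- The inclusion of the summand `Q_j` with index `t = (j, i)` in `⨁ Q_j ^ (m j)`. -/
def copyInclusion (t : Σ j, Fin (m j)) : Q t.1 →ₗ[A] (∀ j, Fin (m j) → Q j) :=
  LinearMap.single A (fun j => Fin (m j) → Q j) t.1 ∘ₗ
    LinearMap.single A (fun _ : Fin (m t.1) => Q t.1) t.2

/-- The projection of `⨁ Q_j ^ (m j)` to the summand `Q_j` with index `t = (j, i)`. -/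
def copyProjection (t : Σ j, Fin (m j)) : (∀ j, Fin (m j) → Q j) →ₗ[A] Q t.1 :=
  LinearMap.proj (R := A) (φ := fun _ : Fin (m t.1) => Q t.1) t.2 ∘ₗ
    LinearMap.proj (R := A) (φ := fun j => Fin (m j) → Q j) t.1

lemma copyProjection_inclusion (t : Σ j, Fin (m j)) (x : Q t.1) :
    copyProjection (A := A) Q m t (copyInclusion (A := A) Q m t x) = x := by
  simp [copyProjection, copyInclusion]

lemma copyProjection_inclusion_of_ne {t t' : Σ j, Fin (m j)} (h : t ≠ t') (x : Q t'.1) :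
    copyProjection (A := A) Q m t (copyInclusion (A := A) Q m t' x) = 0 := by
  obtain ⟨j, i⟩ := t
  obtain ⟨j', i'⟩ := t'
  by_cases hj : j = j'
  · subst hj
    have : i ≠ i' := fun hi => h (by rw [hi])
    simp [copyProjection, copyInclusion, this]
  · simp [copyProjection, copyInclusion, hj]

lemma sum_copy (p : ∀ j, Fin (m j) → Q j) :
    ∑ t, copyInclusion (A := A) Q m t (copyProjection (A := A) Q m t p) = p := by
  funext j i
  rw [Finset.sum_apply, Finset.sum_apply]
  rw [Finset.sum_eq_single (⟨j, i⟩ : Σ j, Fin (m j))]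
  · exact copyProjection_inclusion (A := A) Q m ⟨j, i⟩ _
  · intro t _ ht
    exact copyProjection_inclusion_of_ne (A := A) Q m ht.symm _
  · exact fun h => absurd (Finset.mem_univ _) h

variable {m} (hm : ∀ j, 1 ≤ m j)

/-- The inclusion of `⨁ Q_j` in `⨁ Q_j ^ (m j)`, as the first copies. -/
def firstInclusion : (∀ j, Q j) →ₗ[A] (∀ j, Fin (m j) → Q j) :=
  LinearMap.pi fun j => LinearMap.single A (fun _ : Fin (m j) => Q j) ⟨0, hm j⟩ ∘ₗ LinearMap.proj j

/-- The projection of `⨁ Q_j ^ (m j)` to the sum `⨁ Q_j` of the first copies. -/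
def firstProjection : (∀ j, Fin (m j) → Q j) →ₗ[A] (∀ j, Q j) :=
  LinearMap.pi fun j => copyProjection (A := A) Q m ⟨j, ⟨0, hm j⟩⟩

lemma firstProjection_inclusion (p : ∀ j, Q j) :
    firstProjection (A := A) Q hm (firstInclusion (A := A) Q hm p) = p := by
  funext j
  simp [firstProjection, firstInclusion, copyProjection]

lemma firstInclusion_eq (p : ∀ j, Q j) : firstInclusion (A := A) Q hm p =
    ∑ j, copyInclusion (A := A) Q m ⟨j, ⟨0, hm j⟩⟩ (p j) := by
  funext j
  rw [Finset.sum_apply, Finset.sum_eq_single j]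
  · simp [firstInclusion, copyInclusion]
  · intro i _ hi
    simp [copyInclusion, hi.symm]
  · exact fun h => absurd (Finset.mem_univ _) h

end Multiplicities

section MultiplicitiesResolution

variable {k A : Type u} [Field k] [Ring A] [Algebra k A] [Module.Finite k A]
  {J : Type} [Fintype J] [DecidableEq J] (Q : J → Type u)
  [∀ j, AddCommGroup (Q j)] [∀ j, Module k (Q j)] [∀ j, Module A (Q j)]
  [∀ j, IsScalarTower k A (Q j)] [∀ j, Module.Finite A (Q j)] {m : J → ℕ}


lemma isNoetherian_isArtinian (k : Type u) {A : Type u} [Field k] [Ring A] [Algebra k A] [Module.Finite k A] (M : Type*) [AddCommGroup M] [Module A M] [Module.Finite A M] :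
    IsNoetherian A M ∧ IsArtinian A M := by
  have : IsNoetherianRing A := IsNoetherianRing.of_finite k A
  have : IsArtinianRing A := IsArtinianRing.of_finite k A
  exact ⟨inferInstance, inferInstance⟩

/-- The map `⨁ Q_j ^ (m j) → ⨁ Q_j` given by the projection to the summand with index `t`. -/
def copyToSum (m : J → ℕ) (t : Σ j, Fin (m j)) : (∀ j, Fin (m j) → Q j) →ₗ[A] (∀ j, Q j) :=
  LinearMap.single A Q t.1 ∘ₗ copyProjection Q m t

/-- The map `⨁ Q_j → ⨁ Q_j ^ (m j)` given by the inclusion of the summand with index `t`. -/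
def sumToCopy (m : J → ℕ) (t : Σ j, Fin (m j)) : (∀ j, Q j) →ₗ[A] (∀ j, Fin (m j) → Q j) :=
  copyInclusion Q m t ∘ₗ LinearMap.proj t.1

lemma sum_sumToCopy_copyToSum (p : ∀ j, Fin (m j) → Q j) :
    ∑ t, sumToCopy (A := A) Q m t (copyToSum (A := A) Q m t p) = p := by
  conv_rhs => rw [← sum_copy (A := A) Q m p]
  refine Finset.sum_congr rfl fun t _ => ?_
  simp [sumToCopy, copyToSum]

/-- The corner `EndOp A (⨁ Q_j)` of `EndOp A (⨁ Q_j ^ (m j))`. -/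
abbrev multiplicityCorner (k : Type u) [Field k] [Algebra k A] [∀ j, Module k (Q j)]
    [∀ j, IsScalarTower k A (Q j)] (hm : ∀ j, 1 ≤ m j) :
    CornerHom k (EndOp A (∀ j, Q j)) (EndOp A (∀ j, Fin (m j) → Q j)) :=
  summandCorner k (firstInclusion Q hm) (firstProjection Q hm) (firstProjection_inclusion Q hm)

/-- Restriction of a truncated resolution to the corner defined by the first copies. -/
theorem exists_truncatedResolution_of_multiplicities [∀ j, Module.Projective A (Q j)]
    (hQ : ∀ j, IsIndecomposableModule A (Q j))
    (hiso : ∀ i j, Nonempty (Q i ≃ₗ[A] Q j) → i = j) (hm : ∀ j, 1 ≤ m j) {n : ℕ}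
    (Y' : TruncatedResolution k (EndOp A (∀ j, Fin (m j) → Q j)) n) :
    ∃ Y : TruncatedResolution k (EndOp A (∀ j, Q j)) n,
      Nonempty (periodicTwist A Y ≅ periodicTwist A Y') := by
  have := fun j => (isNoetherian_isArtinian k (A := A) (Q j)).1
  have := fun j => (isNoetherian_isArtinian k (A := A) (Q j)).2
  have := finite_endOp k A (∀ j, Q j)
  let δ : (Σ j, Fin (m j)) → EndOp A (∀ j, Fin (m j) → Q j) := fun t =>
    op (copyInclusion Q m t ∘ₗ copyProjection Q m t)
  have hδ : ∀ t, IsLocalIdempotent (δ t) := fun t =>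
    (hQ t.1).isLocalIdempotent _ _ (copyProjection_inclusion Q m t)
  have hδ' : ∀ t t', t ≠ t' → δ t * δ t' = 0 := fun t t' h => endOp_ext fun p => by
    change copyInclusion Q m t' (copyProjection Q m t' (copyInclusion Q m t _)) = 0
    rw [copyProjection_inclusion_of_ne Q m h.symm, map_zero]
  have hδ1 : ∑ t, δ t = 1 := by
    apply unop_injective
    rw [Finset.unop_sum]
    refine LinearMap.ext fun p => ?_
    rw [LinearMap.sum_apply]
    exact sum_copy Q m p
  have hequiv : ∀ t t', IdemEquiv (δ t) (δ t') → t.1 = t'.1 := fun t t' h =>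
    hiso _ _ (nonempty_linearEquiv_of_idemEquiv _ _ (copyProjection_inclusion Q m t) _ _
      (copyProjection_inclusion Q m t') h)
  have hequiv' : ∀ j (i i' : Fin (m j)), IdemEquiv (δ ⟨j, i⟩) (δ ⟨j, i'⟩) := fun j i i' =>
    ⟨op (copyInclusion Q m ⟨j, i'⟩ ∘ₗ copyProjection Q m ⟨j, i⟩),
      op (copyInclusion Q m ⟨j, i⟩ ∘ₗ copyProjection Q m ⟨j, i'⟩),
      endOp_ext fun p => congrArg (copyInclusion Q m ⟨j, i'⟩) (copyProjection_inclusion Q m ⟨j, i⟩ _),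
      endOp_ext fun p => congrArg (copyInclusion Q m ⟨j, i'⟩)
        (copyProjection_inclusion Q m ⟨j, i'⟩ _),
      endOp_ext fun p => congrArg (copyInclusion Q m ⟨j, i⟩)
        (copyProjection_inclusion Q m ⟨j, i'⟩ _),
      endOp_ext fun p => congrArg (copyInclusion Q m ⟨j, i⟩) (copyProjection_inclusion Q m ⟨j, i⟩ _),
      endOp_ext fun p => congrArg (copyInclusion Q m ⟨j, i⟩)
        (copyProjection_inclusion Q m ⟨j, i'⟩ _),
      endOp_ext fun p => congrArg (copyInclusion Q m ⟨j, i'⟩)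
        (copyProjection_inclusion Q m ⟨j, i⟩ _)⟩
  -- one idempotent in each equivalence class: the projection onto the first copy of each `Q j`
  let ε : J → EndOp A (∀ j, Fin (m j) → Q j) := fun j => δ ⟨j, ⟨0, hm j⟩⟩
  obtain ⟨π, hπ⟩ := exists_perm_idemEquiv (ε := ε) (fun j => hδ _)
    (fun f hf => by
      obtain ⟨t, ht⟩ := hf.exists_idemEquiv hδ hδ1
      exact ⟨t.1, ht.trans (hequiv' t.1 t.2 _)⟩)
    (fun i j h => hequiv _ _ h) Y'.σ.toRingEquiv
  have he : (multiplicityCorner (A := A) Q k hm).e = ∑ j, ε j := by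
    apply unop_injective
    rw [Finset.unop_sum]
    refine LinearMap.ext fun p => ?_
    rw [LinearMap.sum_apply]
    exact firstInclusion_eq Q hm _
  have hne : ∀ i j, i ≠ j → ε i * ε j = 0 := fun i j hij =>
    hδ' _ _ fun h => hij (congrArg Sigma.fst h)
  have h : IdemEquiv (multiplicityCorner (A := A) Q k hm).e
      (Y'.σ (multiplicityCorner (A := A) Q k hm).e) := by
    rw [he, map_sum, ← Equiv.sum_comp π]
    refine IdemEquiv.sum (fun j => (hπ j).symm) (fun i j hij => hne _ _ (π.injective.ne hij))
      fun i j hij => ?_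
    rw [← map_mul, hne i j hij, map_zero]
  obtain ⟨Y, φ, hd, haug⟩ := (multiplicityCorner (A := A) Q k hm).exists_truncatedResolution
    (summandCorner_hasBasis _ _ _ (sum_sumToCopy_copyToSum Q)) Y' h
  exact ⟨Y, periodicTwist_iso_of_cornerMap Y Y' φ hd haug _ _ (sum_sumToCopy_copyToSum Q)⟩

/-- An automorphism of `EndOp A (⨁ Q_j)` permutes the equivalence classes of the idempotents
defined by the indecomposable summands `Q_j`. -/
lemma exists_perm_summandIdempotent (hQ : ∀ j, IsIndecomposableModule A (Q j))
    (hiso : ∀ i j, Nonempty (Q i ≃ₗ[A] Q j) → i = j)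
    (σ : EndOp A (∀ j, Q j) ≃ₐ[k] EndOp A (∀ j, Q j)) :
    ∃ π : Equiv.Perm J, ∀ j, IdemEquiv (σ (summandIdempotent Q j)) (summandIdempotent Q (π j)) := by
  have := fun j => (isNoetherian_isArtinian k (A := A) (Q j)).1
  have := fun j => (isNoetherian_isArtinian k (A := A) (Q j)).2
  have h0 : ∀ j (x : Q j), LinearMap.proj (R := A) (φ := Q) j (LinearMap.single A Q j x) = x :=
    fun j x => by simp
  have hloc : ∀ j, IsLocalIdempotent (summandIdempotent (A := A) Q j) := fun j =>
    (hQ j).isLocalIdempotent _ _ (h0 j)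
  refine exists_perm_idemEquiv hloc (fun f hf => hf.exists_idemEquiv hloc ?_)
    (fun i j h => hiso _ _ (nonempty_linearEquiv_of_idemEquiv _ _ (h0 i) _ _ (h0 j) h))
    σ.toRingEquiv
  apply unop_injective
  rw [Finset.unop_sum]
  refine LinearMap.ext fun p => ?_
  rw [LinearMap.sum_apply]
  exact Finset.univ_sum_single p

lemma PreservesMultiplicities.of_perm (hiso : ∀ i j, Nonempty (Q i ≃ₗ[A] Q j) → i = j)
    {σ : EndOp A (∀ j, Q j) ≃ₐ[k] EndOp A (∀ j, Q j)} {π : Equiv.Perm J}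
    (hπ : ∀ j, IdemEquiv (σ (summandIdempotent Q j)) (summandIdempotent Q (π j))) :
    PreservesMultiplicities Q m σ ↔ ∀ j, m j = m (π j) := by
  have h0 : ∀ j (x : Q j), LinearMap.proj (R := A) (φ := Q) j (LinearMap.single A Q j x) = x :=
    fun j x => by simp
  have key : ∀ j, Nonempty (LinearMap.range (unop (σ (summandIdempotent Q j))) ≃ₗ[A] Q (π j)) := by
    intro j
    have hidem : ∀ p, unop (σ (summandIdempotent Q j)) (unop (σ (summandIdempotent Q j)) p) =
        unop (σ (summandIdempotent Q j)) p := fun p => by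
      have h1 : summandIdempotent (A := A) Q j * summandIdempotent Q j = summandIdempotent Q j :=
        endOp_ext fun p => congrArg (LinearMap.single A Q j) (h0 j _)
      have := congrArg σ h1
      rw [map_mul] at this
      exact congrArg (fun t : EndOp A (∀ j, Q j) => unop t p) this
    refine nonempty_linearEquiv_of_idemEquiv
      (LinearMap.range (unop (σ (summandIdempotent Q j)))).subtype
      (unop (σ (summandIdempotent Q j))).rangeRestrict ?_ _ _ (h0 (π j)) (hπ j)
    rintro ⟨_, p, rfl⟩
    exact Subtype.ext (hidem p)
  constructor
  · exact fun h j => h _ _ (key j)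
  · rintro h i j ⟨e⟩
    rw [h i, hiso _ _ ⟨(key i).some.symm.trans e⟩]

/-- The extension of a truncated resolution from `EndOp A (⨁ Q_j)` to `EndOp A (⨁ Q_j ^ (m j))`. -/
theorem exists_truncatedResolution_of_preservesMultiplicities [∀ j, Module.Projective A (Q j)]
    (hQ : ∀ j, IsIndecomposableModule A (Q j))
    (hiso : ∀ i j, Nonempty (Q i ≃ₗ[A] Q j) → i = j) (hm : ∀ j, 1 ≤ m j) {n : ℕ}
    (Y : TruncatedResolution k (EndOp A (∀ j, Q j)) n) (hY : PreservesMultiplicities Q m Y.σ) :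
    ∃ Y' : TruncatedResolution k (EndOp A (∀ j, Fin (m j) → Q j)) n,
      Nonempty (periodicTwist A Y ≅ periodicTwist A Y') := by
  have := finite_endOp k A (∀ j, Fin (m j) → Q j)
  obtain ⟨π, hπ⟩ := exists_perm_summandIdempotent Q hQ hiso Y.σ
  have hmπ := (PreservesMultiplicities.of_perm Q hiso hπ).1 hY
  let C := matrixPresentation k (copyToSum (A := A) Q m) (sumToCopy (A := A) Q m)
    (sum_sumToCopy_copyToSum Q)
  have hidem : C.idem = ∑ t : Σ j, Fin (m j), Matrix.single t t (summandIdempotent Q t.1) := by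
    ext t t'
    rw [Matrix.sum_apply]
    by_cases h : t = t'
    · subst h
      rw [Finset.sum_eq_single t (fun s _ hs => by simp [hs]) (fun h => absurd (Finset.mem_univ _) h)]
      rw [Matrix.single_apply_same]
      exact endOp_ext fun p =>
        congrArg (LinearMap.single A Q t.1) (copyProjection_inclusion Q m t _)
    · rw [Finset.sum_eq_zero fun s _ => by
        rw [Matrix.single_apply, if_neg]
        rintro ⟨rfl, rfl⟩
        exact h rfl]
      refine endOp_ext fun p => ?_
      refine (congrArg (LinearMap.single A Q t'.1)
        (copyProjection_inclusion_of_ne (A := A) Q m (Ne.symm h) _)).trans (map_zero _)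
  -- The permutation of the classes lifts to a permutation of the copies since `m (π j) = m j`.
  let θ : (Σ j, Fin (m j)) ≃ Σ j, Fin (m j) :=
    Equiv.sigmaCongr π fun j => finCongr (hmπ j)
  have hθ : ∀ t, (θ t).1 = π t.1 := fun t => rfl
  have h : IdemEquiv C.idem (C.idem.map Y.σ) := by
    have h1 : C.idem.map Y.σ = ∑ t : Σ j, Fin (m j),
        Matrix.single t t (Y.σ (summandIdempotent Q t.1)) := by
      rw [hidem]
      ext a b
      simp only [Matrix.map_apply, Matrix.sum_apply, map_sum, Matrix.single_apply]
      refine Finset.sum_congr rfl fun t _ => ?_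
      split_ifs
      · rfl
      · exact map_zero _
    rw [h1, hidem, ← Equiv.sum_comp θ]
    refine IdemEquiv.sum (fun t => ?_) (fun t t' htt' => ?_) (fun t t' htt' => ?_)
    · rw [hθ]
      exact (hπ t.1).symm.matrix_single _ _
    · exact Matrix.single_mul_single_of_ne _ _ _ _ (θ.injective.ne htt') _
    · exact Matrix.single_mul_single_of_ne _ _ _ _ htt' _
  -- The matrix of an element `x` of the corner consists of the elements `s_a x t_b`, where
  -- `∑ t_a s_a = 1`.
  have hst : ∀ a b x, C.entry a b ((multiplicityCorner (A := A) Q k hm).toFun x) =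
      (op (firstProjection (A := A) Q hm ∘ₗ sumToCopy Q m a) : EndOp A (∀ j, Q j)) * x *
        op (copyToSum (A := A) Q m b ∘ₗ firstInclusion Q hm) := fun a b x => rfl
  have hts : ∑ a, (op (copyToSum (A := A) Q m a ∘ₗ firstInclusion Q hm) : EndOp A (∀ j, Q j)) *
      op (firstProjection (A := A) Q hm ∘ₗ sumToCopy Q m a) = 1 := by
    apply unop_injective
    rw [Finset.unop_sum]
    refine LinearMap.ext fun p => ?_
    rw [LinearMap.sum_apply]
    refine (map_sum (firstProjection (A := A) Q hm) (fun t => sumToCopy (A := A) Q m t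
      (copyToSum (A := A) Q m t (firstInclusion (A := A) Q hm p))) Finset.univ).symm.trans ?_
    rw [sum_sumToCopy_copyToSum, firstProjection_inclusion]
    rfl
  obtain ⟨Y', φ, hd, haug⟩ := C.exists_truncatedResolution
    (matrixPresentation_hasLeftBasis _ (firstProjection_inclusion Q hm)) Y h hst hts
  exact ⟨Y', periodicTwist_iso_of_cornerMap Y Y' φ hd haug _ _ (sum_sumToCopy_copyToSum Q)⟩

end MultiplicitiesResolution

/-! ### Splicing of resolutions -/

section ExactRes

variable {S : Type u} [Ring S]

/-- There is an exact sequence `0 → K → P_{n-1} → ⋯ → P_0 → M → 0` with finitely generated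
projective modules `P_i`. -/
inductive ExactRes : ℕ → ModuleCat.{u} S → ModuleCat.{u} S → Prop
  | zero {K M : ModuleCat.{u} S} (e : K ≅ M) : ExactRes 0 K M
  | succ {n : ℕ} {K L P M : ModuleCat.{u} S} (i : L ⟶ P) (p : P ⟶ M)
      (hi : Function.Injective i.hom) (hp : Function.Surjective p.hom)
      (hip : Function.Exact i.hom p.hom) (hP : FGProj S P) (h : ExactRes n K L) :
      ExactRes (n + 1) K M

namespace ExactRes

lemma trans {m n : ℕ} {K L M : ModuleCat.{u} S} (h : ExactRes m K L) (h' : ExactRes n L M) :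
    ExactRes (m + n) K M := by
  induction h' with
  | zero e =>
    cases h with
    | zero e' => exact zero (e' ≪≫ e)
    | succ i p hi hp hip hP h =>
      have he : Function.Injective e.hom.hom := (ModuleCat.mono_iff_injective _).1 inferInstance
      have he' : Function.Surjective e.hom.hom := (ModuleCat.epi_iff_surjective _).1 inferInstance
      exact succ i (p ≫ e.hom) hi (he'.comp hp)
        (fun x => (map_eq_zero_iff e.hom.hom he).trans (hip x)) hP h
  | succ i p hi hp hip hP _ ih => exact succ i p hi hp hip hP (ih h)

lemma of_iso_left {n : ℕ} {K K' M : ModuleCat.{u} S} (e : K' ≅ K) (h : ExactRes n K M) :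
    ExactRes n K' M := by simpa using (zero e).trans h

lemma of_iso_right {n : ℕ} {K M M' : ModuleCat.{u} S} (h : ExactRes n K M) (e : M ≅ M') :
    ExactRes n K M' := h.trans (zero e)

lemma of_ker {P M : ModuleCat.{u} S} (p : P ⟶ M) (hp : Function.Surjective p.hom)
    (hP : FGProj S P) : ExactRes 1 (ModuleCat.of S (LinearMap.ker p.hom)) M :=
  succ (ModuleCat.ofHom (LinearMap.ker p.hom).subtype) p (Submodule.injective_subtype _) hp
    (LinearMap.exact_subtype_ker_map p.hom) hP (zero (Iso.refl _))

/-- The resolution of the kernel of a map, followed by a projective module mapping onto the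
kernel. -/
lemma ker_of_exact {n : ℕ} {X Y Z M : ModuleCat.{u} S} (f : X ⟶ Y) (g : Y ⟶ Z)
    (hfg : Function.Exact f.hom g.hom) (hX : FGProj S X)
    (h : ExactRes n (ModuleCat.of S (LinearMap.ker g.hom)) M) :
    ExactRes (n + 1) (ModuleCat.of S (LinearMap.ker f.hom)) M := by
  let p : X ⟶ ModuleCat.of S (LinearMap.ker g.hom) :=
    ModuleCat.ofHom (f.hom.codRestrict _ fun x => (hfg _).2 ⟨x, rfl⟩)
  have hp : Function.Surjective p.hom := fun y => by
    obtain ⟨x, hx⟩ := (hfg y.1).1 y.2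
    exact ⟨x, Subtype.ext hx⟩
  have hk : LinearMap.ker f.hom = LinearMap.ker p.hom := (LinearMap.ker_codRestrict _ _ _).symm
  rw [add_comm]
  exact (of_iso_left (LinearEquiv.ofEq _ _ hk).toModuleIso (of_ker p hp hX)).trans h

lemma map {S' : Type u} [Ring S'] {G : ModuleCat.{u} S ⥤ ModuleCat.{u} S'}
    (hG : PreservesResolutions G) {n : ℕ} {K M : ModuleCat.{u} S} (h : ExactRes n K M) :
    ExactRes n (G.obj K) (G.obj M) := by
  induction h with
  | zero e => exact zero (G.mapIso e)
  | succ i p hi hp hip hP _ ih =>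
    exact succ (G.map i) (G.map p) (hG.injective i hi) (hG.surjective p hp) (hG.exact i p hip)
      (hG.fgProj _ hP) ih

/-- The decomposition of a resolution into short exact sequences `0 → Z_{i+1} → X_i → Z_i → 0`. -/
lemma exists_family {n : ℕ} {K M : ModuleCat.{u} S} (h : ExactRes n K M) :
    ∃ (Z X : ℕ → ModuleCat.{u} S) (i : ∀ j, Z (j + 1) ⟶ X j) (p : ∀ j, X j ⟶ Z j),
      (∀ j < n, FGProj S (X j) ∧ Function.Injective (i j).hom ∧ Function.Surjective (p j).hom ∧
        Function.Exact (i j).hom (p j).hom) ∧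
      (∀ j, n ≤ j → Subsingleton (X j)) ∧ Nonempty (Z 0 ≅ M) ∧ Nonempty (Z n ≅ K) := by
  induction h with
  | @zero K M e =>
    exact ⟨fun _ => M, fun _ => ModuleCat.of S PUnit, fun _ => 0, fun _ => 0,
      fun j hj => absurd hj (Nat.not_lt_zero j), fun j _ => inferInstanceAs (Subsingleton PUnit),
      ⟨Iso.refl _⟩, ⟨e.symm⟩⟩
  | @succ n K L P M i p hi hp hip hP _ ih =>
    obtain ⟨Z, X, i', p', h1, h2, ⟨e⟩, ⟨e'⟩⟩ := ih
    let Z' : ℕ → ModuleCat.{u} S := fun j => j.casesOn M Z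
    let X' : ℕ → ModuleCat.{u} S := fun j => j.casesOn P X
    refine ⟨Z', X', fun j => match j with
      | 0 => e.hom ≫ i
      | j + 1 => i' j, fun j => match j with
      | 0 => p
      | j + 1 => p' j, fun j hj => ?_, fun j hj => ?_, ⟨Iso.refl _⟩, ⟨e'⟩⟩
    · cases j with
      | zero =>
        have he : Function.Injective e.hom.hom := (ModuleCat.mono_iff_injective _).1 inferInstance
        have he' : Function.Surjective e.hom.hom :=
          (ModuleCat.epi_iff_surjective _).1 inferInstance
        refine ⟨hP, hi.comp he, hp, fun x => (hip x).trans ⟨?_, ?_⟩⟩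
        · rintro ⟨y, rfl⟩
          obtain ⟨z, rfl⟩ := he' y
          exact ⟨z, rfl⟩
        · rintro ⟨z, rfl⟩
          exact ⟨e.hom.hom z, rfl⟩
      | succ j => exact h1 j (by omega)
    · cases j with
      | zero => omega
      | succ j => exact h2 j (by omega)

end ExactRes

/-- The modules of the cochain complex `complexOfSequence`. -/
def sequenceObj (X : ℕ → ModuleCat.{u} S) : ℤ → ModuleCat.{u} S
  | Int.ofNat 0 => X 0
  | Int.ofNat (_ + 1) => ModuleCat.of S PUnit
  | Int.negSucc j => X (j + 1)

/-- The differentials of the cochain complex `complexOfSequence`. -/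
def sequenceD (X : ℕ → ModuleCat.{u} S) (d : ∀ j, X (j + 1) ⟶ X j) :
    ∀ i : ℤ, sequenceObj X i ⟶ sequenceObj X (i + 1)
  | Int.ofNat _ => 0
  | Int.negSucc 0 => d 0
  | Int.negSucc (j + 1) => d (j + 1)

/-- The cochain complex `⋯ → X 2 → X 1 → X 0 → 0` with `X j` in degree `-j`. -/
def complexOfSequence (X : ℕ → ModuleCat.{u} S) (d : ∀ j, X (j + 1) ⟶ X j)
    (hd : ∀ j, d (j + 1) ≫ d j = 0) : CochainComplex (ModuleCat.{u} S) ℤ :=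
  CochainComplex.of (sequenceObj X) (sequenceD X d) fun
    | Int.ofNat _ => Limits.zero_comp
    | Int.negSucc 0 => Limits.comp_zero
    | Int.negSucc 1 => hd 0
    | Int.negSucc (j + 2) => hd (j + 1)

section complexOfSequence

variable (X : ℕ → ModuleCat.{u} S) (d : ∀ j, X (j + 1) ⟶ X j)
    (hd : ∀ j, d (j + 1) ≫ d j = 0)

lemma complexOfSequence_d_zero : (complexOfSequence X d hd).d (-1) 0 = d 0 :=
  CochainComplex.of_d (sequenceObj X) (sequenceD X d) (-1 : ℤ)

lemma complexOfSequence_d_succ (j : ℕ) :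
    (complexOfSequence X d hd).d (Int.negSucc (j + 1)) (Int.negSucc j) = d (j + 1) :=
  CochainComplex.of_d (sequenceObj X) (sequenceD X d) (Int.negSucc (j + 1))

end complexOfSequence

end ExactRes

section Twisting

variable {k E : Type u} [Field k] [Ring E] [Algebra k E]

lemma TruncatedResolution.exact' {n : ℕ} (Y : TruncatedResolution k E n) {a b c : ℤ}
    (hab : a + 1 = b) (hbc : b + 1 = c) (h : 1 - n < b) (h' : b < 0) :
    Function.Exact (Y.Y.d a b).hom (Y.Y.d b c).hom := by
  obtain rfl : a = b - 1 := by omega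
  subst hbc
  exact Y.exact b h h'

/-- A truncated resolution is a resolution of `E` by projective bimodules that starts with `E_σ`. -/
lemma TruncatedResolution.exactRes {n : ℕ} (Y : TruncatedResolution k E n) :
    ExactRes n (twistedBimod Y.σ) (regularBimod k E) := by
  have h1 := ExactRes.of_ker Y.aug Y.aug_surjective ⟨Y.finite 0, Y.projective 0⟩
  rcases Y.one_le.eq_or_lt with rfl | hn
  · obtain ⟨e⟩ := Y.ker_of_eq_one rfl
    exact h1.of_iso_left e.symm.toModuleIso
  have key : ∀ j : ℕ, j + 2 ≤ n → ∀ a b : ℤ, a = -(j + 1) → b = -j →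
      ExactRes (j + 2) (ModuleCat.of _ (LinearMap.ker (Y.Y.d a b).hom)) (regularBimod k E) := by
    intro j
    induction j with
    | zero =>
      rintro _ a b rfl rfl
      exact h1.ker_of_exact _ _ (Y.exact_aug hn) ⟨Y.finite _, Y.projective _⟩
    | succ j ih =>
      rintro hj a b rfl hb
      obtain rfl : b = -(j + 1) := by rw [hb]; push_cast; ring
      exact (ih (by omega) (-(j + 1)) (-j) rfl rfl).ker_of_exact _ _
        (Y.exact' (by push_cast; ring) (by ring) (by omega) (by omega))
        ⟨Y.finite _, Y.projective _⟩
  obtain ⟨m, rfl⟩ : ∃ m, n = m + 2 := ⟨n - 2, by omega⟩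
  obtain ⟨e⟩ := Y.ker_of_two_le hn
  exact (key m le_rfl _ _ (by push_cast; ring) (by push_cast; ring)).of_iso_left e.symm.toModuleIso

/-- Each resolution of `E` by projective bimodules that starts with `E_σ` is defined by a truncated
resolution. -/
lemma exists_truncatedResolution_of_exactRes {n : ℕ} (hn : 1 ≤ n) {σ : E ≃ₐ[k] E}
    (h : ExactRes n (twistedBimod σ) (regularBimod k E)) :
    ∃ Y : TruncatedResolution k E n, Y.σ = σ := by
  obtain ⟨Z, X, i, p, h1, h2, ⟨e⟩, ⟨e'⟩⟩ := h.exists_family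
  have hX : ∀ j, FGProj (E ⊗[k] Eᵐᵒᵖ) (X j) := fun j => by
    rcases lt_or_ge j n with hj | hj
    · exact (h1 j hj).1
    · have := h2 j hj
      exact FGProj.of_subsingleton
  have hip : ∀ j, i j ≫ p j = 0 := fun j => by
    rcases lt_or_ge j n with hj | hj
    · ext x
      exact (h1 j hj).2.2.2.apply_apply_eq_zero x
    · have := h2 j hj
      ext x
      change (p j).hom ((i j).hom x) = 0
      rw [Subsingleton.elim ((i j).hom x) 0, map_zero]
  let d : ∀ j, X (j + 1) ⟶ X j := fun j => p (j + 1) ≫ i j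
  have hd : ∀ j, d (j + 1) ≫ d j = 0 := fun j => by
    simp only [d, Category.assoc]
    rw [reassoc_of% (hip (j + 1)), Limits.zero_comp, Limits.comp_zero]
  have hker : ∀ j, j + 1 < n → Function.Exact (i (j + 1)).hom (d j).hom := fun j hj x =>
    (map_eq_zero_iff (i j).hom (h1 j (by omega)).2.1).trans ((h1 (j + 1) hj).2.2.2 x)
  have hexact : ∀ j, j + 2 < n → Function.Exact (d (j + 1)).hom (d j).hom := fun j hj x => by
    rw [hker j (by omega)]
    constructor
    · rintro ⟨y, rfl⟩
      obtain ⟨z, rfl⟩ := (h1 (j + 2) hj).2.2.1 y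
      exact ⟨z, rfl⟩
    · rintro ⟨y, rfl⟩
      exact ⟨(p (j + 2)).hom y, rfl⟩
  have he : Function.Injective e.hom.hom := (ModuleCat.mono_iff_injective _).1 inferInstance
  have he' : Function.Surjective e.hom.hom := (ModuleCat.epi_iff_surjective _).1 inferInstance
  have hkeriso : ∀ {j} {N : ModuleCat.{u} (E ⊗[k] Eᵐᵒᵖ)} (f : X j ⟶ N), j + 1 = n →
      Function.Exact (i j).hom f.hom →
      Nonempty (LinearMap.ker f.hom ≃ₗ[E ⊗[k] Eᵐᵒᵖ] twistedBimod σ) := by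
    rintro j N f rfl hf
    exact ⟨(LinearEquiv.ofEq _ _ (LinearMap.exact_iff.1 hf)).trans
      ((LinearEquiv.ofInjective _ (h1 j (by omega)).2.1).symm.trans e'.toLinearEquiv)⟩
  have haug : Function.Exact (i 0).hom (p 0 ≫ e.hom).hom := fun x =>
    (map_eq_zero_iff e.hom.hom he).trans ((h1 0 hn).2.2.2 x)
  let C := complexOfSequence X d hd
  have hC : ∀ a : ℤ, FGProj (E ⊗[k] Eᵐᵒᵖ) (C.X a) := fun a => match a with
    | Int.ofNat 0 => hX 0
    | Int.ofNat (_ + 1) =>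
      have : Subsingleton (ModuleCat.of (E ⊗[k] Eᵐᵒᵖ) PUnit) :=
        inferInstanceAs (Subsingleton PUnit)
      FGProj.of_subsingleton (M := ModuleCat.of (E ⊗[k] Eᵐᵒᵖ) PUnit)
    | Int.negSucc j => hX (j + 1)
  refine ⟨{
    σ := σ
    Y := C
    one_le := hn
    finite := fun a => (hC a).1
    projective := fun a => (hC a).2
    subsingleton := fun a ha => match a, ha with
      | Int.ofNat 0, ha => by simp at ha; omega
      | Int.ofNat (_ + 1), _ => inferInstanceAs (Subsingleton PUnit)
      | Int.negSucc j, ha => h2 (j + 1) (by omega)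
    aug := p 0 ≫ e.hom
    aug_surjective := he'.comp (h1 0 hn).2.2.1
    d_aug := ?_
    exact_aug := fun hn2 => ?_
    exact := fun a ha ha' => ?_
    ker_of_eq_one := fun hn1 => hkeriso (p 0 ≫ e.hom) (by omega) haug
    ker_of_two_le := fun hn2 => ?_ }, rfl⟩
  · rw [complexOfSequence_d_zero]
    ext x
    exact (haug _).2 ⟨(p 1).hom x, rfl⟩
  · rw [complexOfSequence_d_zero]
    intro x
    refine (haug x).trans ⟨?_, ?_⟩
    · rintro ⟨y, rfl⟩
      obtain ⟨z, rfl⟩ := (h1 1 hn2).2.2.1 y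
      exact ⟨z, rfl⟩
    · rintro ⟨y, rfl⟩
      exact ⟨(p 1).hom y, rfl⟩
  · obtain ⟨j, rfl⟩ : ∃ j, a = Int.negSucc j := ⟨(-a - 1).toNat, by omega⟩
    have e1 : Int.negSucc j - 1 = Int.negSucc (j + 1) := by omega
    rw [e1, complexOfSequence_d_succ]
    cases j with
    | zero =>
      have : C.d (Int.negSucc 0) (Int.negSucc 0 + 1) = d 0 := complexOfSequence_d_zero X d hd
      rw [this]
      exact hexact 0 (by omega)
    | succ j =>
      have e2 : Int.negSucc (j + 1) + 1 = Int.negSucc j := by omega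
      rw [e2, complexOfSequence_d_succ]
      exact hexact (j + 1) (by omega)
  · obtain ⟨m, rfl⟩ : ∃ m, n = m + 2 := ⟨n - 2, by omega⟩
    have e1 : 1 - ((m + 2 : ℕ) : ℤ) = Int.negSucc m := by omega
    have e2 : 2 - ((m + 2 : ℕ) : ℤ) = -m := by omega
    rw [e1, e2]
    cases m with
    | zero =>
      have : C.d (Int.negSucc 0) (-((0 : ℕ) : ℤ)) = d 0 := complexOfSequence_d_zero X d hd
      rw [this]
      exact hkeriso (d 0) rfl (hker 0 (by omega))
    | succ m =>
      have : C.d (Int.negSucc (m + 1)) (-((m + 1 : ℕ) : ℤ)) = d (m + 1) :=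
        complexOfSequence_d_succ X d hd m
      rw [this]
      exact hkeriso (d (m + 1)) rfl (hker (m + 1) (by omega))

/-- The automorphism of the enveloping algebra defined by an automorphism of the right factor. -/
def envelopingTwist (σ : E ≃ₐ[k] E) : (E ⊗[k] Eᵐᵒᵖ) ≃ₐ[k] (E ⊗[k] Eᵐᵒᵖ) :=
  Algebra.TensorProduct.congr AlgEquiv.refl (AlgEquiv.op σ)

/-- The functor `M ↦ M_σ` that twists the right action on a bimodule by the automorphism `σ`. -/
def twistFunctor (σ : E ≃ₐ[k] E) : BimodCat k E E ⥤ BimodCat k E E :=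
  ModuleCat.restrictScalars (envelopingTwist σ).toAlgHom.toRingHom

/-- The underlying additive group of `M_σ`. -/
def twistFunctorEquiv (σ : E ≃ₐ[k] E) (M : BimodCat k E E) : (twistFunctor σ).obj M ≃+ M :=
  AddEquiv.refl M

lemma twistFunctor_preservesResolutions (σ : E ≃ₐ[k] E) :
    PreservesResolutions (twistFunctor σ) where
  exact f g h := h
  injective f h := h
  surjective f h := h
  fgProj M h := by
    obtain ⟨ι, _, x, f, hf⟩ := fgProj_iff_dualBasis.1 h
    refine fgProj_iff_dualBasis.2 ⟨ι, inferInstance, x, fun i =>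
      { toFun := fun m => (envelopingTwist σ).symm (f i m)
        map_add' := fun m m' => (congrArg (envelopingTwist σ).symm (map_add (f i) m m')).trans
          (map_add _ _ _)
        map_smul' := fun s m => by
          refine (congrArg (envelopingTwist σ).symm
            (map_smul (f i) (envelopingTwist σ s) (twistFunctorEquiv σ M m))).trans ?_
          rw [smul_eq_mul, map_mul, AlgEquiv.symm_apply_apply]
          rfl }, fun m => ?_⟩
    refine Eq.trans (Finset.sum_congr rfl fun i _ => ?_) (hf m)
    change (envelopingTwist σ ((envelopingTwist σ).symm (f i m))) • x i = _
    rw [AlgEquiv.apply_symm_apply]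

lemma twistFunctorEquiv_left (σ : E ≃ₐ[k] E) (M : BimodCat k E E) (a : E)
    (m : (twistFunctor σ).obj M) :
    twistFunctorEquiv σ M (a • m) = a • twistFunctorEquiv σ M m := by
  change (envelopingTwist σ (a ⊗ₜ 1)) • twistFunctorEquiv σ M m = _
  rw [BimodCat.left_smul_def, envelopingTwist, Algebra.TensorProduct.congr_apply]
  simp

lemma twistFunctorEquiv_right (σ : E ≃ₐ[k] E) (M : BimodCat k E E) (a : E)
    (m : (twistFunctor σ).obj M) :
    twistFunctorEquiv σ M (op a • m) = op (σ a) • twistFunctorEquiv σ M m := by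
  change (envelopingTwist σ (1 ⊗ₜ op a)) • twistFunctorEquiv σ M m = _
  rw [BimodCat.right_smul_def, envelopingTwist, Algebra.TensorProduct.congr_apply]
  simp

/-- The isomorphism of bimodules given by a bijection. -/
def bimodIso {M N : BimodCat k E E} (f : M ≃+ N) (hl : ∀ (b : E) (m : M), f (b • m) = b • f m)
    (hr : ∀ (c : E) (m : M), f (op c • m) = op c • f m) : M ≅ N :=
  isoOfBijective (BimodCat.homMk (f : M →+ N) hl fun c => hr (unop c)) f.bijective

lemma nonempty_twistFunctor_twistedBimod_iso (σ ρ : E ≃ₐ[k] E) :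
    Nonempty ((twistFunctor σ).obj (twistedBimod ρ) ≅ twistedBimod (ρ * σ)) :=
  ⟨bimodIso ((twistFunctorEquiv σ _).trans ((twistedEquiv ρ).trans (twistedEquiv (ρ * σ)).symm))
    (fun b m => (twistedEquiv (ρ * σ)).injective (by
      simp [twistFunctorEquiv_left, twistedEquiv_left]))
    (fun b m => (twistedEquiv (ρ * σ)).injective (by
      simp [twistFunctorEquiv_right, twistedEquiv_right]))⟩

lemma nonempty_twistFunctor_regularBimod_iso (σ : E ≃ₐ[k] E) :
    Nonempty ((twistFunctor σ).obj (regularBimod k E) ≅ twistedBimod σ) :=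
  ⟨bimodIso ((twistFunctorEquiv σ _).trans ((regularEquiv k E).trans (twistedEquiv σ).symm))
    (fun b m => (twistedEquiv σ).injective (by
      simp [twistFunctorEquiv_left, twistedEquiv_left, regularEquiv_left]))
    (fun b m => (twistedEquiv σ).injective (by
      simp [twistFunctorEquiv_right, twistedEquiv_right, regularEquiv_right]))⟩

lemma nonempty_twistedBimod_one_iso :
    Nonempty (twistedBimod (1 : E ≃ₐ[k] E) ≅ regularBimod k E) :=
  ⟨bimodIso ((twistedEquiv 1).trans (regularEquiv k E).symm)
    (fun b m => (regularEquiv k E).injective (by simp [twistedEquiv_left, regularEquiv_left]))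
    (fun b m => (regularEquiv k E).injective (by simp [twistedEquiv_right, regularEquiv_right]))⟩

/-- Splicing the twists `Y, Y_σ, Y_{σ²}, …` of a truncated resolution of period `n` gives
resolutions of period `n r` with automorphism `σ^r`. -/
lemma TruncatedResolution.exactRes_pow {n : ℕ} (Y : TruncatedResolution k E n) (r : ℕ) :
    ExactRes (r * n) (twistedBimod (Y.σ ^ r)) (regularBimod k E) := by
  induction r with
  | zero =>
    obtain ⟨e⟩ := nonempty_twistedBimod_one_iso (k := k) (E := E)
    rw [zero_mul]
    exact ExactRes.zero e
  | succ r ih =>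
    obtain ⟨e⟩ := nonempty_twistFunctor_twistedBimod_iso Y.σ (Y.σ ^ r)
    obtain ⟨e'⟩ := nonempty_twistFunctor_regularBimod_iso Y.σ
    have := ((ih.map (twistFunctor_preservesResolutions Y.σ)).of_iso_left e.symm).of_iso_right e'
    rw [Nat.succ_mul]
    exact this.trans Y.exactRes

end Twisting

/-- Twisted periodicity does not depend on the multiplicities of the indecomposable summands: a power
of the automorphism of a truncated resolution fixes all isomorphism classes of summands. -/
theorem isTwistedPeriodic_iff_of_multiplicities {k A : Type u} [Field k] [Ring A] [Algebra k A]
    [Module.Finite k A] {J : Type} [Fintype J] [DecidableEq J] (Q : J → Type u)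
    [∀ j, AddCommGroup (Q j)] [∀ j, Module k (Q j)] [∀ j, Module A (Q j)]
    [∀ j, IsScalarTower k A (Q j)] [∀ j, Module.Finite A (Q j)] [∀ j, Module.Projective A (Q j)]
    {m : J → ℕ} (hQ : ∀ j, IsIndecomposableModule A (Q j))
    (hiso : ∀ i j, Nonempty (Q i ≃ₗ[A] Q j) → i = j) (hm : ∀ j, 1 ≤ m j) :
    IsTwistedPeriodic k (EndOp A (∀ j, Q j)) ↔
      IsTwistedPeriodic k (EndOp A (∀ j, Fin (m j) → Q j)) := by
  constructor
  · rintro ⟨n, ⟨Y⟩⟩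
    obtain ⟨π, hπ⟩ := exists_perm_summandIdempotent Q hQ hiso Y.σ
    have hpow : ∀ r j, IdemEquiv ((Y.σ ^ r) (summandIdempotent Q j))
        (summandIdempotent Q ((π ^ r) j)) := by
      intro r
      induction r with
      | zero =>
        exact fun j => IdemEquiv.refl (endOp_ext fun p => by
          change LinearMap.single A Q j (LinearMap.single A Q j (p j) j) = _
          simp [summandIdempotent])
      | succ r ih =>
        intro j
        rw [pow_succ', pow_succ']
        exact ((ih j).map Y.σ).trans (hπ _)
    -- The period is multiplied by the order of `π`, so that the new automorphism fixes all classes.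
    have hr : 0 < orderOf π := orderOf_pos π
    obtain ⟨Y₂, hY₂⟩ := exists_truncatedResolution_of_exactRes
      (Nat.mul_pos hr Y.one_le) (Y.exactRes_pow (orderOf π))
    have hp : PreservesMultiplicities Q m Y₂.σ := by
      rw [hY₂]
      refine (PreservesMultiplicities.of_perm Q hiso (hpow (orderOf π))).2 fun j => ?_
      rw [pow_orderOf_eq_one]
      rfl
    obtain ⟨Y', -⟩ := exists_truncatedResolution_of_preservesMultiplicities Q hQ hiso hm Y₂ hp
    exact ⟨_, ⟨Y'⟩⟩
  · rintro ⟨n, ⟨Y'⟩⟩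
    obtain ⟨Y, -⟩ := exists_truncatedResolution_of_multiplicities Q hQ hiso hm Y'
    exact ⟨n, ⟨Y⟩⟩

/-! ### Corners defined by central idempotents, and tensor products -/

section CentralCorner

variable {k A B : Type u} [Field k] [Ring A] [Algebra k A] [Ring B] [Algebra k B]

/-- The maps that define morphisms `L ⊗_R V ⟶ W` of left modules. -/
structure IsBalancedBilinear {L : BimodCat k B A} {V : ModuleCat.{u} A} {W : ModuleCat.{u} B}
    (T : L → V → W) : Prop where
  add_left : ∀ l l' v, T (l + l') v = T l v + T l' v
  add_right : ∀ l v v', T l (v + v') = T l v + T l v'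
  balanced : ∀ l (a : A) v, T (op a • l) v = T l (a • v)
  smul : ∀ (b : B) l v, T (b • l) v = b • T l v

/-- The morphism `L ⊗_R V ⟶ W` defined by a balanced bilinear map. -/
def moduleTensorDesc {L : BimodCat k B A} {V : ModuleCat.{u} A} {W : ModuleCat.{u} B}
    (T : L → V → W) (hT : IsBalancedBilinear T) : tensorObj L V ⟶ W :=
  letI : Module k W := Module.compHom W (algebraMap k B)
  have hl : ∀ (a : k) (l : L) (v : V), T (a • l) v = a • T l v := fun a l v => by
    rw [← algebraMap_smul B a l, hT.smul]
    rfl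
  have hr : ∀ (a : k) (l : L) (v : V), T l (a • v) = a • T l v := fun a l v => by
    rw [← algebraMap_smul A a v, ← hT.balanced, ← hl, ← algebraMap_smul Aᵐᵒᵖ a l]
    rfl
  let f : BalancedTensor k A L V →ₗ[k] W := BalancedTensor.lift
    (LinearMap.mk₂ k T hT.add_left hl hT.add_right hr) hT.balanced
  have hf : ∀ l v, f (BalancedTensor.tmul k A l v) = T l v := fun l v =>
    BalancedTensor.lift_tmul (R := A) _ _ l v
  moduleHomMk (V := tensorObj L V)
    { toFun := fun z => f z
      map_zero' := map_zero f
      map_add' := fun x y => map_add f x y }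
    (fun b z => by
      induction z using tensorObj_induction with
      | h0 => rw [smul_zero, map_zero, smul_zero]
      | ht l n =>
        rw [smul_tmul]
        exact (hf _ _).trans ((hT.smul b l n).trans (congrArg (fun t => b • t) (hf l n)).symm)
      | ha x y hx hy => rw [smul_add, map_add, map_add, smul_add, hx, hy])

lemma moduleTensorDesc_tmul {L : BimodCat k B A} {V : ModuleCat.{u} A} {W : ModuleCat.{u} B}
    (T : L → V → W) (hT : IsBalancedBilinear T) (l : L) (v : V) :
    (moduleTensorDesc T hT).hom (tmul L V l v) = T l v :=
  letI : Module k W := Module.compHom W (algebraMap k B)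
  BalancedTensor.lift_tmul (R := A) (LinearMap.mk₂ k T hT.add_left (fun a l v => by
    rw [← algebraMap_smul B a l, hT.smul]
    rfl) hT.add_right (fun a l v => by
    have : a • l = op (algebraMap k A a) • l := (algebraMap_smul Aᵐᵒᵖ a l).symm
    rw [← algebraMap_smul A a v, ← hT.balanced, ← this, ← algebraMap_smul B a l, hT.smul]
    rfl)) hT.balanced l v

namespace CornerHom

variable (c : CornerHom k B A)

/-- The inclusion of `e V` in `V`. -/
def mval (V : ModuleCat.{u} A) : c.functor.obj V →+ V := (c.cornerSubgroup V).subtype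

lemma mval_injective (V : ModuleCat.{u} A) : Function.Injective (c.mval V) :=
  Subtype.val_injective

lemma mval_smul (V : ModuleCat.{u} A) (b : B) (v : c.functor.obj V) :
    c.mval V (b • v) = c.toFun b • c.mval V v := rfl

lemma e_smul_mval (V : ModuleCat.{u} A) (v : c.functor.obj V) : c.e • c.mval V v = c.mval V v :=
  c.mem_corner.1 v.2

/-- The projection of `V` to `e V`. -/
def mretr (V : ModuleCat.{u} A) : V →+ c.functor.obj V :=
  AddMonoidHom.mk' (fun v => ⟨c.e • v, c.e_smul_mem v⟩) fun _ _ => Subtype.ext (smul_add _ _ _)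

lemma mval_mretr (V : ModuleCat.{u} A) (v : V) : c.mval V (c.mretr V v) = c.e • v := rfl

lemma mretr_mval (V : ModuleCat.{u} A) (v : c.functor.obj V) : c.mretr V (c.mval V v) = v :=
  c.mval_injective V (c.e_smul_mval V v)

/-- The idempotent `e` is central. -/
def IsCentral : Prop := ∀ a, c.e * a = a * c.e

variable {c}

/-- The projection `A → e A e = e A` on the corner defined by a central idempotent is a
homomorphism. -/
def IsCentral.retrHom (hc : c.IsCentral) : A →ₐ[k] B := AlgHom.ofLinearMap c.retr
  (c.injective (by rw [c.toFun_retr, mul_one]; exact c.e_mul_e))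
  (fun a a' => c.injective (by
    rw [c.map_mul, c.toFun_retr', c.toFun_retr', c.toFun_retr', mul_assoc (c.e * a),
      ← mul_assoc c.e (c.e * a'), ← mul_assoc c.e c.e, c.e_mul_e, hc a']
    simp only [mul_assoc, c.e_mul_e]))

lemma IsCentral.toFun_retr (hc : c.IsCentral) (a : A) : c.toFun (c.retr a) = c.e * a := by
  rw [c.toFun_retr', mul_assoc, ← hc, ← mul_assoc, c.e_mul_e]

lemma IsCentral.mretr_smul (hc : c.IsCentral) (V : ModuleCat.{u} A) (a : A) (v : V) :
    c.mretr V (a • v) = c.retr a • c.mretr V v :=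
  c.mval_injective V (by
    rw [mval_smul, mval_mretr, mval_mretr, hc.toFun_retr, smul_smul, smul_smul, mul_assoc, ← hc,
      ← mul_assoc, c.e_mul_e])

end CornerHom

namespace CornerMap

variable {c : CornerHom k B A} {X' : BimodCat k B B} {X : BimodCat k A A} (ψ : CornerMap c X' X)

lemma retr_smul (hc : c.IsCentral) (a : A) (x : X) : ψ.retr (a • x) = c.retr a • ψ.retr x :=
  ψ.injective (by
    rw [ψ.left, ψ.toFun_retr, ψ.toFun_retr, hc.toFun_retr, ← smul_comm a, smul_smul, smul_smul,
      mul_assoc, ← hc, ← mul_assoc, c.e_mul_e])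

lemma retr_op_smul (hc : c.IsCentral) (a : A) (x : X) : ψ.retr (op a • x) = op (c.retr a) • ψ.retr x :=
  ψ.injective (by
    rw [ψ.right, ψ.toFun_retr, ψ.toFun_retr, hc.toFun_retr, ← smul_comm c.e (op (c.e * a)),
      smul_smul (op _), smul_smul (op _), ← op_mul, ← op_mul, hc, mul_assoc, ← hc, ← mul_assoc,
      c.e_mul_e])

variable (V : ModuleCat.{u} A)

lemma isBalancedBilinear_tensor : IsBalancedBilinear (L := X') (V := c.functor.obj V)
    (W := c.functor.obj (tensorObj X V))
    (fun x v => c.mretr _ (tmul X V (ψ.toFun x) (c.mval V v))) where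
  add_left l l' v := by rw [map_add, add_tmul, map_add]
  add_right l v v' := by rw [map_add, tmul_add, map_add]
  balanced l b v := by rw [ψ.right, tmul_balanced, c.mval_smul]
  smul b l v := c.mval_injective _ (by
    rw [c.mval_smul, c.mval_mretr, c.mval_mretr, ψ.left, smul_tmul, smul_tmul, smul_tmul, smul_smul,
      ψ.e_smul, c.e_mul])

/-- The map `X' ⊗ e V → e (X ⊗ V)`, where `X' = e X e`. -/
def tensorHom : tensorObj X' (c.functor.obj V) ⟶ c.functor.obj (tensorObj X V) :=
  moduleTensorDesc _ (ψ.isBalancedBilinear_tensor V)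

lemma mval_tensorHom (x : X') (v : c.functor.obj V) :
    c.mval _ ((ψ.tensorHom V).hom (tmul _ _ x v)) = tmul X V (ψ.toFun x) (c.mval V v) := by
  refine (congrArg (c.mval _)
    (moduleTensorDesc_tmul _ (ψ.isBalancedBilinear_tensor V) x v)).trans ?_
  rw [c.mval_mretr, smul_tmul, ψ.e_smul]

lemma isBalancedBilinear_tensorInv (hc : c.IsCentral) : IsBalancedBilinear (L := X) (V := V)
    (W := (ModuleCat.restrictScalars hc.retrHom.toRingHom).obj (tensorObj X' (c.functor.obj V)))
    (fun x v => tmul X' (c.functor.obj V) (ψ.retr x) (c.mretr V v)) where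
  add_left l l' v := by rw [map_add, add_tmul]; rfl
  add_right l v v' := by rw [map_add, tmul_add]; rfl
  balanced l b v := by rw [ψ.retr_op_smul hc, tmul_balanced, hc.mretr_smul]
  smul a l v := by
    rw [ψ.retr_smul hc, ← smul_tmul]
    rfl

/-- If `e` is central and `e X = X e`, then `e X ⊗ e V → e (X ⊗ V)` is bijective. -/
lemma tensorHom_bijective (hc : c.IsCentral) (hX : ∀ x : X, c.e • x = op c.e • x) :
    Function.Bijective (ψ.tensorHom V).hom := by
  -- the inverse `x ⊗ v ↦ e x e ⊗ e v`, which vanishes on `(1 - e) (X ⊗ V)`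
  let g := moduleTensorDesc _ (ψ.isBalancedBilinear_tensorInv V hc)
  have hg : ∀ x v, g.hom (tmul X V x v) = tmul X' (c.functor.obj V) (ψ.retr x) (c.mretr V v) :=
    moduleTensorDesc_tmul _ (ψ.isBalancedBilinear_tensorInv V hc)
  let g' : tensorObj X V →+ tensorObj X' (c.functor.obj V) :=
    { toFun := fun z => g.hom z, map_zero' := map_zero g.hom, map_add' := map_add g.hom }
  have h1 : ∀ z, g' (c.mval _ ((ψ.tensorHom V).hom z)) = z := fun z => by
    induction z using tensorObj_induction with
    | h0 => rw [map_zero, map_zero, map_zero]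
    | ht x v =>
      rw [mval_tensorHom]
      refine (hg _ _).trans ?_
      rw [ψ.retr_toFun, c.mretr_mval]
    | ha x y hx hy => rw [map_add, map_add, map_add, hx, hy]
  have h2 : ∀ z, c.mval _ ((ψ.tensorHom V).hom (g' z)) = c.e • z := fun z => by
    induction z using tensorObj_induction with
    | h0 => rw [map_zero, map_zero, map_zero, smul_zero]
    | ht x v =>
      refine (congrArg (fun t => c.mval _ ((ψ.tensorHom V).hom t)) (hg x v)).trans ?_
      rw [mval_tensorHom, ψ.toFun_retr, c.mval_mretr, ← tmul_balanced,
        ← hX (c.e • op c.e • x), ← hX x, smul_smul, c.e_mul_e, smul_smul, c.e_mul_e, smul_tmul]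
    | ha x y hx hy => rw [map_add, map_add, map_add, hx, hy, smul_add]
  refine ⟨Function.LeftInverse.injective (g := fun z => g' (c.mval _ z)) h1, fun w => ?_⟩
  exact ⟨g' (c.mval _ w), c.mval_injective _ (by rw [h2, c.e_smul_mval])⟩

end CornerMap

/-! ### Tensor products of complexes and central idempotents -/

section Complexes

variable {c : CornerHom k B A}

/-- Componentwise identifications of a complex `X'` of bimodules over `B = e A e` with `e X e`. -/
structure ComplexCornerMap (c : CornerHom k B A) (X' : CochainComplex (BimodCat k B B) ℤ)
    (X : CochainComplex (BimodCat k A A) ℤ) where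
  /-- The components. -/
  map : ∀ p, CornerMap c (X'.X p) (X.X p)
  comm : ∀ p q x, (map q).toFun ((X'.d p q).hom x) = (X.d p q).hom ((map p).toFun x)

variable {X' : CochainComplex (BimodCat k B B) ℤ} {X : CochainComplex (BimodCat k A A) ℤ}
  (ψ : ComplexCornerMap c X' X) (V : CochainComplex (ModuleCat.{u} A) ℤ)

/-- The functor `V ↦ e V` on complexes. -/
abbrev cornerComplex (c : CornerHom k B A) :
    CochainComplex (ModuleCat.{u} A) ℤ ⥤ CochainComplex (ModuleCat.{u} B) ℤ :=
  c.functor.mapHomologicalComplex (ComplexShape.up ℤ)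

/-- The inclusion of `X'^p ⊗ e V^q` in `(X' ⊗ e V)^n`. -/
def ιC (p q n : ℤ) (h : p + q = n) : tensorObj (X'.X p) (c.functor.obj (V.X q)) ⟶
    ((tensorComplex X').obj ((cornerComplex c).obj V)).X n :=
  ιT X' ((cornerComplex c).obj V) p q n h

/-- The projection of `(X' ⊗ e V)^n` on `X'^p ⊗ e V^q`. -/
def πC (p q n : ℤ) (h : p + q = n) : ((tensorComplex X').obj ((cornerComplex c).obj V)).X n ⟶
    tensorObj (X'.X p) (c.functor.obj (V.X q)) :=
  πT X' ((cornerComplex c).obj V) p q n h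

lemma corner_hom_ext {n : ℤ} {Z : ModuleCat.{u} B}
    {f g : ((tensorComplex X').obj ((cornerComplex c).obj V)).X n ⟶ Z}
    (h : ∀ p q (hpq : p + q = n) z, f.hom ((ιC (X' := X') V p q n hpq).hom z) =
      g.hom ((ιC (X' := X') V p q n hpq).hom z)) : f = g :=
  total_hom_ext X' ((cornerComplex c).obj V) fun p q hpq =>
    ModuleCat.hom_ext (LinearMap.ext (h p q hpq))

lemma πC_ιC_self (p q n : ℤ) (h : p + q = n) (z : tensorObj (X'.X p) (c.functor.obj (V.X q))) :
    (πC V p q n h).hom ((ιC V p q n h).hom z) = z :=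
  π_ι_apply_self X' ((cornerComplex c).obj V) p q n h z

lemma πC_ιC_of_ne (p q p' q' n : ℤ) (h : p + q = n) (h' : p' + q' = n) (hp : p ≠ p')
    (z : tensorObj (X'.X p) (c.functor.obj (V.X q))) :
    (πC (X' := X') V p' q' n h').hom ((ιC V p q n h).hom z) = 0 :=
  π_ι_apply_of_ne X' ((cornerComplex c).obj V) p q p' q' n h h' hp z

lemma sum_ιC_πC {a b : ℤ} (hX : ∀ i, (i < a ∨ b < i) → Subsingleton (X'.X i)) (n : ℤ)
    (z : ((tensorComplex X').obj ((cornerComplex c).obj V)).X n) :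
    ∑ p ∈ Finset.Icc a b, (ιC V p (n - p) n (by omega)).hom
      ((πC V p (n - p) n (by omega)).hom z) = z :=
  sum_ι_π X' ((cornerComplex c).obj V) hX n z

lemma d_ιC_apply (p p' q q' n n' : ℤ) (h : p + q = n) (hp : p + 1 = p') (hq : q + 1 = q')
    (hn : n + 1 = n') (z : tensorObj (X'.X p) (c.functor.obj (V.X q))) :
    (((tensorComplex X').obj ((cornerComplex c).obj V)).d n n').hom ((ιC V p q n h).hom z) =
      (ιC V p' q n' (by omega)).hom ((tensorMap (X'.d p p') (𝟙 _)).hom z) +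
      p.negOnePow • (ιC V p q' n' (by omega)).hom
        ((tensorMap (𝟙 _) (c.functor.map (V.d q q'))).hom z) :=
  d_ι_apply X' ((cornerComplex c).obj V) p p' q q' n n' h hp hq hn z

lemma map_ιC_apply {V W : CochainComplex (ModuleCat.{u} A) ℤ} (φ : V ⟶ W) (p q n : ℤ)
    (h : p + q = n) (z : tensorObj (X'.X p) (c.functor.obj (V.X q))) :
    (((tensorComplex X').map ((cornerComplex c).map φ)).f n).hom ((ιC V p q n h).hom z) =
      (ιC W p q n h).hom ((tensorMap (𝟙 _) (c.functor.map (φ.f q))).hom z) :=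
  map_ι_apply X' ((cornerComplex c).map φ) p q n h z

namespace ComplexCornerMap

/-- The components of the map `X' ⊗ e V → e (X ⊗ V)`. -/
def totalHom (n : ℤ) : ((tensorComplex X').obj ((cornerComplex c).obj V)).X n ⟶
    c.functor.obj (((tensorComplex X).obj V).X n) :=
  HomologicalComplex.mapBifunctorDesc (K₁ := X') (K₂ := (cornerComplex c).obj V)
    (F := tensorFunctor k B B) (c := ComplexShape.up ℤ) (j := n)
    fun p q (h : p + q = n) => (ψ.map p).tensorHom (V.X q) ≫ c.functor.map (ιT X V p q n h)

lemma totalHom_ι_apply (p q n : ℤ) (h : p + q = n)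
    (z : tensorObj (X'.X p) (c.functor.obj (V.X q))) :
    c.mval _ ((ψ.totalHom V n).hom ((ιC V p q n h).hom z)) =
      (ιT X V p q n h).hom (c.mval _ (((ψ.map p).tensorHom (V.X q)).hom z)) :=
  congrArg (fun f => c.mval _ (f.hom z))
    (HomologicalComplex.ι_mapBifunctorDesc (K₁ := X') (K₂ := (cornerComplex c).obj V)
      (F := tensorFunctor k B B) (c := ComplexShape.up ℤ) (j := n)
      (fun p q (h : p + q = n) => (ψ.map p).tensorHom (V.X q) ≫ c.functor.map (ιT X V p q n h))
      p q h)

lemma tensorHom_d_left (p p' q : ℤ) (z : tensorObj (X'.X p) (c.functor.obj (V.X q))) :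
    c.mval _ (((ψ.map p').tensorHom (V.X q)).hom ((tensorMap (X'.d p p') (𝟙 _)).hom z)) =
      (tensorMap (X.d p p') (𝟙 _)).hom (c.mval _ (((ψ.map p).tensorHom (V.X q)).hom z)) := by
  induction z using tensorObj_induction with
  | h0 => simp only [map_zero]
  | ht x v =>
    rw [tensorMap_tmul, CornerMap.mval_tensorHom, CornerMap.mval_tensorHom, tensorMap_tmul, ψ.comm]
    rfl
  | ha x y hx hy => simp only [map_add, hx, hy]

lemma tensorHom_map_right {V W : ModuleCat.{u} A} (f : V ⟶ W) (p : ℤ)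
    (z : tensorObj (X'.X p) (c.functor.obj V)) :
    c.mval _ (((ψ.map p).tensorHom W).hom ((tensorMap (𝟙 _) (c.functor.map f)).hom z)) =
      (tensorMap (𝟙 _) f).hom (c.mval _ (((ψ.map p).tensorHom V).hom z)) := by
  induction z using tensorObj_induction with
  | h0 => simp only [map_zero]
  | ht x v =>
    rw [tensorMap_tmul, CornerMap.mval_tensorHom, CornerMap.mval_tensorHom, tensorMap_tmul]
    rfl
  | ha x y hx hy => simp only [map_add, hx, hy]

lemma totalHom_comm (n n' : ℤ) (hn : n + 1 = n') :
    ψ.totalHom V n ≫ c.functor.map (((tensorComplex X).obj V).d n n') =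
      ((tensorComplex X').obj ((cornerComplex c).obj V)).d n n' ≫ ψ.totalHom V n' := by
  refine corner_hom_ext V fun p q hpq z => c.mval_injective _ ?_
  refine (congrArg (((tensorComplex X).obj V).d n n').hom
    (ψ.totalHom_ι_apply V p q n hpq z)).trans ?_
  rw [d_ι_apply X V p (p + 1) q (q + 1) n n' hpq rfl rfl hn, ← tensorHom_d_left,
    ← tensorHom_map_right, ← totalHom_ι_apply, ← totalHom_ι_apply]
  refine Eq.trans ?_ (congrArg (fun t => c.mval _ ((ψ.totalHom V n').hom t))
    (d_ιC_apply V p (p + 1) q (q + 1) n n' hpq rfl rfl hn z)).symm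
  rw [map_add, map_add, map_units_smul' (ψ.totalHom V n').hom]
  congr 1

lemma totalHom_naturality {V W : CochainComplex (ModuleCat.{u} A) ℤ} (f : V ⟶ W) (n : ℤ) :
    ((tensorComplex X').map ((cornerComplex c).map f)).f n ≫ ψ.totalHom W n =
      ψ.totalHom V n ≫ c.functor.map (((tensorComplex X).map f).f n) := by
  refine corner_hom_ext V fun p q hpq z => c.mval_injective _ ?_
  refine (congrArg (fun t => c.mval _ ((ψ.totalHom W n).hom t))
    (map_ιC_apply f p q n hpq z)).trans ?_
  refine Eq.trans ?_ (congrArg (((tensorComplex X).map f).f n).hom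
    (ψ.totalHom_ι_apply V p q n hpq z)).symm
  rw [totalHom_ι_apply, map_ι_apply, tensorHom_map_right]

/-- The map `X' ⊗ e V → e (X ⊗ V)`, as a natural transformation. -/
def totalNatTrans : cornerComplex c ⋙ tensorComplex X' ⟶ tensorComplex X ⋙ cornerComplex c where
  app V :=
    { f := ψ.totalHom V
      comm' := fun n n' hn => ψ.totalHom_comm V n n' hn }
  naturality V W f := by
    ext n : 1
    exact ψ.totalHom_naturality f n

lemma totalHom_π_apply (p q n : ℤ) (h : p + q = n)
    (z : ((tensorComplex X').obj ((cornerComplex c).obj V)).X n) :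
    (πT X V p q n h).hom (c.mval _ ((ψ.totalHom V n).hom z)) =
      c.mval _ (((ψ.map p).tensorHom (V.X q)).hom ((πC V p q n h).hom z)) := by
  have : ψ.totalHom V n ≫ c.functor.map (πT X V p q n h) =
      πC V p q n h ≫ (ψ.map p).tensorHom (V.X q) := by
    refine corner_hom_ext V fun p' q' h' z => c.mval_injective _ ?_
    refine (congrArg (πT X V p q n h).hom (ψ.totalHom_ι_apply V p' q' n h' z)).trans ?_
    change _ = c.mval _ (((ψ.map p).tensorHom (V.X q)).hom
      ((πC V p q n h).hom ((ιC V p' q' n h').hom z)))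
    by_cases hp : p' = p
    · subst hp
      obtain rfl : q' = q := by omega
      rw [π_ι_apply_self, πC_ιC_self]
    · rw [π_ι_apply_of_ne X V _ _ _ _ _ _ _ hp, πC_ιC_of_ne V _ _ _ _ _ _ _ hp, map_zero, map_zero]
  exact congrArg (fun f => c.mval _ (f.hom z)) this

lemma totalHom_bijective (hc : c.IsCentral) (hX : ∀ p, ∀ x : X.X p, c.e • x = op c.e • x)
    (hb : IsBounded X) (hb' : IsBounded X') (n : ℤ) :
    Function.Bijective (ψ.totalHom V n).hom := by
  have hψ := fun p q => (ψ.map p).tensorHom_bijective (V.X q) hc (hX p)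
  constructor
  · rw [injective_iff_map_eq_zero]
    intro z hz
    obtain ⟨a, b, hab⟩ := hb'
    rw [← sum_ιC_πC V hab n z]
    refine Finset.sum_eq_zero fun p _ => ?_
    have h1 := ψ.totalHom_π_apply V p (n - p) n (by omega) z
    rw [hz, map_zero, map_zero] at h1
    have h2 : ((ψ.map p).tensorHom (V.X (n - p))).hom ((πC V p (n - p) n (by omega)).hom z) = 0 :=
      c.mval_injective _ (by rw [← h1, map_zero])
    have h3 := (map_eq_zero_iff _ (hψ p (n - p)).1).1 h2
    rw [h3, map_zero]
  · intro w
    obtain ⟨a, b, hab⟩ := hb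
    choose u hu using fun p => (hψ p (n - p)).2
      ((c.functor.map (πT X V p (n - p) n (by omega))).hom w)
    refine ⟨∑ p ∈ Finset.Icc a b, (ιC V p (n - p) n (by omega)).hom (u p),
      c.mval_injective _ ?_⟩
    rw [map_sum, map_sum]
    refine Eq.trans (Finset.sum_congr rfl fun p _ => ?_) (sum_ι_π X V hab n (c.mval _ w))
    rw [totalHom_ι_apply, hu]
    rfl

lemma totalNatTrans_isIso (hc : c.IsCentral) (hX : ∀ p, ∀ x : X.X p, c.e • x = op c.e • x)
    (hb : IsBounded X) (hb' : IsBounded X') : IsIso ψ.totalNatTrans := by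
  have : ∀ V, IsIso (ψ.totalNatTrans.app V) := fun V => by
    have : ∀ n, IsIso ((ψ.totalNatTrans.app V).f n) := fun n =>
      (isoOfBijective (ψ.totalHom V n) (ψ.totalHom_bijective V hc hX hb hb' n)).isIso_hom
    exact HomologicalComplex.Hom.isIso_of_components _
  exact NatIso.isIso_of_isIso_app _

/-- If `e` is central and `X' = e X = X e`, then `X' ⊗ e V ≅ e (X ⊗ V)`. -/
def totalIso (hc : c.IsCentral) (hX : ∀ p, ∀ x : X.X p, c.e • x = op c.e • x)
    (hb : IsBounded X) (hb' : IsBounded X') :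
    cornerComplex c ⋙ tensorComplex X' ≅ tensorComplex X ⋙ cornerComplex c :=
  have := ψ.totalNatTrans_isIso hc hX hb hb'
  asIso ψ.totalNatTrans

end ComplexCornerMap

end Complexes

end CentralCorner

/-! ### The functor `V ↦ e V` as a tensor product, for a central idempotent `e` -/

section CornerTensor

variable {k A B : Type u} [Field k] [Ring A] [Algebra k A] [Ring B] [Algebra k B]

/-- The identification of `viaAlgHoms f g` with the underlying algebra. -/
def viaEquiv {C D S : Type u} [Ring C] [Algebra k C] [Ring D] [Algebra k D] [Ring S] [Algebra k S]
    (f : C →ₐ[k] S) (g : D →ₐ[k] S) : viaAlgHoms f g ≃+ S :=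
  BimodCat.ofActionsEquiv _ _ _ _

lemma viaEquiv_left {C D S : Type u} [Ring C] [Algebra k C] [Ring D] [Algebra k D] [Ring S]
    [Algebra k S] (f : C →ₐ[k] S) (g : D →ₐ[k] S) (x : C) (m : viaAlgHoms f g) :
    viaEquiv f g (x • m) = f x * viaEquiv f g m := BimodCat.ofActionsEquiv_left _ _ _ _ _ _

lemma viaEquiv_right {C D S : Type u} [Ring C] [Algebra k C] [Ring D] [Algebra k D] [Ring S]
    [Algebra k S] (f : C →ₐ[k] S) (g : D →ₐ[k] S) (x : D) (m : viaAlgHoms f g) :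
    viaEquiv f g (op x • m) = viaEquiv f g m * g x := BimodCat.ofActionsEquiv_right _ _ _ _ _ _

/-- The bimodule `B` through `ρ : A → B`, as a complex concentrated in degree `0`. -/
abbrev singleVia (ρ : A →ₐ[k] B) : CochainComplex (BimodCat k B A) ℤ :=
  (HomologicalComplex.single (BimodCat k B A) (ComplexShape.up ℤ) 0).obj
    (viaAlgHoms (AlgHom.id k B) ρ)

/-- The identification of the term of degree `0` of `singleVia ρ` with `B`. -/
def singleViaEquiv (ρ : A →ₐ[k] B) : (singleVia ρ).X 0 ≃+ B :=
  (HomologicalComplex.singleObjXSelf (ComplexShape.up ℤ) 0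
    (viaAlgHoms (AlgHom.id k B) ρ)).toLinearEquiv.toAddEquiv.trans (viaEquiv _ _)

variable (ρ : A →ₐ[k] B)

lemma singleViaEquiv_left (b : B) (m : (singleVia ρ).X 0) :
    singleViaEquiv ρ (b • m) = b * singleViaEquiv ρ m :=
  (congrArg (viaEquiv _ _) (BimodCat.hom_left (HomologicalComplex.singleObjXSelf
    (ComplexShape.up ℤ) 0 (viaAlgHoms (AlgHom.id k B) ρ)).hom b m)).trans
      (viaEquiv_left (AlgHom.id k B) ρ b _)

lemma singleViaEquiv_right (a : A) (m : (singleVia ρ).X 0) :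
    singleViaEquiv ρ (op a • m) = singleViaEquiv ρ m * ρ a :=
  (congrArg (viaEquiv _ _) (BimodCat.hom_right (HomologicalComplex.singleObjXSelf
    (ComplexShape.up ℤ) 0 (viaAlgHoms (AlgHom.id k B) ρ)).hom (op a) m)).trans
      (viaEquiv_right (AlgHom.id k B) ρ a _)

lemma singleViaEquiv_symm_left (b b' : B) :
    b • (singleViaEquiv ρ).symm b' = (singleViaEquiv ρ).symm (b * b') :=
  (singleViaEquiv ρ).injective (by rw [singleViaEquiv_left, AddEquiv.apply_symm_apply,
    AddEquiv.apply_symm_apply])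

lemma singleViaEquiv_symm_right (a : A) (b' : B) :
    op a • (singleViaEquiv ρ).symm b' = (singleViaEquiv ρ).symm (b' * ρ a) :=
  (singleViaEquiv ρ).injective (by rw [singleViaEquiv_right, AddEquiv.apply_symm_apply,
    AddEquiv.apply_symm_apply])

namespace CornerHom

variable {c : CornerHom k B A} {ρ}

lemma isBalancedBilinear_action {ρ : A →ₐ[k] B} (hc : c.IsCentral) (hρ : ∀ a, ρ a = c.retr a)
    (V : ModuleCat.{u} A) :
    IsBalancedBilinear (L := (singleVia ρ).X 0) (V := V) (W := c.functor.obj V)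
      (fun l v => singleViaEquiv ρ l • c.mretr V v) where
  add_left l l' v := by rw [map_add, add_smul]
  add_right l v v' := by rw [map_add, smul_add]
  balanced l a v := by rw [singleViaEquiv_right, hc.mretr_smul, mul_smul, hρ]
  smul b l v := by rw [singleViaEquiv_left, mul_smul]

/-- The map `e V → B ⊗_A V`, `v ↦ 1 ⊗ v`. -/
def toTensor (hρ : ∀ a, ρ a = c.retr a) (V : ModuleCat.{u} A) :
    c.functor.obj V ⟶ tensorObj ((singleVia ρ).X 0) V :=
  moduleHomMk (V := c.functor.obj V) (W := tensorObj ((singleVia ρ).X 0) V)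
    (AddMonoidHom.mk' (fun v => tmul ((singleVia ρ).X 0) V ((singleViaEquiv ρ).symm 1) (c.mval V v))
      fun v v' => by rw [map_add, tmul_add])
    fun b v => by
      change tmul _ _ _ (c.mval V (b • v)) = b • tmul _ _ _ _
      rw [c.mval_smul, ← tmul_balanced, smul_tmul, singleViaEquiv_symm_right,
        singleViaEquiv_symm_left, one_mul, mul_one, hρ, c.retr_toFun]

lemma toTensor_apply (hρ : ∀ a, ρ a = c.retr a) (V : ModuleCat.{u} A) (v : c.functor.obj V) :
    (toTensor hρ V).hom v = tmul ((singleVia ρ).X 0) V ((singleViaEquiv ρ).symm 1) (c.mval V v) :=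
  rfl

lemma toTensor_bijective (hc : c.IsCentral) (hρ : ∀ a, ρ a = c.retr a) (V : ModuleCat.{u} A) :
    Function.Bijective (toTensor hρ V).hom := by
  constructor
  · refine Function.LeftInverse.injective
      (g := (moduleTensorDesc _ (isBalancedBilinear_action hc hρ V)).hom) fun v => ?_
    rw [toTensor_apply]
    refine (moduleTensorDesc_tmul _ (isBalancedBilinear_action hc hρ V) _ _).trans ?_
    rw [AddEquiv.apply_symm_apply, one_smul, c.mretr_mval]
  · intro z
    induction z using tensorObj_induction with
    | h0 => exact ⟨0, map_zero _⟩
    | ht l v =>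
      refine ⟨singleViaEquiv ρ l • c.mretr V v, ?_⟩
      refine (map_smul (toTensor hρ V).hom _ _).trans ?_
      rw [toTensor_apply, c.mval_mretr, smul_tmul, ← tmul_balanced, singleViaEquiv_symm_left,
        singleViaEquiv_symm_right, mul_one, hρ]
      have : c.retr c.e = 1 := c.retr_toFun 1
      rw [this, mul_one, AddEquiv.symm_apply_apply]
    | ha x y hx hy =>
      obtain ⟨x', rfl⟩ := hx
      obtain ⟨y', rfl⟩ := hy
      exact ⟨x' + y', map_add _ _ _⟩

/-- The components of the map of complexes `e V → B ⊗_A V`. -/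
def toTensorComplexHom (hρ : ∀ a, ρ a = c.retr a) (V : CochainComplex (ModuleCat.{u} A) ℤ) (n : ℤ) :
    c.functor.obj (V.X n) ⟶ ((tensorComplex (singleVia ρ)).obj V).X n :=
  toTensor hρ (V.X n) ≫ ιT (singleVia ρ) V 0 n n (zero_add n)

lemma toTensorComplexHom_comm (hρ : ∀ a, ρ a = c.retr a) (V : CochainComplex (ModuleCat.{u} A) ℤ)
    (n n' : ℤ) (hn : n + 1 = n') :
    toTensorComplexHom hρ V n ≫ ((tensorComplex (singleVia ρ)).obj V).d n n' =
      c.functor.map (V.d n n') ≫ toTensorComplexHom hρ V n' := by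
  refine ModuleCat.hom_ext (LinearMap.ext fun v => ?_)
  refine (d_ι_apply (singleVia ρ) V 0 1 n n' n n' (zero_add n) rfl hn hn
    ((toTensor hρ (V.X n)).hom v)).trans ?_
  have h1 : Subsingleton ((singleVia ρ).X 1) := ModuleCat.subsingleton_of_isZero
    (HomologicalComplex.isZero_single_obj_X _ _ _ _ (by omega))
  rw [ιT_apply_eq_zero, zero_add, Int.negOnePow_zero, one_smul, toTensor_apply, tensorMap_tmul]
  rfl

/-- The map `e V → B ⊗_A V`, for complexes. -/
def toTensorComplex (hρ : ∀ a, ρ a = c.retr a) : cornerComplex c ⟶ tensorComplex (singleVia ρ) where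
  app V :=
    { f := toTensorComplexHom hρ V
      comm' := fun n n' hn => toTensorComplexHom_comm hρ V n n' hn }
  naturality V W f := by
    ext n : 1
    refine ModuleCat.hom_ext (LinearMap.ext fun v => ?_)
    refine Eq.trans ?_ (map_ι_apply (singleVia ρ) f 0 n n (zero_add n)
      ((toTensor hρ (V.X n)).hom v)).symm
    exact congrArg (ιT (singleVia ρ) W 0 n n (zero_add n)).hom (tensorMap_tmul
      (𝟙 ((singleVia ρ).X 0)) (f.f n) ((singleViaEquiv ρ).symm 1) (c.mval _ v)).symm

lemma toTensorComplex_isIso (hc : c.IsCentral) (hρ : ∀ a, ρ a = c.retr a) :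
    IsIso (toTensorComplex hρ) := by
  have : ∀ V, IsIso ((toTensorComplex hρ).app V) := fun V => by
    have : ∀ n, IsIso (((toTensorComplex hρ).app V).f n) := fun n => by
      have h : ∀ q (hq : 0 + q = n) x, (ιT (singleVia ρ) V 0 q n hq).hom
          ((πT (singleVia ρ) V 0 q n hq).hom x) = x := fun q hq x => by
        obtain rfl : q = n - 0 := by omega
        have := sum_ι_π (singleVia ρ) V (a := 0) (b := 0) (fun i hi =>
          ModuleCat.subsingleton_of_isZero
            (HomologicalComplex.isZero_single_obj_X _ _ _ _ (by omega))) n x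
        rwa [Finset.Icc_self, Finset.sum_singleton] at this
      have hb : Function.Bijective (toTensorComplexHom hρ V n).hom := by
        refine Function.Bijective.comp (g := (ιT (singleVia ρ) V 0 n n (zero_add n)).hom)
          ⟨?_, ?_⟩ (toTensor_bijective hc hρ (V.X n))
        · exact Function.LeftInverse.injective
            (π_ι_apply_self (singleVia ρ) V 0 n n (zero_add n))
        · exact Function.RightInverse.surjective (h n (zero_add n))
      exact (isoOfBijective (toTensorComplexHom hρ V n) hb).isIso_hom
    exact HomologicalComplex.Hom.isIso_of_components _
  exact NatIso.isIso_of_isIso_app _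

/-- For a central idempotent `e` with `B ≅ e A`, the functors `V ↦ e V` and `V ↦ B ⊗_A V` are
isomorphic. -/
def toTensorComplexIso (hc : c.IsCentral) (hρ : ∀ a, ρ a = c.retr a) :
    cornerComplex c ≅ tensorComplex (singleVia ρ) :=
  have := toTensorComplex_isIso hc hρ
  asIso (toTensorComplex hρ)

end CornerHom

end CornerTensor

/-! ### Compositions of derived tensor functors -/

section Composition

variable {k R B C D : Type u} [Field k] [Ring R] [Algebra k R] [Ring B] [Algebra k B]
  [Ring C] [Algebra k C] [Ring D] [Algebra k D] [Module.Finite k R] [Module.Finite k B]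
  [Module.Finite k C] [Module.Finite k D]

/-- The derived functor `Y ⊗ (X ⊗ -)` is induced by the functor `Y ⊗ (X ⊗ -)` on complexes. -/
@[reducible]
def compLifting {X : CochainComplex (BimodCat k B R) ℤ} (hX : IsTensorable X)
    {Y : CochainComplex (BimodCat k C B) ℤ} (hY : IsTensorable Y) :
    Localization.Lifting (quasiIsos R).Q (quasiIsos R)
      (boundedTensor X hX ⋙ boundedTensor Y hY ⋙ (quasiIsos C).Q)
      (derivedTensor X hX ⋙ derivedTensor Y hY) :=
  let h1 : Localization.Lifting (quasiIsos R).Q (quasiIsos R)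
      (boundedTensor X hX ⋙ (quasiIsos B).Q) (derivedTensor X hX) :=
    Localization.liftingConstructionLift _ _
  let h2 : Localization.Lifting (quasiIsos B).Q (quasiIsos B)
      (boundedTensor Y hY ⋙ (quasiIsos C).Q) (derivedTensor Y hY) :=
    Localization.liftingConstructionLift _ _
  ⟨(Functor.associator _ _ _).symm ≪≫ Functor.isoWhiskerRight h1.iso (derivedTensor Y hY) ≪≫
    Functor.associator _ _ _ ≪≫ Functor.isoWhiskerLeft (boundedTensor X hX) h2.iso⟩

lemma derivedTensor_comp_iso {X : CochainComplex (BimodCat k B R) ℤ} (hX : IsTensorable X)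
    {Y : CochainComplex (BimodCat k C B) ℤ} (hY : IsTensorable Y)
    {X' : CochainComplex (BimodCat k D R) ℤ} (hX' : IsTensorable X')
    {Y' : CochainComplex (BimodCat k C D) ℤ} (hY' : IsTensorable Y')
    (η : tensorComplex X ⋙ tensorComplex Y ≅ tensorComplex X' ⋙ tensorComplex Y') :
    Nonempty (derivedTensor X hX ⋙ derivedTensor Y hY ≅
      derivedTensor X' hX' ⋙ derivedTensor Y' hY') := by
  let t : boundedTensor X hX ⋙ boundedTensor Y hY ≅ boundedTensor X' hX' ⋙ boundedTensor Y' hY' :=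
    NatIso.ofComponents (fun V => ObjectProperty.isoMk _ (η.app V.obj)) fun {V W} f => by
      ext1
      exact η.hom.naturality f.hom
  have h1 := compLifting hX hY
  have h2 := compLifting hX' hY'
  exact ⟨Localization.liftNatIso (quasiIsos R).Q (quasiIsos R)
    (boundedTensor X hX ⋙ boundedTensor Y hY ⋙ (quasiIsos C).Q)
    (boundedTensor X' hX' ⋙ boundedTensor Y' hY' ⋙ (quasiIsos C).Q) _ _
    ((Functor.associator _ _ _).symm ≪≫ Functor.isoWhiskerRight t (quasiIsos C).Q ≪≫
      Functor.associator _ _ _)⟩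

variable {c : CornerHom k B R}

/-- If `e` is a central idempotent with `B ≅ e R`, and `X` is a complex of `R`-bimodules with
`e X = X e = X'`, then `e (X ⊗ V) ≅ X' ⊗ e V` in the derived category. -/
lemma derivedTensor_corner_iso (hc : c.IsCentral) {ρ : R →ₐ[k] B} (hρ : ∀ a, ρ a = c.retr a)
    {X' : CochainComplex (BimodCat k B B) ℤ} {X : CochainComplex (BimodCat k R R) ℤ}
    (ψ : ComplexCornerMap c X' X) (he : ∀ p, ∀ x : X.X p, c.e • x = op c.e • x)
    (hX : IsTensorable X) (hX' : IsTensorable X') (hL : IsTensorable (singleVia ρ)) :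
    Nonempty (derivedTensor X hX ⋙ derivedTensor (singleVia ρ) hL ≅
      derivedTensor (singleVia ρ) hL ⋙ derivedTensor X' hX') :=
  let θ := CornerHom.toTensorComplexIso hc hρ
  derivedTensor_comp_iso _ _ _ _
    (Functor.isoWhiskerLeft (tensorComplex X) θ.symm ≪≫
      (ψ.totalIso hc he hX.bounded hX'.bounded).symm ≪≫
      Functor.isoWhiskerRight θ (tensorComplex X'))

end Composition

/-! ### Restriction of bimodules along an algebra homomorphism -/

section Restriction

variable {k A B : Type u} [Field k] [Ring A] [Algebra k A] [Ring B] [Algebra k B]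

/-- The homomorphism of enveloping algebras defined by a homomorphism of algebras. -/
def envelopingHom (ρ : A →ₐ[k] B) : A ⊗[k] Aᵐᵒᵖ →ₐ[k] B ⊗[k] Bᵐᵒᵖ :=
  Algebra.TensorProduct.map ρ (AlgHom.op ρ)

/-- The functor that restricts both actions on a bimodule along a homomorphism of algebras. -/
def resFunctor (ρ : A →ₐ[k] B) : BimodCat k B B ⥤ BimodCat k A A :=
  ModuleCat.restrictScalars (envelopingHom ρ).toRingHom

/-- The underlying additive group of the restriction of a bimodule. -/
def resEquiv (ρ : A →ₐ[k] B) (M : BimodCat k B B) : (resFunctor ρ).obj M ≃+ M := AddEquiv.refl M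

lemma resEquiv_left (ρ : A →ₐ[k] B) (M : BimodCat k B B) (a : A) (m : (resFunctor ρ).obj M) :
    resEquiv ρ M (a • m) = ρ a • resEquiv ρ M m := by
  change (envelopingHom ρ (a ⊗ₜ 1)) • resEquiv ρ M m = _
  rw [BimodCat.left_smul_def, envelopingHom, Algebra.TensorProduct.map_tmul]
  simp

lemma resEquiv_right (ρ : A →ₐ[k] B) (M : BimodCat k B B) (a : A) (m : (resFunctor ρ).obj M) :
    resEquiv ρ M (op a • m) = op (ρ a) • resEquiv ρ M m := by
  change (envelopingHom ρ (1 ⊗ₜ op a)) • resEquiv ρ M m = _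
  rw [BimodCat.right_smul_def, envelopingHom, Algebra.TensorProduct.map_tmul]
  simp

end Restriction

/-! ### The bimodules `P ⊗ Q ⊗ P^∨` and central idempotents -/

section CentralSandwich

variable {k A B P Q : Type u} [Field k] [Ring A] [Algebra k A] [Ring B] [Algebra k B]
  [AddCommGroup P] [Module k P] [Module A P] [IsScalarTower k A P]
  [AddCommGroup Q] [Module k Q] [Module B Q] [IsScalarTower k B Q]

lemma moduleSandwich_induction {X : BimodCat k (EndOp A P) (EndOp A P)}
    {p : (moduleSandwich k A P).obj X → Prop} (z : (moduleSandwich k A P).obj X) (h0 : p 0)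
    (ht : ∀ q x f, p (ptmul X q x f)) (ha : ∀ x y, p x → p y → p (x + y)) : p z := by
  refine BimodCat.tensor_induction (p := p) z h0 (fun w n => ?_) ha
  induction w using BimodCat.tensor_induction with
  | h0 =>
    have := BimodCat.add_tmul (BimodCat.tensor (moduleBimod k A P) X) (dualBimod k A P) 0 0 n
    rw [add_zero] at this
    rw [left_eq_add.1 this]
    exact h0
  | ht l x =>
    have := ht (moduleEquiv k A P l) x (dualEquiv k A P n)
    rw [ptmul, AddEquiv.symm_apply_apply, AddEquiv.symm_apply_apply] at this
    exact this
  | ha x y hx hy =>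
    rw [BimodCat.add_tmul]
    exact ha _ _ hx hy

/-- An identification of the `B`-module `Q` with `e P`, where `B` is identified with `e A e` for an
idempotent `e`. -/
structure ModuleCorner (c : CornerHom k B A) (Q P : Type u) [AddCommGroup P] [Module k P]
    [Module A P] [AddCommGroup Q] [Module k Q] [Module B Q] where
  /-- The inclusion `Q → P`. -/
  incl : Q →ₗ[k] P
  /-- The projection `P → Q`. -/
  proj : P →ₗ[k] Q
  proj_incl : ∀ q, proj (incl q) = q
  incl_proj : ∀ p, incl (proj p) = c.e • p
  incl_smul : ∀ (b : B) q, incl (b • q) = c.toFun b • incl q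

namespace CornerHom.IsCentral

variable {c : CornerHom k B A} (hc : c.IsCentral)

lemma retr_mul (hc : c.IsCentral) (a a' : A) : c.retr (a * a') = c.retr a * c.retr a' :=
  _root_.map_mul hc.retrHom a a'

lemma mul_toFun (hc : c.IsCentral) (a : A) (b : B) :
    a * c.toFun b = c.toFun (c.retr a * b) := by
  rw [c.map_mul, hc.toFun_retr, hc, mul_assoc, c.e_mul]

end CornerHom.IsCentral

lemma CornerHom.retr_e (c : CornerHom k B A) : c.retr c.e = 1 := c.retr_toFun 1

namespace ModuleCorner

variable {c : CornerHom k B A} (hc : c.IsCentral) (μ : ModuleCorner c Q P)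

lemma incl_injective (μ : ModuleCorner c Q P) : Function.Injective μ.incl :=
  Function.LeftInverse.injective μ.proj_incl

lemma e_smul_incl (μ : ModuleCorner c Q P) (q : Q) : c.e • μ.incl q = μ.incl q := by
  rw [CornerHom.e, ← μ.incl_smul, one_smul]

lemma proj_smul (hc : c.IsCentral) (μ : ModuleCorner c Q P) (a : A) (p : P) :
    μ.proj (a • p) = c.retr a • μ.proj p :=
  μ.incl_injective (by
    rw [μ.incl_smul, μ.incl_proj, μ.incl_proj, hc.toFun_retr, smul_smul, smul_smul, mul_assoc,
      ← hc, ← mul_assoc, c.e_mul_e])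

lemma proj_e_smul (hc : c.IsCentral) (μ : ModuleCorner c Q P) (p : P) :
    μ.proj (c.e • p) = μ.proj p := by
  rw [μ.proj_smul hc, c.retr_e, one_smul]

/-- The identification of the endomorphism algebra of `Q ≅ e P` with a corner of the endomorphism
algebra of `P`. -/
def endCorner (hc : c.IsCentral) (μ : ModuleCorner c Q P) :
    CornerHom k (EndOp B Q) (EndOp A P) where
  toFun :=
    { toFun := fun f => op
        { toFun := fun p => μ.incl (unop f (μ.proj p))
          map_add' := fun p p' => by rw [map_add, map_add, map_add]
          map_smul' := fun a p => by
            rw [μ.proj_smul hc, map_smul, μ.incl_smul, hc.toFun_retr, hc, mul_smul, μ.e_smul_incl]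
            rfl }
      map_add' := fun f f' => endOp_ext fun p => map_add μ.incl _ _
      map_smul' := fun t f => endOp_ext fun p => map_smul μ.incl t (unop f (μ.proj p)) }
  retr :=
    { toFun := fun g => op
        { toFun := fun q => μ.proj (unop g (μ.incl q))
          map_add' := fun q q' => by rw [map_add, map_add, map_add]
          map_smul' := fun b q => by
            rw [μ.incl_smul, map_smul, μ.proj_smul hc, c.retr_toFun]
            rfl }
      map_add' := fun f f' => endOp_ext fun q => map_add μ.proj _ _
      map_smul' := fun t f => endOp_ext fun q => map_smul μ.proj t (unop f (μ.incl q)) }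
  map_mul f f' := endOp_ext fun p => by
    change μ.incl (unop f' (unop f (μ.proj p))) =
      μ.incl (unop f' (μ.proj (μ.incl (unop f (μ.proj p)))))
    rw [μ.proj_incl]
  retr_toFun f := endOp_ext fun q => by
    change μ.proj (μ.incl (unop f (μ.proj (μ.incl q)))) = _
    rw [μ.proj_incl, μ.proj_incl]
  toFun_retr g := rfl

lemma unop_endCorner_e (hc : c.IsCentral) (μ : ModuleCorner c Q P) (p : P) :
    unop (μ.endCorner hc).e p = c.e • p := μ.incl_proj p

lemma unop_endCorner_retr (hc : c.IsCentral) (μ : ModuleCorner c Q P) (g : EndOp A P) (q : Q) :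
    unop ((μ.endCorner hc).retr g) q = μ.proj (unop g (μ.incl q)) := rfl

lemma unop_endCorner_toFun (hc : c.IsCentral) (μ : ModuleCorner c Q P) (f : EndOp B Q) (p : P) :
    unop ((μ.endCorner hc).toFun f) p = μ.incl (unop f (μ.proj p)) := rfl

lemma endCorner_isCentral (hc : c.IsCentral) (μ : ModuleCorner c Q P) :
    (μ.endCorner hc).IsCentral := fun g => endOp_ext fun p => by
  change unop g (unop (μ.endCorner hc).e p) = unop (μ.endCorner hc).e (unop g p)
  rw [unop_endCorner_e, unop_endCorner_e, map_smul]

/-- The map `Hom_B(e P, B) → Hom_A(P, A)`. -/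
def dualIncl (hc : c.IsCentral) (μ : ModuleCorner c Q P) (f : Q →ₗ[B] B) : P →ₗ[A] A where
  toFun p := c.toFun (f (μ.proj p))
  map_add' p p' := by simp only [map_add]
  map_smul' a p := by
    rw [μ.proj_smul hc, map_smul, smul_eq_mul, ← hc.mul_toFun]
    rfl

/-- The map `Hom_A(P, A) → Hom_B(e P, B)`. -/
def dualProj (hc : c.IsCentral) (μ : ModuleCorner c Q P) (g : P →ₗ[A] A) : Q →ₗ[B] B where
  toFun q := c.retr (g (μ.incl q))
  map_add' p p' := by simp only [map_add]
  map_smul' b q := by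
    rw [μ.incl_smul, map_smul, smul_eq_mul, hc.retr_mul, c.retr_toFun]
    rfl

variable {X' : BimodCat k (EndOp B Q) (EndOp B Q)} {X : BimodCat k (EndOp A P) (EndOp A P)}

/-- The image of `q ⊗ x ⊗ f` in `e P ⊗ X ⊗ P^∨ e`. -/
def sandwichFun (hc : c.IsCentral) (μ : ModuleCorner c Q P) (φ : CornerMap (μ.endCorner hc) X' X)
    (q : Q) (x : X') (f : Q →ₗ[B] B) :
    c.enveloping.functor.obj ((moduleSandwich k A P).obj X) :=
  (c.cornerMap _).retr (ptmul X (μ.incl q) (φ.toFun x) (μ.dualIncl hc f))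

lemma val_sandwichFun (hc : c.IsCentral) (μ : ModuleCorner c Q P)
    (φ : CornerMap (μ.endCorner hc) X' X) (q : Q) (x : X') (f : Q →ₗ[B] B) :
    c.val _ (μ.sandwichFun hc φ q x f) = ptmul X (μ.incl q) (φ.toFun x) (μ.dualIncl hc f) := by
  have h := isEndTrilinear_ptmul X
  refine ((c.cornerMap _).toFun_retr _).trans ?_
  rw [← h.right_smul, ← h.left_smul, μ.e_smul_incl]
  congr 1
  exact LinearMap.ext fun p => c.mul_e _

lemma isEndTrilinear_sandwichFun (hc : c.IsCentral) (μ : ModuleCorner c Q P)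
    (φ : CornerMap (μ.endCorner hc) X' X) : IsEndTrilinear (μ.sandwichFun hc φ) := by
  have h := isEndTrilinear_ptmul X
  refine ⟨fun l l' x n => c.val_injective _ ?_, fun l x x' n => c.val_injective _ ?_,
    fun l x n n' => c.val_injective _ ?_, fun l r x n => c.val_injective _ ?_,
    fun l x r n => c.val_injective _ ?_, fun b l x n => c.val_injective _ ?_,
    fun b l x n => c.val_injective _ ?_⟩
  · simp only [map_add, val_sandwichFun, h.add_left]
  · simp only [map_add, val_sandwichFun, h.add_mid]
  · rw [map_add, val_sandwichFun, val_sandwichFun, val_sandwichFun, ← h.add_right]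
    congr 1
    exact LinearMap.ext fun p => map_add c.toFun _ _
  · rw [val_sandwichFun, val_sandwichFun, φ.left, ← h.balanced_left, unop_endCorner_toFun,
      μ.proj_incl]
  · rw [val_sandwichFun, val_sandwichFun, φ.right, h.balanced_right]
    congr 1
    refine LinearMap.ext fun p => ?_
    change c.toFun (n (μ.proj (μ.incl (unop r (μ.proj p))))) = c.toFun (n (unop r (μ.proj p)))
    rw [μ.proj_incl]
  · rw [c.val_left, val_sandwichFun, val_sandwichFun, ← h.left_smul, μ.incl_smul]
  · rw [← op_unop b, c.val_right, val_sandwichFun, val_sandwichFun, ← h.right_smul]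
    congr 1
    exact LinearMap.ext fun p => c.map_mul _ _

/-- The map `e P ⊗ e X e ⊗ P^∨ e → e (P ⊗ X ⊗ P^∨) e`. -/
def sandwichHom (hc : c.IsCentral) (μ : ModuleCorner c Q P)
    (φ : CornerMap (μ.endCorner hc) X' X) : (moduleSandwich k B Q).obj X' ⟶
      c.enveloping.functor.obj ((moduleSandwich k A P).obj X) :=
  moduleSandwichDesc _ (μ.isEndTrilinear_sandwichFun hc φ)

lemma val_sandwichHom (hc : c.IsCentral) (μ : ModuleCorner c Q P)
    (φ : CornerMap (μ.endCorner hc) X' X) (q : Q) (x : X') (f : Q →ₗ[B] B) :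
    c.val _ ((μ.sandwichHom hc φ).hom (ptmul X' q x f)) =
      ptmul X (μ.incl q) (φ.toFun x) (μ.dualIncl hc f) :=
  (congrArg (c.val _) (moduleSandwichDesc_ptmul _ (μ.isEndTrilinear_sandwichFun hc φ) q x f)).trans
    (μ.val_sandwichFun hc φ q x f)

lemma isEndTrilinear_sandwichInv (hc : c.IsCentral) (μ : ModuleCorner c Q P)
    (φ : CornerMap (μ.endCorner hc) X' X) :
    IsEndTrilinear (W := (resFunctor hc.retrHom).obj ((moduleSandwich k B Q).obj X'))
      (fun p x g => (resEquiv hc.retrHom _).symm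
        (ptmul X' (μ.proj p) (φ.retr x) (μ.dualProj hc g))) := by
  have h := isEndTrilinear_ptmul X'
  have hc' := μ.endCorner_isCentral hc
  refine ⟨fun l l' x n => ?_, fun l x x' n => ?_, fun l x n n' => ?_, fun l r x n => ?_,
    fun l x r n => ?_, fun b l x n => ?_, fun b l x n => ?_⟩
  · simp only [map_add, h.add_left]
  · simp only [map_add, h.add_mid]
  · rw [← map_add, ← h.add_right]
    congr 2
    exact LinearMap.ext fun p => map_add c.retr _ _
  · congr 1
    rw [φ.retr_smul hc', ← h.balanced_left, unop_endCorner_retr, μ.incl_proj, map_smul,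
      μ.proj_e_smul hc]
  · congr 1
    rw [φ.retr_op_smul hc', h.balanced_right]
    congr 1
    refine LinearMap.ext fun q => ?_
    change c.retr (n (μ.incl (μ.proj (unop r (μ.incl q))))) = c.retr (n (unop r (μ.incl q)))
    rw [μ.incl_proj, map_smul, smul_eq_mul, hc.retr_mul, c.retr_e, one_mul]
  · refine (resEquiv hc.retrHom _).injective ?_
    rw [resEquiv_left, AddEquiv.apply_symm_apply, AddEquiv.apply_symm_apply, ← h.left_smul,
      μ.proj_smul hc]
    rfl
  · refine (resEquiv hc.retrHom _).injective ?_
    rw [← op_unop b, resEquiv_right, AddEquiv.apply_symm_apply, AddEquiv.apply_symm_apply,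
      ← h.right_smul]
    congr 1
    exact LinearMap.ext fun p => hc.retr_mul _ _

/-- If `e` is central then `e P ⊗ e X ⊗ P^∨ e ≅ e (P ⊗ X ⊗ P^∨)`, for a bimodule `X` with
`e X = X e`. -/
lemma sandwichHom_bijective (hc : c.IsCentral) (μ : ModuleCorner c Q P)
    (φ : CornerMap (μ.endCorner hc) X' X)
    (hX : ∀ x : X, (μ.endCorner hc).e • x = op (μ.endCorner hc).e • x) :
    Function.Bijective (μ.sandwichHom hc φ).hom := by
  have h := isEndTrilinear_ptmul X
  let g := moduleSandwichDesc _ (μ.isEndTrilinear_sandwichInv hc φ)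
  have hg : ∀ p x f, g.hom (ptmul X p x f) = (resEquiv hc.retrHom _).symm
      (ptmul X' (μ.proj p) (φ.retr x) (μ.dualProj hc f)) :=
    moduleSandwichDesc_ptmul _ (μ.isEndTrilinear_sandwichInv hc φ)
  let g' : (moduleSandwich k A P).obj X →+ (moduleSandwich k B Q).obj X' :=
    { toFun := fun z => resEquiv hc.retrHom _ (g.hom z)
      map_zero' := by rw [map_zero, map_zero]
      map_add' := fun z z' => by rw [map_add, map_add] }
  have hg' : ∀ p x f, g' (ptmul X p x f) = ptmul X' (μ.proj p) (φ.retr x) (μ.dualProj hc f) :=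
    fun p x f => (congrArg (resEquiv hc.retrHom _) (hg p x f)).trans
      (AddEquiv.apply_symm_apply _ _)
  have h1 : ∀ z, g' (c.val _ ((μ.sandwichHom hc φ).hom z)) = z := fun z => by
    induction z using moduleSandwich_induction with
    | h0 => simp only [map_zero]
    | ht q x f =>
      rw [val_sandwichHom, hg', μ.proj_incl, φ.retr_toFun]
      congr 1
      refine LinearMap.ext fun q => ?_
      change c.retr (c.toFun (f (μ.proj (μ.incl q)))) = f q
      rw [c.retr_toFun, μ.proj_incl]
    | ha x y hx hy => simp only [map_add, hx, hy]
  have h2 : ∀ z, c.val _ ((μ.sandwichHom hc φ).hom (g' z)) = c.e • op c.e • z := fun z => by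
    induction z using moduleSandwich_induction with
    | h0 => simp only [map_zero, smul_zero]
    | ht p x f =>
      rw [hg', val_sandwichHom, ← h.right_smul, ← h.left_smul, φ.toFun_retr, ← hX, smul_smul,
        CornerHom.e_mul_e, ← h.balanced_left, unop_endCorner_e, μ.incl_proj, smul_smul, c.e_mul_e]
      congr 1
      refine LinearMap.ext fun p => ?_
      change c.toFun (c.retr (f (μ.incl (μ.proj p)))) = f p * c.e
      rw [μ.incl_proj, map_smul, smul_eq_mul, hc.toFun_retr, ← mul_assoc, c.e_mul_e, hc]
    | ha x y hx hy => simp only [map_add, hx, hy, smul_add]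
  refine ⟨Function.LeftInverse.injective (g := fun z => g' (c.val _ z)) h1, fun w => ?_⟩
  exact ⟨g' (c.val _ w), c.val_injective _ (by rw [h2, c.e_smul_val])⟩

lemma sandwich_central (hc : c.IsCentral) (μ : ModuleCorner c Q P)
    (hX : ∀ x : X, (μ.endCorner hc).e • x = op (μ.endCorner hc).e • x)
    (z : (moduleSandwich k A P).obj X) : c.e • z = op c.e • z := by
  have h := isEndTrilinear_ptmul X
  induction z using moduleSandwich_induction with
  | h0 => simp only [smul_zero]
  | ht p x f =>
    rw [← h.left_smul, ← h.right_smul, ← μ.unop_endCorner_e hc, h.balanced_left, hX,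
      h.balanced_right]
    congr 1
    refine LinearMap.ext fun p => ?_
    change f (unop (μ.endCorner hc).e p) = f p * c.e
    rw [unop_endCorner_e, map_smul, smul_eq_mul, hc]
  | ha x y hx hy => simp only [smul_add, hx, hy]

end ModuleCorner

end CentralSandwich

/-! ### Periodic twists and central idempotents -/

section CentralTwist

/-- The isomorphism of mapping cones defined by an isomorphism of maps. -/
def mappingConeIso {C : Type*} [Category* C] [Preadditive C] [Limits.HasBinaryBiproducts C]
    {K K' L L' : CochainComplex C ℤ} (g : K ⟶ L) (g' : K' ⟶ L') (a : K ≅ K') (b : L ≅ L')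
    (h : g ≫ b.hom = a.hom ≫ g') :
    CochainComplex.mappingCone g ≅ CochainComplex.mappingCone g' where
  hom := CochainComplex.mappingCone.map g g' a.hom b.hom h
  inv := CochainComplex.mappingCone.map g' g a.inv b.inv (by
    rw [Iso.eq_inv_comp, ← Category.assoc, ← h, Category.assoc, Iso.hom_inv_id, Category.comp_id])
  hom_inv_id := by
    rw [← CochainComplex.mappingCone.map_comp, ← CochainComplex.mappingCone.map_id]
    congr 1 <;> simp
  inv_hom_id := by
    rw [← CochainComplex.mappingCone.map_comp, ← CochainComplex.mappingCone.map_id]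
    congr 1 <;> simp

variable {k A B P Q : Type u} [Field k] [Ring A] [Algebra k A] [Ring B] [Algebra k B]
  [AddCommGroup P] [Module k P] [Module A P] [IsScalarTower k A P]
  [AddCommGroup Q] [Module k Q] [Module B Q] [IsScalarTower k B Q]

/-- The functor `M ↦ e M e` on complexes of bimodules. -/
abbrev bimodCornerComplex (c : CornerHom k B A) :
    CochainComplex (BimodCat k A A) ℤ ⥤ CochainComplex (BimodCat k B B) ℤ :=
  c.enveloping.functor.mapHomologicalComplex (ComplexShape.up ℤ)

/-- An isomorphism `X' ≅ e X e`, as a family of componentwise identifications. -/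
def ComplexCornerMap.ofIso {c : CornerHom k B A} {X' : CochainComplex (BimodCat k B B) ℤ}
    {X : CochainComplex (BimodCat k A A) ℤ} (θ : X' ≅ (bimodCornerComplex c).obj X) :
    ComplexCornerMap c X' X :=
  have hθ : ∀ p, Function.Bijective (θ.hom.f p).hom := fun p =>
    (ConcreteCategory.isIso_iff_bijective (θ.hom.f p)).1 inferInstance
  { map := fun p =>
      { toFun := (c.val (X.X p)).comp (θ.hom.f p).hom.toAddMonoidHom
        left := fun x m => (congrArg (c.val (X.X p)) (BimodCat.hom_left (θ.hom.f p) x m)).trans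
          (c.val_left _ _ _)
        right := fun x m =>
          (congrArg (c.val (X.X p)) (BimodCat.hom_right (θ.hom.f p) (op x) m)).trans
            (c.val_right _ _ _)
        injective := (c.val_injective (X.X p)).comp (hθ p).1
        surjective := fun m => by
          obtain ⟨m₀, h₀⟩ := c.exists_val (X.X p) m
          obtain ⟨m₁, rfl⟩ := (hθ p).2 m₀
          exact ⟨m₁, h₀⟩ }
    comm := fun p q x => congrArg (c.val (X.X q)) (hom_d_apply θ.hom p q x).symm.symm }

variable {c : CornerHom k B A} {n : ℕ} {Y' : TruncatedResolution k (EndOp B Q) n}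
  {Y : TruncatedResolution k (EndOp A P) n}

/-- A truncated resolution `Y` of `End_A(P)^op`, with an identification of `e Y e` with a truncated
resolution `Y'` of `End_B(e P)^op`, where `e` is a central idempotent with `B ≅ e A`. The condition
`central` means that `e Y = Y e`. -/
structure ResolutionCorner (hc : c.IsCentral) (μ : ModuleCorner c Q P)
    (Y' : TruncatedResolution k (EndOp B Q) n) (Y : TruncatedResolution k (EndOp A P) n) where
  /-- The components of the identification. -/
  map : ∀ i, CornerMap (μ.endCorner hc) (Y'.Y.X i) (Y.Y.X i)
  comm : ∀ i i' x, (map i').toFun ((Y'.Y.d i i').hom x) = (Y.Y.d i i').hom ((map i).toFun x)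
  aug : ∀ x, regularEquiv k _ (Y.aug.hom ((map 0).toFun x)) =
    (μ.endCorner hc).toFun (regularEquiv k _ (Y'.aug.hom x))
  central : ∀ i, ∀ x : Y.Y.X i, (μ.endCorner hc).e • x = op (μ.endCorner hc).e • x

namespace ResolutionCorner

variable {hc : c.IsCentral} {μ : ModuleCorner c Q P} (r : ResolutionCorner hc μ Y' Y)

/-- The isomorphism `e P ⊗ e Y e ⊗ P^∨ e ≅ e (P ⊗ Y ⊗ P^∨)` of complexes. -/
def sandwichIso (r : ResolutionCorner hc μ Y' Y) :
    sandwichComplex B Y' ≅ (bimodCornerComplex c).obj (sandwichComplex A Y) :=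
  HomologicalComplex.Hom.isoOfComponents
    (fun i => isoOfBijective (μ.sandwichHom hc (r.map i))
      (μ.sandwichHom_bijective hc (r.map i) (r.central i)))
    fun i i' _ => moduleSandwich_hom_ext fun p m g => c.val_injective _ (by
      refine (congrArg ((moduleSandwich k A P).map (Y.Y.d i i')).hom
        (μ.val_sandwichHom hc (r.map i) p m g)).trans ?_
      refine (moduleSandwich_map_ptmul _ _ _ _).trans ?_
      rw [← r.comm]
      refine (μ.val_sandwichHom hc (r.map i') _ _ _).symm.trans ?_
      exact congrArg (fun t => c.val _ ((μ.sandwichHom hc (r.map i')).hom t))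
        (moduleSandwich_map_ptmul (Y'.Y.d i i') p m g).symm)

/-- The isomorphism `e A e ≅ B` of complexes concentrated in degree `0`. -/
def singleRegularIso (c : CornerHom k B A) : (bimodCornerComplex c).obj
    ((HomologicalComplex.single _ (ComplexShape.up ℤ) 0).obj (regularBimod k A)) ≅
      (HomologicalComplex.single _ (ComplexShape.up ℤ) 0).obj (regularBimod k B) :=
  (HomologicalComplex.singleMapHomologicalComplex c.enveloping.functor (ComplexShape.up ℤ) 0).app
      (regularBimod k A) ≪≫
    (HomologicalComplex.single _ (ComplexShape.up ℤ) 0).mapIso c.regularIso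

lemma sandwichHom_aug (r : ResolutionCorner hc μ Y' Y) :
    μ.sandwichHom hc (r.map 0) ≫ c.enveloping.functor.map (sandwichAug Y.aug) ≫
      c.regularIso.hom = sandwichAug Y'.aug := by
  refine moduleSandwich_hom_ext fun p m g => (regularEquiv k B).injective (c.injective ?_)
  refine (c.toFun_regularIso _).trans ?_
  refine (congrArg (fun t => regularEquiv k A ((sandwichAug Y.aug).hom t))
    (μ.val_sandwichHom hc (r.map 0) p m g)).trans ?_
  rw [sandwichAug_ptmul, sandwichAug_ptmul, r.aug]
  change c.toFun (g (μ.proj (μ.incl (unop (regularEquiv k _ (Y'.aug.hom m))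
    (μ.proj (μ.incl p)))))) = _
  rw [μ.proj_incl, μ.proj_incl]

lemma sandwichIso_twistMap (r : ResolutionCorner hc μ Y' Y) :
    r.sandwichIso.hom ≫ (bimodCornerComplex c).map (twistMap A Y) ≫ (singleRegularIso c).hom =
      twistMap B Y' := by
  apply HomologicalComplex.to_single_hom_ext
  have h1 : (twistMap A Y).f 0 = sandwichAug Y.aug ≫
      (HomologicalComplex.singleObjXSelf (ComplexShape.up ℤ) 0 (regularBimod k A)).inv :=
    HomologicalComplex.mkHomToSingle_f _ _
  have h2 : (twistMap B Y').f 0 = sandwichAug Y'.aug ≫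
      (HomologicalComplex.singleObjXSelf (ComplexShape.up ℤ) 0 (regularBimod k B)).inv :=
    HomologicalComplex.mkHomToSingle_f _ _
  have h3 : (singleRegularIso c).hom.f 0 = c.enveloping.functor.map
      (HomologicalComplex.singleObjXSelf (ComplexShape.up ℤ) 0 (regularBimod k A)).hom ≫
        c.regularIso.hom ≫
      (HomologicalComplex.singleObjXSelf (ComplexShape.up ℤ) 0 (regularBimod k B)).inv := by
    refine (congrArg₂ (· ≫ ·)
      (HomologicalComplex.singleMapHomologicalComplex_hom_app_self _ _ _ _)
      (HomologicalComplex.single_map_f_self _ _ _)).trans ?_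
    exact (Category.assoc _ _ _).trans (congrArg (fun t => _ ≫ t) (Iso.inv_hom_id_assoc _ _))
  rw [h2, ← r.sandwichHom_aug]
  refine (congrArg (fun t => μ.sandwichHom hc (r.map 0) ≫ t)
    (congrArg₂ (· ≫ ·) (congrArg c.enveloping.functor.map h1) h3)).trans ?_
  rw [← Functor.map_comp_assoc, Category.assoc, Iso.inv_hom_id, Category.comp_id, Category.assoc,
    Category.assoc]

/-- The isomorphism between the complex that defines the periodic twist of `B` and the corner of the
complex that defines the periodic twist of `A`. -/
def twistIso (r : ResolutionCorner hc μ Y' Y) :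
    twistComplex B Y' ≅ (bimodCornerComplex c).obj (twistComplex A Y) :=
  mappingConeIso (twistMap B Y') ((bimodCornerComplex c).map (twistMap A Y)) r.sandwichIso
      (singleRegularIso c).symm (by
        rw [Iso.symm_hom, Iso.comp_inv_eq, Category.assoc, r.sandwichIso_twistMap]) ≪≫
    (CochainComplex.mappingCone.mapHomologicalComplexIso (twistMap A Y)
      c.enveloping.functor).symm

lemma regularBimod_central (hc : c.IsCentral) (x : regularBimod k A) : c.e • x = op c.e • x :=
  (regularEquiv k A).injective (by rw [regularEquiv_left, regularEquiv_right, hc])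

lemma single_central (hc : c.IsCentral) (i : ℤ) (x : ((HomologicalComplex.single _
      (ComplexShape.up ℤ) 0).obj (regularBimod k A)).X i) : c.e • x = op c.e • x := by
  by_cases hi : i = 0
  · subst hi
    let s := HomologicalComplex.singleObjXSelf (ComplexShape.up ℤ) 0 (regularBimod k A)
    have hs : Function.Injective s.hom.hom := (ModuleCat.mono_iff_injective _).1 inferInstance
    exact hs (by rw [BimodCat.hom_left, BimodCat.hom_right, regularBimod_central hc])
  · have := ModuleCat.subsingleton_of_isZero
      (HomologicalComplex.isZero_single_obj_X (ComplexShape.up ℤ) 0 (regularBimod k A) i hi)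
    exact Subsingleton.elim _ _

lemma twistComplex_central (r : ResolutionCorner hc μ Y' Y) (i : ℤ)
    (x : (twistComplex A Y).X i) : c.e • x = op c.e • x := by
  let g := twistMap A Y
  let a := HomologicalComplex.homotopyCofiber.fstX g i (i + 1) rfl
  let a' := HomologicalComplex.homotopyCofiber.inlX g (i + 1) i rfl
  let b := HomologicalComplex.homotopyCofiber.sndX g i
  let b' := HomologicalComplex.homotopyCofiber.inrX g i
  have hx : a'.hom (a.hom x) + b'.hom (b.hom x) = x :=
    congrArg (fun f => f.hom x) (mappingCone_decomp g i)
  have h1 : c.e • a'.hom (a.hom x) = op c.e • a'.hom (a.hom x) := by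
    rw [← BimodCat.hom_left, ← BimodCat.hom_right]
    exact congrArg a'.hom (μ.sandwich_central hc (r.central (i + 1)) (a.hom x))
  have h2 : c.e • b'.hom (b.hom x) = op c.e • b'.hom (b.hom x) := by
    rw [← BimodCat.hom_left, ← BimodCat.hom_right]
    exact congrArg b'.hom (single_central hc i (b.hom x))
  rw [← hx]
  exact (smul_add _ _ _).trans ((congrArg₂ (· + ·) h1 h2).trans (smul_add _ _ _).symm)

variable [Module.Finite k A] [Module.Finite k B] [Module.Finite A P] [Module.Projective A P]
  [Module.Finite B Q] [Module.Projective B Q]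

/-- Periodic twists are compatible with the functor `V ↦ e V` for a central idempotent `e`. -/
lemma periodicTwist_comp_iso (r : ResolutionCorner hc μ Y' Y) {ρ : A →ₐ[k] B}
    (hρ : ∀ a, ρ a = c.retr a) (hL : IsTensorable (singleVia ρ)) :
    Nonempty (periodicTwist A Y ⋙ derivedTensor (singleVia ρ) hL ≅
      derivedTensor (singleVia ρ) hL ⋙ periodicTwist B Y') :=
  derivedTensor_corner_iso hc hρ (ComplexCornerMap.ofIso r.twistIso) r.twistComplex_central _ _ hL

end ResolutionCorner

end CentralTwist

/-! ### Truncated resolutions of products of algebras -/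

section ProductResolution

variable {k E S : Type u} [Field k] [Ring E] [Algebra k E] [Ring S] [Algebra k S]

namespace CornerHom

variable {c : CornerHom k E S}

lemma IsCentral.enveloping (hc : c.IsCentral) : c.enveloping.IsCentral := fun z => by
  rw [enveloping_e]
  induction z using TensorProduct.induction_on with
  | zero => simp
  | add x y hx hy => rw [mul_add, add_mul, hx, hy]
  | tmul x y =>
    rw [Algebra.TensorProduct.tmul_mul_tmul, Algebra.TensorProduct.tmul_mul_tmul, hc, ← op_unop y,
      ← op_mul, ← op_mul, hc]

lemma IsCentral.envelopingHom_retrHom (hc : c.IsCentral) (z : S ⊗[k] Sᵐᵒᵖ) :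
    envelopingHom hc.retrHom z = c.enveloping.retr z := by
  induction z using TensorProduct.induction_on with
  | zero => rw [map_zero, map_zero]
  | add x y hx hy => rw [map_add, map_add, hx, hy]
  | tmul x y => rfl

/-- Restriction along the projection `S → e S` preserves resolutions, for a central idempotent
`e`. -/
lemma IsCentral.preservesResolutions (hc : c.IsCentral) :
    PreservesResolutions (resFunctor hc.retrHom) where
  exact f g h := h
  injective f h := h
  surjective f h := h
  fgProj M h := by
    obtain ⟨ι, _, x, f, hf⟩ := fgProj_iff_dualBasis.1 h
    refine fgProj_iff_dualBasis.2 ⟨ι, inferInstance, x, fun i =>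
      { toFun := fun m => c.enveloping.toFun (f i (resEquiv hc.retrHom M m))
        map_add' := fun m m' => by rw [map_add, map_add, map_add]
        map_smul' := fun s m => by
          refine (congrArg c.enveloping.toFun
            (map_smul (f i) (envelopingHom hc.retrHom s) (resEquiv hc.retrHom M m))).trans ?_
          rw [smul_eq_mul, hc.envelopingHom_retrHom, ← hc.enveloping.mul_toFun]
          rfl }, fun m => ?_⟩
    refine Eq.trans (Finset.sum_congr rfl fun i _ => ?_) (hf (resEquiv hc.retrHom M m))
    change envelopingHom hc.retrHom (c.enveloping.toFun (f i (resEquiv hc.retrHom M m))) • x i = _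
    rw [hc.envelopingHom_retrHom, c.enveloping.retr_toFun]

end CornerHom

variable {ι : Type} [Fintype ι] [DecidableEq ι] {E : ι → Type u} [∀ i, Ring (E i)]
  [∀ i, Algebra k (E i)] {c : ∀ i, CornerHom k (E i) S}

/-- The corners `c i` identify the algebra `S` with the product of the algebras `E i`. -/
structure IsProduct (c : ∀ i, CornerHom k (E i) S) : Prop where
  central : ∀ i, (c i).IsCentral
  retr_of_ne : ∀ i j, i ≠ j → ∀ x, (c j).retr ((c i).toFun x) = 0
  ext : ∀ x, (∀ i, (c i).retr x = 0) → x = 0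

namespace IsProduct

variable (h : IsProduct c)

/-- The isomorphism `S ≅ ∏ E i`. -/
def equiv (h : IsProduct c) : S ≃ₐ[k] ∀ i, E i :=
  AlgEquiv.ofBijective (AlgHom.pi fun i => (h.central i).retrHom)
    ⟨(injective_iff_map_eq_zero _).2 fun x hx => h.ext x fun i => congrFun hx i, fun z =>
      ⟨∑ i, (c i).toFun (z i), funext fun j => by
        change (c j).retr (∑ i, (c i).toFun (z i)) = z j
        rw [map_sum, Finset.sum_eq_single j (fun i _ hij => h.retr_of_ne i j hij _)
          (fun hj => absurd (Finset.mem_univ j) hj), (c j).retr_toFun]⟩⟩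

lemma equiv_apply (h : IsProduct c) (x : S) (i : ι) : h.equiv x i = (c i).retr x := rfl

lemma equiv_toFun (h : IsProduct c) (i : ι) (x : E i) :
    h.equiv ((c i).toFun x) = Pi.single i x := by
  ext j
  rw [equiv_apply]
  by_cases hij : i = j
  · subst hij
    rw [(c i).retr_toFun, Pi.single_eq_same]
  · rw [h.retr_of_ne i j hij, Pi.single_eq_of_ne (Ne.symm hij)]

/-- The bimodule over `S ≅ ∏ E i` defined by a family of bimodules. -/
def bimod (h : IsProduct c) (M : ∀ i, BimodCat k (E i) (E i)) : BimodCat k S S :=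
  ModuleCat.of (S ⊗[k] Sᵐᵒᵖ) (∀ i, (resFunctor (h.central i).retrHom).obj (M i))

/-- The underlying additive group of `bimod`. -/
def bimodEquiv (h : IsProduct c) (M : ∀ i, BimodCat k (E i) (E i)) : h.bimod M ≃+ ∀ i, M i :=
  AddEquiv.refl _

lemma bimodEquiv_left (h : IsProduct c) (M : ∀ i, BimodCat k (E i) (E i)) (a : S) (m : h.bimod M)
    (i : ι) : h.bimodEquiv M (a • m) i = (c i).retr a • h.bimodEquiv M m i :=
  resEquiv_left (h.central i).retrHom (M i) a (m i)

lemma bimodEquiv_right (h : IsProduct c) (M : ∀ i, BimodCat k (E i) (E i)) (a : S) (m : h.bimod M)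
    (i : ι) : h.bimodEquiv M (op a • m) i = op ((c i).retr a) • h.bimodEquiv M m i :=
  resEquiv_right (h.central i).retrHom (M i) a (m i)

/-- The map of bimodules defined by a family of maps. -/
def bimodMap (h : IsProduct c) {M N : ∀ i, BimodCat k (E i) (E i)} (f : ∀ i, M i ⟶ N i) :
    h.bimod M ⟶ h.bimod N :=
  ModuleCat.ofHom (LinearMap.pi fun i =>
    ((resFunctor (h.central i).retrHom).map (f i)).hom ∘ₗ LinearMap.proj i)

lemma bimodEquiv_map (h : IsProduct c) {M N : ∀ i, BimodCat k (E i) (E i)} (f : ∀ i, M i ⟶ N i)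
    (m : h.bimod M) (i : ι) :
    h.bimodEquiv N ((h.bimodMap f).hom m) i = (f i).hom (h.bimodEquiv M m i) := rfl

lemma bimod_ext (h : IsProduct c) {M : ∀ i, BimodCat k (E i) (E i)} {m m' : h.bimod M}
    (H : ∀ i, h.bimodEquiv M m i = h.bimodEquiv M m' i) : m = m' := funext H

lemma bimodMap_exact (h : IsProduct c) {L M N : ∀ i, BimodCat k (E i) (E i)} (f : ∀ i, L i ⟶ M i)
    (g : ∀ i, M i ⟶ N i) (H : ∀ i, Function.Exact (f i).hom (g i).hom) :
    Function.Exact (h.bimodMap f).hom (h.bimodMap g).hom := fun y => by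
  constructor
  · intro hy
    choose x hx using fun i => (H i (h.bimodEquiv M y i)).1 (congrFun hy i)
    exact ⟨x, h.bimod_ext hx⟩
  · rintro ⟨x, rfl⟩
    exact h.bimod_ext fun i => (H i _).2 ⟨h.bimodEquiv L x i, rfl⟩

lemma bimodMap_injective (h : IsProduct c) {M N : ∀ i, BimodCat k (E i) (E i)}
    (f : ∀ i, M i ⟶ N i) (H : ∀ i, Function.Injective (f i).hom) :
    Function.Injective (h.bimodMap f).hom :=
  fun _ _ hxy => h.bimod_ext fun i => H i (congrFun hxy i)

lemma bimodMap_surjective (h : IsProduct c) {M N : ∀ i, BimodCat k (E i) (E i)}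
    (f : ∀ i, M i ⟶ N i) (H : ∀ i, Function.Surjective (f i).hom) :
    Function.Surjective (h.bimodMap f).hom := fun y => by
  choose x hx using fun i => H i (h.bimodEquiv N y i)
  exact ⟨x, h.bimod_ext hx⟩

lemma fgProj_bimod (h : IsProduct c) {M : ∀ i, BimodCat k (E i) (E i)}
    (H : ∀ i, FGProj (E i ⊗[k] (E i)ᵐᵒᵖ) (M i)) : FGProj (S ⊗[k] Sᵐᵒᵖ) (h.bimod M) :=
  FGProj.pi fun i => (h.central i).preservesResolutions.fgProj _ (H i)

/-- The automorphism of `S ≅ ∏ E i` defined by a family of automorphisms. -/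
def aut (h : IsProduct c) (σ : ∀ i, E i ≃ₐ[k] E i) : S ≃ₐ[k] S :=
  h.equiv.trans ((AlgEquiv.piCongrRight σ).trans h.equiv.symm)

lemma retr_aut (h : IsProduct c) (σ : ∀ i, E i ≃ₐ[k] E i) (x : S) (i : ι) :
    (c i).retr (h.aut σ x) = σ i ((c i).retr x) := by
  rw [← h.equiv_apply, aut, AlgEquiv.trans_apply, AlgEquiv.trans_apply, AlgEquiv.apply_symm_apply]
  rfl

lemma retr_equiv_symm (h : IsProduct c) (z : ∀ i, E i) (i : ι) :
    (c i).retr (h.equiv.symm z) = z i := by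
  rw [← h.equiv_apply, AlgEquiv.apply_symm_apply]

/-- The product of the regular bimodules is the regular bimodule. -/
def regularIso (h : IsProduct c) :
    h.bimod (fun i => regularBimod k (E i)) ≅ regularBimod k S :=
  bimodIso (((h.bimodEquiv _).trans (AddEquiv.piCongrRight fun i => regularEquiv k (E i))).trans
      (h.equiv.symm.toAddEquiv.trans (regularEquiv k S).symm))
    (fun b m => (regularEquiv k S).injective (h.equiv.injective (funext fun i => by
      rw [regularEquiv_left, h.equiv_apply, h.equiv_apply, (h.central i).retr_mul]
      refine (h.retr_equiv_symm _ i).trans ((congrArg (regularEquiv k (E i))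
        (h.bimodEquiv_left _ b m i)).trans ((regularEquiv_left _ _).trans ?_))
      exact congrArg _ (h.retr_equiv_symm _ i).symm)))
    (fun b m => (regularEquiv k S).injective (h.equiv.injective (funext fun i => by
      rw [regularEquiv_right, h.equiv_apply, h.equiv_apply, (h.central i).retr_mul]
      refine (h.retr_equiv_symm _ i).trans ((congrArg (regularEquiv k (E i))
        (h.bimodEquiv_right _ b m i)).trans ((regularEquiv_right _ _).trans ?_))
      exact congrArg (· * _) (h.retr_equiv_symm _ i).symm)))

lemma retr_regularIso (h : IsProduct c) (m : h.bimod (fun i => regularBimod k (E i))) (i : ι) :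
    (c i).retr (regularEquiv k S (h.regularIso.hom.hom m)) =
      regularEquiv k (E i) (h.bimodEquiv _ m i) := by
  change (c i).retr (regularEquiv k S ((regularEquiv k S).symm (h.equiv.symm fun i =>
    regularEquiv k (E i) (h.bimodEquiv _ m i)))) = _
  rw [AddEquiv.apply_symm_apply, ← h.equiv_apply, AlgEquiv.apply_symm_apply]

/-- The product of twisted regular bimodules is a twisted regular bimodule. -/
def twistedIso (h : IsProduct c) (σ : ∀ i, E i ≃ₐ[k] E i) :
    h.bimod (fun i => twistedBimod (σ i)) ≅ twistedBimod (h.aut σ) :=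
  bimodIso (((h.bimodEquiv _).trans (AddEquiv.piCongrRight fun i => twistedEquiv (σ i))).trans
      (h.equiv.symm.toAddEquiv.trans (twistedEquiv (h.aut σ)).symm))
    (fun b m => (twistedEquiv (h.aut σ)).injective (h.equiv.injective (funext fun i => by
      rw [twistedEquiv_left, h.equiv_apply, h.equiv_apply, (h.central i).retr_mul]
      refine (h.retr_equiv_symm _ i).trans ((congrArg (twistedEquiv (σ i))
        (h.bimodEquiv_left _ b m i)).trans ((twistedEquiv_left _ _ _).trans ?_))
      exact congrArg _ (h.retr_equiv_symm _ i).symm)))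
    (fun b m => (twistedEquiv (h.aut σ)).injective (h.equiv.injective (funext fun i => by
      rw [twistedEquiv_right, h.equiv_apply, h.equiv_apply, (h.central i).retr_mul, h.retr_aut]
      refine (h.retr_equiv_symm _ i).trans ((congrArg (twistedEquiv (σ i))
        (h.bimodEquiv_right _ b m i)).trans ((twistedEquiv_right _ _ _).trans ?_))
      exact congrArg (· * _) (h.retr_equiv_symm _ i).symm)))

lemma ker_equiv (h : IsProduct c) {σ : ∀ i, E i ≃ₐ[k] E i} {X Z : ∀ i, BimodCat k (E i) (E i)}
    (f : ∀ i, X i ⟶ Z i) (H : ∀ i, Nonempty (LinearMap.ker (f i).hom ≃ₗ[E i ⊗[k] (E i)ᵐᵒᵖ]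
      twistedBimod (σ i))) :
    Nonempty (LinearMap.ker (h.bimodMap f).hom ≃ₗ[S ⊗[k] Sᵐᵒᵖ] twistedBimod (h.aut σ)) := by
  have e := fun i => (H i).some
  let j : ∀ i, twistedBimod (σ i) ⟶ X i := fun i =>
    ModuleCat.homEquiv.symm ((LinearMap.ker (f i).hom).subtype ∘ₗ (e i).symm.toLinearMap)
  have hj : ∀ i, Function.Injective (j i).hom := fun i =>
    (Submodule.injective_subtype _).comp (e i).symm.injective
  have hjf : ∀ i, Function.Exact (j i).hom (f i).hom := fun i x =>
    ⟨fun hx => ⟨e i ⟨x, hx⟩, congrArg Subtype.val ((e i).symm_apply_apply ⟨x, hx⟩)⟩, by rintro ⟨y, rfl⟩; exact ((e i).symm y).2⟩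
  have h1 := h.bimodMap_injective j hj
  have h3 : LinearMap.ker (h.bimodMap f).hom = LinearMap.range (h.bimodMap j).hom :=
    LinearMap.exact_iff.1 (h.bimodMap_exact j f hjf)
  exact ⟨(LinearEquiv.ofEq _ _ h3).trans ((LinearEquiv.ofInjective _ h1).symm.trans
    (h.twistedIso σ).toLinearEquiv)⟩

variable {n : ℕ}

/-- The truncated resolution of `S ≅ ∏ E i` defined by a family of truncated resolutions. -/
def resolution (h : IsProduct c) (hn : 1 ≤ n) (Y : ∀ i, TruncatedResolution k (E i) n) :
    TruncatedResolution k S n where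
  σ := h.aut fun i => (Y i).σ
  Y :=
    { X := fun p => h.bimod fun i => (Y i).Y.X p
      d := fun p q => h.bimodMap fun i => (Y i).Y.d p q
      shape := fun p q hpq => ModuleCat.hom_ext (LinearMap.ext fun m => h.bimod_ext fun i =>
        congrArg (fun f => f.hom (h.bimodEquiv _ m i)) ((Y i).Y.shape p q hpq))
      d_comp_d' := fun p q r _ _ => ModuleCat.hom_ext (LinearMap.ext fun m => h.bimod_ext fun i =>
        congrArg (fun f => f.hom (h.bimodEquiv _ m i)) ((Y i).Y.d_comp_d p q r)) }
  one_le := hn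
  finite p := (h.fgProj_bimod fun i => ⟨(Y i).finite p, (Y i).projective p⟩).1
  projective p := (h.fgProj_bimod fun i => ⟨(Y i).finite p, (Y i).projective p⟩).2
  subsingleton p hp :=
    ⟨fun x y => h.bimod_ext fun i =>
      have := (Y i).subsingleton p hp
      Subsingleton.elim (h.bimodEquiv _ x i) (h.bimodEquiv _ y i)⟩
  aug := (h.bimodMap fun i => (Y i).aug) ≫ h.regularIso.hom
  aug_surjective := by
    have hs : Function.Surjective h.regularIso.hom.hom :=
      (ModuleCat.epi_iff_surjective _).1 inferInstance
    exact hs.comp (h.bimodMap_surjective _ fun i => (Y i).aug_surjective)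
  d_aug := by
    have h0 : (h.bimodMap fun i => (Y i).Y.d (-1) 0) ≫ (h.bimodMap fun i => (Y i).aug) = 0 :=
      ModuleCat.hom_ext (LinearMap.ext fun m => h.bimod_ext fun i =>
        congrArg (fun f => f.hom (h.bimodEquiv _ m i)) (Y i).d_aug)
    exact (Category.assoc _ _ _).symm.trans ((congrArg (fun t => t ≫ _) h0).trans
      Limits.zero_comp)
  exact_aug hn := by
    have hi : Function.Injective h.regularIso.hom.hom :=
      (ModuleCat.mono_iff_injective _).1 inferInstance
    intro x
    refine Iff.trans ?_ (h.bimodMap_exact _ _ (fun i => (Y i).exact_aug hn) x)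
    exact map_eq_zero_iff h.regularIso.hom.hom hi
  exact p h1 h2 := h.bimodMap_exact _ _ fun i => (Y i).exact p h1 h2
  ker_of_eq_one hn := by
    have hi : Function.Injective h.regularIso.hom.hom :=
      (ModuleCat.mono_iff_injective _).1 inferInstance
    obtain ⟨e⟩ := h.ker_equiv (fun i => (Y i).aug) fun i => (Y i).ker_of_eq_one hn
    have h' : LinearMap.ker ((h.bimodMap fun i => (Y i).aug) ≫ h.regularIso.hom).hom =
        LinearMap.ker (h.bimodMap fun i => (Y i).aug).hom :=
      LinearMap.ker_comp_of_ker_eq_bot _ (LinearMap.ker_eq_bot.2 hi)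
    exact ⟨(LinearEquiv.ofEq _ _ h').trans e⟩
  ker_of_two_le hn := h.ker_equiv (fun i => (Y i).Y.d (1 - n) (2 - n)) fun i =>
    (Y i).ker_of_two_le hn

lemma retr_e_of_ne (h : IsProduct c) {i j : ι} (hij : i ≠ j) : (c j).retr (c i).e = 0 :=
  h.retr_of_ne i j hij 1

/-- The bimodule `M i` is the corner of `∏ M j` defined by the `i`-th idempotent. -/
def cornerMap (h : IsProduct c) (M : ∀ i, BimodCat k (E i) (E i)) (i : ι) :
    CornerMap (c i) (M i) (h.bimod M) where
  toFun := AddMonoidHom.mk' (fun m => (h.bimodEquiv M).symm (Pi.single i m))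
    fun m m' => (congrArg (h.bimodEquiv M).symm (Pi.single_add i m m')).trans (map_add _ _ _)
  left x m := h.bimod_ext fun j => by
    rw [bimodEquiv_left]
    change (Pi.single i (x • m) : ∀ i, M i) j = (c j).retr ((c i).toFun x) •
      (Pi.single i m : ∀ i, M i) j
    by_cases hij : i = j
    · subst hij
      rw [Pi.single_eq_same, Pi.single_eq_same, (c i).retr_toFun]
    · rw [Pi.single_eq_of_ne (Ne.symm hij), Pi.single_eq_of_ne (Ne.symm hij), smul_zero]
  right x m := h.bimod_ext fun j => by
    rw [bimodEquiv_right]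
    change (Pi.single i (op x • m) : ∀ i, M i) j = op ((c j).retr ((c i).toFun x)) •
      (Pi.single i m : ∀ i, M i) j
    by_cases hij : i = j
    · subst hij
      rw [Pi.single_eq_same, Pi.single_eq_same, (c i).retr_toFun]
    · rw [Pi.single_eq_of_ne (Ne.symm hij), Pi.single_eq_of_ne (Ne.symm hij), smul_zero]
  injective _ _ hxy := Pi.single_injective (M := fun i => (M i : Type u)) i hxy
  surjective m := ⟨h.bimodEquiv M m i, h.bimod_ext fun j => by
    rw [bimodEquiv_left, bimodEquiv_right]
    change (Pi.single i (h.bimodEquiv M m i) : ∀ i, M i) j = _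
    by_cases hij : i = j
    · subst hij
      rw [Pi.single_eq_same, (c i).retr_e, one_smul, op_one, one_smul]
    · rw [Pi.single_eq_of_ne (Ne.symm hij), h.retr_e_of_ne hij, zero_smul]⟩

lemma bimodEquiv_cornerMap (h : IsProduct c) (M : ∀ i, BimodCat k (E i) (E i)) (i : ι) (m : M i) :
    h.bimodEquiv M ((h.cornerMap M i).toFun m) = (Pi.single i m : ∀ i, M i) := rfl

lemma cornerMap_map (h : IsProduct c) {M N : ∀ i, BimodCat k (E i) (E i)} (f : ∀ i, M i ⟶ N i)
    (i : ι) (m : M i) : (h.cornerMap N i).toFun ((f i).hom m) =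
      (h.bimodMap f).hom ((h.cornerMap M i).toFun m) := h.bimod_ext fun j => by
  rw [bimodEquiv_map, bimodEquiv_cornerMap, bimodEquiv_cornerMap]
  by_cases hij : i = j
  · subst hij
    rw [Pi.single_eq_same, Pi.single_eq_same]
  · rw [Pi.single_eq_of_ne (Ne.symm hij), Pi.single_eq_of_ne (Ne.symm hij), map_zero]

lemma bimod_central (h : IsProduct c) (M : ∀ i, BimodCat k (E i) (E i)) (i : ι) (m : h.bimod M) :
    (c i).e • m = op (c i).e • m := h.bimod_ext fun j => by
  rw [bimodEquiv_left, bimodEquiv_right]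
  by_cases hij : i = j
  · subst hij
    rw [(c i).retr_e, one_smul, op_one, one_smul]
  · rw [h.retr_e_of_ne hij, zero_smul, op_zero, zero_smul]

lemma resolution_aug (h : IsProduct c) (hn : 1 ≤ n) (Y : ∀ i, TruncatedResolution k (E i) n) (i : ι)
    (x : (Y i).Y.X 0) : regularEquiv k S ((h.resolution hn Y).aug.hom
      ((h.cornerMap (fun i => (Y i).Y.X 0) i).toFun x)) =
        (c i).toFun (regularEquiv k (E i) ((Y i).aug.hom x)) :=
  h.equiv.injective (funext fun j => by
    rw [h.equiv_toFun]
    refine (h.retr_regularIso _ j).trans ((congrArg (regularEquiv k (E j))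
      (h.bimodEquiv_map _ _ j)).trans ?_)
    rw [bimodEquiv_cornerMap]
    by_cases hij : i = j
    · subst hij
      rw [Pi.single_eq_same, Pi.single_eq_same]
    · rw [Pi.single_eq_of_ne (Ne.symm hij), Pi.single_eq_of_ne (Ne.symm hij), map_zero, map_zero])

end IsProduct

end ProductResolution

/-! ### Periodic twists of products of algebras -/

section BlockTwists

variable {k : Type u} [Field k] {c : ℕ} (A : Fin c → Type u) [∀ i, Ring (A i)]
  [∀ i, Algebra k (A i)] (P : Fin c → Type u) [∀ i, AddCommGroup (P i)] [∀ i, Module k (P i)]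
  [∀ i, Module (A i) (P i)] [∀ i, IsScalarTower k (A i) (P i)]

variable (k) in
/-- The factor `A i` of a product of algebras, as a corner. -/
def blockCorner (i : Fin c) : CornerHom k (A i) (∀ i, A i) where
  toFun := LinearMap.single k A i
  retr := LinearMap.proj i
  map_mul x y := Pi.single_mul i x y
  retr_toFun x := Pi.single_eq_same i x
  toFun_retr x := by
    ext j
    by_cases h : j = i
    · subst h
      simp
    · simp [h]

lemma blockCorner_e (i : Fin c) : (blockCorner k A i).e = Pi.single i 1 := rfl

lemma blockCorner_isCentral (i : Fin c) : (blockCorner k A i).IsCentral := fun x => by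
  rw [blockCorner_e]
  ext j
  by_cases h : j = i
  · subst h
    simp
  · simp [h]

variable (k) in
/-- The factor `P i` of a product of modules, as a corner. -/
def blockModuleCorner (i : Fin c) : ModuleCorner (blockCorner k A i) (P i) (∀ i, P i) where
  incl := LinearMap.single k P i
  proj := LinearMap.proj i
  proj_incl q := Pi.single_eq_same i q
  incl_proj p := by
    rw [blockCorner_e]
    ext j
    by_cases h : j = i
    · subst h
      simp
    · simp [h]
  incl_smul b q := by
    change Pi.single i (b • q) = (Pi.single i b : ∀ i, A i) • (Pi.single i q : ∀ i, P i)
    ext j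
    by_cases h : j = i
    · subst h
      simp
    · simp [h]

variable (k) in
/-- The endomorphism algebra of `P i`, as a corner of the endomorphism algebra of `⨁ P i`. -/
abbrev blockEndCorner (i : Fin c) :
    CornerHom k (EndOp (A i) (P i)) (EndOp (∀ i, A i) (∀ i, P i)) :=
  (blockModuleCorner k A P i).endCorner (blockCorner_isCentral A i)

lemma blockEndCorner_e (i : Fin c) : (blockEndCorner k A P i).e = blockIdempotent A P i :=
  endOp_ext fun p => (blockModuleCorner k A P i).unop_endCorner_e _ p

variable (k) in
lemma isProduct_blockEndCorner : IsProduct (blockEndCorner k A P) where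
  central i := (blockModuleCorner k A P i).endCorner_isCentral (blockCorner_isCentral A i)
  retr_of_ne i j hij f := endOp_ext fun q => by
    change (Pi.single i _ : ∀ i, P i) j = 0
    exact Pi.single_eq_of_ne (Ne.symm hij) _
  ext f hf := endOp_ext fun p => funext fun j => by
    have h1 := DFunLike.congr_fun (congrArg unop (hf j)) (p j)
    have h2 : (blockCorner k A j).e • p = Pi.single j (p j) :=
      ((blockModuleCorner k A P j).incl_proj p).symm
    have h3 : (unop f p) j = ((blockCorner k A j).e • unop f p) j := by
      rw [Pi.smul_apply', blockCorner_e, Pi.single_eq_same, one_smul]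
    rw [h3, ← map_smul, h2]
    exact h1

variable [∀ i, Module.Finite k (A i)] [∀ i, Module.Finite (A i) (P i)]
  [∀ i, Module.Projective (A i) (P i)] {n : ℕ}

/-- The product resolution induces the product of the periodic twists. -/
lemma periodicTwist_blockDecomposition_iso (hn : 1 ≤ n)
    (Yb : ∀ i, TruncatedResolution k (EndOp (A i) (P i)) n) :
    Nonempty (periodicTwist (∀ i, A i) ((isProduct_blockEndCorner k A P).resolution hn Yb) ⋙
        blockDecomposition k A ≅
      blockDecomposition k A ⋙ Functor.pi fun i => periodicTwist (A i) (Yb i)) := by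
  have H := isProduct_blockEndCorner k A P
  have h : ∀ i, Nonempty (periodicTwist (∀ i, A i) (H.resolution hn Yb) ⋙ blockProjection k A i ≅
      blockProjection k A i ⋙ periodicTwist (A i) (Yb i)) := fun i =>
    ResolutionCorner.periodicTwist_comp_iso (hc := blockCorner_isCentral A i)
      (μ := blockModuleCorner k A P i) (Y' := Yb i) (Y := H.resolution hn Yb)
      { map := fun p => H.cornerMap (fun i => (Yb i).Y.X p) i
        comm := fun p q x => H.cornerMap_map (fun i => (Yb i).Y.d p q) i x
        aug := fun x => H.resolution_aug hn Yb i x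
        central := fun p x => H.bimod_central (fun i => (Yb i).Y.X p) i x }
      (ρ := Pi.evalAlgHom k A i) (fun _ => rfl) _
  have e := fun i => (h i).some
  exact ⟨NatIso.ofComponents (fun V => Pi.isoMk fun i => (e i).app V) fun f =>
    funext fun i => (e i).hom.naturality f⟩

end BlockTwists

/-! ### The diagonal part of a resolution over a product of algebras -/

section DiagonalPart

variable {k S : Type u} [Field k] [Ring S] [Algebra k S]
variable {ι : Type} [Fintype ι] [DecidableEq ι] {E : ι → Type u} [∀ i, Ring (E i)]
  [∀ i, Algebra k (E i)] {c : ∀ i, CornerHom k (E i) S}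

lemma CornerHom.IsCentral.hasBasis {E : Type u} [Ring E] [Algebra k E] {c : CornerHom k E S}
    (hc : c.IsCentral) : c.HasBasis :=
  ⟨Unit, inferInstance, fun _ => 1, fun _ => 1,
    fun x => by
      rw [Finset.univ_unique, Finset.sum_singleton, one_mul, mul_one, mul_assoc, ← hc, ← mul_assoc,
        c.e_mul_e],
    fun x => by
      rw [Finset.univ_unique, Finset.sum_singleton, one_mul, mul_one, hc, mul_assoc, c.e_mul_e]⟩

namespace IsProduct

lemma e_mul_e_of_ne (h : IsProduct c) {i j : ι} (hij : i ≠ j) : (c i).e * (c j).e = 0 := by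
  rw [← (h.central i).toFun_retr, h.retr_e_of_ne (Ne.symm hij), map_zero]

lemma sum_e (h : IsProduct c) : ∑ i, (c i).e = 1 :=
  h.equiv.injective (funext fun j => by
    rw [map_one, map_sum, Finset.sum_apply, Finset.sum_eq_single j, h.equiv_apply, (c j).retr_e]
    · rfl
    · exact fun i _ hij => h.retr_e_of_ne hij
    · exact fun hj => absurd (Finset.mem_univ j) hj)

/-- The projection of a bimodule `M` onto `⨁ e_i M e_i`. -/
def diag (h : IsProduct c) (M : BimodCat k S S) : M ⟶ M :=
  BimodCat.homMk
    (AddMonoidHom.mk' (fun m => ∑ i, (c i).e • op (c i).e • m) fun m m' => by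
      simp only [smul_add, Finset.sum_add_distrib])
    (fun b m => (Finset.sum_congr rfl fun i _ => by
      rw [← smul_comm b (op (c i).e), smul_smul, h.central, mul_smul]).trans
        Finset.smul_sum.symm)
    (fun b m => (Finset.sum_congr rfl fun i _ => by
      rw [smul_smul (op (c i).e) b, ← op_unop b, ← op_mul, ← h.central, op_mul, mul_smul,
        smul_comm (c i).e (op (unop b))]).trans Finset.smul_sum.symm)

lemma diag_apply (h : IsProduct c) (M : BimodCat k S S) (m : M) :
    (h.diag M).hom m = ∑ i, (c i).e • op (c i).e • m := rfl

lemma diag_naturality (h : IsProduct c) {M N : BimodCat k S S} (f : M ⟶ N) (m : M) :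
    (h.diag N).hom (f.hom m) = f.hom ((h.diag M).hom m) := by
  rw [diag_apply, diag_apply, map_sum]
  exact Finset.sum_congr rfl fun i _ => by rw [BimodCat.hom_left, BimodCat.hom_right]

lemma diag_diag (h : IsProduct c) (M : BimodCat k S S) (m : M) :
    (h.diag M).hom ((h.diag M).hom m) = (h.diag M).hom m := by
  conv_lhs => rw [diag_apply]
  rw [diag_apply]
  refine Finset.sum_congr rfl fun i _ => ?_
  rw [Finset.smul_sum, Finset.smul_sum, Finset.sum_eq_single i]
  · rw [← smul_comm (c i).e (op (c i).e), smul_smul, smul_smul, ← op_mul, (c i).e_mul_e]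
  · intro j _ hj
    rw [← smul_comm (c j).e (op (c i).e), smul_smul, h.e_mul_e_of_ne (Ne.symm hj), zero_smul]
  · exact fun hi => absurd (Finset.mem_univ i) hi

lemma diag_regular (h : IsProduct c) (m : regularBimod k S) :
    (h.diag (regularBimod k S)).hom m = m := (regularEquiv k S).injective (by
  rw [diag_apply, map_sum]
  refine (Finset.sum_congr rfl fun i _ => ?_ : _ = ∑ i, (c i).e * regularEquiv k S m).trans ?_
  · rw [regularEquiv_left, regularEquiv_right, ← h.central, ← mul_assoc, (c i).e_mul_e]
  · rw [← Finset.sum_mul, h.sum_e, one_mul])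

lemma diag_twisted (h : IsProduct c) {σ : S ≃ₐ[k] S} (hσ : ∀ i, σ (c i).e = (c i).e)
    (m : twistedBimod σ) : (h.diag (twistedBimod σ)).hom m = m := (twistedEquiv σ).injective (by
  rw [diag_apply, map_sum]
  refine (Finset.sum_congr rfl fun i _ => ?_ : _ = ∑ i, (c i).e * twistedEquiv σ m).trans ?_
  · rw [twistedEquiv_left, twistedEquiv_right, hσ, ← h.central, ← mul_assoc, (c i).e_mul_e]
  · rw [← Finset.sum_mul, h.sum_e, one_mul])

lemma eq_zero_of_diag_eq_zero (h : IsProduct c) {σ : S ≃ₐ[k] S} (hσ : ∀ i, σ (c i).e = (c i).e)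
    {M N : BimodCat k S S} (f : M ⟶ N)
    (H : Nonempty (LinearMap.ker f.hom ≃ₗ[S ⊗[k] Sᵐᵒᵖ] twistedBimod σ)) (x : M)
    (hx : (h.diag M).hom x = 0) (hf : f.hom x = 0) : x = 0 := by
  obtain ⟨e⟩ := H
  let g : twistedBimod σ ⟶ M :=
    ModuleCat.homEquiv.symm ((LinearMap.ker f.hom).subtype ∘ₗ e.symm.toLinearMap)
  have hg : g.hom (e ⟨x, hf⟩) = x := congrArg Subtype.val (e.symm_apply_apply ⟨x, hf⟩)
  rw [← hg, diag_naturality, h.diag_twisted hσ] at hx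
  exact hg.symm.trans hx

variable {n : ℕ}

/-- The off-diagonal part `⨁_{i ≠ j} e_i Y e_j` of a truncated resolution is acyclic if the twisting
automorphism fixes the `e_i`, since the off-diagonal parts of `E` and `E_σ` vanish. -/
lemma exists_of_diag_eq_zero (h : IsProduct c) (Y : TruncatedResolution k S n)
    (hσ : ∀ i, Y.σ (c i).e = (c i).e) (p : ℤ) (x : Y.Y.X p)
    (hx : (h.diag (Y.Y.X p)).hom x = 0) (hd : (Y.Y.d p (p + 1)).hom x = 0) :
    ∃ y, (h.diag (Y.Y.X (p - 1))).hom y = 0 ∧ (Y.Y.d (p - 1) p).hom y = x := by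
  suffices H : ∃ y, (Y.Y.d (p - 1) p).hom y = x by
    obtain ⟨y, rfl⟩ := H
    refine ⟨y - (h.diag _).hom y, ?_, ?_⟩
    · rw [map_sub, diag_diag, sub_self]
    · rw [map_sub, ← diag_naturality, hx, sub_zero]
  have h1 : 1 ≤ n := Y.one_le
  by_cases hp : p ≤ -n ∨ 0 < p
  · have := Y.subsingleton p hp
    exact ⟨0, Subsingleton.elim _ _⟩
  · rw [not_or, not_le, not_lt] at hp
    obtain hp0 | rfl := lt_or_eq_of_le hp.2
    · by_cases hpn : p = 1 - n
      · subst hpn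
        refine ⟨0, (map_zero _).trans
          (h.eq_zero_of_diag_eq_zero hσ _ (Y.ker_of_two_le (by omega)) x hx ?_).symm⟩
        have : (1 - n : ℤ) + 1 = 2 - n := by ring
        rw [this] at hd
        exact hd
      · exact (Y.exact p (by omega) hp0 x).1 hd
    · have ha : Y.aug.hom x = 0 := by
        rw [← h.diag_regular (Y.aug.hom x), diag_naturality, hx, map_zero]
      by_cases hn : n = 1
      · exact ⟨0, (map_zero _).trans
          (h.eq_zero_of_diag_eq_zero hσ _ (Y.ker_of_eq_one hn) x hx ha).symm⟩
      · exact (Y.exact_aug (by omega) x).1 ha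

/-- The off-diagonal part of a complex. -/
def offDiag (h : IsProduct c) (K : CochainComplex (BimodCat k S S) ℤ) :
    CochainComplex (BimodCat k S S) ℤ where
  X p := ModuleCat.of _ (LinearMap.ker (h.diag (K.X p)).hom)
  d p q := ModuleCat.ofHom ((K.d p q).hom.restrict fun x hx => by
    rw [LinearMap.mem_ker, diag_naturality, LinearMap.mem_ker.1 hx, map_zero])
  shape p q hpq := ModuleCat.hom_ext (LinearMap.ext fun x => Subtype.ext
    (congrArg (fun f => f.hom x.1) (K.shape p q hpq)))
  d_comp_d' p q r _ _ := ModuleCat.hom_ext (LinearMap.ext fun x => Subtype.ext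
    (congrArg (fun f => f.hom x.1) (K.d_comp_d p q r)))

/-- The inclusion of the off-diagonal part. -/
def offDiagIncl (h : IsProduct c) (K : CochainComplex (BimodCat k S S) ℤ) : h.offDiag K ⟶ K where
  f p := ModuleCat.homEquiv.symm (LinearMap.ker (h.diag (K.X p)).hom).subtype
  comm' _ _ _ := rfl

/-- The projection onto the off-diagonal part, in one degree. -/
def offDiagProjX (h : IsProduct c) (M : BimodCat k S S) :
    M ⟶ ModuleCat.of _ (LinearMap.ker (h.diag M).hom) :=
  ModuleCat.homEquiv.symm (LinearMap.codRestrict (LinearMap.ker (h.diag M).hom)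
    (LinearMap.id - (h.diag M).hom) fun x => by
      rw [LinearMap.mem_ker, LinearMap.sub_apply, map_sub, diag_diag, LinearMap.id_apply,
        sub_self])

lemma val_offDiagProjX (h : IsProduct c) (M : BimodCat k S S) (m : M) :
    ((h.offDiagProjX M).hom m).1 = m - (h.diag M).hom m := rfl

/-- The projection onto the off-diagonal part. -/
def offDiagProj (h : IsProduct c) (K : CochainComplex (BimodCat k S S) ℤ) : K ⟶ h.offDiag K where
  f p := h.offDiagProjX (K.X p)
  comm' p q _ := ModuleCat.hom_ext (LinearMap.ext fun (x : K.X p) => Subtype.ext (by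
    refine (congrArg (K.d p q).hom (h.val_offDiagProjX _ x)).trans
      (Eq.trans ?_ (h.val_offDiagProjX _ ((K.d p q).hom x)).symm)
    rw [map_sub, diag_naturality]))

lemma offDiag_acyclic (h : IsProduct c) (Y : TruncatedResolution k S n)
    (hσ : ∀ i, Y.σ (c i).e = (c i).e) : (h.offDiag Y.Y).Acyclic := fun p => by
  rw [HomologicalComplex.exactAt_iff' _ (p - 1) p (p + 1) (by simp) (by simp),
    ShortComplex.moduleCat_exact_iff]
  intro x hx
  obtain ⟨y, hy, hyx⟩ := h.exists_of_diag_eq_zero Y hσ p x.1 x.2 (congrArg Subtype.val hx)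
  exact ⟨⟨y, hy⟩, Subtype.ext hyx⟩

end IsProduct

lemma TruncatedResolution.isKProjective (Y : TruncatedResolution k S n) : Y.Y.IsKProjective := by
  have : Y.Y.IsStrictlyLE 0 := (Y.Y.isStrictlyLE_iff 0).2 fun i hi =>
    have := Y.subsingleton i (Or.inr hi)
    ModuleCat.isZero_of_subsingleton _
  have : ∀ i, Projective (Y.Y.X i) := fun i =>
    have := Y.projective i
    ModuleCat.projective_of_categoryTheory_projective _
  exact CochainComplex.isKProjective_of_projective Y.Y 0

namespace IsProduct

/-- The map `M → ∏ M i` for a bimodule `M` with diagonal corners `M i`. -/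
def toProd (h : IsProduct c) {M' : ∀ i, BimodCat k (E i) (E i)} {M : BimodCat k S S}
    (φ : ∀ i, CornerMap (c i) (M' i) M) : M ⟶ h.bimod M' :=
  BimodCat.homMk
    (AddMonoidHom.mk' (fun m => (h.bimodEquiv M').symm fun i => (φ i).retr m) fun m m' =>
      h.bimod_ext fun i => map_add (φ i).retr m m')
    (fun b m => h.bimod_ext fun i => by
      rw [bimodEquiv_left]
      exact (φ i).retr_smul (h.central i) b m)
    (fun b m => h.bimod_ext fun i => by
      rw [← op_unop b, bimodEquiv_right]
      exact (φ i).retr_op_smul (h.central i) (unop b) m)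

lemma bimodEquiv_toProd (h : IsProduct c) {M' : ∀ i, BimodCat k (E i) (E i)} {M : BimodCat k S S}
    (φ : ∀ i, CornerMap (c i) (M' i) M) (m : M) (i : ι) :
    h.bimodEquiv M' ((h.toProd φ).hom m) i = (φ i).retr m := rfl

/-- The map `∏ M i → M` for a bimodule `M` with diagonal corners `M i`. -/
def ofProd (h : IsProduct c) {M' : ∀ i, BimodCat k (E i) (E i)} {M : BimodCat k S S}
    (φ : ∀ i, CornerMap (c i) (M' i) M) : h.bimod M' ⟶ M :=
  BimodCat.homMk
    (AddMonoidHom.mk' (fun m => ∑ i, (φ i).toFun (h.bimodEquiv M' m i)) fun m m' =>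
      (Finset.sum_congr rfl fun i _ => map_add (φ i).toFun _ _).trans Finset.sum_add_distrib)
    (fun b m => (Finset.sum_congr rfl fun i _ => by
      rw [bimodEquiv_left, (φ i).left, (h.central i).toFun_retr, h.central, mul_smul,
        (φ i).e_smul]).trans Finset.smul_sum.symm)
    (fun b m => (Finset.sum_congr rfl fun i _ => by
      rw [← op_unop b, bimodEquiv_right, (φ i).right, (h.central i).toFun_retr, op_mul, mul_smul,
        (φ i).op_e_smul]).trans Finset.smul_sum.symm)

lemma ofProd_apply (h : IsProduct c) {M' : ∀ i, BimodCat k (E i) (E i)} {M : BimodCat k S S}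
    (φ : ∀ i, CornerMap (c i) (M' i) M) (m : h.bimod M') :
    (h.ofProd φ).hom m = ∑ i, (φ i).toFun (h.bimodEquiv M' m i) := rfl

lemma ofProd_toProd (h : IsProduct c) {M' : ∀ i, BimodCat k (E i) (E i)} {M : BimodCat k S S}
    (φ : ∀ i, CornerMap (c i) (M' i) M) (m : M) :
    (h.ofProd φ).hom ((h.toProd φ).hom m) = (h.diag M).hom m :=
  Finset.sum_congr rfl fun i _ => (φ i).toFun_retr m

lemma toProd_ofProd (h : IsProduct c) {M' : ∀ i, BimodCat k (E i) (E i)} {M : BimodCat k S S}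
    (φ : ∀ i, CornerMap (c i) (M' i) M) (m : h.bimod M') :
    (h.toProd φ).hom ((h.ofProd φ).hom m) = m := h.bimod_ext fun i => by
  rw [bimodEquiv_toProd, ofProd_apply, map_sum, Finset.sum_eq_single i, (φ i).retr_toFun]
  · intro j _ hj
    rw [← (φ j).e_smul, (φ i).retr_smul (h.central i), h.retr_e_of_ne hj, zero_smul]
  · exact fun hi => absurd (Finset.mem_univ i) hi

variable {Y : TruncatedResolution k S n} {Yb : ∀ i, TruncatedResolution k (E i) n}
  (φ : ∀ i p, CornerMap (c i) ((Yb i).Y.X p) (Y.Y.X p))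

/-- The projection of a truncated resolution onto its diagonal part. -/
def toResolution (h : IsProduct c) (hn : 1 ≤ n)
    (φ : ∀ i p, CornerMap (c i) ((Yb i).Y.X p) (Y.Y.X p))
    (hd : ∀ i p q x, (φ i q).toFun (((Yb i).Y.d p q).hom x) =
      (Y.Y.d p q).hom ((φ i p).toFun x)) : Y.Y ⟶ (h.resolution hn Yb).Y where
  f p := h.toProd fun i => φ i p
  comm' p q _ := ModuleCat.hom_ext (LinearMap.ext fun m => h.bimod_ext fun i =>
    (φ i q).injective (by
      change (φ i q).toFun (((Yb i).Y.d p q).hom ((φ i p).retr m)) =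
        (φ i q).toFun ((φ i q).retr ((Y.Y.d p q).hom m))
      rw [hd, (φ i p).toFun_retr, (φ i q).toFun_retr, BimodCat.hom_left, BimodCat.hom_right]))

/-- The inclusion of the diagonal part of a truncated resolution. -/
def ofResolution (h : IsProduct c) (hn : 1 ≤ n)
    (φ : ∀ i p, CornerMap (c i) ((Yb i).Y.X p) (Y.Y.X p))
    (hd : ∀ i p q x, (φ i q).toFun (((Yb i).Y.d p q).hom x) =
      (Y.Y.d p q).hom ((φ i p).toFun x)) : (h.resolution hn Yb).Y ⟶ Y.Y where
  f p := h.ofProd fun i => φ i p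
  comm' p q _ := ModuleCat.hom_ext (LinearMap.ext fun _ =>
    (map_sum (Y.Y.d p q).hom _ _).trans (Finset.sum_congr rfl fun i _ => (hd i p q _).symm))

/-- A truncated resolution is homotopy equivalent to its diagonal part if the twisting automorphism
fixes the `e_i`. -/
def resolutionHomotopyEquiv (h : IsProduct c) (hn : 1 ≤ n) (hσ : ∀ i, Y.σ (c i).e = (c i).e)
    (φ : ∀ i p, CornerMap (c i) ((Yb i).Y.X p) (Y.Y.X p))
    (hd : ∀ i p q x, (φ i q).toFun (((Yb i).Y.d p q).hom x) =
      (Y.Y.d p q).hom ((φ i p).toFun x)) : HomotopyEquiv Y.Y (h.resolution hn Yb).Y where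
  hom := h.toResolution hn φ hd
  inv := h.ofResolution hn φ hd
  homotopyHomInvId := by
    -- The identity of `Y` minus the projection to the diagonal part factors through the off-diagonal
    -- part, which is acyclic, and maps from a K-projective complex to it are null-homotopic.
    have := Y.isKProjective
    have H : 𝟙 _ - h.toResolution hn φ hd ≫ h.ofResolution hn φ hd =
        h.offDiagProj Y.Y ≫ h.offDiagIncl Y.Y :=
      HomologicalComplex.hom_ext _ _ fun p => ModuleCat.hom_ext (LinearMap.ext fun m =>
        congrArg (fun t => m - t) (h.ofProd_toProd (fun i => φ i p) m))
    have H2 : Homotopy (h.offDiagProj Y.Y ≫ h.offDiagIncl Y.Y) 0 :=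
      ((CochainComplex.IsKProjective.homotopyZero (h.offDiagProj Y.Y)
        (h.offDiag_acyclic Y hσ)).compRight (h.offDiagIncl Y.Y)).trans
          (Homotopy.ofEq Limits.zero_comp)
    exact (Homotopy.equivSubZero.symm ((Homotopy.ofEq H).trans H2)).symm
  homotopyInvHomId := Homotopy.ofEq (HomologicalComplex.hom_ext _ _ fun p =>
    ModuleCat.hom_ext (LinearMap.ext fun m => h.toProd_ofProd (fun i => φ i p) m))

lemma toResolution_aug (h : IsProduct c) (hn : 1 ≤ n)
    (φ : ∀ i p, CornerMap (c i) ((Yb i).Y.X p) (Y.Y.X p))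
    (haug : ∀ i x, regularEquiv k S (Y.aug.hom ((φ i 0).toFun x)) =
      (c i).toFun (regularEquiv k (E i) ((Yb i).aug.hom x))) :
    h.toProd (fun i => φ i 0) ≫ (h.resolution hn Yb).aug = Y.aug :=
  ModuleCat.hom_ext (LinearMap.ext fun m => (regularEquiv k S).injective (h.equiv.injective
    (funext fun i => by
      refine (h.retr_regularIso _ i).trans ((c i).injective ?_)
      change (c i).toFun (regularEquiv k (E i) ((Yb i).aug.hom ((φ i 0).retr m))) =
        (c i).toFun ((c i).retr (regularEquiv k S (Y.aug.hom m)))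
      rw [← haug, (φ i 0).toFun_retr, BimodCat.hom_left, BimodCat.hom_right, regularEquiv_left,
        regularEquiv_right, (c i).toFun_retr, mul_assoc]
      rfl)))

end IsProduct

end DiagonalPart

section DiagonalTwist

variable {k A P : Type u} [Field k] [Ring A] [Algebra k A] [AddCommGroup P] [Module k P]
  [Module A P] [IsScalarTower k A P] [Module.Finite A P] [Module.Projective A P]
  [Module.Finite k A]
  {ι : Type} [Fintype ι] [DecidableEq ι] {E : ι → Type u} [∀ i, Ring (E i)]
  [∀ i, Algebra k (E i)] [∀ i, Module.Finite k (E i)] {c : ∀ i, CornerHom k (E i) (EndOp A P)}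
  {n : ℕ}

/-- If the twisting automorphism of a truncated resolution of `E ≅ ∏ E i` fixes the central
idempotents `e_i`, then the periodic twist is that of a product resolution. -/
lemma IsProduct.exists_periodicTwist_iso (h : IsProduct c) (hn : 1 ≤ n)
    (Y : TruncatedResolution k (EndOp A P) n) (hσ : ∀ i, Y.σ (c i).e = (c i).e) :
    ∃ Yb : ∀ i, TruncatedResolution k (E i) n,
      Nonempty (periodicTwist A Y ≅ periodicTwist A (h.resolution hn Yb)) := by
  have H := fun i => (c i).exists_truncatedResolution (h.central i).hasBasis Y (by
    rw [hσ]
    exact IdemEquiv.refl (c i).e_mul_e)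
  choose Yb φ hd haug using H
  let e := (moduleSandwich k A P).mapHomotopyEquiv (h.resolutionHomotopyEquiv hn hσ φ hd)
  let f : sandwichComplex A Y ⟶ sandwichComplex A (h.resolution hn Yb) := e.hom
  refine ⟨Yb, periodicTwist_iso_of_isIso Y (h.resolution hn Yb) f ?_
    (inferInstanceAs (IsIso (HomotopyCategory.isoOfHomotopyEquiv e).hom))⟩
  apply HomologicalComplex.to_single_hom_ext
  have h1 : (moduleSandwich k A P).map (h.toProd fun i => φ i 0) ≫
      sandwichAug (h.resolution hn Yb).aug = sandwichAug Y.aug :=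
    (Category.assoc _ _ _).symm.trans (congrArg (fun t => t ≫ _)
      (((moduleSandwich k A P).map_comp _ _).symm.trans
        (congrArg (moduleSandwich k A P).map (h.toResolution_aug hn φ haug))))
  rw [HomologicalComplex.comp_f, twistMap, twistMap, HomologicalComplex.mkHomToSingle_f,
    HomologicalComplex.mkHomToSingle_f]
  exact (Category.assoc _ _ _).symm.trans (congrArg (fun t => t ≫ _) h1)

end DiagonalTwist

/-! ### Symmetric algebras and semisimple projective modules -/

section Symmetrizing

variable {k A : Type u} [Field k] [Ring A] [Algebra k A]

/-- A symmetrizing form: a linear form `l` with `l (a b) = l (b a)` whose kernel contains no nonzero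
left ideal. -/
structure IsSymmetrizing (l : A →ₗ[k] k) : Prop where
  comm : ∀ a b, l (a * b) = l (b * a)
  eq_zero : ∀ a, (∀ b, l (b * a) = 0) → a = 0

lemma IsSymmetricAlgebra.exists_isSymmetrizing (h : IsSymmetricAlgebra k A) :
    ∃ l : A →ₗ[k] k, IsSymmetrizing l := by
  obtain ⟨φ, hφ⟩ := h
  have h1 : ∀ a b, φ a b = φ 1 (b * a) := fun a b => by
    rw [← mul_one (b * a), mul_assoc, ← one_mul (b * _), ← mul_assoc 1 b, one_mul, mul_one]
    simpa using hφ a 1 1 b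
  have h2 : ∀ a b, φ a b = φ 1 (a * b) := fun a b => by simpa using hφ 1 1 a b
  refine ⟨φ 1, ⟨fun a b => (h2 a b).symm.trans (h1 a b), fun a ha => ?_⟩⟩
  exact φ.injective (LinearMap.ext fun b => by rw [h1, ha, map_zero, LinearMap.zero_apply])

lemma IsSymmetrizing.comp_toFun {B : Type u} [Ring B] [Algebra k B] {c : CornerHom k B A}
    (hc : c.IsCentral) {l : A →ₗ[k] k} (h : IsSymmetrizing l) : IsSymmetrizing (l ∘ₗ c.toFun) where
  comm a b := by
    rw [LinearMap.comp_apply, LinearMap.comp_apply, c.map_mul, c.map_mul, h.comm]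
  eq_zero a ha := c.injective (by
    rw [map_zero]
    refine h.eq_zero _ fun b => ?_
    rw [hc.mul_toFun]
    exact ha (c.retr b))

variable {l : A →ₗ[k] k} (hl : IsSymmetrizing l)

section Projective

variable {P : Type u} [AddCommGroup P] [Module A P] [Module.Finite A P] [Module.Projective A P]

lemma exists_dualBasis (A P : Type u) [Ring A] [AddCommGroup P] [Module A P] [Module.Finite A P]
    [Module.Projective A P] : ∃ (n : ℕ) (m : Fin n → P) (φ : Fin n → P →ₗ[A] A),
      ∀ p, ∑ i, φ i p • m i = p := by
  obtain ⟨n, π, hπ⟩ := Module.Finite.exists_fin' A P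
  obtain ⟨s, hs⟩ := Module.projective_lifting_property π LinearMap.id hπ
  refine ⟨n, fun i => π (Pi.single i 1), fun i => LinearMap.proj i ∘ₗ s, fun p => ?_⟩
  refine Eq.trans ?_ (LinearMap.congr_fun hs p)
  rw [LinearMap.comp_apply]
  conv_rhs => rw [← Finset.univ_sum_single (s p), map_sum]
  refine Finset.sum_congr rfl fun i _ => ?_
  rw [← map_smul, ← Pi.single_smul, smul_eq_mul, mul_one]
  rfl

/-- A nonzero element of a projective module over a symmetric algebra is not annihilated by the
trace ideal of the module. -/
lemma IsSymmetrizing.eq_zero_of_forall_smul (hl : IsSymmetrizing l) (x : P)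
    (hx : ∀ (ψ : P →ₗ[A] A) q, ψ q • x = 0) : x = 0 := by
  obtain ⟨n, m, φ, hφ⟩ := exists_dualBasis A P
  have h : ∀ i, φ i x = 0 := fun i => hl.eq_zero _ fun a => by
    conv_lhs => rw [← hφ x]
    rw [map_sum, Finset.mul_sum, map_sum]
    refine Finset.sum_eq_zero fun j _ => ?_
    -- `φ i (m j) a` lies in the trace ideal, hence annihilates `φ j x`
    let ψ : P →ₗ[A] A := (LinearMap.mulRight A a).restrictScalars A ∘ₗ φ i
    rw [map_smul, smul_eq_mul, ← mul_assoc, hl.comm, ← mul_assoc]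
    have h1 : φ i (m j) * a * φ j x = 0 := by
      have := congrArg (φ j) (hx ψ (m j))
      rwa [map_smul, map_zero] at this
    rw [h1, map_zero]
  rw [← hφ x]
  exact Finset.sum_eq_zero fun i _ => by rw [h, zero_smul]

end Projective

/-- In an indecomposable symmetric algebra, an ideal that meets its annihilator trivially is
trivial. -/
lemma IsSymmetrizing.eq_bot_or_eq_top [Module.Finite k A] (hl : IsSymmetrizing l)
    (hA : IsIndecomposableRing A) (K : Ideal A) (hK : K.IsTwoSided)
    (h : ∀ y ∈ K, (∀ x ∈ K, x * y = 0) → y = 0) : K = ⊥ ∨ K = ⊤ := by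
  let B : LinearMap.BilinForm k A := (LinearMap.mul k A).compr₂ l
  have hB : ∀ x y, B x y = l (x * y) := fun x y => rfl
  have hr : B.IsRefl := fun x y hxy => by rw [hB, hl.comm]; exact hxy
  let W : Submodule k A := K.restrictScalars k
  have hann : ∀ y, (∀ x ∈ K, l (x * y) = 0) → ∀ x ∈ K, x * y = 0 := fun y hy x hx =>
    hl.eq_zero _ fun b => by
      rw [← mul_assoc]
      exact hy _ (K.mul_mem_left b hx)
  have hW : (B.restrict W).Nondegenerate := by
    have : (B.restrict W).SeparatingRight := fun y hy =>
      Subtype.ext (h y.1 y.2 (hann y.1 fun x hx => hy ⟨x, hx⟩))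
    refine ⟨fun x hx => this x fun y => ?_, this⟩
    exact hr _ _ (hx y)
  have hc := LinearMap.BilinForm.isCompl_orthogonal_of_restrict_nondegenerate hr hW
  have ho : ∀ y, y ∈ B.orthogonal W ↔ ∀ x ∈ K, x * y = 0 := fun y =>
    ⟨fun hy => hann y fun x hx => hy x hx, fun hy x hx => by
      change l (x * y) = 0
      rw [hy x hx, map_zero]⟩
  have h0 : ∀ y, y ∈ K → (∀ x ∈ K, x * y = 0) → y = 0 := h
  obtain ⟨e, he, f, hf, hef⟩ := Submodule.mem_sup.1 (hc.sup_eq_top ▸ Submodule.mem_top :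
    (1 : A) ∈ W ⊔ B.orthogonal W)
  have he : e ∈ K := he
  rw [ho] at hf
  have hf' : ∀ x ∈ K, f * x = 0 := fun x hx => by
    have : f * x ∈ B.orthogonal W := by
      intro z hz
      change l (z * (f * x)) = 0
      rw [← mul_assoc, hf z hz, zero_mul, map_zero]
    exact h0 _ (K.mul_mem_left f hx) ((ho _).1 this)
  have h1 : ∀ x ∈ K, x * e = x := fun x hx => by
    conv_rhs => rw [← mul_one x, ← hef, mul_add, hf x hx, add_zero]
  have h2 : ∀ x ∈ K, e * x = x := fun x hx => by
    conv_rhs => rw [← one_mul x, ← hef, add_mul, hf' x hx, add_zero]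
  rcases hA.2 e (h1 e he) fun x => by
    rw [← h1 (e * x) (hK.mul_mem_of_left x he), mul_assoc, h2 (x * e) (K.mul_mem_left x he)]
    with rfl | rfl
  · left
    rw [eq_bot_iff]
    intro x hx
    rw [Submodule.mem_bot, ← h1 x hx, mul_zero]
  · right
    exact (Ideal.eq_top_iff_one K).2 he

/-- A submodule of a semisimple module generated by `M` vanishes if it receives no nonzero map
from `M`. -/
lemma eq_bot_of_forall_hom_eq_zero {A M X : Type*} [Ring A] [AddCommGroup M] [Module A M]
    [AddCommGroup X] [Module A X] [IsSemisimpleModule A X]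
    (hX : ⨆ ψ : M →ₗ[A] X, LinearMap.range ψ = ⊤) (N : Submodule A X)
    (h : ∀ g : M →ₗ[A] N, g = 0) : N = ⊥ := by
  obtain ⟨N', hN'⟩ := exists_isCompl N
  let pr : X →ₗ[A] N := N.projectionOnto N' hN'
  have hpr : ⊤ ≤ LinearMap.ker pr := by
    rw [← hX]
    refine iSup_le fun ψ => ?_
    rintro _ ⟨q, rfl⟩
    exact LinearMap.congr_fun (h (pr ∘ₗ ψ)) q
  rw [eq_bot_iff]
  intro z hz
  have h1 : pr z = ⟨z, hz⟩ := Submodule.projectionOnto_apply_left hN' ⟨z, hz⟩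
  have h2 : pr z = 0 := hpr Submodule.mem_top
  exact congrArg Subtype.val (h1.symm.trans h2)

/-- An indecomposable symmetric algebra with a nonzero finitely generated projective module that is
semisimple is a simple algebra. -/
lemma IsSymmetrizing.isSimpleRing [Module.Finite k A] (hl : IsSymmetrizing l)
    (hA : IsIndecomposableRing A) (M : Type u) [AddCommGroup M] [Module A M] [Module.Finite A M]
    [Module.Projective A M] [Nontrivial M] [IsSemisimpleModule A M] : IsSimpleRing A := by
  obtain ⟨n, m, φ, hφ⟩ := exists_dualBasis A M
  have := hA.1
  let I : Ideal A := ⨆ ψ : M →ₗ[A] A, LinearMap.range ψ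
  have hmem : ∀ (ψ : M →ₗ[A] A) q, ψ q ∈ I := fun ψ q =>
    Submodule.mem_iSup_of_mem ψ ⟨q, rfl⟩
  have hI : I.IsTwoSided := ⟨fun {x} a hx => by
    refine Submodule.iSup_induction (motive := fun x => x * a ∈ I) _ hx ?_ ?_ ?_
    · rintro ψ _ ⟨q, rfl⟩
      exact hmem ((LinearMap.mulRight A a).restrictScalars A ∘ₗ ψ) q
    · rw [zero_mul]
      exact I.zero_mem
    · intro x y hx hy
      rw [add_mul]
      exact I.add_mem hx hy⟩
  have hss : IsSemisimpleModule A I := by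
    have h : IsSemisimpleModule A
        (⨆ ψ ∈ (Set.univ : Set (M →ₗ[A] A)), LinearMap.range ψ : Submodule A A) :=
      isSemisimpleModule_biSup_of_isSemisimpleModule_submodule fun ψ _ =>
        IsSemisimpleModule.range ψ
    have hE : I = ⨆ ψ ∈ (Set.univ : Set (M →ₗ[A] A)), LinearMap.range ψ := by simp [I]
    rw [hE]
    exact h
  -- a homomorphism from `M` to a submodule annihilated by the trace ideal vanishes
  have hzero : ∀ (N : Ideal A), (∀ x ∈ I, ∀ y ∈ N, x * y = 0) → ∀ g : M →ₗ[A] A,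
      (∀ q, g q ∈ N) → g = 0 := fun N hN g hg => LinearMap.ext fun q => by
    rw [← hφ q, map_sum]
    exact Finset.sum_eq_zero fun i _ => by
      rw [map_smul, smul_eq_mul, hN _ (hmem _ _) _ (hg _)]
  -- The trace ideal `I` of `M` is a direct factor of `A`: the elements `z` of `I` with `I z = 0` form a
  -- submodule of the semisimple module `I` that receives no nonzero map from `M`.
  have hItop : I = ⊤ := by
    refine (hl.eq_bot_or_eq_top hA I hI fun y hy hy' => ?_).resolve_left fun h => ?_
    · let N : Submodule A I :=
        { carrier := {z | ∀ x ∈ I, x * z.1 = 0}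
          add_mem' := fun {z z'} hz hz' x hx => by
            change x * (z.1 + z'.1) = 0
            rw [mul_add, hz x hx, hz' x hx, add_zero]
          zero_mem' := fun x _ => mul_zero x
          smul_mem' := fun a z hz x hx => by
            change x * (a * z.1) = 0
            rw [← mul_assoc]
            exact hz _ (hI.mul_mem_of_left a hx) }
      have hN : N = ⊥ := eq_bot_of_forall_hom_eq_zero (M := M) (eq_top_iff.2 fun z _ => by
          have hle : I ≤ (⨆ ψ : M →ₗ[A] I, LinearMap.range ψ).map I.subtype :=
            iSup_le fun ψ => by
              rintro _ ⟨q, rfl⟩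
              exact ⟨_, Submodule.mem_iSup_of_mem (ψ.codRestrict I (hmem ψ)) ⟨q, rfl⟩, rfl⟩
          obtain ⟨z', hz', h⟩ := hle z.2
          rwa [← Subtype.ext (h : z'.1 = z.1)]) N fun g => LinearMap.ext fun q =>
        Subtype.ext (Subtype.ext (LinearMap.congr_fun (hzero (N.map I.subtype) (fun x hx y hy => by
            obtain ⟨z, hz, rfl⟩ := hy
            exact hz x hx) (I.subtype ∘ₗ N.subtype ∘ₗ g) fun q => ⟨_, (g q).2, rfl⟩) q))
      have : (⟨y, hy⟩ : I) ∈ N := hy'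
      rw [hN, Submodule.mem_bot] at this
      exact congrArg Subtype.val this
    · obtain ⟨x, hx⟩ := exists_ne (0 : M)
      refine hx ?_
      rw [← hφ x]
      refine Finset.sum_eq_zero fun i _ => ?_
      have h0 := hmem (φ i) x
      rw [h, Submodule.mem_bot] at h0
      rw [h0, zero_smul]
  have hA' : IsSemisimpleModule A A := by
    rw [hItop] at hss
    exact IsSemisimpleModule.congr (Submodule.topEquiv (R := A) (M := A)).symm
  refine isSimpleRing_iff_isTwoSided_imp.2 ⟨inferInstance, fun K hK => ?_⟩
  refine hl.eq_bot_or_eq_top hA K hK fun y hy hy' => ?_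
  -- a left ideal of square zero of a semisimple ring vanishes
  let N : Ideal A :=
    { carrier := {z | z ∈ K ∧ ∀ x ∈ K, x * z = 0}
      add_mem' := fun {z z'} hz hz' => ⟨K.add_mem hz.1 hz'.1, fun x hx => by
        rw [mul_add, hz.2 x hx, hz'.2 x hx, add_zero]⟩
      zero_mem' := ⟨K.zero_mem, fun x _ => mul_zero x⟩
      smul_mem' := fun a z hz => ⟨K.mul_mem_left a hz.1, fun x hx => by
        change x * (a * z) = 0
        rw [← mul_assoc]
        exact hz.2 _ (hK.mul_mem_of_left a hx)⟩ }
  obtain ⟨N', hN'⟩ := exists_isCompl N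
  obtain ⟨e, he, f, hf, hef⟩ := Submodule.mem_sup.1 (hN'.sup_eq_top ▸ Submodule.mem_top :
    (1 : A) ∈ N ⊔ N')
  have hyN : y ∈ N := ⟨hy, hy'⟩
  have h1 : y * f = y := by
    have : y * e = 0 := he.2 y hy
    conv_rhs => rw [← mul_one y, ← hef, mul_add, this, zero_add]
  exact Submodule.disjoint_def.1 hN'.disjoint y hyN (h1 ▸ N'.mul_mem_left y hf)

end Symmetrizing

/-! ### Casimir elements -/

section Casimir

variable {k E : Type u} [Field k] [Ring E] [Algebra k E]

variable (k E) in
/-- The multiplication map `E ⊗ Eᵒᵖ → E`, `x ⊗ y ↦ x y`. -/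
def contraction : E ⊗[k] Eᵐᵒᵖ →ₗ[k] E :=
  LinearMap.mul' k E ∘ₗ TensorProduct.map LinearMap.id (opLinearEquiv k).symm.toLinearMap

lemma contraction_tmul (x y : E) : contraction k E (x ⊗ₜ op y) = x * y := rfl

variable (k) in
/-- There is an element `∑ x_i ⊗ y_i` of `E ⊗ E` with `∑ h x_i ⊗ y_i = ∑ x_i ⊗ y_i h` for all `h`
and `∑ x_i y_i = z`. For a central idempotent `z`, this means that `z E` is a separable algebra. -/
def HasCasimir (z : E) : Prop :=
  ∃ T : E ⊗[k] Eᵐᵒᵖ, (∀ h : E, (h ⊗ₜ[k] (1 : Eᵐᵒᵖ)) * T = ((1 : E) ⊗ₜ[k] op h) * T) ∧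
    contraction k E T = z

lemma HasCasimir.map_of_surjective {F : Type u} [Ring F] [Algebra k F] (f : E →ₐ[k] F)
    (hf : Function.Surjective f) {z : E} (h : HasCasimir k z) : HasCasimir k (f z) := by
  obtain ⟨T, h1, h2⟩ := h
  let g : E ⊗[k] Eᵐᵒᵖ →ₐ[k] F ⊗[k] Fᵐᵒᵖ := Algebra.TensorProduct.map f (AlgHom.op f)
  have hg : ∀ x y, g (x ⊗ₜ op y) = f x ⊗ₜ op (f y) := fun _ _ => rfl
  refine ⟨g T, fun h => ?_, ?_⟩
  · obtain ⟨h, rfl⟩ := hf h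
    have := congrArg g (h1 h)
    rwa [map_mul, map_mul, ← op_one, hg, hg, map_one, op_one] at this
  · rw [← h2]
    clear h1 h2
    induction T using TensorProduct.induction_on with
    | zero => rw [map_zero, map_zero, map_zero, map_zero]
    | add x y hx hy => rw [map_add, map_add, hx, hy, map_add, map_add]
    | tmul x y =>
      rw [← op_unop y, hg, contraction_tmul, contraction_tmul, map_mul]

/-- The symmetry of a Casimir element: `∑ β(h x_i, y_i) = ∑ β(x_i, y_i h)`. -/
lemma lift_casimir {V : Type*} [AddCommGroup V] [Module k V] (β : E →ₗ[k] E →ₗ[k] V)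
    {T : E ⊗[k] Eᵐᵒᵖ} (hT : ∀ h : E, (h ⊗ₜ[k] (1 : Eᵐᵒᵖ)) * T = ((1 : E) ⊗ₜ[k] op h) * T) (h : E) :
    TensorProduct.lift ((β ∘ₗ LinearMap.mulLeft k h).compl₂ (opLinearEquiv k).symm.toLinearMap) T =
      TensorProduct.lift (β.compl₂ (LinearMap.mulRight k h ∘ₗ
        (opLinearEquiv k).symm.toLinearMap)) T := by
  let L : E ⊗[k] Eᵐᵒᵖ →ₗ[k] V := TensorProduct.lift (β.compl₂ (opLinearEquiv k).symm.toLinearMap)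
  have h1 : TensorProduct.lift ((β ∘ₗ LinearMap.mulLeft k h).compl₂
      (opLinearEquiv k).symm.toLinearMap) = L ∘ₗ LinearMap.mulLeft k (h ⊗ₜ[k] (1 : Eᵐᵒᵖ)) :=
    TensorProduct.ext' fun x y => by
      rw [LinearMap.comp_apply, LinearMap.mulLeft_apply, Algebra.TensorProduct.tmul_mul_tmul,
        one_mul]
      rfl
  have h2 : TensorProduct.lift (β.compl₂ (LinearMap.mulRight k h ∘ₗ
        (opLinearEquiv k).symm.toLinearMap)) = L ∘ₗ LinearMap.mulLeft k ((1 : E) ⊗ₜ[k] op h) :=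
    TensorProduct.ext' fun x y => by
      rw [LinearMap.comp_apply, LinearMap.mulLeft_apply, Algebra.TensorProduct.tmul_mul_tmul,
        one_mul]
      rfl
  rw [h1, h2, LinearMap.comp_apply, LinearMap.comp_apply, LinearMap.mulLeft_apply,
    LinearMap.mulLeft_apply, hT]

/-- Maschke's theorem: for a left ideal `H` of an algebra with a Casimir element of contraction `z`
there is an element `π` of `H` with `x π = x z` for `x ∈ H`. -/
lemma HasCasimir.exists_mem_of_leftIdeal {z : E} (hz : HasCasimir k z) (hc : ∀ x, z * x = x * z)
    (H : Submodule k E) (hH : ∀ a, ∀ x ∈ H, a * x ∈ H) : ∃ π ∈ H, ∀ x ∈ H, x * π = x * z := by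
  obtain ⟨T, h1, h2⟩ := hz
  obtain ⟨H', hH'⟩ := exists_isCompl H
  let p : E →ₗ[k] E := H.subtype ∘ₗ H.projectionOnto H' hH'
  have hp : ∀ x, p x ∈ H := fun x => (H.projectionOnto H' hH' x).2
  have hpx : ∀ x ∈ H, p x = x := fun x hx =>
    congrArg Subtype.val (Submodule.projectionOnto_apply_left hH' ⟨x, hx⟩)
  -- `π = ∑ x_i p(y_i)`
  let β : E →ₗ[k] E →ₗ[k] E := (LinearMap.mul k E).compl₂ p
  let L : E ⊗[k] Eᵐᵒᵖ →ₗ[k] E := TensorProduct.lift (β.compl₂ (opLinearEquiv k).symm.toLinearMap)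
  refine ⟨L T, ?_, fun x hx => ?_⟩
  · clear h1 h2
    induction T using TensorProduct.induction_on with
    | zero => rw [map_zero]; exact H.zero_mem
    | add x y hx hy => rw [map_add]; exact H.add_mem hx hy
    | tmul x y => exact hH x _ (hp (unop y))
  · have h3 := lift_casimir β h1 x
    have h4 : TensorProduct.lift ((β ∘ₗ LinearMap.mulLeft k x).compl₂
        (opLinearEquiv k).symm.toLinearMap) T = x * L T := by
      clear h1 h2 h3
      induction T using TensorProduct.induction_on with
      | zero => rw [map_zero, map_zero, mul_zero]
      | add a b ha hb => rw [map_add, map_add, ha, hb, mul_add]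
      | tmul a b => exact mul_assoc x a (p (unop b))
    have h5 : TensorProduct.lift (β.compl₂ (LinearMap.mulRight k x ∘ₗ
        (opLinearEquiv k).symm.toLinearMap)) T = contraction k E T * x := by
      clear h1 h2 h3 h4
      induction T using TensorProduct.induction_on with
      | zero => rw [map_zero, map_zero, zero_mul]
      | add a b ha hb => rw [map_add, map_add, ha, hb, add_mul]
      | tmul a b =>
        refine (congrArg (fun t => a * t) (hpx _ (hH (unop b) x hx))).trans ?_
        exact (mul_assoc a (unop b) x).symm
    rw [← h4, h3, h5, h2, hc]

end Casimir

section SemisimpleSummand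

variable {k A P : Type u} [Field k] [Ring A] [Algebra k A] [AddCommGroup P] [Module k P]
  [Module A P] [IsScalarTower k A P] [Module.Finite A P] [Module.Projective A P]

/-- Let `P` be a projective module over a symmetric algebra and `z` a central idempotent of its
endomorphism algebra `E`. If `z E` is separable, then `P z` is semisimple. -/
lemma IsSymmetrizing.isSemisimpleModule_range {l : A →ₗ[k] k} (hl : IsSymmetrizing l)
    {z : EndOp A P} (hz : HasCasimir k z) (hc : ∀ x, z * x = x * z) (hi : z * z = z) :
    IsSemisimpleModule A (LinearMap.range (unop z)) := by
  refine (isSemisimpleModule_iff A _).2 ⟨fun N₀ => ?_⟩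
  let N : Submodule A P := N₀.map (LinearMap.range (unop z)).subtype
  have hN : ∀ x ∈ N, unop z x = x := by
    rintro _ ⟨⟨_, q, rfl⟩, _, rfl⟩
    exact congrArg (fun t : EndOp A P => unop t q) hi
  let H : Submodule k (EndOp A P) :=
    { carrier := {h | ∀ p, unop h p ∈ N}
      add_mem' := fun h h' p => N.add_mem (h p) (h' p)
      zero_mem' := fun p => N.zero_mem
      smul_mem' := fun c h hh p => (N.restrictScalars k).smul_mem c (hh p) }
  obtain ⟨π, hπ, hπ'⟩ := hz.exists_mem_of_leftIdeal hc H fun a x hx p => hx (unop a p)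
  have hH : ∀ h ∈ H, h * π = h := fun h hh => by
    rw [hπ' h hh]
    exact endOp_ext fun p => hN _ (hh p)
  have hππ : ∀ p, unop π (unop π p) = unop π p := fun p =>
    congrArg (fun t : EndOp A P => unop t p) (hH π hπ)
  have hfix : ∀ x ∈ N, unop π x = x := fun x hx => by
    refine (sub_eq_zero.1 (hl.eq_zero_of_forall_smul (x - unop π x) fun ψ q => ?_)).symm
    -- the endomorphism `p ↦ ψ(p) (x - π x)` has image in `N`
    let h : EndOp A P := op (LinearMap.toSpanSingleton A P (x - unop π x) ∘ₗ ψ)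
    have hh : h ∈ H := fun p => N.smul_mem _ (N.sub_mem hx (hπ x))
    have h1 : unop π (ψ q • (x - unop π x)) = ψ q • (x - unop π x) :=
      congrArg (fun t : EndOp A P => unop t q) (hH h hh)
    rw [← h1, map_smul, map_sub, hππ, sub_self, smul_zero]
  have hmem : ∀ x, unop π x ∈ LinearMap.range (unop z) := fun x => by
    obtain ⟨y, _, hy⟩ := hπ x
    rw [← hy]
    exact y.2
  let pr : LinearMap.range (unop z) →ₗ[A] N₀ :=
    ((unop π).restrict fun x _ => hmem x).codRestrict N₀ fun x => by
      obtain ⟨y, hy, hyx⟩ := hπ x.1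
      have : (unop π).restrict (fun x _ => hmem x) x = y := Subtype.ext hyx.symm
      rw [this]
      exact hy
  exact ⟨LinearMap.ker pr, LinearMap.isCompl_of_proj (f := pr) fun x =>
    Subtype.ext (Subtype.ext (hfix _ ⟨x.1, x.2, rfl⟩))⟩

/-- If a nonzero factor `z E` of the endomorphism algebra `E` of a projective module over an
indecomposable symmetric algebra is separable, then the algebra is simple. -/
lemma IsSymmetrizing.isSimpleRing_of_hasCasimir [Module.Finite k A] {l : A →ₗ[k] k}
    (hl : IsSymmetrizing l) (hA : IsIndecomposableRing A) {z : EndOp A P} (hz : HasCasimir k z)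
    (hc : ∀ x, z * x = x * z) (hi : z * z = z) (h0 : z ≠ 0) : IsSimpleRing A := by
  have := hl.isSemisimpleModule_range hz hc hi
  have hp : ∀ x, unop z (unop z x) = unop z x := fun x => congrArg (fun t : EndOp A P => unop t x) hi
  let p : P →ₗ[A] LinearMap.range (unop z) := (unop z).rangeRestrict
  have : Module.Projective A (LinearMap.range (unop z)) :=
    Module.Projective.of_split (LinearMap.range (unop z)).subtype p (by
      refine LinearMap.ext ?_
      rintro ⟨_, x, rfl⟩
      exact Subtype.ext (hp x))
  have : Nontrivial (LinearMap.range (unop z)) := by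
    by_contra h
    rw [not_nontrivial_iff_subsingleton] at h
    refine h0 (endOp_ext fun x => ?_)
    exact congrArg Subtype.val (Subsingleton.elim (p x) 0)
  exact hl.isSimpleRing hA (LinearMap.range (unop z))

end SemisimpleSummand

/-! ### Casimir elements and resolutions -/

section CasimirResolution

/-- Multiplication by `z` on `M` factors through a projective module. -/
def FactorsThroughProjective {R : Type u} [Ring R] (z : R) (M : ModuleCat.{u} R) : Prop :=
  ∃ (Q : ModuleCat.{u} R) (_ : Module.Projective R Q) (u : M ⟶ Q) (v : Q ⟶ M),
    ∀ m, v.hom (u.hom m) = z • m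

/-- If multiplication by a central element factors through a projective module on `M`, then it does
so on every syzygy of `M`. -/
lemma ExactRes.factorsThroughProjective {R : Type u} [Ring R] {z : R} (hz : ∀ s, z * s = s * z)
    {n : ℕ} {K M : ModuleCat.{u} R} (h : ExactRes n K M) (hM : FactorsThroughProjective z M) :
    FactorsThroughProjective z K := by
  induction h with
  | zero e =>
    obtain ⟨Q, hQ, u, v, huv⟩ := hM
    refine ⟨Q, hQ, e.hom ≫ u, v ≫ e.inv, fun m => ?_⟩
    refine (congrArg e.inv.hom (huv (e.hom.hom m))).trans ?_
    rw [map_smul]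
    exact congrArg (z • ·) (congrArg (fun f => f.hom m) e.hom_inv_id)
  | @succ n K L P M i p hi hp hip hP h ih =>
    refine ih ?_
    obtain ⟨Q, hQ, u, v, huv⟩ := hM
    obtain ⟨v', hv'⟩ := Module.projective_lifting_property p.hom v.hom hp
    have hpv : ∀ q, p.hom (v' q) = v.hom q := fun q => LinearMap.congr_fun hv' q
    -- On the cover `P` of `M`, multiplication by `z` minus the map through `Q` takes values in the
    -- syzygy `L`, so it factors multiplication by `z` on `L` through `P`.
    let r : P →ₗ[R] P :=
      { toFun := fun x => z • x - v' (u.hom (p.hom x))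
        map_add' := fun x y => by
          rw [map_add, map_add, map_add, smul_add]
          abel
        map_smul' := fun s x => by
          rw [map_smul, map_smul, map_smul, RingHom.id_apply, smul_sub, smul_smul, smul_smul, hz] }
    have hr : ∀ x, r x ∈ LinearMap.range i.hom := fun x => (hip _).1 (by
      change p.hom (z • x - v' (u.hom (p.hom x))) = 0
      rw [map_sub, map_smul, hpv, huv, sub_self])
    let e := LinearEquiv.ofInjective i.hom hi
    let r' : P →ₗ[R] L := e.symm.toLinearMap ∘ₗ r.codRestrict _ hr
    have hr' : ∀ x, i.hom (r' x) = r x := fun x =>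
      congrArg Subtype.val (e.apply_symm_apply ⟨r x, hr x⟩)
    refine ⟨P, hP.2, i, ModuleCat.homEquiv.symm r', fun m => hi ?_⟩
    refine (hr' _).trans ?_
    change z • i.hom m - v' (u.hom (p.hom (i.hom m))) = _
    rw [(hip _).2 ⟨m, rfl⟩, map_zero, map_zero, sub_zero, map_smul]

variable {k E : Type u} [Field k] [Ring E] [Algebra k E]

lemma twistedEquiv_tmul_smul (σ : E ≃ₐ[k] E) (x y : E) (m : twistedBimod σ) :
    twistedEquiv σ ((x ⊗ₜ[k] op y) • m) = x * twistedEquiv σ m * σ y := by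
  have h : (x ⊗ₜ[k] op y) • m = x • op y • m := by
    rw [BimodCat.left_smul_def, BimodCat.right_smul_def, smul_smul,
      Algebra.TensorProduct.tmul_mul_tmul, mul_one, one_mul]
  rw [h, twistedEquiv_left, twistedEquiv_right, mul_assoc]

lemma regularEquiv_tmul_smul (x y : E) (m : regularBimod k E) :
    regularEquiv k E ((x ⊗ₜ[k] op y) • m) = x * regularEquiv k E m * y := by
  have h : (x ⊗ₜ[k] op y) • m = x • op y • m := by
    rw [BimodCat.left_smul_def, BimodCat.right_smul_def, smul_smul,
      Algebra.TensorProduct.tmul_mul_tmul, mul_one, one_mul]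
  rw [h, regularEquiv_left, regularEquiv_right, mul_assoc]

lemma hasCasimir_of_factorsThroughProjective {σ : E ≃ₐ[k] E} {e f : E}
    (h : FactorsThroughProjective (e ⊗ₜ[k] op f) (twistedBimod σ)) : HasCasimir k (e * σ f) := by
  obtain ⟨Q, hQ, u, v, huv⟩ := h
  let w : twistedBimod σ := (twistedEquiv σ).symm 1
  have hw : twistedEquiv σ w = 1 := (twistedEquiv σ).apply_symm_apply 1
  -- The map through `Q` lifts to the free cover `p`; the lift `T` of the image of the generator `w`
  -- is a Casimir element up to the twist by `σ`.
  let p : E ⊗[k] Eᵐᵒᵖ →ₗ[E ⊗[k] Eᵐᵒᵖ] twistedBimod σ := LinearMap.toSpanSingleton _ _ w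
  have hp : Function.Surjective p := fun m =>
    ⟨twistedEquiv σ m ⊗ₜ op 1, (twistedEquiv σ).injective (by
      refine (twistedEquiv_tmul_smul σ _ _ w).trans ?_
      rw [hw, mul_one, map_one, mul_one])⟩
  obtain ⟨v', hv'⟩ := Module.projective_lifting_property p v.hom hp
  let T : E ⊗[k] Eᵐᵒᵖ := v' (u.hom w)
  have hT : T • w = (e ⊗ₜ[k] op f) • w := (LinearMap.congr_fun hv' (u.hom w)).trans (huv w)
  let g : E ⊗[k] Eᵐᵒᵖ →ₐ[k] E ⊗[k] Eᵐᵒᵖ :=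
    Algebra.TensorProduct.map (AlgHom.id k E) (AlgHom.op σ.toAlgHom)
  have hg : ∀ x y, g (x ⊗ₜ op y) = x ⊗ₜ op (σ y) := fun _ _ => rfl
  refine ⟨g T, fun h => ?_, ?_⟩
  · have h1 : (h ⊗ₜ[k] op (1 : E)) • w = ((1 : E) ⊗ₜ[k] op (σ.symm h)) • w :=
      (twistedEquiv σ).injective (by
        rw [twistedEquiv_tmul_smul, twistedEquiv_tmul_smul, hw, σ.apply_symm_apply]
        simp)
    have h2 := congrArg (fun m => v' (u.hom m)) h1
    simp only [map_smul, smul_eq_mul] at h2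
    have h3 := congrArg g h2
    rw [map_mul, map_mul, hg, hg, map_one, σ.apply_symm_apply] at h3
    exact h3
  · have h1 : ∀ T : E ⊗[k] Eᵐᵒᵖ, contraction k E (g T) = twistedEquiv σ (T • w) := fun T => by
      induction T using TensorProduct.induction_on with
      | zero =>
        rw [map_zero, map_zero]
        exact ((congrArg _ (zero_smul (E ⊗[k] Eᵐᵒᵖ) w)).trans (map_zero _)).symm
      | add x y hx hy => rw [add_smul, map_add, map_add, map_add, hx, hy]
      | tmul x y =>
        rw [← op_unop y, hg, contraction_tmul, twistedEquiv_tmul_smul, hw, mul_one]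
    rw [h1, hT, twistedEquiv_tmul_smul, hw, mul_one]

/-- If `e` and `f` are orthogonal central idempotents, then `e E f = 0`, so that the summand
`e E_σ f` of the last term of a truncated resolution is projective. -/
lemma TruncatedResolution.hasCasimir {n : ℕ} (Y : TruncatedResolution k E n) {e f : E}
    (he : ∀ x, e * x = x * e) (hf : ∀ x, f * x = x * f) (hef : e * f = 0) :
    HasCasimir k (e * Y.σ f) := by
  refine hasCasimir_of_factorsThroughProjective (Y.exactRes.factorsThroughProjective
    (fun s => ?_) ⟨ModuleCat.of (E ⊗[k] Eᵐᵒᵖ) PUnit.{u + 1},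
      inferInstance, 0, 0, fun m => (regularEquiv k E).injective ?_⟩)
  · induction s using TensorProduct.induction_on with
    | zero => rw [mul_zero, zero_mul]
    | add x y hx hy => rw [mul_add, add_mul, hx, hy]
    | tmul x y =>
      rw [← op_unop y, Algebra.TensorProduct.tmul_mul_tmul, Algebra.TensorProduct.tmul_mul_tmul,
        ← op_mul, ← op_mul, he, hf]
  · refine (map_zero (regularEquiv k E)).trans ((regularEquiv_tmul_smul e f m).trans ?_).symm
    rw [mul_assoc, ← hf, ← mul_assoc, hef, zero_mul]

lemma HasCasimir.fgProj_regularBimod (h : HasCasimir k (1 : E)) :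
    FGProj (E ⊗[k] Eᵐᵒᵖ) (regularBimod k E) := by
  obtain ⟨T, h1, h2⟩ := h
  let w : regularBimod k E := (regularEquiv k E).symm 1
  have hw : regularEquiv k E w = 1 := (regularEquiv k E).apply_symm_apply 1
  let f : regularBimod k E ⟶ ModuleCat.of (E ⊗[k] Eᵐᵒᵖ) (E ⊗[k] Eᵐᵒᵖ) := BimodCat.homMk
    (AddMonoidHom.mk' (fun m => ((regularEquiv k E m) ⊗ₜ[k] (1 : Eᵐᵒᵖ)) * T) fun m m' => by
      rw [map_add, TensorProduct.add_tmul, add_mul])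
    (fun b m => by
      change ((regularEquiv k E (b • m)) ⊗ₜ[k] (1 : Eᵐᵒᵖ)) * T =
        (b ⊗ₜ[k] (1 : Eᵐᵒᵖ)) * (((regularEquiv k E m) ⊗ₜ[k] (1 : Eᵐᵒᵖ)) * T)
      rw [regularEquiv_left, ← mul_assoc, Algebra.TensorProduct.tmul_mul_tmul, one_mul])
    (fun b m => by
      change ((regularEquiv k E (b • m)) ⊗ₜ[k] (1 : Eᵐᵒᵖ)) * T =
        ((1 : E) ⊗ₜ[k] b) * (((regularEquiv k E m) ⊗ₜ[k] (1 : Eᵐᵒᵖ)) * T)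
      rw [← op_unop b, regularEquiv_right, ← mul_assoc, Algebra.TensorProduct.tmul_mul_tmul,
        one_mul, mul_one]
      have h3 : ((regularEquiv k E m * unop b) ⊗ₜ[k] (1 : Eᵐᵒᵖ)) =
          (regularEquiv k E m ⊗ₜ[k] (1 : Eᵐᵒᵖ)) * (unop b ⊗ₜ[k] (1 : Eᵐᵒᵖ)) := by
        rw [Algebra.TensorProduct.tmul_mul_tmul, one_mul]
      rw [h3, mul_assoc, h1, ← mul_assoc, Algebra.TensorProduct.tmul_mul_tmul, one_mul, mul_one])
  refine fgProj_iff_dualBasis.2 ⟨Unit, inferInstance, fun _ => w, fun _ => f.hom, fun m =>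
    (regularEquiv k E).injective ?_⟩
  rw [Finset.univ_unique, Finset.sum_singleton]
  have h3 : ∀ (S : E ⊗[k] Eᵐᵒᵖ) a, regularEquiv k E (((a ⊗ₜ[k] (1 : Eᵐᵒᵖ)) * S) • w) =
      a * contraction k E S := fun S a => by
    induction S using TensorProduct.induction_on with
    | zero =>
      rw [mul_zero, map_zero, mul_zero]
      exact (congrArg _ (zero_smul (E ⊗[k] Eᵐᵒᵖ) w)).trans (map_zero _)
    | add x y hx hy => rw [mul_add, add_smul, map_add, map_add, hx, hy, mul_add]
    | tmul x y =>
      rw [← op_unop y, Algebra.TensorProduct.tmul_mul_tmul, one_mul, regularEquiv_tmul_smul, hw,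
        contraction_tmul, mul_one, mul_assoc]
  refine (h3 T (regularEquiv k E m)).trans ?_
  rw [h2, mul_one]

lemma ExactRes.self {R : Type u} [Ring R] {M : ModuleCat.{u} R} (hM : FGProj R M) (n : ℕ) :
    ExactRes n M M := by
  induction n with
  | zero => exact .zero (Iso.refl M)
  | succ n ih =>
    have := hM.1
    have := hM.2
    exact .succ (P := ModuleCat.of R (M × M)) (ModuleCat.homEquiv.symm (LinearMap.inl R M M))
      (ModuleCat.homEquiv.symm (LinearMap.snd R M M)) LinearMap.inl_injective
      LinearMap.snd_surjective Function.Exact.inl_snd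
      ⟨inferInstanceAs (Module.Finite R (M × M)), inferInstanceAs (Module.Projective R (M × M))⟩ ih

/-- A separable algebra is twisted-periodic of every period. -/
lemma HasCasimir.isTwistedPeriodicOfPeriod (h : HasCasimir k (1 : E)) {n : ℕ} (hn : 1 ≤ n) :
    IsTwistedPeriodicOfPeriod k E n := by
  obtain ⟨e⟩ := nonempty_twistedBimod_one_iso (k := k) (E := E)
  obtain ⟨Y, _⟩ := exists_truncatedResolution_of_exactRes hn
    ((ExactRes.self h.fgProj_regularBimod n).of_iso_left e)
  exact ⟨Y⟩

lemma IsProduct.hasCasimir {ι : Type} [Fintype ι] [DecidableEq ι] {F : ι → Type u}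
    [∀ i, Ring (F i)] [∀ i, Algebra k (F i)] {c : ∀ i, CornerHom k (F i) E} (H : IsProduct c)
    (h : ∀ i, HasCasimir k (1 : F i)) : HasCasimir k (1 : E) := by
  choose T h1 h2 using h
  have hc := fun i => (H.central i).enveloping
  have hr : ∀ i a b, (c i).enveloping.retr (a ⊗ₜ op b) = (c i).retr a ⊗ₜ op ((c i).retr b) :=
    fun _ _ _ => rfl
  have h1' : ∀ i, (c i).retr 1 = 1 := fun i => map_one (H.central i).retrHom
  refine ⟨∑ i, (c i).enveloping.toFun (T i), fun x => ?_, ?_⟩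
  · rw [Finset.mul_sum, Finset.mul_sum]
    refine Finset.sum_congr rfl fun i _ => ?_
    rw [(hc i).mul_toFun, (hc i).mul_toFun, ← op_one, hr, hr, h1', op_one, h1 i]
  · rw [map_sum]
    refine (Finset.sum_congr rfl fun i _ => ?_).trans H.sum_e
    rw [CornerHom.e, ← h2 i]
    generalize T i = S
    induction S using TensorProduct.induction_on with
    | zero => simp only [map_zero]
    | add x y hx hy => simp only [map_add, hx, hy]
    | tmul x y =>
      rw [← op_unop y, contraction_tmul, (c i).map_mul]
      rfl

lemma hasCasimir_matrix (d : ℕ) [NeZero d] : HasCasimir k (1 : Matrix (Fin d) (Fin d) k) := by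
  -- the separability element `∑ E_{a0} ⊗ E_{0a}`
  refine ⟨∑ a, Matrix.single a 0 1 ⊗ₜ op (Matrix.single 0 a 1), fun h => ?_, ?_⟩
  · have h1 : ∀ a, h * Matrix.single a 0 1 = ∑ b, h b a • Matrix.single b (0 : Fin d) (1 : k) :=
      fun a => by
        ext i j
        simp [Matrix.sum_apply, Matrix.single_apply, Matrix.mul_apply, ite_and]
    have h2 : ∀ b, Matrix.single 0 b 1 * h = ∑ a, h b a • Matrix.single (0 : Fin d) a (1 : k) :=
      fun b => by
        ext i j
        simp [Matrix.sum_apply, Matrix.single_apply, Matrix.mul_apply, ite_and]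
    simp only [Finset.mul_sum, Algebra.TensorProduct.tmul_mul_tmul, one_mul, ← op_mul, h1, h2,
      TensorProduct.sum_tmul, Finset.op_sum, TensorProduct.tmul_sum, MulOpposite.op_smul,
      TensorProduct.tmul_smul, ← TensorProduct.smul_tmul']
    exact Finset.sum_comm
  · rw [map_sum]
    simp only [contraction_tmul, Matrix.single_mul_single_same, mul_one]
    ext i j
    simp [Matrix.sum_apply, Matrix.single_apply, Matrix.one_apply, ite_and]

lemma hasCasimir_of_isSemisimpleRing [IsAlgClosed k] [Module.Finite k E] [IsSemisimpleRing E] :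
    HasCasimir k (1 : E) := by
  obtain ⟨n, d, hd, ⟨e⟩⟩ := IsSemisimpleRing.exists_algEquiv_pi_matrix_of_isAlgClosed k E
  have H : IsProduct (blockCorner k fun i => Matrix (Fin (d i)) (Fin (d i)) k) :=
    { central := fun i => blockCorner_isCentral _ i
      retr_of_ne := fun i j hij x =>
        Pi.single_eq_of_ne (M := fun i => Matrix (Fin (d i)) (Fin (d i)) k) (Ne.symm hij) x
      ext := fun x hx => funext hx }
  have h := (H.hasCasimir fun i => hasCasimir_matrix (d i)).map_of_surjective e.symm.toAlgHom
    e.symm.surjective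
  rwa [map_one] at h

/-- The endomorphism algebra of a module over a simple algebra is separable. -/
lemma hasCasimir_endOp [IsAlgClosed k] (A P : Type u) [Ring A] [Algebra k A] [Module.Finite k A]
    [AddCommGroup P] [Module k P] [Module A P] [IsScalarTower k A P] [Module.Finite A P]
    [IsSimpleRing A] : HasCasimir k (1 : EndOp A P) := by
  have := IsArtinianRing.of_finite k A
  have := finite_endOp k A P
  have : IsSemisimpleRing (Module.End A P) := IsSemisimpleRing.moduleEnd A P
  exact hasCasimir_of_isSemisimpleRing

end CasimirResolution

/-! ### Twisting automorphisms and blocks -/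

section Blocks

variable {k : Type u} [Field k] {c : ℕ} (A : Fin c → Type u) [∀ i, Ring (A i)]
  [∀ i, Algebra k (A i)] [∀ i, Module.Finite k (A i)] (P : Fin c → Type u)
  [∀ i, AddCommGroup (P i)] [∀ i, Module k (P i)] [∀ i, Module (A i) (P i)]
  [∀ i, IsScalarTower k (A i) (P i)] [∀ i, Module.Finite (A i) (P i)]
  [∀ i, Module.Projective (A i) (P i)] {n : ℕ}

/-- A nonzero separable factor of the endomorphism algebra of `⨁ P i` that is contained in the
`i`-th block exists only if `A i` is simple. -/
lemma isSimpleRing_of_hasCasimir (hA : IsSymmetricAlgebra k (∀ i, A i))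
    (hind : ∀ i, IsIndecomposableRing (A i)) (i : Fin c) {z : EndOp (∀ i, A i) (∀ i, P i)}
    (hz : HasCasimir k z) (hc : ∀ x, z * x = x * z) (hi : z * z = z)
    (hzi : blockIdempotent A P i * z = z) (h0 : z ≠ 0) : IsSimpleRing (A i) := by
  have H := isProduct_blockEndCorner k A P
  let d := blockEndCorner k A P i
  have hd : d.IsCentral := H.central i
  obtain ⟨l, hl⟩ := hA.exists_isSymmetrizing
  have hs : Function.Surjective hd.retrHom := fun x => ⟨d.toFun x, d.retr_toFun x⟩
  refine (hl.comp_toFun (blockCorner_isCentral A i)).isSimpleRing_of_hasCasimir (hind i)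
    (hz.map_of_surjective hd.retrHom hs) (fun x => ?_) ?_ fun h => h0 ?_
  · obtain ⟨x, rfl⟩ := hs x
    rw [← map_mul, hc, map_mul]
  · rw [← map_mul, hi]
  · rw [← hzi, ← blockEndCorner_e (k := k), ← hd.toFun_retr]
    exact (congrArg d.toFun h).trans (map_zero _)

/-- The twisting automorphism of a truncated resolution fixes the idempotents of the blocks that are
not simple algebras. -/
lemma TruncatedResolution.apply_blockIdempotent (hA : IsSymmetricAlgebra k (∀ i, A i))
    (hind : ∀ i, IsIndecomposableRing (A i))
    (Y : TruncatedResolution k (EndOp (∀ i, A i) (∀ i, P i)) n) (i : Fin c)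
    (hi : ¬ IsSimpleRing (A i)) : Y.σ (blockIdempotent A P i) = blockIdempotent A P i := by
  have H := isProduct_blockEndCorner k A P
  let e : Fin c → EndOp (∀ i, A i) (∀ i, P i) := blockIdempotent A P
  have he : ∀ i, (blockEndCorner k A P i).e = e i := blockEndCorner_e A P
  have hc : ∀ i x, e i * x = x * e i := fun i x => he i ▸ H.central i x
  have hee : ∀ i, e i * e i = e i := fun i => he i ▸ (blockEndCorner k A P i).e_mul_e
  have horth : ∀ i j, i ≠ j → e i * e j = 0 := fun i j hij => by
    rw [← he, ← he]
    exact H.e_mul_e_of_ne hij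
  have hsum : ∑ j, e j = 1 := by
    rw [← H.sum_e]
    exact Finset.sum_congr rfl fun j _ => (he j).symm
  have hcσ : ∀ (τ : EndOp (∀ i, A i) (∀ i, P i) ≃ₐ[k] EndOp (∀ i, A i) (∀ i, P i)) i x,
      τ (e i) * x = x * τ (e i) := fun τ i x => by
    obtain ⟨x, rfl⟩ := τ.surjective x
    rw [← map_mul, hc, map_mul]
  -- products of two of these central idempotents are central idempotents
  have hprod : ∀ (τ : EndOp (∀ i, A i) (∀ i, P i) ≃ₐ[k] EndOp (∀ i, A i) (∀ i, P i)) j,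
      HasCasimir k (e i * τ (e j)) → e i * τ (e j) = 0 := fun τ j hT => by
    by_contra h0
    refine hi (isSimpleRing_of_hasCasimir A P hA hind i hT (fun x => ?_) ?_ ?_ h0)
    · rw [mul_assoc, hcσ, ← mul_assoc, hc, mul_assoc]
    · rw [mul_assoc, ← mul_assoc (τ (e j)), ← hc, mul_assoc, ← map_mul, hee, ← mul_assoc, hee]
    · change e i * _ = _
      rw [← mul_assoc, hee]
  have h1 : ∀ j, j ≠ i → e i * Y.σ (e j) = 0 := fun j hj =>
    hprod Y.σ j (Y.hasCasimir (hc i) (hc j) (horth i j (Ne.symm hj)))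
  have h2 : ∀ j, j ≠ i → e j * Y.σ (e i) = 0 := fun j hj => by
    have h := (Y.hasCasimir (hc j) (hc i) (horth j i hj)).map_of_surjective
      Y.σ.symm.toAlgHom Y.σ.symm.surjective
    have h3 : Y.σ.symm.toAlgHom (e j * Y.σ (e i)) = e i * Y.σ.symm (e j) := by
      refine (map_mul Y.σ.symm _ _).trans ?_
      rw [Y.σ.symm_apply_apply, ← hc]
    rw [h3] at h
    have h4 := congrArg Y.σ (hprod Y.σ.symm j h)
    rwa [map_mul, Y.σ.apply_symm_apply, map_zero, hcσ] at h4
  change Y.σ (e i) = e i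
  have h5 : e i * Y.σ (e i) = e i := by
    conv_rhs => rw [← mul_one (e i), ← map_one Y.σ, ← hsum, map_sum, Finset.mul_sum,
      Finset.sum_eq_single i (fun j _ hj => h1 j hj) (fun h => absurd (Finset.mem_univ i) h)]
  have h6 : e i * Y.σ (e i) = Y.σ (e i) := by
    conv_rhs => rw [← one_mul (Y.σ (e i)), ← hsum, Finset.sum_mul,
      Finset.sum_eq_single i (fun j _ hj => h2 j hj) (fun h => absurd (Finset.mem_univ i) h)]
  rw [← h6, h5]

/-- The factors of a twisted-periodic algebra of endomorphisms are twisted-periodic. -/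
lemma isTwistedPeriodicOfPeriod_block [IsAlgClosed k] (hA : IsSymmetricAlgebra k (∀ i, A i))
    (hind : ∀ i, IsIndecomposableRing (A i))
    (Y : TruncatedResolution k (EndOp (∀ i, A i) (∀ i, P i)) n) (i : Fin c) :
    IsTwistedPeriodicOfPeriod k (EndOp (A i) (P i)) n := by
  by_cases hi : IsSimpleRing (A i)
  -- The automorphism may move the idempotent of a simple block, but then `EndOp (A i) (P i)` is
  -- separable and every period occurs.
  · exact (hasCasimir_endOp (A i) (P i)).isTwistedPeriodicOfPeriod Y.one_le
  · have := finite_endOp k (A i) (P i)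
    obtain ⟨Yi, _⟩ := (blockEndCorner k A P i).exists_truncatedResolution
      ((isProduct_blockEndCorner k A P).central i).hasBasis Y (by
        rw [blockEndCorner_e, Y.apply_blockIdempotent A P hA hind i hi, ← blockEndCorner_e (k := k)]
        exact IdemEquiv.refl (blockEndCorner k A P i).e_mul_e)
    exact ⟨Yi⟩

/-- A periodic twist of `∏ A i` whose twisting automorphism fixes the idempotents of the simple
blocks is a product of periodic twists. -/
lemma exists_periodicTwist_blockDecomposition_iso (hA : IsSymmetricAlgebra k (∀ i, A i))
    (hind : ∀ i, IsIndecomposableRing (A i))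
    (Y : TruncatedResolution k (EndOp (∀ i, A i) (∀ i, P i)) n)
    (hσ : ∀ i, IsSimpleRing (A i) → Y.σ (blockIdempotent A P i) = blockIdempotent A P i) :
    ∃ Yb : ∀ i, TruncatedResolution k (EndOp (A i) (P i)) n,
      Nonempty (periodicTwist (∀ i, A i) Y ⋙ blockDecomposition k A ≅
        blockDecomposition k A ⋙ Functor.pi fun i => periodicTwist (A i) (Yb i)) := by
  have := fun i => finite_endOp k (A i) (P i)
  obtain ⟨Yb, ⟨e⟩⟩ := (isProduct_blockEndCorner k A P).exists_periodicTwist_iso Y.one_le Y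
    fun i => by
      rw [blockEndCorner_e]
      by_cases hi : IsSimpleRing (A i)
      · exact hσ i hi
      · exact Y.apply_blockIdempotent A P hA hind i hi
  obtain ⟨e'⟩ := periodicTwist_blockDecomposition_iso A P Y.one_le Yb
  exact ⟨Yb, ⟨Functor.isoWhiskerRight e _ ≪≫ e'⟩⟩

end Blocks

end

end PeriodicTwist

theorem lemma3p6 (k : Type u) [Field k] [IsAlgClosed k] :
    -- independence of the multiplicities
    (∀ (A : Type u) [Ring A] [Algebra k A] [Module.Finite k A]
        (J : Type) [Fintype J] [DecidableEq J] (Q : J → Type u)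
        [∀ j, AddCommGroup (Q j)] [∀ j, Module k (Q j)] [∀ j, Module A (Q j)]
        [∀ j, IsScalarTower k A (Q j)] [∀ j, Module.Finite A (Q j)]
        [∀ j, Module.Projective A (Q j)] (m : J → ℕ),
      PeriodicTwist.IsSymmetricAlgebra k A →
      (∀ j, PeriodicTwist.IsIndecomposableModule A (Q j)) →
      (∀ i j, Nonempty (Q i ≃ₗ[A] Q j) → i = j) →
      (∀ j, 1 ≤ m j) →
        (PeriodicTwist.IsTwistedPeriodic k (PeriodicTwist.EndOp A (∀ j, Q j)) ↔
          PeriodicTwist.IsTwistedPeriodic k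
            (PeriodicTwist.EndOp A (∀ j, Fin (m j) → Q j))) ∧
        (∀ (n : ℕ) (Y' : PeriodicTwist.TruncatedResolution k
              (PeriodicTwist.EndOp A (∀ j, Fin (m j) → Q j)) n),
          ∃ Y : PeriodicTwist.TruncatedResolution k (PeriodicTwist.EndOp A (∀ j, Q j)) n,
            Nonempty (PeriodicTwist.periodicTwist A Y ≅ PeriodicTwist.periodicTwist A Y')) ∧
        (∀ (n : ℕ) (Y : PeriodicTwist.TruncatedResolution k
              (PeriodicTwist.EndOp A (∀ j, Q j)) n),
          PeriodicTwist.PreservesMultiplicities Q m Y.σ →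
          ∃ Y' : PeriodicTwist.TruncatedResolution k
              (PeriodicTwist.EndOp A (∀ j, Fin (m j) → Q j)) n,
            Nonempty (PeriodicTwist.periodicTwist A Y ≅ PeriodicTwist.periodicTwist A Y'))) ∧
    -- decomposition into blocks
    (∀ (c : ℕ) (A : Fin c → Type u) [∀ i, Ring (A i)] [∀ i, Algebra k (A i)]
        [∀ i, Module.Finite k (A i)] (P : Fin c → Type u)
        [∀ i, AddCommGroup (P i)] [∀ i, Module k (P i)] [∀ i, Module (A i) (P i)]
        [∀ i, IsScalarTower k (A i) (P i)] [∀ i, Module.Finite (A i) (P i)]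
        [∀ i, Module.Projective (A i) (P i)],
      PeriodicTwist.IsSymmetricAlgebra k (∀ i, A i) →
      (∀ i, PeriodicTwist.IsIndecomposableRing (A i)) →
      ∀ n : ℕ, 1 ≤ n →
        (PeriodicTwist.IsTwistedPeriodicOfPeriod k
            (PeriodicTwist.EndOp (∀ i, A i) (∀ i, P i)) n ↔
          ∀ i, PeriodicTwist.IsTwistedPeriodicOfPeriod k (PeriodicTwist.EndOp (A i) (P i)) n) ∧
        (∀ Yb : ∀ i, PeriodicTwist.TruncatedResolution k (PeriodicTwist.EndOp (A i) (P i)) n,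
          ∃ Y : PeriodicTwist.TruncatedResolution k
              (PeriodicTwist.EndOp (∀ i, A i) (∀ i, P i)) n,
            Nonempty (PeriodicTwist.periodicTwist (∀ i, A i) Y ⋙
                PeriodicTwist.blockDecomposition k A ≅
              PeriodicTwist.blockDecomposition k A ⋙
                Functor.pi fun i => PeriodicTwist.periodicTwist (A i) (Yb i))) ∧
        (∀ Y : PeriodicTwist.TruncatedResolution k
            (PeriodicTwist.EndOp (∀ i, A i) (∀ i, P i)) n,
          (∀ i, IsSimpleRing (A i) →
            Y.σ (PeriodicTwist.blockIdempotent A P i) = PeriodicTwist.blockIdempotent A P i) →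
          ∃ Yb : ∀ i, PeriodicTwist.TruncatedResolution k (PeriodicTwist.EndOp (A i) (P i)) n,
            Nonempty (PeriodicTwist.periodicTwist (∀ i, A i) Y ⋙
                PeriodicTwist.blockDecomposition k A ≅
              PeriodicTwist.blockDecomposition k A ⋙
                Functor.pi fun i => PeriodicTwist.periodicTwist (A i) (Yb i)))) := by
  refine ⟨fun A _ _ _ J _ _ Q _ _ _ _ _ _ m _ hQ hiso hm =>
      ⟨PeriodicTwist.isTwistedPeriodic_iff_of_multiplicities Q hQ hiso hm, fun n Y' =>
        PeriodicTwist.exists_truncatedResolution_of_multiplicities Q hQ hiso hm Y', fun n Y hY =>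
        PeriodicTwist.exists_truncatedResolution_of_preservesMultiplicities Q hQ hiso hm Y hY⟩,
    fun c A _ _ _ P _ _ _ _ _ _ hA hind n hn => ⟨⟨?_, fun h => ?_⟩, fun Yb =>
      ⟨_, PeriodicTwist.periodicTwist_blockDecomposition_iso A P hn Yb⟩, fun Y hY =>
      PeriodicTwist.exists_periodicTwist_blockDecomposition_iso A P hA hind Y hY⟩⟩
  · rintro ⟨Y⟩ i
    exact PeriodicTwist.isTwistedPeriodicOfPeriod_block A P hA hind Y i
  · exact ⟨(PeriodicTwist.isProduct_blockEndCorner k A P).resolution hn fun i => (h i).some⟩
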